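/- **Theorem 2.5.** Let $a<b$, $\kappa,G_c,\rho>0$, and let $\eta_\varepsilon>0$ ($\varepsilon>0$) satisfy $\eta_\varepsilon=o(\varepsilon)$ as $\varepsilon\to0^+$. Fix integers $p\ge 2$ and $1\le k\le p-1$. For every $\varepsilon>0$ let $\mathcal T_h$, $h=h_\varepsilon$, be a mesh of $[a,b]$ whose largest element has length $h$, with $h=o(\varepsilon)$, and let $\mathcal S_h\subset H^2(a,b)$ be the space of $C^k$ splines on $\mathcal T_h$ of degree at most $p$ (functions of class $C^k$ on $[a,b]$ that agree with a polynomial of degree at most $p$ on each element). Let $\mathcal W=\{w\in L^1(\mathbb R_+): w'\in H^1(\mathbb R_+),\ w(0)=1,\ w'(0)=0\}$ and $\mathcal K(w)=\int_{\mathbb R_+}\left(w+|w'|^2+\rho|w''|^2\right)dx$. Then $\mathcal K$ has a minimizer $w_*$ among the $w\in\mathcal W$ with $0\le w\le 1$; for any such minimizer put $c_\rho=2\mathcal K(w_*)$. Define $\mathcal F_{\varepsilon,h}:L^1(a,b)\times L^1(a,b)\to[0,+\infty]$ by $$\mathcal F_{\varepsilon,h}(u,v)=\int_{(a,b)}\left(\kappa\left((v-1)^2+\eta_\varepsilon\right)|u'|_+^2+\kappa|u'|_-^2\right)dx+\frac{G_c}{c_\rho}\int_{(a,b)}\left(\varepsilon^{-1}v+\varepsilon|v'|^2+\rho\,\varepsilon^3|v''|^2\right)dx$$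 if $u,v\in\mathcal S_h$ and $0\le v\le1$, and $\mathcal F_{\varepsilon,h}(u,v)=+\infty$ otherwise, where $|\cdot|_\pm$ are the positive and negative parts. Define $$\mathcal F(u,v)=\int_{(a,b)\setminus J_u}\kappa|u'|^2\,dx+G_c\,\#J_u$$ if $u\in SBV^2(a,b)$, $[\![u]\!]=u^+-u^->0$ at every point of the jump set $J_u$, and $v=0$ a.e. in $(a,b)$, and $\mathcal F(u,v)=+\infty$ otherwise. Here $u\in SBV^2(a,b)$ means that $J_u$ is finite and that the distributional derivative of $u$ is $u'\,dx+\sum_{s\in J_u}[\![u]\!](s)\,\delta_s$ with $u'\in L^2(a,b)$. Then $\mathcal F_{\varepsilon,h}$ $\Gamma$-converges to $\mathcal F$ as $\varepsilon\to0^+$ with respect to the strong topology of $L^1(a,b)\times L^1(a,b)$. -/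

import Mathlib

open MeasureTheory Set Filter Topology Asymptotics
open scoped ENNReal ContDiff

noncomputable section

namespace ATFracture

/-! ### Weak derivatives and Sobolev functions on an open subset of the line -/

/-- `φ` is a test function on `Ω`: smooth, with compact support contained in `Ω`. -/
def IsTestFunction (Ω : Set ℝ) (φ : ℝ → ℝ) : Prop :=
  ContDiff ℝ ∞ φ ∧ HasCompactSupport φ ∧ tsupport φ ⊆ Ω

/-- `g` is a weak derivative of `u` on the open set `Ω`. -/
def IsWeakDeriv (Ω : Set ℝ) (u g : ℝ → ℝ) : Prop :=
  LocallyIntegrableOn u Ω ∧ LocallyIntegrableOn g Ω ∧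
    ∀ φ : ℝ → ℝ, IsTestFunction Ω φ →
      ∫ x in Ω, u x * deriv φ x = -∫ x in Ω, g x * φ x

open Classical in
/-- The weak derivative of `u` on `Ω` (unique up to null sets); `0` if there is none. -/
def weakDeriv (Ω : Set ℝ) (u : ℝ → ℝ) : ℝ → ℝ :=
  if h : ∃ g, IsWeakDeriv Ω u g then Classical.choose h else 0

/-- `u ∈ H¹(Ω)`. -/
def MemH1 (Ω : Set ℝ) (u : ℝ → ℝ) : Prop :=
  MemLp u 2 (volume.restrict Ω) ∧
    ∃ g, IsWeakDeriv Ω u g ∧ MemLp g 2 (volume.restrict Ω)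

/-- `u ∈ H²(Ω)`. -/
def MemH2 (Ω : Set ℝ) (u : ℝ → ℝ) : Prop :=
  MemH1 Ω u ∧ MemH1 Ω (weakDeriv Ω u)

/-! ### One-sided limits and special functions of bounded variation -/

/-- The filter of essential limits from the left at `s`. -/
def essLeft (s : ℝ) : Filter ℝ := 𝓝[<] s ⊓ ae volume

/-- The filter of essential limits from the right at `s`. -/
def essRight (s : ℝ) : Filter ℝ := 𝓝[>] s ⊓ ae volume

/-- The jump set `J_u` of `u` in `(a,b)`: the points with two different (essential) one-sided
limits `u⁻` (from the left) and `u⁺` (from the right). -/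
def jumpSet (a b : ℝ) (u : ℝ → ℝ) : Set ℝ :=
  {s | s ∈ Ioo a b ∧ ∃ l r : ℝ,
    Tendsto u (essLeft s) (𝓝 l) ∧ Tendsto u (essRight s) (𝓝 r) ∧ l ≠ r}

/-- The jump `⟦u⟧ = u⁺ - u⁻` at `s`. -/
def jump (u : ℝ → ℝ) (s : ℝ) : ℝ :=
  limUnder (essRight s) u - limUnder (essLeft s) u

/-- `u ∈ SBV²(a,b)`: `u` is integrable, `J_u` is finite, and the distributional derivative of `u`
on `(a,b)` is `u' dx + ∑_{s ∈ J_u} ⟦u⟧(s) δ_s` (no Cantor part), with `u'` square integrable. -/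
def MemSBV2 (a b : ℝ) (u : ℝ → ℝ) : Prop :=
  MemLp u 1 (volume.restrict (Ioo a b)) ∧ (jumpSet a b u).Finite ∧
    ∃ g : ℝ → ℝ, MemLp g 2 (volume.restrict (Ioo a b)) ∧
      ∀ φ : ℝ → ℝ, IsTestFunction (Ioo a b) φ →
        ∫ x in Ioo a b, u x * deriv φ x =
          -((∫ x in Ioo a b, g x * φ x) + ∑ᶠ s ∈ jumpSet a b u, jump u s * φ s)

/-! ### The space `L¹(a,b)` and the energies -/

/-- The Banach space `L¹(a,b)`. -/
abbrev L1 (a b : ℝ) : Type := Lp ℝ 1 (volume.restrict (Ioo a b))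

/-- The fourth-order `AT₁` energy
`∫ (κ ((v-1)² + η) |u'|₊² + κ |u'|₋²) dx + (G/c) ∫ (ε⁻¹ v + ε |v'|² + ρ ε³ |v''|²) dx`. -/
def atEnergy (a b κ G ρ c η ε : ℝ) (u v : ℝ → ℝ) : ℝ≥0∞ :=
  (∫⁻ x in Ioo a b, ENNReal.ofReal
      (κ * ((v x - 1) ^ 2 + η) * (max (weakDeriv (Ioo a b) u x) 0) ^ 2
        + κ * (max (-weakDeriv (Ioo a b) u x) 0) ^ 2))
    + ENNReal.ofReal (G / c) * ∫⁻ x in Ioo a b, ENNReal.ofReal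
      (ε⁻¹ * v x + ε * (weakDeriv (Ioo a b) v x) ^ 2
        + ρ * ε ^ 3 * (weakDeriv (Ioo a b) (weakDeriv (Ioo a b) v) x) ^ 2)

open Classical in
/-- The `AT₁` functional on `L¹(a,b) × L¹(a,b)`, finite only for `u ∈ H¹(a,b)` and
`v ∈ H²((a,b);[0,1])`. -/
def atFunctional (a b κ G ρ c η ε : ℝ) (z : L1 a b × L1 a b) : ℝ≥0∞ :=
  if MemH1 (Ioo a b) z.1 ∧ MemH2 (Ioo a b) z.2 ∧
      (∀ᵐ x ∂volume.restrict (Ioo a b), z.2 x ∈ Icc (0 : ℝ) 1)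
  then atEnergy a b κ G ρ c η ε z.1 z.2 else ⊤

open Classical in
/-- The sharp-crack functional: `∫_{(a,b) ∖ J_u} κ |u'|² dx + G #J_u` if `u ∈ SBV²(a,b)`, `⟦u⟧ > 0`
on `J_u` and `v = 0` a.e., and `+∞` otherwise. -/
def crackFunctional (a b κ G : ℝ) (z : L1 a b × L1 a b) : ℝ≥0∞ :=
  if MemSBV2 a b z.1 ∧ (∀ s ∈ jumpSet a b z.1, 0 < jump z.1 s) ∧
      (∀ᵐ x ∂volume.restrict (Ioo a b), z.2 x = 0)
  then (∫⁻ x in Ioo a b \ jumpSet a b z.1,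
      ENNReal.ofReal (κ * (weakDeriv (Ioo a b \ jumpSet a b z.1) z.1 x) ^ 2))
    + ENNReal.ofReal G * ((jumpSet a b z.1).ncard : ℝ≥0∞)
  else ⊤

/-! ### The optimal profile -/

/-- `𝒲`: the `w ∈ L¹(ℝ₊)` with `w' ∈ H¹(ℝ₊)` and traces `w(0) = 1`, `w'(0) = 0`. -/
def profileSpace : Set (ℝ → ℝ) :=
  {w | MemLp w 1 (volume.restrict (Ioi 0)) ∧ (∃ g, IsWeakDeriv (Ioi 0) w g) ∧
    MemH1 (Ioi 0) (weakDeriv (Ioi 0) w) ∧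
    Tendsto w (essRight 0) (𝓝 1) ∧ Tendsto (weakDeriv (Ioi 0) w) (essRight 0) (𝓝 0)}

/-- The transition energy `𝒦(w) = ∫_{ℝ₊} (w + |w'|² + ρ |w''|²) dx`. -/
def profileEnergy (ρ : ℝ) (w : ℝ → ℝ) : ℝ :=
  ∫ x in Ioi (0 : ℝ), (w x + (weakDeriv (Ioi 0) w x) ^ 2
    + ρ * (weakDeriv (Ioi 0) (weakDeriv (Ioi 0) w) x) ^ 2)

/-- The competitors `w ∈ 𝒲` with `0 ≤ w ≤ 1`. -/
def admissibleProfiles : Set (ℝ → ℝ) :=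
  {w | w ∈ profileSpace ∧ ∀ᵐ x ∂volume.restrict (Ioi (0 : ℝ)), w x ∈ Icc (0 : ℝ) 1}

/-- `w` is an optimal profile: a minimizer of `𝒦` among the `w ∈ 𝒲` with `0 ≤ w ≤ 1`. -/
def IsOptimalProfile (ρ : ℝ) (w : ℝ → ℝ) : Prop :=
  w ∈ admissibleProfiles ∧ IsMinOn (profileEnergy ρ) admissibleProfiles w

/-! ### Meshes, splines and the isogeometric functionals -/

/-- A mesh of `[a,b]`: nodes `a = x₀ < x₁ < ⋯ < x_N = b`. -/
structure Mesh (a b : ℝ) where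
  /-- The number of elements. -/
  N : ℕ
  /-- The nodes. -/
  node : Fin (N + 1) → ℝ
  strictMono : StrictMono node
  node_zero : node 0 = a
  node_last : node (Fin.last N) = b

/-- The size of a mesh: the largest length of an element. -/
def Mesh.size {a b : ℝ} (T : Mesh a b) : ℝ :=
  ⨆ i : Fin T.N, (T.node i.succ - T.node i.castSucc)

/-- The splines on `T` of degree at most `p` and smoothness `C^k`: functions of class `C^k` on
`[a,b]` that agree on each element with a polynomial of degree at most `p`. -/
def splineSpace {a b : ℝ} (T : Mesh a b) (p k : ℕ) : Set (ℝ → ℝ) :=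
  {s | ContDiffOn ℝ k s (Icc a b) ∧
    ∀ i : Fin T.N, ∃ P : Polynomial ℝ, P.natDegree ≤ p ∧
      ∀ x ∈ Icc (T.node i.castSucc) (T.node i.succ), s x = P.eval x}

/-- The class `f ∈ L¹(a,b)` is represented by a spline. -/
def IsSpline {a b : ℝ} (T : Mesh a b) (p k : ℕ) (f : L1 a b) : Prop :=
  ∃ s ∈ splineSpace T p k, f =ᵐ[volume.restrict (Ioo a b)] s

open Classical in
/-- The isogeometric functional: the restriction of the `AT₁` functional to pairs of splines
(the constraint `v ∈ [0,1]` is part of `atFunctional`), and `+∞` elsewhere. -/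
def isoFunctional {a b : ℝ} (T : Mesh a b) (p k : ℕ) (κ G ρ c η ε : ℝ)
    (z : L1 a b × L1 a b) : ℝ≥0∞ :=
  if IsSpline T p k z.1 ∧ IsSpline T p k z.2 then atFunctional a b κ G ρ c η ε z else ⊤

/-! ### Gamma-convergence -/

/-- `F ε` Gamma-converges to `F₀` as `ε → 0⁺`, in a metric space `X`: along every sequence
`ε_n → 0⁺` the liminf inequality holds and recovery sequences exist. -/
def GammaConverges {X : Type*} [MetricSpace X] (F : ℝ → X → ℝ≥0∞) (F₀ : X → ℝ≥0∞) : Prop :=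
  ∀ ε : ℕ → ℝ, (∀ n, 0 < ε n) → Tendsto ε atTop (𝓝 0) →
    (∀ (z : X) (y : ℕ → X), Tendsto y atTop (𝓝 z) →
      F₀ z ≤ liminf (fun n => F (ε n) (y n)) atTop) ∧
    (∀ z : X, ∃ y : ℕ → X, Tendsto y atTop (𝓝 z) ∧
      limsup (fun n => F (ε n) (y n)) atTop ≤ F₀ z)

end ATFracture

end

noncomputable section

namespace ATFracture

/-! ### Calculus of weak derivatives -/

/-! A crack costs exactly `G` because the surface term, rescaled by `ε` about a point where the
damage reaches 1, becomes two copies of the half-line energy, and dividing by `c = 2 K`, with `K`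
the minimal profile energy, normalises it.

Existence of the minimizer. A profile is the double primitive of its second derivative, and the
energy is a linear term plus squared `L²` norms. The parallelogram law
(`IsProfileSecondDeriv.exists_midpoint`) makes minimizing sequences strongly Cauchy, and Fatou
handles the linear term.

Lower bound. An ultrafilter plays the role of a subsequence with bounded energy. The term `ε⁻¹ v`
forces `v → 0` in `L¹`. Call a point a crack point if `v` comes arbitrarily close to 1 arbitrarily
near to it. Around such a point there are, on both sides, intervals of length `ε` with little
energy; between them `v` has an interior maximum with zero slope, and each half, rescaled and cut
off inside the quiet interval, competes in the profile problem (`exists_crack_cost`). So every crack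
point costs at least `2 K` in the limit and there are finitely many (`card_crackPoints_le`). On
compact sets away from them `v` stays below some `M < 1`, and the weak `L²` limit of `(1 - v) u'` is
the derivative of the limit displacement. Weak lower semicontinuity gives the bulk term. The
compressive strain is never degraded, hence bounded in `L²`, so it cannot concentrate and jumps can
only open (`crackFunctional_le_of_ultrafilter`).

Upper bound. A nearly optimal profile is truncated, given a short plateau at height 1, averaged to
become `C²`, and reflected (`exists_smooth_profile`). Copies of width `ε` are placed at the jumps,
and the displacement opens over a length `r ε / 4` inside the plateau, where only the residual
stiffness `η` acts; that costs `η ε⁻² ε = η / ε → 0`. To obtain splines, nearly uniform knots of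
spacing `δ`, a small fixed fraction of `ε`, are selected among the mesh nodes, which `h = o(ε)`
permits, and the Schoenberg operator is applied. Its splines of degree `p` are `C^(p-1)`, hence
`C^k`. It averages sampled values, so it keeps the constraint `0 ≤ v ≤ 1` and the plateau exactly;
first derivatives are averages of difference quotients, and second derivatives are accurate up to
the oscillation of `f''` and the defect `h / δ` of uniformity (`IsNearUniform.schoenberg₂_mem`).
This gives recovery at every finite accuracy (`eventually_exists_isoFunctional_le`), and a diagonal
choice yields the recovery sequence. -/

theorem IsTestFunction.continuous {Ω : Set ℝ} {φ : ℝ → ℝ} (h : IsTestFunction Ω φ) :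
    Continuous φ := h.1.continuous

theorem IsTestFunction.mono {Ω Ω' : Set ℝ} {φ : ℝ → ℝ} (h : IsTestFunction Ω φ) (hs : Ω ⊆ Ω') :
    IsTestFunction Ω' φ := ⟨h.1, h.2.1, h.2.2.trans hs⟩

theorem IsTestFunction.deriv {Ω : Set ℝ} {φ : ℝ → ℝ} (h : IsTestFunction Ω φ) :
    IsTestFunction Ω (deriv φ) :=
  ⟨(contDiff_infty_iff_deriv.1 h.1).2, h.2.1.deriv, tsupport_deriv_subset.trans h.2.2⟩

theorem IsTestFunction.eq_zero {Ω : Set ℝ} {φ : ℝ → ℝ} (h : IsTestFunction Ω φ) {x : ℝ}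
    (hx : x ∉ Ω) : φ x = 0 := image_eq_zero_of_notMem_tsupport fun h' => hx (h.2.2 h')

theorem IsTestFunction.mul_smooth {Ω : Set ℝ} {φ χ : ℝ → ℝ} (h : IsTestFunction Ω φ)
    (hχ : ContDiff ℝ ∞ χ) : IsTestFunction Ω (fun x => χ x * φ x) :=
  ⟨hχ.mul h.1, h.2.1.mul_left, (tsupport_mul_subset_right (f := χ)).trans h.2.2⟩

theorem IsTestFunction.setIntegral_mul {Ω : Set ℝ} {φ : ℝ → ℝ} (h : IsTestFunction Ω φ)
    (f : ℝ → ℝ) : ∫ x in Ω, f x * φ x = ∫ x, f x * φ x :=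
  setIntegral_eq_integral_of_forall_compl_eq_zero fun x hx => by rw [h.eq_zero hx, mul_zero]

theorem integrable_mul_of_tsupport_subset {Ω : Set ℝ} {f φ : ℝ → ℝ}
    (hf : LocallyIntegrableOn f Ω) (hφ : Continuous φ) (hc : HasCompactSupport φ)
    (hs : tsupport φ ⊆ Ω) : Integrable (fun x => f x * φ x) := by
  have h1 : IntegrableOn f (tsupport φ) := hf.integrableOn_compact_subset hs hc
  refine (integrableOn_iff_integrable_of_support_subset (s := tsupport φ) ?_).1
    (h1.mul_continuousOn hφ.continuousOn hc)
  exact fun x hx => subset_tsupport φ (right_ne_zero_of_mul hx)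

theorem IsTestFunction.integrable_mul {Ω : Set ℝ} {φ f : ℝ → ℝ} (h : IsTestFunction Ω φ)
    (hf : LocallyIntegrableOn f Ω) : Integrable (fun x => f x * φ x) :=
  integrable_mul_of_tsupport_subset hf h.continuous h.2.1 h.2.2

theorem IsWeakDeriv.integral_eq {Ω : Set ℝ} {u g φ : ℝ → ℝ} (h : IsWeakDeriv Ω u g)
    (hφ : IsTestFunction Ω φ) : ∫ x, u x * deriv φ x = -∫ x, g x * φ x := by
  rw [← hφ.setIntegral_mul, ← hφ.deriv.setIntegral_mul]; exact h.2.2 φ hφ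

theorem isWeakDeriv_of_integral_eq {Ω : Set ℝ} {u g : ℝ → ℝ} (hu : LocallyIntegrableOn u Ω)
    (hg : LocallyIntegrableOn g Ω)
    (h : ∀ φ, IsTestFunction Ω φ → ∫ x, u x * deriv φ x = -∫ x, g x * φ x) :
    IsWeakDeriv Ω u g :=
  ⟨hu, hg, fun φ hφ => by rw [hφ.setIntegral_mul, hφ.deriv.setIntegral_mul]; exact h φ hφ⟩

theorem ae_restrict_eq_of_forall_test {Ω : Set ℝ} (hΩ : IsOpen Ω) {f g : ℝ → ℝ}
    (hf : LocallyIntegrableOn f Ω) (hg : LocallyIntegrableOn g Ω)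
    (h : ∀ φ, IsTestFunction Ω φ → ∫ x, f x * φ x = ∫ x, g x * φ x) :
    f =ᵐ[volume.restrict Ω] g := by
  have := hΩ.ae_eq_zero_of_integral_contDiff_smul_eq_zero (μ := volume) (f := fun x => f x - g x)
    (hf.sub hg) (fun φ h1 h2 h3 => by
      have hφ : IsTestFunction Ω φ := ⟨h1, h2, h3⟩
      have e : (fun x => φ x • (f x - g x)) = fun x => f x * φ x - g x * φ x := by
        ext x; simp only [smul_eq_mul]; ring
      rw [e, integral_sub (hφ.integrable_mul hf) (hφ.integrable_mul hg), h φ hφ, sub_self])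
  rw [Filter.EventuallyEq, ae_restrict_iff' hΩ.measurableSet]
  filter_upwards [this] with x hx hxΩ
  linarith [hx hxΩ]

theorem IsWeakDeriv.ae_eq {Ω : Set ℝ} (hΩ : IsOpen Ω) {u g g' : ℝ → ℝ} (h : IsWeakDeriv Ω u g)
    (h' : IsWeakDeriv Ω u g') : g =ᵐ[volume.restrict Ω] g' :=
  ae_restrict_eq_of_forall_test hΩ h.2.1 h'.2.1 fun φ hφ => by
    have := h.integral_eq hφ
    rw [h'.integral_eq hφ] at this
    linarith

theorem IsWeakDeriv.weakDeriv {Ω : Set ℝ} {u g : ℝ → ℝ} (h : IsWeakDeriv Ω u g) :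
    IsWeakDeriv Ω u (weakDeriv Ω u) := by
  have h' : ∃ g, IsWeakDeriv Ω u g := ⟨g, h⟩
  rw [ATFracture.weakDeriv, dif_pos h']
  exact Classical.choose_spec h'

theorem IsWeakDeriv.weakDeriv_ae_eq {Ω : Set ℝ} (hΩ : IsOpen Ω) {u g : ℝ → ℝ}
    (h : IsWeakDeriv Ω u g) : ATFracture.weakDeriv Ω u =ᵐ[volume.restrict Ω] g :=
  h.weakDeriv.ae_eq hΩ h

theorem IsWeakDeriv.congr {Ω : Set ℝ} {u g u' g' : ℝ → ℝ} (h : IsWeakDeriv Ω u g)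
    (hu : u =ᵐ[volume.restrict Ω] u') (hg : g =ᵐ[volume.restrict Ω] g') :
    IsWeakDeriv Ω u' g' := by
  refine ⟨h.1.congr hu, h.2.1.congr hg, fun φ hφ => ?_⟩
  have e1 : ∫ x in Ω, u' x * _root_.deriv φ x = ∫ x in Ω, u x * _root_.deriv φ x :=
    integral_congr_ae (by filter_upwards [hu] with x hx; rw [hx])
  have e2 : ∫ x in Ω, g' x * φ x = ∫ x in Ω, g x * φ x :=
    integral_congr_ae (by filter_upwards [hg] with x hx; rw [hx])
  rw [e1, e2]; exact h.2.2 φ hφ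

theorem IsWeakDeriv.weakDeriv_weakDeriv_ae_eq {Ω : Set ℝ} (hΩ : IsOpen Ω) {u g k : ℝ → ℝ}
    (h : IsWeakDeriv Ω u g) (h' : IsWeakDeriv Ω g k) :
    ATFracture.weakDeriv Ω (ATFracture.weakDeriv Ω u) =ᵐ[volume.restrict Ω] k :=
  (h'.congr (h.weakDeriv_ae_eq hΩ).symm (ae_eq_refl _)).weakDeriv_ae_eq hΩ

theorem IsWeakDeriv.mono {Ω Ω' : Set ℝ} {u g : ℝ → ℝ} (h : IsWeakDeriv Ω u g) (hs : Ω' ⊆ Ω) :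
    IsWeakDeriv Ω' u g :=
  isWeakDeriv_of_integral_eq (h.1.mono_set hs) (h.2.1.mono_set hs)
    fun _ hφ => h.integral_eq (hφ.mono hs)

theorem IsWeakDeriv.add {Ω : Set ℝ} {u g u' g' : ℝ → ℝ} (h : IsWeakDeriv Ω u g)
    (h' : IsWeakDeriv Ω u' g') :
    IsWeakDeriv Ω (fun x => u x + u' x) (fun x => g x + g' x) := by
  refine isWeakDeriv_of_integral_eq (h.1.add h'.1) (h.2.1.add h'.2.1) fun φ hφ => ?_
  simp only [add_mul]
  rw [integral_add (hφ.deriv.integrable_mul h.1) (hφ.deriv.integrable_mul h'.1),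
    integral_add (hφ.integrable_mul h.2.1) (hφ.integrable_mul h'.2.1), h.integral_eq hφ,
    h'.integral_eq hφ]
  ring

theorem IsWeakDeriv.const_mul {Ω : Set ℝ} {u g : ℝ → ℝ} (h : IsWeakDeriv Ω u g) (c : ℝ) :
    IsWeakDeriv Ω (fun x => c * u x) (fun x => c * g x) := by
  refine isWeakDeriv_of_integral_eq (h.1.smul c) (h.2.1.smul c) fun φ hφ => ?_
  simp only [mul_assoc]
  rw [integral_const_mul, integral_const_mul, h.integral_eq hφ]
  ring

/-- A point of `Ω` lies either in the support of `χ`, hence in `Ω'`, or in an open set where the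
product vanishes. Nothing is asked of `f` outside `Ω'`, so cut-off functions can be extended by
zero. -/
theorem locallyIntegrableOn_smooth_mul {Ω Ω' : Set ℝ} (hΩ' : IsOpen Ω') {f χ : ℝ → ℝ}
    (hf : LocallyIntegrableOn f Ω') (hχ : Continuous χ)
    (hs : Ω ∩ tsupport χ ⊆ Ω') : LocallyIntegrableOn (fun x => χ x * f x) Ω := by
  intro x hx
  by_cases hxs : x ∈ tsupport χ
  · have hx' := hs ⟨hx, hxs⟩
    have h1 : LocallyIntegrableOn (fun x => χ x * f x) Ω' := by
      rw [locallyIntegrableOn_iff hΩ'.isLocallyClosed] at hf ⊢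
      intro K hK hKc
      exact (hf K hK hKc).continuousOn_mul hχ.continuousOn hKc
    have h2 := h1 x hx'
    rw [hΩ'.nhdsWithin_eq hx'] at h2
    exact h2.filter_mono nhdsWithin_le_nhds
  · refine ⟨(tsupport χ)ᶜ, mem_nhdsWithin_of_mem_nhds
      ((isClosed_tsupport χ).isOpen_compl.mem_nhds hxs), ?_⟩
    refine (integrableOn_zero : IntegrableOn (fun _ => (0 : ℝ)) _ volume).congr_fun (fun y hy => ?_)
      (isClosed_tsupport χ).isOpen_compl.measurableSet
    simp [image_eq_zero_of_notMem_tsupport hy]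

/-- Product with a smooth function; where the smooth function vanishes, the other factor need not
be weakly differentiable. -/
theorem IsWeakDeriv.smooth_mul {Ω Ω' : Set ℝ} (hΩ' : IsOpen Ω') {f g χ : ℝ → ℝ}
    (h : IsWeakDeriv Ω' f g) (hχ : ContDiff ℝ ∞ χ) (hs : Ω ∩ tsupport χ ⊆ Ω') :
    IsWeakDeriv Ω (fun x => χ x * f x) (fun x => χ x * g x + deriv χ x * f x) := by
  have hχ' : ContDiff ℝ ∞ (_root_.deriv χ) := (contDiff_infty_iff_deriv.1 hχ).2
  have hs' : Ω ∩ tsupport (_root_.deriv χ) ⊆ Ω' :=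
    (inter_subset_inter_right _ tsupport_deriv_subset).trans hs
  have l1 := locallyIntegrableOn_smooth_mul hΩ' h.2.1 hχ.continuous hs
  have l2 := locallyIntegrableOn_smooth_mul hΩ' h.1 hχ'.continuous hs'
  have l3 := locallyIntegrableOn_smooth_mul hΩ' h.1 hχ.continuous hs
  refine isWeakDeriv_of_integral_eq l3 (l1.add l2) fun φ hφ => ?_
  -- The cut-off moves the support of the test function from `Ω` into `Ω'`, where the derivative of
  -- `f` is known.
  have hψ : IsTestFunction Ω' (fun x => χ x * φ x) := by
    refine ⟨hχ.mul hφ.1, hφ.2.1.mul_left, ?_⟩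
    refine Subset.trans (subset_inter ?_ ?_) hs
    · exact (tsupport_mul_subset_right (f := χ)).trans hφ.2.2
    · exact tsupport_mul_subset_left
  have hd : _root_.deriv (fun x => χ x * φ x) =
      fun x => _root_.deriv χ x * φ x + χ x * _root_.deriv φ x := by
    ext x
    exact deriv_fun_mul (hχ.differentiable (by simp) x) (hφ.1.differentiable (by simp) x)
  have key := h.integral_eq hψ
  have e1 : (fun x => f x * _root_.deriv (fun x => χ x * φ x) x) =
      fun x => (_root_.deriv χ x * f x) * φ x + (χ x * f x) * _root_.deriv φ x := by
    ext x; rw [hd]; ring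
  have e2 : (fun x => g x * (χ x * φ x)) = fun x => (χ x * g x) * φ x := by ext x; ring
  rw [e1, e2, integral_add (hφ.integrable_mul l2) (hφ.deriv.integrable_mul l3)] at key
  simp only [add_mul]
  rw [integral_add (hφ.integrable_mul l1) (hφ.integrable_mul l2)]
  linarith

/-! ### Affine changes of variable -/

theorem locallyIntegrableOn_comp_affine {Ω : Set ℝ} (hΩ : IsOpen Ω) {f : ℝ → ℝ}
    (hf : LocallyIntegrableOn f Ω) (x₀ : ℝ) {α : ℝ} (hα : α ≠ 0) :
    LocallyIntegrableOn (fun y => f (x₀ + α * y)) ((fun y => x₀ + α * y) ⁻¹' Ω) := by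
  have hA : Continuous fun y : ℝ => x₀ + α * y := by fun_prop
  rw [locallyIntegrableOn_iff hΩ.isLocallyClosed] at hf
  rw [locallyIntegrableOn_iff (hΩ.preimage hA).isLocallyClosed]
  intro K hK hKc
  have h1 := hf ((fun y => x₀ + α * y) '' K) (image_subset_iff.2 hK) (hKc.image hA)
  rw [← integrable_indicator_iff hKc.measurableSet]
  rw [← integrable_indicator_iff (hKc.image hA).measurableSet] at h1
  have h2 := (h1.comp_add_left x₀).comp_mul_left' hα
  refine h2.congr (Eventually.of_forall fun y => ?_)
  have hinj : Function.Injective fun y : ℝ => x₀ + α * y := fun a b h => by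
    simpa [hα] using h
  have hm := hinj.mem_set_image (s := K) (a := y)
  show indicator _ f (x₀ + α * y) = _
  by_cases hy : y ∈ K
  · rw [indicator_of_mem hy, indicator_of_mem (hm.2 hy)]
  · rw [indicator_of_notMem hy, indicator_of_notMem (fun h => hy (hm.1 h))]

theorem integral_comp_affine (f : ℝ → ℝ) (x₀ α : ℝ) :
    ∫ y, f (x₀ + α * y) = |α⁻¹| * ∫ x, f x := by
  rw [Measure.integral_comp_mul_left (fun x => f (x₀ + x)) α, integral_add_left_eq_self]
  rfl

/-- The test function is transported by the inverse map. A negative `α` is allowed: it reflects the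
left half of a crack onto the half-line. -/
theorem IsWeakDeriv.comp_affine {Ω : Set ℝ} (hΩ : IsOpen Ω) {f g : ℝ → ℝ}
    (h : IsWeakDeriv Ω f g) (x₀ : ℝ) {α : ℝ} (hα : α ≠ 0) :
    IsWeakDeriv ((fun y => x₀ + α * y) ⁻¹' Ω) (fun y => f (x₀ + α * y))
      (fun y => α * g (x₀ + α * y)) := by
  refine isWeakDeriv_of_integral_eq (locallyIntegrableOn_comp_affine hΩ h.1 x₀ hα)
    ((locallyIntegrableOn_comp_affine hΩ h.2.1 x₀ hα).smul α) fun φ hφ => ?_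
  have hinv : ∀ y, α⁻¹ * (x₀ + α * y - x₀) = y := fun y => by field_simp; ring
  have hinv' : ∀ x, x₀ + α * (α⁻¹ * (x - x₀)) = x := fun y => by field_simp; ring
  let e : ℝ ≃ₜ ℝ :=
    { toFun := fun x => α⁻¹ * (x - x₀)
      invFun := fun y => x₀ + α * y
      left_inv := hinv'
      right_inv := hinv
      continuous_toFun := by fun_prop
      continuous_invFun := by fun_prop }
  have hψ : IsTestFunction Ω (fun x => φ (α⁻¹ * (x - x₀))) := by
    refine ⟨hφ.1.comp (by fun_prop), hφ.2.1.comp_homeomorph e, ?_⟩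
    intro x hx
    have : e x ∈ tsupport φ := by
      have := (tsupport_comp_eq_preimage φ e)
      have hx2 : x ∈ tsupport (φ ∘ e) := hx
      rw [this] at hx2
      exact hx2
    have := hφ.2.2 this
    simpa [e, hinv'] using this
  have key := h.integral_eq hψ
  have hd : ∀ y, _root_.deriv (fun x => φ (α⁻¹ * (x - x₀))) (x₀ + α * y)
      = α⁻¹ * _root_.deriv φ y := by
    intro y
    have h1 : HasDerivAt (fun x => α⁻¹ * (x - x₀)) α⁻¹ (x₀ + α * y) := by
      simpa using ((hasDerivAt_id (x₀ + α * y)).sub_const x₀).const_mul α⁻¹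
    have h2 : HasDerivAt φ (_root_.deriv φ y) (α⁻¹ * (x₀ + α * y - x₀)) := by
      rw [hinv]; exact (hφ.1.differentiable (by simp) y).hasDerivAt
    have h3 := (h2.comp (x₀ + α * y) h1).deriv
    exact h3.trans (mul_comm _ _)
  have k1 := integral_comp_affine (fun x => f x * _root_.deriv (fun x => φ (α⁻¹ * (x - x₀))) x) x₀ α
  have k2 := integral_comp_affine (fun x => g x * φ (α⁻¹ * (x - x₀))) x₀ α
  simp only [hd, hinv] at k1 k2
  have e1 : ∫ y, f (x₀ + α * y) * _root_.deriv φ y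
      = α * ∫ y, f (x₀ + α * y) * (α⁻¹ * _root_.deriv φ y) := by
    rw [← integral_const_mul]; congr 1; ext y; field_simp
  have e2 : ∫ y, α * g (x₀ + α * y) * φ y = α * ∫ y, g (x₀ + α * y) * φ y := by
    rw [← integral_const_mul]; congr 1; ext y; ring
  rw [e1, e2, k1, k2, key]; ring

end ATFracture

end

noncomputable section

namespace ATFracture

/-! ### Primitives and absolutely continuous representatives -/

/-- Supplies a compact interval containing both the support of a test function and the base point of
a primitive, so that identities for interval integrals apply. -/
theorem exists_Icc_of_isCompact {Ω K : Set ℝ} (hΩ : IsOpen Ω) (hΩc : OrdConnected Ω)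
    (hK : IsCompact K) (hKΩ : K ⊆ Ω) {x₀ : ℝ} (hx₀ : x₀ ∈ Ω) :
    ∃ α β, α ≤ β ∧ x₀ ∈ Icc α β ∧ Icc α β ⊆ Ω ∧ K ⊆ Ioo α β := by
  have hK' : IsCompact (insert x₀ K) := hK.insert x₀
  obtain ⟨m, hm, hml⟩ := hK'.exists_isLeast (insert_nonempty _ _)
  obtain ⟨M, hM, hMl⟩ := hK'.exists_isGreatest (insert_nonempty _ _)
  have hsub : insert x₀ K ⊆ Ω := insert_subset hx₀ hKΩ
  obtain ⟨ε, hε, hεm⟩ := Metric.isOpen_iff.1 hΩ m (hsub hm)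
  obtain ⟨ε', hε', hεM⟩ := Metric.isOpen_iff.1 hΩ M (hsub hM)
  have h1 := hml (mem_insert x₀ K)
  have h2 := hMl (mem_insert x₀ K)
  refine ⟨m - ε / 2, M + ε' / 2, by linarith, ⟨by linarith, by linarith⟩, ?_, ?_⟩
  · refine hΩc.out (hεm ?_) (hεM ?_)
    · rw [Metric.mem_ball, Real.dist_eq, abs_lt]; constructor <;> linarith
    · rw [Metric.mem_ball, Real.dist_eq, abs_lt]; constructor <;> linarith
  · intro x hx
    have h3 := hml (mem_insert_of_mem _ hx)
    have h4 := hMl (mem_insert_of_mem _ hx)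
    constructor <;> linarith

theorem LocallyIntegrableOn.intervalIntegrable {Ω : Set ℝ} {g : ℝ → ℝ}
    (hg : LocallyIntegrableOn g Ω) {α β : ℝ} (h : uIcc α β ⊆ Ω) :
    IntervalIntegrable g volume α β :=
  (hg.integrableOn_compact_subset h isCompact_uIcc).intervalIntegrable

theorem continuousOn_primitive {Ω : Set ℝ} (hΩ : IsOpen Ω) (hΩc : OrdConnected Ω) {g : ℝ → ℝ}
    (hg : LocallyIntegrableOn g Ω) {x₀ : ℝ} (hx₀ : x₀ ∈ Ω) :
    ContinuousOn (fun x => ∫ t in x₀..x, g t) Ω := by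
  intro x hx
  obtain ⟨α, β, hαβ, hx0, hsub, hK⟩ := exists_Icc_of_isCompact hΩ hΩc isCompact_singleton
    (singleton_subset_iff.2 hx) hx₀
  rw [← uIcc_of_le hαβ] at hsub hx0
  have hi := LocallyIntegrableOn.intervalIntegrable hg hsub
  have h1 := (hi.absolutelyContinuousOnInterval_intervalIntegral hx0).continuousOn
  have hx' : x ∈ Ioo α β := hK rfl
  refine (h1.continuousAt ?_).continuousWithinAt
  rw [uIcc_of_le hαβ]
  exact Icc_mem_nhds hx'.1 hx'.2

/-- A primitive is absolutely continuous on compact intervals with derivative `g` almost everywhere;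
integration by parts has no boundary term because `φ` vanishes at both ends. -/
theorem isWeakDeriv_primitive {Ω : Set ℝ} (hΩ : IsOpen Ω) (hΩc : OrdConnected Ω) {g : ℝ → ℝ}
    (hg : LocallyIntegrableOn g Ω) {x₀ : ℝ} (hx₀ : x₀ ∈ Ω) (c : ℝ) :
    IsWeakDeriv Ω (fun x => c + ∫ t in x₀..x, g t) g := by
  have hcont : ContinuousOn (fun x => c + ∫ t in x₀..x, g t) Ω :=
    continuousOn_const.add (continuousOn_primitive hΩ hΩc hg hx₀)
  refine isWeakDeriv_of_integral_eq (hcont.locallyIntegrableOn hΩ.measurableSet) hg fun φ hφ => ?_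
  obtain ⟨α, β, hαβ, hx0, hsub, hK⟩ := exists_Icc_of_isCompact hΩ hΩc hφ.2.1 hφ.2.2 hx₀
  rw [← uIcc_of_le hαβ] at hsub hx0
  have hi := LocallyIntegrableOn.intervalIntegrable hg hsub
  have hGac : AbsolutelyContinuousOnInterval (fun x => c + ∫ t in x₀..x, g t) α β := by
    refine AbsolutelyContinuousOnInterval.add ?_
      (hi.absolutelyContinuousOnInterval_intervalIntegral hx0)
    exact (contDiffOn_const (c := c)).absolutelyContinuousOnInterval
  have hφac : AbsolutelyContinuousOnInterval φ α β :=
    (hφ.1.of_le (by exact_mod_cast le_top)).contDiffOn.absolutelyContinuousOnInterval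
  have key := hGac.integral_mul_deriv_eq_deriv_mul hφac
  have zero : ∀ x, x ∉ Ioo α β → φ x = 0 := fun x hx =>
    image_eq_zero_of_notMem_tsupport fun h => hx (hK h)
  have zero' : ∀ x, x ∉ Ioo α β → _root_.deriv φ x = 0 := fun x hx =>
    image_eq_zero_of_notMem_tsupport fun h => hx (hK (tsupport_deriv_subset h))
  rw [zero α (by simp), zero β (by simp)] at key
  have full : ∀ f ψ : ℝ → ℝ, (∀ x, x ∉ Ioo α β → ψ x = 0) →
      ∫ x in α..β, f x * ψ x = ∫ x, f x * ψ x := by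
    intro f ψ hψ
    rw [intervalIntegral.integral_of_le hαβ]
    refine setIntegral_eq_integral_of_forall_compl_eq_zero fun x hx => ?_
    rw [hψ x fun h => hx (Ioo_subset_Ioc_self h), mul_zero]
  have e : ∫ x in α..β, _root_.deriv (fun x => c + ∫ t in x₀..x, g t) x * φ x
      = ∫ x in α..β, g x * φ x := by
    refine intervalIntegral.integral_congr_ae ?_
    filter_upwards [hi.ae_hasDerivAt_integral] with x hx hx'
    rw [((hx (uIoc_subset_uIcc hx') x₀ hx0).const_add c).deriv]
  rw [e, full _ _ zero, full _ _ zero'] at key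
  simpa using key

theorem exists_test_integral_eq_one {Ω : Set ℝ} (hΩ : IsOpen Ω) (hne : Ω.Nonempty) :
    ∃ θ, IsTestFunction Ω θ ∧ ∫ x, θ x = 1 := by
  obtain ⟨x₀, hx₀⟩ := hne
  obtain ⟨ε, hε, hsub⟩ := Metric.isOpen_iff.1 hΩ x₀ hx₀
  let f : ContDiffBump x₀ := ⟨ε / 4, ε / 2, by linarith, by linarith⟩
  refine ⟨f.normed volume, ⟨f.contDiff_normed, f.hasCompactSupport_normed, ?_⟩, f.integral_normed⟩
  rw [f.tsupport_normed_eq]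
  exact (Metric.closedBall_subset_ball (by show ε / 2 < ε; linarith)).trans hsub

/-- A test function with zero mean on an interval is the derivative of a test function. -/
theorem IsTestFunction.exists_primitive {Ω : Set ℝ} (hΩ : IsOpen Ω) (hΩc : OrdConnected Ω)
    {ψ : ℝ → ℝ} (hψ : IsTestFunction Ω ψ) (h0 : ∫ x, ψ x = 0) (hne : Ω.Nonempty) :
    ∃ φ, IsTestFunction Ω φ ∧ _root_.deriv φ = ψ := by
  obtain ⟨x₀, hx₀⟩ := hne
  obtain ⟨α, β, hαβ, hx0, hsub, hK⟩ := exists_Icc_of_isCompact hΩ hΩc hψ.2.1 hψ.2.2 hx₀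
  have zero : ∀ x, x ∉ Ioo α β → ψ x = 0 := fun x hx =>
    image_eq_zero_of_notMem_tsupport fun h => hx (hK h)
  have hd : ∀ x, HasDerivAt (fun x => ∫ t in α..x, ψ t) (ψ x) x := fun x =>
    hψ.continuous.integral_hasStrictDerivAt α x |>.hasDerivAt
  have hdd : _root_.deriv (fun x => ∫ t in α..x, ψ t) = ψ := funext fun x => (hd x).deriv
  have hout : ∀ x, x ∉ Icc α β → ∫ t in α..x, ψ t = 0 := by
    intro x hx
    rcases lt_or_ge x α with h | h
    · refine (intervalIntegral.integral_congr (g := fun _ => 0) fun t ht => ?_).trans (by simp)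
      rw [uIcc_of_ge h.le] at ht
      exact zero t fun h' => absurd ht.2 (not_le.2 h'.1)
    · have hβ : β < x := by by_contra h'; exact hx ⟨h, not_lt.1 h'⟩
      rw [intervalIntegral.integral_of_le h, ← h0]
      refine setIntegral_eq_integral_of_forall_compl_eq_zero fun t ht => zero t fun h' => ht ?_
      exact ⟨h'.1, h'.2.le.trans hβ.le⟩
  have hts : tsupport (fun x => ∫ t in α..x, ψ t) ⊆ Icc α β :=
    closure_minimal (fun x hx => by by_contra h; exact hx (hout x h)) isClosed_Icc
  refine ⟨fun x => ∫ t in α..x, ψ t, ⟨?_, ?_, hts.trans hsub⟩, hdd⟩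
  · rw [contDiff_infty_iff_deriv, hdd]
    exact ⟨fun x => (hd x).differentiableAt, hψ.1⟩
  · exact isCompact_Icc.of_isClosed_subset (isClosed_tsupport _) hts

/-- Du Bois-Reymond: subtracting from `ψ` its mean times a fixed bump `θ` of mass one leaves a
derivative of a test function, which `f` annihilates. The constant is therefore `∫ f θ`. -/
theorem IsWeakDeriv.ae_const {Ω : Set ℝ} (hΩ : IsOpen Ω) (hΩc : OrdConnected Ω) {f : ℝ → ℝ}
    (h : IsWeakDeriv Ω f fun _ => 0) : ∃ c, f =ᵐ[volume.restrict Ω] fun _ => c := by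
  rcases Ω.eq_empty_or_nonempty with rfl | hne
  · exact ⟨0, by simp [Filter.EventuallyEq]⟩
  obtain ⟨θ, hθ, hθ1⟩ := exists_test_integral_eq_one hΩ hne
  refine ⟨∫ x, f x * θ x, ae_restrict_eq_of_forall_test hΩ h.1 (locallyIntegrableOn_const _)
    fun ψ hψ => ?_⟩
  have hcθ : IsTestFunction Ω (fun x => (∫ y, ψ y) * θ x) := hθ.mul_smooth contDiff_const
  have hψi : Integrable ψ := by
    simpa using hψ.integrable_mul (locallyIntegrableOn_const (1 : ℝ))
  have hθi : Integrable θ := by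
    simpa using hθ.integrable_mul (locallyIntegrableOn_const (1 : ℝ))
  have hζ : IsTestFunction Ω (fun x => ψ x - (∫ y, ψ y) * θ x) := by
    refine ⟨hψ.1.sub hcθ.1, hψ.2.1.sub hcθ.2.1, ?_⟩
    exact (tsupport_sub ψ _).trans (union_subset hψ.2.2 hcθ.2.2)
  have hz : ∫ x, (ψ x - (∫ y, ψ y) * θ x) = 0 := by
    rw [integral_sub hψi (hθi.const_mul _), integral_const_mul, hθ1]; ring
  obtain ⟨φ, hφ, hφd⟩ := hζ.exists_primitive hΩ hΩc hz hne
  have key := h.integral_eq hφ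
  rw [hφd] at key
  have e : (fun x => f x * (ψ x - (∫ y, ψ y) * θ x))
      = fun x => f x * ψ x - (∫ y, ψ y) * (f x * θ x) := by ext x; ring
  rw [e, integral_sub (hψ.integrable_mul h.1) ((hθ.integrable_mul h.1).const_mul _),
    integral_const_mul] at key
  simp only [zero_mul, integral_zero, neg_zero] at key
  rw [integral_const_mul]
  linarith

theorem IsWeakDeriv.exists_ae_eq_primitive {Ω : Set ℝ} (hΩ : IsOpen Ω) (hΩc : OrdConnected Ω)
    {u g : ℝ → ℝ} (h : IsWeakDeriv Ω u g) {x₀ : ℝ} (hx₀ : x₀ ∈ Ω) :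
    ∃ c, u =ᵐ[volume.restrict Ω] fun x => c + ∫ t in x₀..x, g t := by
  have h1 := isWeakDeriv_primitive hΩ hΩc h.2.1 hx₀ 0
  have h2 := h.add (h1.const_mul (-1))
  obtain ⟨c, hc⟩ := (h2.congr (ae_eq_refl _) (g' := fun _ => 0)
    (Eventually.of_forall fun x => by simp)).ae_const hΩ hΩc
  refine ⟨c, ?_⟩
  filter_upwards [hc] with x hx
  linarith

theorem intervalIntegrable_of_integrableOn_Ioo {a b : ℝ} {g : ℝ → ℝ}
    (hg : IntegrableOn g (Ioo a b)) {x y : ℝ} (hx : x ∈ Icc a b) (hy : y ∈ Icc a b) :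
    IntervalIntegrable g volume x y := by
  have h1 : IntegrableOn g (Icc a b) := by rwa [integrableOn_Icc_iff_integrableOn_Ioo]
  exact (h1.mono_set (uIcc_subset_Icc hx hy)).intervalIntegrable

theorem IsWeakDeriv.exists_ae_eq_primitive_Ioo {a b : ℝ} (hab : a < b) {u g : ℝ → ℝ}
    (h : IsWeakDeriv (Ioo a b) u g) (hg : IntegrableOn g (Ioo a b)) :
    ∃ c, u =ᵐ[volume.restrict (Ioo a b)] fun x => c + ∫ t in a..x, g t := by
  have hx₀ : (a + b) / 2 ∈ Ioo a b := ⟨by linarith, by linarith⟩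
  obtain ⟨c, hc⟩ := h.exists_ae_eq_primitive isOpen_Ioo ordConnected_Ioo hx₀
  refine ⟨c - ∫ t in a..((a + b) / 2), g t, ?_⟩
  filter_upwards [hc, ae_restrict_mem measurableSet_Ioo] with x hx hxm
  rw [hx, ← intervalIntegral.integral_add_adjacent_intervals (b := (a + b) / 2)
    (intervalIntegrable_of_integrableOn_Ioo hg ⟨le_rfl, hab.le⟩ (Ioo_subset_Icc_self hx₀))
    (intervalIntegrable_of_integrableOn_Ioo hg (Ioo_subset_Icc_self hx₀)
      (Ioo_subset_Icc_self hxm))]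
  ring

theorem isWeakDeriv_primitive_Ioo {a b : ℝ} (hab : a < b) {g : ℝ → ℝ}
    (hg : IntegrableOn g (Ioo a b)) (c : ℝ) :
    IsWeakDeriv (Ioo a b) (fun x => c + ∫ t in a..x, g t) g := by
  have hx₀ : (a + b) / 2 ∈ Ioo a b := ⟨by linarith, by linarith⟩
  refine (isWeakDeriv_primitive isOpen_Ioo ordConnected_Ioo hg.locallyIntegrableOn hx₀
    (c + ∫ t in a..((a + b) / 2), g t)).congr ?_ (ae_eq_refl _)
  filter_upwards [ae_restrict_mem measurableSet_Ioo] with x hxm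
  rw [← intervalIntegral.integral_add_adjacent_intervals (b := (a + b) / 2) (c := x)
    (intervalIntegrable_of_integrableOn_Ioo hg ⟨le_rfl, hab.le⟩ (Ioo_subset_Icc_self hx₀))
    (intervalIntegrable_of_integrableOn_Ioo hg (Ioo_subset_Icc_self hx₀)
      (Ioo_subset_Icc_self hxm))]
  ring

end ATFracture

end

noncomputable section

namespace ATFracture

/-! ### Square integrable functions -/

theorem MemLp.integral_sq_eq {α : Type*} [MeasurableSpace α] {μ : Measure α} {f : α → ℝ}
    (hf : MemLp f 2 μ) : ∫ x, f x ^ 2 ∂μ = ‖hf.toLp f‖ ^ 2 := by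
  rw [← real_inner_self_eq_norm_sq, L2.inner_def]
  refine integral_congr_ae ?_
  filter_upwards [hf.coeFn_toLp] with x hx
  rw [hx]; simp [sq]

theorem MemLp.abs_setIntegral_le {α : Type*} [MeasurableSpace α] {μ : Measure α} {f : α → ℝ}
    (hf : MemLp f 2 μ) {s : Set α} (hs : MeasurableSet s) (hμ : μ s ≠ ⊤) :
    |∫ x in s, f x ∂μ| ≤ Real.sqrt (μ.real s) * ‖hf.toLp f‖ := by
  have h1 := abs_real_inner_le_norm (indicatorConstLp 2 hs hμ (1 : ℝ)) (hf.toLp f)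
  rw [L2.inner_indicatorConstLp_one hs hμ] at h1
  have e : ∫ x in s, (hf.toLp f) x ∂μ = ∫ x in s, f x ∂μ :=
    integral_congr_ae (ae_restrict_of_ae hf.coeFn_toLp)
  rw [e] at h1
  refine h1.trans (mul_le_mul_of_nonneg_right ?_ (norm_nonneg _))
  rw [norm_indicatorConstLp (by simp) (by simp), Real.sqrt_eq_rpow]
  simp

theorem MemLp.integrableOn_of_measure_ne_top {α : Type*} [MeasurableSpace α] {μ : Measure α}
    {f : α → ℝ} (hf : MemLp f 2 μ) {s : Set α} (hμ : μ s ≠ ⊤) : IntegrableOn f s μ := by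
  have : IsFiniteMeasure (μ.restrict s) := ⟨by simpa using lt_top_iff_ne_top.2 hμ⟩
  exact (hf.restrict s).integrable (by norm_num)

/-! ### Functions on the half-line -/

/-- The primitive vanishing at the origin. -/
def prim (q : ℝ → ℝ) (x : ℝ) : ℝ := ∫ t in (0 : ℝ)..x, q t

/-- Integrability on all bounded intervals with left end point `0`. -/
def IntegrableNearZero (q : ℝ → ℝ) : Prop := ∀ R, IntegrableOn q (Ioo 0 R)

theorem IntegrableNearZero.intervalIntegrable {q : ℝ → ℝ} (h : IntegrableNearZero q) {x y : ℝ}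
    (hx : 0 ≤ x) (hy : 0 ≤ y) : IntervalIntegrable q volume x y :=
  intervalIntegrable_of_integrableOn_Ioo (h (max x y)) ⟨hx, le_max_left _ _⟩
    ⟨hy, le_max_right _ _⟩

theorem IntegrableNearZero.locallyIntegrableOn {q : ℝ → ℝ} (h : IntegrableNearZero q) :
    LocallyIntegrableOn q (Ioi 0) := by
  intro x hx
  refine ⟨Ioo 0 (x + 1), ?_, h _⟩
  exact mem_nhdsWithin_of_mem_nhds (Ioo_mem_nhds hx (by linarith))

theorem integrableNearZero_of_memLp {q : ℝ → ℝ} (h : MemLp q 2 (volume.restrict (Ioi 0))) :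
    IntegrableNearZero q := fun R => by
  have := MemLp.integrableOn_of_measure_ne_top h (s := Ioo 0 R)
    (((Measure.restrict_apply_le _ _).trans_lt (by simp)).ne)
  rwa [IntegrableOn, Measure.restrict_restrict_of_subset Ioo_subset_Ioi_self] at this

theorem IntegrableNearZero.continuousOn_prim {q : ℝ → ℝ} (h : IntegrableNearZero q) :
    ContinuousOn (prim q) (Ici 0) := by
  intro x hx
  have hx0 : (0 : ℝ) ≤ x := hx
  have h1 := (h.intervalIntegrable le_rfl (y := x + 1)
    (by linarith)).absolutelyContinuousOnInterval_intervalIntegral (c := 0) left_mem_uIcc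
  have h2 := h1.continuousOn x (by rw [uIcc_of_le (by linarith)]; exact ⟨hx0, by linarith⟩)
  refine h2.mono_of_mem_nhdsWithin ?_
  rw [uIcc_of_le (by linarith)]
  filter_upwards [self_mem_nhdsWithin, mem_nhdsWithin_of_mem_nhds
    (Iio_mem_nhds (show x < x + 1 by linarith))] with y hy1 hy2
  exact ⟨hy1, (mem_Iio.1 hy2).le⟩

theorem IntegrableNearZero.prim {q : ℝ → ℝ} (h : IntegrableNearZero q) :
    IntegrableNearZero (prim q) := fun _ =>
  ((h.continuousOn_prim.mono Icc_subset_Ici_self).integrableOn_Icc).mono_set Ioo_subset_Icc_self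

theorem IntegrableNearZero.isWeakDeriv_prim {q : ℝ → ℝ} (h : IntegrableNearZero q) (c : ℝ) :
    IsWeakDeriv (Ioi 0) (fun x => c + ATFracture.prim q x) q := by
  refine (isWeakDeriv_primitive isOpen_Ioi ordConnected_Ioi h.locallyIntegrableOn
    (x₀ := 1) (by simp) (c + ATFracture.prim q 1)).congr ?_ (ae_eq_refl _)
  filter_upwards [ae_restrict_mem measurableSet_Ioi] with x hx
  have hx0 : (0 : ℝ) < x := hx
  rw [ATFracture.prim, ATFracture.prim, ← intervalIntegral.integral_add_adjacent_intervals (b := 1) (c := x)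
    (h.intervalIntegrable le_rfl zero_le_one) (h.intervalIntegrable zero_le_one hx0.le)]
  ring

theorem IsWeakDeriv.exists_ae_eq_prim {u q : ℝ → ℝ} (h : IsWeakDeriv (Ioi 0) u q)
    (hq : IntegrableNearZero q) :
    ∃ c, u =ᵐ[volume.restrict (Ioi 0)] fun x => c + prim q x := by
  obtain ⟨c, hc⟩ := h.exists_ae_eq_primitive isOpen_Ioi ordConnected_Ioi (x₀ := 1) (by simp)
  refine ⟨c - prim q 1, ?_⟩
  filter_upwards [hc, ae_restrict_mem measurableSet_Ioi] with x hx hxm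
  have hx0 : (0 : ℝ) < x := hxm
  rw [hx, prim, prim, ← intervalIntegral.integral_add_adjacent_intervals (b := 1) (c := x)
    (hq.intervalIntegrable le_rfl zero_le_one) (hq.intervalIntegrable zero_le_one hx0.le)]
  ring

/-- Every one-sided interval has positive measure and so meets every conull set. Uniqueness of
essential limits, hence of traces and jumps, rests on this. -/
instance essRight_neBot (s : ℝ) : (essRight s).NeBot := by
  rw [essRight, inf_neBot_iff]
  intro A hA B hB
  obtain ⟨u, hu, hsub⟩ := mem_nhdsGT_iff_exists_Ioo_subset.1 hA
  by_contra hne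
  rw [not_nonempty_iff_eq_empty] at hne
  have : Ioo s u ⊆ Bᶜ := fun x hx hxB => by
    have : x ∈ A ∩ B := ⟨hsub hx, hxB⟩
    rw [hne] at this; exact this
  have h0 := measure_mono_null this (mem_ae_iff.1 hB)
  rw [Real.volume_Ioo, ENNReal.ofReal_eq_zero] at h0
  have : s < u := hu
  linarith

instance essLeft_neBot (s : ℝ) : (essLeft s).NeBot := by
  rw [essLeft, inf_neBot_iff]
  intro A hA B hB
  obtain ⟨u, hu, hsub⟩ := mem_nhdsLT_iff_exists_Ioo_subset.1 hA
  by_contra hne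
  rw [not_nonempty_iff_eq_empty] at hne
  have : Ioo u s ⊆ Bᶜ := fun x hx hxB => by
    have : x ∈ A ∩ B := ⟨hsub hx, hxB⟩
    rw [hne] at this; exact this
  have h0 := measure_mono_null this (mem_ae_iff.1 hB)
  rw [Real.volume_Ioo, ENNReal.ofReal_eq_zero] at h0
  have : u < s := hu
  linarith

theorem tendsto_essRight_congr {s c : ℝ} (hsc : s < c) {u v : ℝ → ℝ} {l : Filter ℝ}
    (h : u =ᵐ[volume.restrict (Ioo s c)] v) (hv : Tendsto v (𝓝[>] s) l) :
    Tendsto u (essRight s) l := by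
  have h1 : Tendsto v (essRight s) l := hv.mono_left inf_le_left
  refine h1.congr' ?_
  rw [Filter.EventuallyEq, ae_restrict_iff' measurableSet_Ioo] at h
  have h2 : ∀ᶠ x in essRight s, x ∈ Ioo s c :=
    (inf_le_left : essRight s ≤ _) (Ioo_mem_nhdsGT hsc)
  have h3 : ∀ᶠ x in essRight s, x ∈ Ioo s c → u x = v x := (inf_le_right : essRight s ≤ _) h
  filter_upwards [h2, h3] with x hx hx'
  exact (hx' hx).symm

theorem tendsto_essLeft_congr {s c : ℝ} (hsc : c < s) {u v : ℝ → ℝ} {l : Filter ℝ}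
    (h : u =ᵐ[volume.restrict (Ioo c s)] v) (hv : Tendsto v (𝓝[<] s) l) :
    Tendsto u (essLeft s) l := by
  have h1 : Tendsto v (essLeft s) l := hv.mono_left inf_le_left
  refine h1.congr' ?_
  rw [Filter.EventuallyEq, ae_restrict_iff' measurableSet_Ioo] at h
  have h2 : ∀ᶠ x in essLeft s, x ∈ Ioo c s :=
    (inf_le_left : essLeft s ≤ _) (Ioo_mem_nhdsLT hsc)
  have h3 : ∀ᶠ x in essLeft s, x ∈ Ioo c s → u x = v x := (inf_le_right : essLeft s ≤ _) h
  filter_upwards [h2, h3] with x hx hx'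
  exact (hx' hx).symm

theorem IntegrableNearZero.tendsto_prim {q : ℝ → ℝ} (h : IntegrableNearZero q) (c : ℝ) :
    Tendsto (fun x => c + ATFracture.prim q x) (𝓝[>] 0) (𝓝 c) := by
  have h1 := (h.continuousOn_prim 0 self_mem_Ici).mono_left (nhdsWithin_mono 0 Ioi_subset_Ici_self)
  have h2 := h1.const_add c
  simpa [ATFracture.prim] using h2

theorem eq_of_ae_eq_add_prim {q u : ℝ → ℝ} (hq : IntegrableNearZero q) {c l : ℝ}
    (h : u =ᵐ[volume.restrict (Ioi 0)] fun x => c + prim q x)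
    (hl : Tendsto u (essRight 0) (𝓝 l)) : c = l := by
  have h1 := tendsto_essRight_congr (zero_lt_one) (ae_restrict_of_ae_restrict_of_subset
    Ioo_subset_Ioi_self h) (hq.tendsto_prim c)
  exact tendsto_nhds_unique h1 hl

/-! ### Profiles in terms of their second derivative -/

/-- The profile with second derivative `q`, `w(0) = 1` and `w'(0) = 0`. -/
def profileOf (q : ℝ → ℝ) (x : ℝ) : ℝ := 1 + prim (prim q) x

/-- `q` is the second derivative of an admissible profile. -/
structure IsProfileSecondDeriv (q : ℝ → ℝ) : Prop where
  memLp : MemLp q 2 (volume.restrict (Ioi 0))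
  memLp_prim : MemLp (prim q) 2 (volume.restrict (Ioi 0))
  integrable : IntegrableOn (profileOf q) (Ioi 0)
  mem_Icc : ∀ x, 0 ≤ x → profileOf q x ∈ Icc (0 : ℝ) 1

theorem mem_admissibleProfiles {w w₁ w₂ : ℝ → ℝ} (h1 : IsWeakDeriv (Ioi 0) w w₁)
    (h2 : IsWeakDeriv (Ioi 0) w₁ w₂) (hw : IntegrableOn w (Ioi 0))
    (hw1 : MemLp w₁ 2 (volume.restrict (Ioi 0))) (hw2 : MemLp w₂ 2 (volume.restrict (Ioi 0)))
    (t0 : Tendsto w (essRight 0) (𝓝 1)) (t1 : Tendsto w₁ (essRight 0) (𝓝 0))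
    (hI : ∀ᵐ x ∂volume.restrict (Ioi (0 : ℝ)), w x ∈ Icc (0 : ℝ) 1) :
    w ∈ admissibleProfiles := by
  have e1 := h1.weakDeriv_ae_eq isOpen_Ioi
  refine ⟨⟨memLp_one_iff_integrable.2 hw, ⟨_, h1⟩, ⟨hw1.ae_eq e1.symm, w₂,
    h2.congr e1.symm (ae_eq_refl _), hw2⟩, t0, ?_⟩, hI⟩
  refine t1.congr' ?_
  rw [Filter.EventuallyEq, ae_restrict_iff' measurableSet_Ioi] at e1
  have h2 : ∀ᶠ x in essRight 0, x ∈ Ioi (0 : ℝ) :=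
    (inf_le_left : essRight 0 ≤ _) self_mem_nhdsWithin
  have h3 := (inf_le_right : essRight 0 ≤ _) e1
  filter_upwards [h2, h3] with x hx hx'
  exact (hx' hx).symm

theorem profileEnergy_eq {ρ : ℝ} {w w₁ w₂ : ℝ → ℝ} (h1 : IsWeakDeriv (Ioi 0) w w₁)
    (h2 : IsWeakDeriv (Ioi 0) w₁ w₂) :
    profileEnergy ρ w = ∫ x in Ioi (0 : ℝ), (w x + w₁ x ^ 2 + ρ * w₂ x ^ 2) := by
  refine integral_congr_ae ?_
  filter_upwards [h1.weakDeriv_ae_eq isOpen_Ioi, h1.weakDeriv_weakDeriv_ae_eq isOpen_Ioi h2]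
    with x e1 e2
  rw [e1, e2]

namespace IsProfileSecondDeriv

variable {q : ℝ → ℝ}

theorem nearZero (h : IsProfileSecondDeriv q) : IntegrableNearZero q :=
  integrableNearZero_of_memLp h.memLp

theorem isWeakDeriv_profileOf (h : IsProfileSecondDeriv q) :
    IsWeakDeriv (Ioi 0) (profileOf q) (prim q) := h.nearZero.prim.isWeakDeriv_prim 1

theorem isWeakDeriv_prim (h : IsProfileSecondDeriv q) : IsWeakDeriv (Ioi 0) (prim q) q := by
  simpa using h.nearZero.isWeakDeriv_prim 0

theorem mem_admissible (h : IsProfileSecondDeriv q) : profileOf q ∈ admissibleProfiles := by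
  refine mem_admissibleProfiles h.isWeakDeriv_profileOf h.isWeakDeriv_prim h.integrable
    h.memLp_prim h.memLp ((h.nearZero.prim.tendsto_prim 1).mono_left inf_le_left) ?_ ?_
  · have := (h.nearZero.tendsto_prim 0).mono_left (inf_le_left : essRight 0 ≤ _)
    exact this.congr fun x => zero_add _
  · filter_upwards [ae_restrict_mem measurableSet_Ioi] with x hx
    exact h.mem_Icc x (le_of_lt hx)

theorem integral_nonneg (h : IsProfileSecondDeriv q) : 0 ≤ ∫ x in Ioi (0 : ℝ), profileOf q x :=
  setIntegral_nonneg measurableSet_Ioi fun x hx => (h.mem_Icc x (le_of_lt hx)).1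

theorem profileEnergy_eq (h : IsProfileSecondDeriv q) (ρ : ℝ) :
    profileEnergy ρ (profileOf q) = (∫ x in Ioi (0 : ℝ), profileOf q x)
      + ‖h.memLp_prim.toLp (prim q)‖ ^ 2 + ρ * ‖h.memLp.toLp q‖ ^ 2 := by
  rw [ATFracture.profileEnergy_eq h.isWeakDeriv_profileOf h.isWeakDeriv_prim,
    ← MemLp.integral_sq_eq h.memLp_prim, ← MemLp.integral_sq_eq h.memLp,
    ← integral_add h.integrable h.memLp_prim.integrable_sq, ← integral_const_mul]
  exact integral_add (h.integrable.add h.memLp_prim.integrable_sq)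
    (h.memLp.integrable_sq.const_mul ρ)

end IsProfileSecondDeriv

/-- The two trace conditions fix the two constants of integration, so a profile is determined by its
second derivative and the minimisation can be carried out over `q`. -/
theorem exists_isProfileSecondDeriv {w : ℝ → ℝ} (hw : w ∈ admissibleProfiles) :
    ∃ q, IsProfileSecondDeriv q ∧ w =ᵐ[volume.restrict (Ioi 0)] profileOf q ∧
      weakDeriv (Ioi 0) w =ᵐ[volume.restrict (Ioi 0)] prim q ∧
      ∀ ρ, profileEnergy ρ w = profileEnergy ρ (profileOf q) := by
  obtain ⟨⟨hw1, ⟨g, hg⟩, ⟨hd, q, hq, hq2⟩, t0, t1⟩, hI⟩ := hw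
  have n2 := integrableNearZero_of_memLp hq2
  have hwd := hg.weakDeriv
  obtain ⟨c, hc⟩ := hq.exists_ae_eq_prim n2
  have hc0 := eq_of_ae_eq_add_prim n2 hc t1
  subst hc0
  have hc' : weakDeriv (Ioi 0) w =ᵐ[volume.restrict (Ioi 0)] prim q := by simpa using hc
  have hwp : IsWeakDeriv (Ioi 0) w (prim q) := hwd.congr (ae_eq_refl _) hc'
  obtain ⟨c, hcw⟩ := hwp.exists_ae_eq_prim n2.prim
  have hc1 := eq_of_ae_eq_add_prim n2.prim hcw t0
  subst hc1
  have hW : w =ᵐ[volume.restrict (Ioi 0)] profileOf q := hcw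
  have hcont : ContinuousOn (profileOf q) (Ici 0) :=
    continuousOn_const.add n2.prim.continuousOn_prim
  have hprof : IsProfileSecondDeriv q := by
    refine ⟨hq2, hd.ae_eq hc', (memLp_one_iff_integrable.1 hw1).congr hW, ?_⟩
    have hae : ∀ᵐ x ∂volume.restrict (Ioi (0 : ℝ)), profileOf q x ∈ Icc (0 : ℝ) 1 := by
      filter_upwards [hI, hW] with x h1 h2
      rwa [← h2]
    -- A conull subset of the half-line is dense in it, so by continuity the constraint holds at
    -- every point, including the origin.
    intro x hx
    rw [ae_restrict_iff' measurableSet_Ioi] at hae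
    have hx' : x ∈ closure (Ioi (0 : ℝ) ∩ {x | x ∈ Ioi (0:ℝ) → profileOf q x ∈ Icc (0 : ℝ) 1}) := by
      have := (Measure.dense_of_ae hae).open_subset_closure_inter (isOpen_Ioi (a := (0 : ℝ)))
      have h3 := closure_mono this
      rw [closure_closure, closure_Ioi] at h3
      exact h3 hx
    have hcw : ContinuousWithinAt (profileOf q)
      (Ioi (0 : ℝ) ∩ {x | x ∈ Ioi (0:ℝ) → profileOf q x ∈ Icc (0 : ℝ) 1}) x :=
      (hcont x hx).mono fun y hy => (le_of_lt hy.1 : (0:ℝ) ≤ y)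
    have := hcw.mem_closure hx' (t := Icc (0 : ℝ) 1) fun y hy => hy.2 hy.1
    rwa [isClosed_Icc.closure_eq] at this
  refine ⟨q, hprof, hW, hc', fun ρ => ?_⟩
  rw [profileEnergy_eq hwp (hq.congr hc' (ae_eq_refl _)),
    profileEnergy_eq hprof.isWeakDeriv_profileOf hprof.isWeakDeriv_prim]
  refine integral_congr_ae ?_
  filter_upwards [hW] with x hx
  rw [hx]

end ATFracture

end

noncomputable section

namespace ATFracture

/-! ### Existence of an optimal profile -/

theorem prim_eq_setIntegral (f : ℝ → ℝ) {x : ℝ} (hx : 0 ≤ x) :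
    prim f x = ∫ t in Ioc 0 x, f t ∂volume.restrict (Ioi 0) := by
  rw [prim, intervalIntegral.integral_of_le hx,
    Measure.restrict_restrict_of_subset Ioc_subset_Ioi_self]

theorem abs_prim_le {f : ℝ → ℝ} (hf : MemLp f 2 (volume.restrict (Ioi 0))) {x : ℝ} (hx : 0 ≤ x) :
    |prim f x| ≤ Real.sqrt x * ‖hf.toLp f‖ := by
  have hm : (volume.restrict (Ioi (0 : ℝ))) (Ioc 0 x) = ENNReal.ofReal x := by
    rw [Measure.restrict_eq_self _ Ioc_subset_Ioi_self, Real.volume_Ioc, sub_zero]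
  have := MemLp.abs_setIntegral_le hf (s := Ioc 0 x) measurableSet_Ioc (by rw [hm]; simp)
  rwa [← prim_eq_setIntegral f hx, Measure.real, hm, ENNReal.toReal_ofReal hx] at this

theorem prim_sub {f g : ℝ → ℝ} (hf : IntegrableNearZero f) (hg : IntegrableNearZero g) {x : ℝ}
    (hx : 0 ≤ x) : prim (fun t => f t - g t) x = prim f x - prim g x :=
  intervalIntegral.integral_sub (hf.intervalIntegrable le_rfl hx) (hg.intervalIntegrable le_rfl hx)

theorem prim_congr {f g : ℝ → ℝ} (h : f =ᵐ[volume.restrict (Ioi 0)] g) {x : ℝ} (hx : 0 ≤ x) :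
    prim f x = prim g x := by
  rw [prim_eq_setIntegral f hx, prim_eq_setIntegral g hx]
  exact integral_congr_ae (ae_restrict_of_ae h)

theorem prim_midpoint {f g : ℝ → ℝ} (hf : IntegrableNearZero f) (hg : IntegrableNearZero g) {x : ℝ}
    (hx : 0 ≤ x) : prim (fun t => 2⁻¹ * (f t + g t)) x = 2⁻¹ * (prim f x + prim g x) := by
  rw [prim, intervalIntegral.integral_const_mul, intervalIntegral.integral_add
    (hf.intervalIntegrable le_rfl hx) (hg.intervalIntegrable le_rfl hx)]
  rfl

theorem tendsto_prim_of_tendsto_toLp {f : ℕ → ℝ → ℝ} {g : ℝ → ℝ}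
    (hf : ∀ n, MemLp (f n) 2 (volume.restrict (Ioi 0)))
    (hg : MemLp g 2 (volume.restrict (Ioi 0)))
    (h : Tendsto (fun n => (hf n).toLp (f n)) atTop (𝓝 (hg.toLp g))) {x : ℝ} (hx : 0 ≤ x) :
    Tendsto (fun n => prim (f n) x) atTop (𝓝 (prim g x)) := by
  rw [tendsto_iff_norm_sub_tendsto_zero] at h ⊢
  have h2 := h.const_mul (Real.sqrt x)
  rw [mul_zero] at h2
  refine squeeze_zero (fun _ => norm_nonneg _) (fun n => ?_) h2
  rw [Real.norm_eq_abs, ← prim_sub (integrableNearZero_of_memLp (hf n))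
    (integrableNearZero_of_memLp hg) hx, ← MemLp.toLp_sub]
  exact abs_prim_le ((hf n).sub hg) hx

/-- The constraints are convex and the energy is linear plus two squared Hilbert norms, so the
parallelogram law computes exactly what averaging gains. This quantitative convexity gives strong
convergence of minimizing sequences. -/
theorem IsProfileSecondDeriv.exists_midpoint {a b : ℝ → ℝ} (ha : IsProfileSecondDeriv a)
    (hb : IsProfileSecondDeriv b) (ρ : ℝ) : ∃ c, IsProfileSecondDeriv c ∧
      profileEnergy ρ (profileOf c)
        = (profileEnergy ρ (profileOf a) + profileEnergy ρ (profileOf b)) / 2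
        - (‖ha.memLp_prim.toLp _ - hb.memLp_prim.toLp _‖ ^ 2
          + ρ * ‖ha.memLp.toLp _ - hb.memLp.toLp _‖ ^ 2) / 4 := by
  set c : ℝ → ℝ := fun t => 2⁻¹ * (a t + b t) with hc
  have e1 : ∀ x, 0 ≤ x → prim c x = 2⁻¹ * (prim a x + prim b x) := fun x hx =>
    prim_midpoint ha.nearZero hb.nearZero hx
  have e1' : prim c =ᵐ[volume.restrict (Ioi 0)] fun x => 2⁻¹ * (prim a x + prim b x) := by
    filter_upwards [ae_restrict_mem measurableSet_Ioi] with x hx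
    exact e1 x (le_of_lt hx)
  have e2 : ∀ x, 0 ≤ x → profileOf c x = 2⁻¹ * (profileOf a x + profileOf b x) := fun x hx => by
    rw [profileOf, prim_congr e1' hx, prim_midpoint ha.nearZero.prim hb.nearZero.prim hx,
      profileOf, profileOf]
    ring
  have hcm : MemLp c 2 (volume.restrict (Ioi 0)) := (ha.memLp.add hb.memLp).const_mul 2⁻¹
  have hpm' : MemLp (fun x => 2⁻¹ * (prim a x + prim b x)) 2 (volume.restrict (Ioi 0)) :=
    (ha.memLp_prim.add hb.memLp_prim).const_mul 2⁻¹
  have hpm : MemLp (prim c) 2 (volume.restrict (Ioi 0)) := hpm'.ae_eq e1'.symm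
  have hint : IntegrableOn (fun x => 2⁻¹ * (profileOf a x + profileOf b x)) (Ioi 0) :=
    (ha.integrable.add hb.integrable).const_mul _
  have e2' : profileOf c =ᵐ[volume.restrict (Ioi 0)]
      fun x => 2⁻¹ * (profileOf a x + profileOf b x) := by
    filter_upwards [ae_restrict_mem measurableSet_Ioi] with x hx
    exact e2 x (le_of_lt hx)
  have hprof : IsProfileSecondDeriv c := by
    refine ⟨hcm, hpm, hint.congr e2'.symm, fun x hx => ?_⟩
    rw [e2 x hx]
    have h1 := ha.mem_Icc x hx
    have h2 := hb.mem_Icc x hx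
    exact ⟨by linarith [h1.1, h2.1], by linarith [h1.2, h2.2]⟩
  refine ⟨c, hprof, ?_⟩
  have t1 : hprof.memLp_prim.toLp (prim c)
      = (2⁻¹ : ℝ) • (ha.memLp_prim.toLp (prim a) + hb.memLp_prim.toLp (prim b)) := by
    rw [← MemLp.toLp_add, ← MemLp.toLp_const_smul]
    exact MemLp.toLp_congr _ _ e1'
  have t2 : hprof.memLp.toLp c
      = (2⁻¹ : ℝ) • (ha.memLp.toLp a + hb.memLp.toLp b) := by
    rw [← MemLp.toLp_add, ← MemLp.toLp_const_smul]
    rfl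
  have par : ∀ x y : Lp ℝ 2 (volume.restrict (Ioi (0 : ℝ))),
      ‖(2⁻¹ : ℝ) • (x + y)‖ ^ 2 = (‖x‖ ^ 2 + ‖y‖ ^ 2) / 2 - ‖x - y‖ ^ 2 / 4 := fun x y => by
    have := parallelogram_law_with_norm ℝ x y
    rw [norm_smul, mul_pow]
    norm_num
    linarith
  rw [hprof.profileEnergy_eq, ha.profileEnergy_eq, hb.profileEnergy_eq, t1, t2, par, par,
    integral_congr_ae e2', integral_const_mul, integral_add ha.integrable hb.integrable]
  ring

theorem profileEnergy_nonneg {ρ : ℝ} (hρ : 0 < ρ) {q : ℝ → ℝ} (h : IsProfileSecondDeriv q) :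
    0 ≤ profileEnergy ρ (profileOf q) := by
  rw [h.profileEnergy_eq]
  have := h.integral_nonneg
  positivity

/-- Closedness of the set of profiles and lower semicontinuity of the energy. -/
theorem exists_isProfileSecondDeriv_le_of_tendsto {ρ : ℝ} {q : ℕ → ℝ → ℝ}
    (hq : ∀ n, IsProfileSecondDeriv (q n)) {Q P : Lp ℝ 2 (volume.restrict (Ioi (0 : ℝ)))}
    (hQ : Tendsto (fun n => (hq n).memLp.toLp (q n)) atTop (𝓝 Q))
    (hP : Tendsto (fun n => (hq n).memLp_prim.toLp (prim (q n))) atTop (𝓝 P)) {I : ℝ}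
    (hI : Tendsto (fun n => profileEnergy ρ (profileOf (q n))) atTop (𝓝 I)) :
    ∃ r, IsProfileSecondDeriv r ∧ profileEnergy ρ (profileOf r) ≤ I := by
  set r : ℝ → ℝ := ⇑Q with hr
  have hrm : MemLp r 2 (volume.restrict (Ioi 0)) := Lp.memLp Q
  have hPm : MemLp P 2 (volume.restrict (Ioi 0)) := Lp.memLp P
  have hQ' : hrm.toLp r = Q := Lp.toLp_coeFn Q hrm
  have hP' : hPm.toLp P = P := Lp.toLp_coeFn P hPm
  rw [← hQ'] at hQ
  have c1 : ∀ x, 0 ≤ x → Tendsto (fun n => prim (q n) x) atTop (𝓝 (prim r x)) := fun x hx =>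
    tendsto_prim_of_tendsto_toLp (fun n => (hq n).memLp) hrm hQ hx
  -- The first derivatives converge pointwise to `prim r`, by convergence of the second derivatives,
  -- and to `P` almost everywhere along a subsequence.
  have e1 : prim r =ᵐ[volume.restrict (Ioi 0)] P := by
    obtain ⟨ns, hns, hae⟩ := (tendstoInMeasure_of_tendsto_Lp hP).exists_seq_tendsto_ae
    have hall : ∀ᵐ x ∂volume.restrict (Ioi (0 : ℝ)), ∀ n,
        (hq n).memLp_prim.toLp (prim (q n)) x = prim (q n) x :=
      ae_all_iff.2 fun n => (hq n).memLp_prim.coeFn_toLp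
    filter_upwards [hae, hall, ae_restrict_mem measurableSet_Ioi] with x h1 h2 h3
    simp only [h2] at h1
    exact tendsto_nhds_unique ((c1 x (le_of_lt h3)).comp hns.tendsto_atTop) h1
  have c2 : ∀ x, 0 ≤ x → Tendsto (fun n => profileOf (q n) x) atTop (𝓝 (profileOf r x)) := by
    intro x hx
    rw [profileOf, prim_congr e1 hx]
    rw [← hP'] at hP
    exact (tendsto_prim_of_tendsto_toLp (fun n => (hq n).memLp_prim) hPm hP hx).const_add 1
  have hpm : MemLp (prim r) 2 (volume.restrict (Ioi 0)) := hPm.ae_eq e1.symm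
  have hI01 : ∀ x, 0 ≤ x → profileOf r x ∈ Icc (0 : ℝ) 1 := fun x hx =>
    isClosed_Icc.mem_of_tendsto (c2 x hx) (Eventually.of_forall fun n => (hq n).mem_Icc x hx)
  have hcont : ContinuousOn (profileOf r) (Ici 0) :=
    continuousOn_const.add (integrableNearZero_of_memLp hrm).prim.continuousOn_prim
  have hmeas : AEStronglyMeasurable (profileOf r) (volume.restrict (Ioi 0)) :=
    (hcont.mono Ioi_subset_Ici_self).aestronglyMeasurable measurableSet_Ioi
  have lim : Tendsto (fun n => ∫ x in Ioi (0 : ℝ), profileOf (q n) x) atTop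
      (𝓝 (I - ‖P‖ ^ 2 - ρ * ‖hrm.toLp r‖ ^ 2)) := by
    have := (hI.sub ((hP.norm).pow 2)).sub (((hQ.norm).pow 2).const_mul ρ)
    refine this.congr fun n => ?_
    rw [(hq n).profileEnergy_eq]; ring
  have ofR : ∀ n, ∫⁻ x in Ioi (0 : ℝ), ENNReal.ofReal (profileOf (q n) x)
      = ENNReal.ofReal (∫ x in Ioi (0 : ℝ), profileOf (q n) x) := fun n =>
    (ofReal_integral_eq_lintegral_ofReal (hq n).integrable (by
      filter_upwards [ae_restrict_mem measurableSet_Ioi] with x hx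
      exact ((hq n).mem_Icc x (le_of_lt hx)).1)).symm
  -- Mass of the linear term may escape to infinity, so only an inequality is available here; it
  -- also proves that the limit is integrable.
  have fatou : ∫⁻ x in Ioi (0 : ℝ), ENNReal.ofReal (profileOf r x)
      ≤ ENNReal.ofReal (I - ‖P‖ ^ 2 - ρ * ‖hrm.toLp r‖ ^ 2) := by
    have h1 : ∫⁻ x in Ioi (0 : ℝ), ENNReal.ofReal (profileOf r x)
        = ∫⁻ x in Ioi (0 : ℝ), liminf (fun n => ENNReal.ofReal (profileOf (q n) x)) atTop := by
      refine lintegral_congr_ae ?_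
      filter_upwards [ae_restrict_mem measurableSet_Ioi] with x hx
      exact ((ENNReal.tendsto_ofReal (c2 x (le_of_lt hx))).liminf_eq).symm
    rw [h1]
    refine (lintegral_liminf_le' fun n => ?_).trans ?_
    · exact (hq n).integrable.aestronglyMeasurable.aemeasurable.ennreal_ofReal
    · simp only [ofR]
      exact (ENNReal.tendsto_ofReal lim).liminf_eq.le
  have hnn : 0 ≤ᵐ[volume.restrict (Ioi 0)] profileOf r := by
    filter_upwards [ae_restrict_mem measurableSet_Ioi] with x hx
    exact (hI01 x (le_of_lt hx)).1
  have hint : IntegrableOn (profileOf r) (Ioi 0) := by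
    refine ⟨hmeas, ?_⟩
    rw [hasFiniteIntegral_iff_ofReal hnn]
    exact fatou.trans_lt ENNReal.ofReal_lt_top
  have hprof : IsProfileSecondDeriv r := ⟨hrm, hpm, hint, hI01⟩
  refine ⟨r, hprof, ?_⟩
  have t1 : hprof.memLp_prim.toLp (prim r) = P := by
    rw [← hP']; exact MemLp.toLp_congr _ _ e1
  rw [hprof.profileEnergy_eq, t1]
  have hge : 0 ≤ I - ‖P‖ ^ 2 - ρ * ‖hrm.toLp r‖ ^ 2 :=
    ge_of_tendsto' lim fun n => (hq n).integral_nonneg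
  rw [← ofReal_integral_eq_lintegral_ofReal hint hnn, ENNReal.ofReal_le_ofReal_iff hge] at fatou
  linarith

theorem admissibleProfiles_nonempty : admissibleProfiles.Nonempty := by
  set χ : ℝ → ℝ := fun x => Real.smoothTransition (2 - x) with hχ
  have hs : ContDiff ℝ ∞ χ := Real.smoothTransition.contDiff.comp (by fun_prop)
  have hs1 : ContDiff ℝ ∞ (deriv χ) := (contDiff_infty_iff_deriv.1 hs).2
  have hs2 : ContDiff ℝ ∞ (deriv (deriv χ)) := (contDiff_infty_iff_deriv.1 hs1).2
  have out : ∀ x, 2 ≤ x → χ x = 0 := fun x hx =>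
    Real.smoothTransition.zero_of_nonpos (by linarith)
  have one : ∀ x, x ≤ 1 → χ x = 1 := fun x hx =>
    Real.smoothTransition.one_of_one_le (by linarith)
  have ts : tsupport χ ⊆ Iic 2 := closure_minimal
    (fun x hx => by by_contra h; exact hx (out x (not_le.1 h).le)) isClosed_Iic
  have mem : ∀ f : ℝ → ℝ, Continuous f → tsupport f ⊆ Iic 2 → ∀ p,
      MemLp f p (volume.restrict (Ioi 0)) := by
    intro f hf hsf p
    have hcs : HasCompactSupport ((Ici (0 : ℝ)).indicator f) := by
      refine HasCompactSupport.of_support_subset_isCompact (isCompact_Icc (a := (0 : ℝ)) (b := 2))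
        fun x hx => ?_
      have h1 := support_indicator_subset hx
      have h2 : f x ≠ 0 := fun h => hx (by simp [indicator, h])
      exact ⟨h1, hsf (subset_tsupport f h2)⟩
    obtain ⟨C, hC⟩ := (isCompact_Icc (a := (0 : ℝ)) (b := 2)).exists_bound_of_continuousOn
      hf.continuousOn
    have h3 : MemLp f p (volume.restrict (Icc 0 2)) :=
      MemLp.of_bound hf.aestronglyMeasurable C (ae_restrict_of_forall_mem measurableSet_Icc hC)
    have h4 : MemLp ((Icc (0 : ℝ) 2).indicator f) p volume :=
      (memLp_indicator_iff_restrict measurableSet_Icc).2 h3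
    refine (h4.restrict (Ioi 0)).ae_eq ?_
    filter_upwards [ae_restrict_mem measurableSet_Ioi] with x hx
    by_cases h2 : f x = 0
    · simp [indicator, h2]
    · rw [indicator_of_mem]
      exact ⟨le_of_lt hx, hsf (subset_tsupport f h2)⟩
  have w0 : IsWeakDeriv (Ioi 0) χ (deriv χ) := by
    have h0 : IsWeakDeriv univ (fun _ => (1 : ℝ)) fun _ => 0 := by
      simpa using isWeakDeriv_primitive isOpen_univ ordConnected_univ
        (g := fun _ => (0 : ℝ)) (locallyIntegrableOn_const 0) (mem_univ 0) 1
    have := h0.smooth_mul (Ω := Ioi 0) isOpen_univ hs (subset_univ _)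
    simpa using this
  have w1 : IsWeakDeriv (Ioi 0) (deriv χ) (deriv (deriv χ)) := by
    have h0 : IsWeakDeriv univ (fun _ => (1 : ℝ)) fun _ => 0 := by
      simpa using isWeakDeriv_primitive isOpen_univ ordConnected_univ
        (g := fun _ => (0 : ℝ)) (locallyIntegrableOn_const 0) (mem_univ 0) 1
    have := h0.smooth_mul (Ω := Ioi 0) isOpen_univ hs1 (subset_univ _)
    simpa using this
  have t1 : tsupport (deriv χ) ⊆ Iic 2 := tsupport_deriv_subset.trans ts
  have hd0 : deriv χ 0 = 0 := by
    have : χ =ᶠ[𝓝 0] fun _ => 1 := by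
      filter_upwards [Iio_mem_nhds (zero_lt_one)] with x hx
      exact one x (le_of_lt hx)
    rw [this.deriv_eq]; simp
  refine ⟨χ, mem_admissibleProfiles w0 w1 (memLp_one_iff_integrable.1 (mem χ hs.continuous ts 1))
    (mem _ hs1.continuous t1 2) (mem _ hs2.continuous (tsupport_deriv_subset.trans t1) 2) ?_ ?_ ?_⟩
  · have := hs.continuous.tendsto 0
    rw [one 0 zero_le_one] at this
    exact this.mono_left (inf_le_left.trans nhdsWithin_le_nhds)
  · have := hs1.continuous.tendsto 0
    rw [hd0] at this
    exact this.mono_left (inf_le_left.trans nhdsWithin_le_nhds)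
  · exact Eventually.of_forall fun x =>
      ⟨Real.smoothTransition.nonneg _, Real.smoothTransition.le_one _⟩

theorem exists_isOptimalProfile {ρ : ℝ} (hρ : 0 < ρ) : ∃ w, IsOptimalProfile ρ w := by
  set S : Set ℝ := {E | ∃ q, IsProfileSecondDeriv q ∧ profileEnergy ρ (profileOf q) = E} with hS
  have hSne : S.Nonempty := by
    obtain ⟨w, hw⟩ := admissibleProfiles_nonempty
    obtain ⟨q, hq, -⟩ := exists_isProfileSecondDeriv hw
    exact ⟨_, q, hq, rfl⟩
  have hSb : BddBelow S := ⟨0, fun E ⟨q, hq, hE⟩ => hE ▸ profileEnergy_nonneg hρ hq⟩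
  set I := sInf S with hI
  have hlow : ∀ q, IsProfileSecondDeriv q → I ≤ profileEnergy ρ (profileOf q) := fun q hq =>
    csInf_le hSb ⟨q, hq, rfl⟩
  have hex : ∀ n : ℕ, ∃ q, IsProfileSecondDeriv q ∧
      profileEnergy ρ (profileOf q) < I + 1 / ((n : ℝ) + 1) := fun n => by
    obtain ⟨E, ⟨q, hq, hE⟩, hlt⟩ := exists_lt_of_csInf_lt hSne
      (show sInf S < I + 1 / ((n : ℝ) + 1) by
        have : (0 : ℝ) < 1 / ((n : ℝ) + 1) := by positivity
        linarith)
    exact ⟨q, hq, hE ▸ hlt⟩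
  choose q hq hlt using hex
  have hlim : Tendsto (fun n => profileEnergy ρ (profileOf (q n))) atTop (𝓝 I) := by
    refine tendsto_of_tendsto_of_tendsto_of_le_of_le tendsto_const_nhds ?_
      (fun n => hlow _ (hq n)) fun n => (hlt n).le
    simpa using (tendsto_one_div_add_atTop_nhds_zero_nat (𝕜 := ℝ)).const_add I
  -- Both profiles exceed the infimum by less than `1 / (N + 1)` and their midpoint is not below it,
  -- so a quarter of the distance term is at most `1 / (N + 1)`.
  have hest : ∀ N m n, N ≤ m → N ≤ n →
      ‖(hq m).memLp_prim.toLp _ - (hq n).memLp_prim.toLp _‖ ^ 2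
        + ρ * ‖(hq m).memLp.toLp _ - (hq n).memLp.toLp _‖ ^ 2 ≤ 4 * (1 / ((N : ℝ) + 1)) := by
    intro N m n hm hn
    obtain ⟨c, hc, hE⟩ := (hq m).exists_midpoint (hq n) ρ
    have h1 := hlow c hc
    have h2 : 1 / ((m : ℝ) + 1) ≤ 1 / ((N : ℝ) + 1) := Nat.one_div_le_one_div hm
    have h3 : 1 / ((n : ℝ) + 1) ≤ 1 / ((N : ℝ) + 1) := Nat.one_div_le_one_div hn
    have h4 := hlt m
    have h5 := hlt n
    linarith
  have b0 : Tendsto (fun N : ℕ => Real.sqrt (4 * (1 / ((N : ℝ) + 1)))) atTop (𝓝 0) := by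
    have := ((tendsto_one_div_add_atTop_nhds_zero_nat (𝕜 := ℝ)).const_mul 4).sqrt
    simpa using this
  have b1 : Tendsto (fun N : ℕ => Real.sqrt (ρ⁻¹ * (4 * (1 / ((N : ℝ) + 1))))) atTop (𝓝 0) := by
    have := (((tendsto_one_div_add_atTop_nhds_zero_nat (𝕜 := ℝ)).const_mul 4).const_mul ρ⁻¹).sqrt
    simpa using this
  have cP : CauchySeq fun n => (hq n).memLp_prim.toLp (prim (q n)) := by
    refine cauchySeq_of_le_tendsto_0 _ (fun m n N hm hn => ?_) b0
    rw [dist_eq_norm]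
    refine Real.le_sqrt_of_sq_le ?_
    have := hest N m n hm hn
    have h2 : 0 ≤ ρ * ‖(hq m).memLp.toLp _ - (hq n).memLp.toLp _‖ ^ 2 := by positivity
    linarith
  have cQ : CauchySeq fun n => (hq n).memLp.toLp (q n) := by
    refine cauchySeq_of_le_tendsto_0 _ (fun m n N hm hn => ?_) b1
    rw [dist_eq_norm]
    refine Real.le_sqrt_of_sq_le ?_
    have := hest N m n hm hn
    rw [← div_eq_inv_mul, le_div_iff₀ hρ]
    have h2 : 0 ≤ ‖(hq m).memLp_prim.toLp _ - (hq n).memLp_prim.toLp _‖ ^ 2 := by positivity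
    linarith
  obtain ⟨P, hP⟩ := cauchySeq_tendsto_of_complete cP
  obtain ⟨Q, hQ⟩ := cauchySeq_tendsto_of_complete cQ
  obtain ⟨r, hr, hrI⟩ := exists_isProfileSecondDeriv_le_of_tendsto hq hQ hP hlim
  refine ⟨profileOf r, hr.mem_admissible, fun w hw => ?_⟩
  obtain ⟨s, hs, -, -, hE⟩ := exists_isProfileSecondDeriv hw
  show profileEnergy ρ (profileOf r) ≤ profileEnergy ρ w
  rw [hE]
  exact hrI.trans (hlow s hs)

end ATFracture

end

noncomputable section

namespace ATFracture

/-! ### Cost of a transition -/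

/-- A smooth cut-off, equal to `1` on `(-∞, 1/4]` and to `0` on `[3/4, ∞)`. -/
def cutoff (y : ℝ) : ℝ := Real.smoothTransition (3 / 2 - 2 * y)

theorem cutoff_contDiff : ContDiff ℝ ∞ cutoff := Real.smoothTransition.contDiff.comp (by fun_prop)

theorem cutoff_one {y : ℝ} (h : y ≤ 1 / 4) : cutoff y = 1 :=
  Real.smoothTransition.one_of_one_le (by linarith)

theorem cutoff_zero {y : ℝ} (h : 3 / 4 ≤ y) : cutoff y = 0 :=
  Real.smoothTransition.zero_of_nonpos (by linarith)

theorem cutoff_mem (y : ℝ) : cutoff y ∈ Icc (0 : ℝ) 1 :=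
  ⟨Real.smoothTransition.nonneg _, Real.smoothTransition.le_one _⟩

theorem exists_cutoff_bound : ∃ C, 0 ≤ C ∧ ∀ y, |deriv cutoff y| ≤ C ∧ |deriv (deriv cutoff) y| ≤ C := by
  have h1 : ContDiff ℝ ∞ (deriv cutoff) := (contDiff_infty_iff_deriv.1 cutoff_contDiff).2
  have h2 : ContDiff ℝ ∞ (deriv (deriv cutoff)) := (contDiff_infty_iff_deriv.1 h1).2
  have z : ∀ y, y ∉ Icc (1 / 4 : ℝ) (3 / 4) → deriv cutoff y = 0 ∧ deriv (deriv cutoff) y = 0 := by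
    intro y hy
    have : (cutoff =ᶠ[𝓝 y] fun _ => 1) ∨ (cutoff =ᶠ[𝓝 y] fun _ => 0) := by
      rcases lt_or_ge y (1 / 4) with h | h
      · left; filter_upwards [Iio_mem_nhds h] with x hx using cutoff_one (le_of_lt hx)
      · right
        have : 3 / 4 < y := by by_contra h'; exact hy ⟨h, not_lt.1 h'⟩
        filter_upwards [Ioi_mem_nhds this] with x hx using cutoff_zero (le_of_lt hx)
    rcases this with h | h
    · have h' := h.deriv
      exact ⟨by rw [h.deriv_eq]; simp, by rw [h'.deriv_eq]; simp⟩
    · have h' := h.deriv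
      exact ⟨by rw [h.deriv_eq]; simp, by rw [h'.deriv_eq]; simp⟩
  obtain ⟨C1, hC1⟩ := (isCompact_Icc (a := (1 / 4 : ℝ)) (b := 3 / 4)).exists_bound_of_continuousOn
    h1.continuous.continuousOn
  obtain ⟨C2, hC2⟩ := (isCompact_Icc (a := (1 / 4 : ℝ)) (b := 3 / 4)).exists_bound_of_continuousOn
    h2.continuous.continuousOn
  refine ⟨max 0 (max C1 C2), le_max_left _ _, fun y => ?_⟩
  by_cases hy : y ∈ Icc (1 / 4 : ℝ) (3 / 4)
  · exact ⟨(hC1 y hy).trans ((le_max_left _ _).trans (le_max_right _ _)),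
      (hC2 y hy).trans ((le_max_right _ _).trans (le_max_right _ _))⟩
  · rw [(z y hy).1, (z y hy).2]; simp

theorem memLp_Ioi_of_eq_zero {F : ℝ → ℝ} {R : ℝ} {p : ℝ≥0∞}
    (h : MemLp F p (volume.restrict (Icc 0 R))) (hz : ∀ y, R < y → F y = 0) :
    MemLp F p (volume.restrict (Ioi 0)) := by
  have h4 : MemLp ((Icc (0 : ℝ) R).indicator F) p volume :=
    (memLp_indicator_iff_restrict measurableSet_Icc).2 h
  refine (h4.restrict (Ioi 0)).ae_eq ?_
  filter_upwards [ae_restrict_mem measurableSet_Ioi] with x hx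
  by_cases h2 : F x = 0
  · simp [indicator, h2]
  · rw [indicator_of_mem]
    exact ⟨le_of_lt hx, by by_contra h; exact h2 (hz x (not_le.1 h))⟩

theorem memLp_Icc_of_continuousOn {F : ℝ → ℝ} {α β : ℝ} {p : ℝ≥0∞}
    (h : ContinuousOn F (Icc α β)) : MemLp F p (volume.restrict (Icc α β)) := by
  obtain ⟨C, hC⟩ := isCompact_Icc.exists_bound_of_continuousOn h
  exact MemLp.of_bound (h.aestronglyMeasurable measurableSet_Icc) C
    (ae_restrict_of_forall_mem measurableSet_Icc hC)

theorem sq_add_le (p q : ℝ) : (p + q) ^ 2 ≤ 2 * p ^ 2 + 2 * q ^ 2 := by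
  nlinarith [sq_nonneg (p - q)]

theorem sq_add_two_mul_add_le (p q r : ℝ) :
    (p + 2 * q + r) ^ 2 ≤ 3 * p ^ 2 + 12 * q ^ 2 + 3 * r ^ 2 := by
  nlinarith [sq_nonneg (p - 2 * q), sq_nonneg (p - r), sq_nonneg (2 * q - r)]

/-- Used with `s = W`, `t = W₁²`, `r = ρ W₂²`, `u = C₀²`, `v = ρ C₀²`: the terms created by
differentiating the cut-off are absorbed into a multiple of the density. -/
theorem half_cost_algebra {s t r u v : ℝ} (hs : 0 ≤ s) (ht : 0 ≤ t) (hr : 0 ≤ r) (hu : 0 ≤ u)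
    (hv : 0 ≤ v) : s + (2 * t + 2 * (u * s)) + (3 * r + 12 * (v * t) + 3 * (v * s))
      ≤ (s + t + r) + (2 + 2 * u + 3 + 12 * v + 3 * v) * (s + t + r) := by
  have : 0 ≤ s * (5 + 12 * v) + t * (4 + 2 * u + 3 * v) + r * (3 + 2 * u + 15 * v) := by positivity
  linarith

/-- The competitor is `M⁻¹ χ W`, with `χ` falling from 1 to 0 on `[L, L + 1]`. The factor `M²`
undoes the normalisation in the squares, and in the linear term `M² M⁻¹ χ W = M χ W ≤ W` because `M
≤ 1`. The constant depends on `ρ` and the fixed cut-off only, and multiplies only the energy of the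
last unit interval. With `M < 1` this serves the lower bound, with `M = 1` the construction of
compactly supported profiles. -/
theorem exists_truncated_profile {ρ : ℝ} (hρ : 0 < ρ) : ∃ C, 0 ≤ C ∧
    ∀ (Ω : Set ℝ) (W W₁ W₂ : ℝ → ℝ) (L M : ℝ), IsOpen Ω → 0 < L → Icc 0 (L + 1) ⊆ Ω →
      IsWeakDeriv Ω W W₁ → IsWeakDeriv Ω W₁ W₂ → ContinuousOn W Ω → ContinuousOn W₁ Ω →
      MemLp W₂ 2 (volume.restrict (Icc 0 (L + 1))) → 0 < M → M ≤ 1 → W 0 = M → W₁ 0 = 0 →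
      (∀ y ∈ Icc 0 (L + 1), W y ∈ Icc 0 M) →
      ∃ w ∈ admissibleProfiles, (∀ y, L + 1 < y → w y = 0) ∧
        M ^ 2 * profileEnergy ρ w ≤ (∫ y in (0 : ℝ)..(L + 1), (W y + W₁ y ^ 2 + ρ * W₂ y ^ 2))
        + C * ∫ y in L..(L + 1), (W y + W₁ y ^ 2 + ρ * W₂ y ^ 2) := by
  obtain ⟨C₀, hC₀, hC⟩ := exists_cutoff_bound
  refine ⟨2 + 2 * C₀ ^ 2 + 3 + 12 * ρ * C₀ ^ 2 + 3 * ρ * C₀ ^ 2, by positivity, ?_⟩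
  set C := 2 + 2 * C₀ ^ 2 + 3 + 12 * ρ * C₀ ^ 2 + 3 * ρ * C₀ ^ 2 with hCdef
  intro Ω W W₁ W₂ L M hΩ hL hsub hd1 hd2 hc hc1 hm2 hM hM1 hW0 hW10 hb
  set χ : ℝ → ℝ := fun y => cutoff (y - L) with hχ
  have hs : ContDiff ℝ ∞ χ := cutoff_contDiff.comp (by fun_prop)
  have hs1 : ContDiff ℝ ∞ (deriv χ) := (contDiff_infty_iff_deriv.1 hs).2
  have dχ : ∀ y, deriv χ y = deriv cutoff (y - L) := fun y => deriv_comp_sub_const cutoff L y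
  have dχ' : deriv χ = fun y => deriv cutoff (y - L) := funext dχ
  have ddχ : ∀ y, deriv (deriv χ) y = deriv (deriv cutoff) (y - L) := fun y => by
    rw [dχ']; exact deriv_comp_sub_const (deriv cutoff) L y
  have hs2 : ContDiff ℝ ∞ (deriv (deriv χ)) := (contDiff_infty_iff_deriv.1 hs1).2
  have ts : tsupport χ ⊆ Iic (L + 3 / 4) := closure_minimal
    (fun x hx => by by_contra h; exact hx (cutoff_zero (by
      have : L + 3 / 4 < x := not_le.1 h
      linarith))) isClosed_Iic
  have ts1 : tsupport (deriv χ) ⊆ Iic (L + 3 / 4) := tsupport_deriv_subset.trans ts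
  have sub : ∀ ψ : ℝ → ℝ, tsupport ψ ⊆ Iic (L + 3 / 4) → Ioi 0 ∩ tsupport ψ ⊆ Ω := fun ψ hψ y hy =>
    hsub ⟨le_of_lt hy.1, by have : y ≤ L + 3 / 4 := hψ hy.2; linarith⟩
  have near : ∀ y, y < L + 1 / 4 → deriv χ y = 0 ∧ deriv (deriv χ) y = 0 := by
    intro y hy
    have h : χ =ᶠ[𝓝 y] fun _ => 1 := by
      filter_upwards [Iio_mem_nhds hy] with x hx
      exact cutoff_one (by have : x < L + 1 / 4 := hx; linarith)
    have h' := h.deriv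
    exact ⟨by rw [h.deriv_eq]; simp, by rw [h'.deriv_eq]; simp⟩
  have d1 := (hd1.smooth_mul (Ω := Ioi 0) hΩ hs (sub _ ts)).const_mul M⁻¹
  have d2 : IsWeakDeriv (Ioi 0) (fun y => M⁻¹ * (χ y * W₁ y + deriv χ y * W y))
      (fun y => M⁻¹ * (χ y * W₂ y + 2 * (deriv χ y * W₁ y) + deriv (deriv χ) y * W y)) := by
    refine (((hd2.smooth_mul (Ω := Ioi 0) hΩ hs (sub _ ts)).add
      (hd1.smooth_mul (Ω := Ioi 0) hΩ hs1 (sub _ ts1))).const_mul M⁻¹).congr (ae_eq_refl _)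
      (Eventually.of_forall fun y => ?_)
    show M⁻¹ * _ = M⁻¹ * _
    ring
  set w : ℝ → ℝ := fun y => M⁻¹ * (χ y * W y) with hw
  set w₁ : ℝ → ℝ := fun y => M⁻¹ * (χ y * W₁ y + deriv χ y * W y) with hw1
  set w₂ : ℝ → ℝ := fun y => M⁻¹ * (χ y * W₂ y + 2 * (deriv χ y * W₁ y) + deriv (deriv χ) y * W y)
    with hw2
  have hcI : ContinuousOn W (Icc 0 (L + 1)) := hc.mono hsub
  have hc1I : ContinuousOn W₁ (Icc 0 (L + 1)) := hc1.mono hsub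
  have zχ : ∀ y, L + 1 < y → χ y = 0 := fun y hy => cutoff_zero (by linarith)
  have zdχ : ∀ y, L + 1 < y → deriv χ y = 0 := fun y hy =>
    image_eq_zero_of_notMem_tsupport fun h => by
      have : y ≤ L + 3 / 4 := ts1 h
      linarith
  have zddχ : ∀ y, L + 1 < y → deriv (deriv χ) y = 0 := fun y hy =>
    image_eq_zero_of_notMem_tsupport fun h => by
      have : y ≤ L + 3 / 4 := ts1 (tsupport_deriv_subset h)
      linarith
  have mw : MemLp w 1 (volume.restrict (Ioi 0)) :=
    memLp_Ioi_of_eq_zero (R := L + 1) (memLp_Icc_of_continuousOn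
      (continuousOn_const.mul (hs.continuous.continuousOn.mul hcI)))
      fun y hy => by simp [hw, zχ y hy]
  have mw1 : MemLp w₁ 2 (volume.restrict (Ioi 0)) :=
    memLp_Ioi_of_eq_zero (R := L + 1) (memLp_Icc_of_continuousOn
      (continuousOn_const.mul ((hs.continuous.continuousOn.mul hc1I).add
        (hs1.continuous.continuousOn.mul hcI))))
      fun y hy => by simp [hw1, zχ y hy, zdχ y hy]
  have mw2 : MemLp w₂ 2 (volume.restrict (Ioi 0)) := by
    refine memLp_Ioi_of_eq_zero (R := L + 1) ?_ fun y hy => by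
      simp [hw2, zχ y hy, zdχ y hy, zddχ y hy]
    have m1 : MemLp (fun y => χ y * W₂ y) 2 (volume.restrict (Icc 0 (L + 1))) := by
      refine MemLp.of_le_mul (c := 1) hm2
        (hs.continuous.aestronglyMeasurable.mul hm2.aestronglyMeasurable)
        (Eventually.of_forall fun y => ?_)
      rw [norm_mul]
      refine mul_le_mul_of_nonneg_right ?_ (norm_nonneg _)
      rw [Real.norm_eq_abs, abs_of_nonneg (cutoff_mem _).1]
      exact (cutoff_mem _).2
    have m2 : MemLp (fun y => 2 * (deriv χ y * W₁ y)) 2 (volume.restrict (Icc 0 (L + 1))) :=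
      memLp_Icc_of_continuousOn (continuousOn_const.mul (hs1.continuous.continuousOn.mul hc1I))
    have m3 : MemLp (fun y => deriv (deriv χ) y * W y) 2 (volume.restrict (Icc 0 (L + 1))) :=
      memLp_Icc_of_continuousOn (hs2.continuous.continuousOn.mul hcI)
    exact ((m1.add m2).add m3).const_mul M⁻¹
  have hcontAt : ∀ F : ℝ → ℝ, ContinuousOn F Ω → Tendsto F (essRight 0) (𝓝 (F 0)) := fun F hF =>
    ((hF.continuousAt (hΩ.mem_nhds (hsub ⟨le_rfl, by linarith⟩))).tendsto).mono_left
      (inf_le_left.trans nhdsWithin_le_nhds)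
  have t0 : Tendsto w (essRight 0) (𝓝 1) := by
    have := hcontAt w (continuousOn_const.mul (hs.continuous.continuousOn.mul hc))
    have e : w 0 = 1 := by
      simp only [hw, hW0]
      rw [show χ 0 = 1 from cutoff_one (by linarith)]
      field_simp
    rwa [e] at this
  have t1 : Tendsto w₁ (essRight 0) (𝓝 0) := by
    have := hcontAt w₁ (continuousOn_const.mul ((hs.continuous.continuousOn.mul hc1).add
        (hs1.continuous.continuousOn.mul hc)))
    have e : w₁ 0 = 0 := by
      simp only [hw1, hW10, (near 0 (by linarith)).1]; simp
    rwa [e] at this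
  have w01 : ∀ y, 0 < y → w y ∈ Icc (0 : ℝ) 1 := by
    intro y hy
    rcases le_or_gt y (L + 1) with h | h
    · have h1 := hb y ⟨hy.le, h⟩
      have h2 := cutoff_mem (y - L)
      refine ⟨mul_nonneg (by positivity) (mul_nonneg h2.1 h1.1), ?_⟩
      rw [hw]; simp only
      rw [inv_mul_le_iff₀ hM, mul_one]
      calc χ y * W y ≤ 1 * M := mul_le_mul h2.2 h1.2 h1.1 zero_le_one
        _ = M := one_mul M
    · simp [hw, zχ y h]
  have hadm : w ∈ admissibleProfiles := mem_admissibleProfiles d1 d2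
    (memLp_one_iff_integrable.1 mw) mw1 mw2 t0 t1
    (by filter_upwards [ae_restrict_mem measurableSet_Ioi] with y hy using w01 y hy)
  refine ⟨w, hadm, fun y hy => by simp [hw, zχ y hy], ?_⟩
  rw [profileEnergy_eq d1 d2]
  set D : ℝ → ℝ := fun y => W y + W₁ y ^ 2 + ρ * W₂ y ^ 2 with hD
  have hDi : IntegrableOn D (Icc 0 (L + 1)) :=
    ((memLp_one_iff_integrable.1 (memLp_Icc_of_continuousOn hcI)).add
      ((memLp_Icc_of_continuousOn hc1I).integrable_sq)).add (hm2.integrable_sq.const_mul ρ)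
  have hDi1 : IntegrableOn D (Ioc 0 (L + 1)) := hDi.mono_set Ioc_subset_Icc_self
  have hDi2 : IntegrableOn D (Ioc L (L + 1)) :=
    hDi.mono_set (Ioc_subset_Icc_self.trans (Icc_subset_Icc_left hL.le))
  have hD0 : ∀ y ∈ Icc 0 (L + 1), 0 ≤ D y := fun y hy => by
    have := (hb y hy).1
    positivity
  have hMinv : 1 ≤ M⁻¹ := (one_le_inv₀ hM).2 hM1
  have hbound : ∀ y, 0 < y → M ^ 2 * (w y + w₁ y ^ 2 + ρ * w₂ y ^ 2) ≤
      (Ioc 0 (L + 1)).indicator D y + C * (Ioc L (L + 1)).indicator D y := by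
    intro y hy
    rcases le_or_gt y (L + 1) with h | h
    swap
    · rw [indicator_of_notMem (fun h' => absurd h'.2 (not_le.2 h)),
        indicator_of_notMem (fun h' => absurd h'.2 (not_le.2 h))]
      simp [hw, hw1, hw2, zχ y h, zdχ y h, zddχ y h]
    have hy' : y ∈ Icc 0 (L + 1) := ⟨hy.le, h⟩
    rw [indicator_of_mem (show y ∈ Ioc 0 (L + 1) from ⟨hy, h⟩)]
    have hWb := hb y hy'
    have hχb := cutoff_mem (y - L)
    have hMM : M * M⁻¹ = 1 := mul_inv_cancel₀ hM.ne'
    have e0 : M ^ 2 * w y ≤ W y := by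
      have : M ^ 2 * w y = (M * χ y) * W y := by
        rw [hw]; simp only
        calc M ^ 2 * (M⁻¹ * (χ y * W y)) = (M * M⁻¹) * (M * (χ y * W y)) := by ring
          _ = _ := by rw [hMM]; ring
      rw [this]
      calc (M * χ y) * W y ≤ 1 * W y :=
            mul_le_mul_of_nonneg_right (mul_le_one₀ hM1 hχb.1 hχb.2) hWb.1
        _ = W y := one_mul _
    have e1 : M ^ 2 * w₁ y ^ 2 = (χ y * W₁ y + deriv χ y * W y) ^ 2 := by
      rw [hw1]; simp only
      calc M ^ 2 * (M⁻¹ * (χ y * W₁ y + deriv χ y * W y)) ^ 2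
          = (M * M⁻¹) ^ 2 * (χ y * W₁ y + deriv χ y * W y) ^ 2 := by ring
        _ = _ := by rw [hMM]; ring
    have e2 : M ^ 2 * w₂ y ^ 2
        = (χ y * W₂ y + 2 * (deriv χ y * W₁ y) + deriv (deriv χ) y * W y) ^ 2 := by
      rw [hw2]; simp only
      calc M ^ 2 * (M⁻¹ * (χ y * W₂ y + 2 * (deriv χ y * W₁ y) + deriv (deriv χ) y * W y)) ^ 2
          = (M * M⁻¹) ^ 2 * (χ y * W₂ y + 2 * (deriv χ y * W₁ y) + deriv (deriv χ) y * W y) ^ 2 := by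
            ring
        _ = _ := by rw [hMM]; ring
    have split : M ^ 2 * (w y + w₁ y ^ 2 + ρ * w₂ y ^ 2)
        = M ^ 2 * w y + M ^ 2 * w₁ y ^ 2 + ρ * (M ^ 2 * w₂ y ^ 2) := by ring
    rw [split, e1, e2]
    rcases le_or_gt y L with hyL | hyL
    · rw [indicator_of_notMem (fun h' => absurd h'.1 (not_lt.2 hyL)),
        (near y (by linarith)).1, (near y (by linarith)).2,
        show χ y = 1 from cutoff_one (by linarith)]
      simp only [hD]
      simp only [one_mul, zero_mul, mul_zero, add_zero]
      linarith
    · rw [indicator_of_mem (show y ∈ Ioc L (L + 1) from ⟨hyL, h⟩)]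
      have hχsq : χ y ^ 2 ≤ 1 := pow_le_one₀ hχb.1 hχb.2
      -- Since `0 ≤ W ≤ 1`, the quadratic error terms in `W` are paid by the linear term of the
      -- density.
      have hW2 : W y ^ 2 ≤ W y := by
        have := hWb.1
        have := hWb.2
        nlinarith
      have hd1' : deriv χ y ^ 2 ≤ C₀ ^ 2 := by
        rw [dχ]; exact sq_le_sq' (abs_le.1 (hC _).1).1 (abs_le.1 (hC _).1).2
      have hd2' : deriv (deriv χ) y ^ 2 ≤ C₀ ^ 2 := by
        rw [ddχ]; exact sq_le_sq' (abs_le.1 (hC _).2).1 (abs_le.1 (hC _).2).2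
      have a1 : (χ y * W₁ y) ^ 2 ≤ W₁ y ^ 2 := by
        rw [mul_pow]; exact mul_le_of_le_one_left (sq_nonneg _) hχsq
      have a2 : (deriv χ y * W y) ^ 2 ≤ C₀ ^ 2 * W y := by
        rw [mul_pow]; exact mul_le_mul hd1' hW2 (sq_nonneg _) (sq_nonneg _)
      have a3 : (χ y * W₂ y) ^ 2 ≤ W₂ y ^ 2 := by
        rw [mul_pow]; exact mul_le_of_le_one_left (sq_nonneg _) hχsq
      have a4 : (deriv χ y * W₁ y) ^ 2 ≤ C₀ ^ 2 * W₁ y ^ 2 := by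
        rw [mul_pow]; exact mul_le_mul_of_nonneg_right hd1' (sq_nonneg _)
      have a5 : (deriv (deriv χ) y * W y) ^ 2 ≤ C₀ ^ 2 * W y := by
        rw [mul_pow]; exact mul_le_mul hd2' hW2 (sq_nonneg _) (sq_nonneg _)
      have b1 := sq_add_le (χ y * W₁ y) (deriv χ y * W y)
      have b2 := sq_add_two_mul_add_le (χ y * W₂ y) (deriv χ y * W₁ y) (deriv (deriv χ) y * W y)
      have b3 : ρ * (χ y * W₂ y + 2 * (deriv χ y * W₁ y) + deriv (deriv χ) y * W y) ^ 2
          ≤ ρ * (3 * W₂ y ^ 2 + 12 * (C₀ ^ 2 * W₁ y ^ 2) + 3 * (C₀ ^ 2 * W y)) :=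
        mul_le_mul_of_nonneg_left (by linarith) hρ.le
      have p0 := hWb.1
      have p1 : 0 ≤ W₁ y ^ 2 := sq_nonneg _
      have p2 : 0 ≤ ρ * W₂ y ^ 2 := by positivity
      have p3 : 0 ≤ C₀ ^ 2 := sq_nonneg _
      have p4 : 0 ≤ ρ * C₀ ^ 2 := by positivity
      have alg := half_cost_algebra p0 p1 p2 p3 p4
      simp only [hD, hCdef]
      linarith
  have hwi : IntegrableOn (fun y => w y + w₁ y ^ 2 + ρ * w₂ y ^ 2) (Ioi 0) :=
    ((memLp_one_iff_integrable.1 mw).add mw1.integrable_sq).add (mw2.integrable_sq.const_mul ρ)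
  have hi1 : IntegrableOn ((Ioc 0 (L + 1)).indicator D) (Ioi 0) :=
    ((integrable_indicator_iff measurableSet_Ioc).2 hDi1).integrableOn
  have hi2 : IntegrableOn ((Ioc L (L + 1)).indicator D) (Ioi 0) :=
    ((integrable_indicator_iff measurableSet_Ioc).2 hDi2).integrableOn
  have key : ∫ y in Ioi (0 : ℝ), M ^ 2 * (w y + w₁ y ^ 2 + ρ * w₂ y ^ 2)
      ≤ ∫ y in Ioi (0 : ℝ), ((Ioc 0 (L + 1)).indicator D y + C * (Ioc L (L + 1)).indicator D y) :=
    setIntegral_mono_on (hwi.const_mul _) (hi1.add (hi2.const_mul C)) measurableSet_Ioi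
      fun y hy => hbound y hy
  rw [integral_const_mul, integral_add hi1 (hi2.const_mul C), integral_const_mul,
    setIntegral_indicator measurableSet_Ioc, setIntegral_indicator measurableSet_Ioc,
    inter_eq_self_of_subset_right Ioc_subset_Ioi_self,
    inter_eq_self_of_subset_right (Ioc_subset_Ioi_self.trans (Ioi_subset_Ioi hL.le)),
    ← intervalIntegral.integral_of_le (by linarith),
    ← intervalIntegral.integral_of_le (by linarith)] at key
  exact key

theorem exists_half_cost {ρ : ℝ} (hρ : 0 < ρ) : ∃ C, 0 ≤ C ∧
    ∀ (K : ℝ), (∀ w ∈ admissibleProfiles, K ≤ profileEnergy ρ w) →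
    ∀ (Ω : Set ℝ) (W W₁ W₂ : ℝ → ℝ) (L M : ℝ), IsOpen Ω → 0 < L → Icc 0 (L + 1) ⊆ Ω →
      IsWeakDeriv Ω W W₁ → IsWeakDeriv Ω W₁ W₂ → ContinuousOn W Ω → ContinuousOn W₁ Ω →
      MemLp W₂ 2 (volume.restrict (Icc 0 (L + 1))) → 0 < M → M ≤ 1 → W 0 = M → W₁ 0 = 0 →
      (∀ y ∈ Icc 0 (L + 1), W y ∈ Icc 0 M) →
      M ^ 2 * K ≤ (∫ y in (0 : ℝ)..(L + 1), (W y + W₁ y ^ 2 + ρ * W₂ y ^ 2))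
        + C * ∫ y in L..(L + 1), (W y + W₁ y ^ 2 + ρ * W₂ y ^ 2) := by
  obtain ⟨C, hC, h⟩ := exists_truncated_profile hρ
  refine ⟨C, hC, ?_⟩
  intro K hK Ω W W₁ W₂ L M hΩ hL hsub hd1 hd2 hc hc1 hm2 hM hM1 hW0 hW10 hb
  obtain ⟨w, hw, -, hle⟩ := h Ω W W₁ W₂ L M hΩ hL hsub hd1 hd2 hc hc1 hm2 hM hM1 hW0 hW10 hb
  exact (mul_le_mul_of_nonneg_left (hK w hw) (sq_nonneg M)).trans hle

end ATFracture

end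

noncomputable section

namespace ATFracture

/-! ### Continuous representatives of `H²` functions -/

theorem forall_mem_of_ae_restrict {Ω S : Set ℝ} (hΩ : IsOpen Ω) (hS : IsClosed S) {f : ℝ → ℝ}
    (hf : ContinuousOn f Ω) (h : ∀ᵐ x ∂volume.restrict Ω, f x ∈ S) {x : ℝ} (hx : x ∈ Ω) :
    f x ∈ S := by
  rw [ae_restrict_iff' hΩ.measurableSet] at h
  have h1 := (Measure.dense_of_ae h).open_subset_closure_inter hΩ hx
  have h2 : ContinuousWithinAt f (Ω ∩ {x | x ∈ Ω → f x ∈ S}) x :=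
    (hf x hx).mono inter_subset_left
  have := h2.mem_closure h1 (t := S) fun y hy => hy.2 hy.1
  rwa [hS.closure_eq] at this

theorem continuousOn_primitive_Icc {a b : ℝ} (hab : a ≤ b) {g : ℝ → ℝ}
    (hg : IntegrableOn g (Ioo a b)) : ContinuousOn (fun x => ∫ t in a..x, g t) (Icc a b) := by
  rw [← integrableOn_Icc_iff_integrableOn_Ioo, ← uIcc_of_le hab] at hg
  rw [← uIcc_of_le hab]
  exact intervalIntegral.continuousOn_primitive_interval hg

theorem hasDerivAt_primitive_Ioo {a b : ℝ} {g : ℝ → ℝ} (hg : ContinuousOn g (Icc a b)) {x : ℝ}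
    (hx : x ∈ Ioo a b) : HasDerivAt (fun x => ∫ t in a..x, g t) (g x) x := by
  have hab : a ≤ b := hx.1.le.trans hx.2.le
  refine intervalIntegral.integral_hasDerivAt_right
    ((hg.mono ?_).intervalIntegrable) ?_ (hg.continuousAt (Icc_mem_nhds hx.1 hx.2))
  · rw [uIcc_of_le hx.1.le]; exact Icc_subset_Icc_right hx.2.le
  · exact hg.stronglyMeasurableAtFilter_nhdsWithin measurableSet_Icc x |>.filter_mono
      (by rw [nhdsWithin_eq_nhds.2 (Icc_mem_nhds hx.1 hx.2)])

/-- `f` is the continuous representative of an `H²(a,b)` function with values in `[0,1]`, and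
`f₁`, `f₂` are its derivatives. -/
structure H2Rep (a b : ℝ) (f f₁ f₂ : ℝ → ℝ) : Prop where
  cont : ContinuousOn f (Icc a b)
  cont₁ : ContinuousOn f₁ (Icc a b)
  hasDerivAt : ∀ x ∈ Ioo a b, HasDerivAt f (f₁ x) x
  wd₁ : IsWeakDeriv (Ioo a b) f f₁
  wd₂ : IsWeakDeriv (Ioo a b) f₁ f₂
  memLp₂ : MemLp f₂ 2 (volume.restrict (Ioo a b))
  mem_Icc : ∀ x ∈ Ioo a b, f x ∈ Icc (0 : ℝ) 1

theorem exists_H2Rep {a b : ℝ} (hab : a < b) {v : ℝ → ℝ} (hv : MemH2 (Ioo a b) v)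
    (h01 : ∀ᵐ x ∂volume.restrict (Ioo a b), v x ∈ Icc (0 : ℝ) 1) :
    ∃ f f₁ f₂, H2Rep a b f f₁ f₂ ∧ v =ᵐ[volume.restrict (Ioo a b)] f ∧
      weakDeriv (Ioo a b) v =ᵐ[volume.restrict (Ioo a b)] f₁ ∧
      weakDeriv (Ioo a b) (weakDeriv (Ioo a b) v) =ᵐ[volume.restrict (Ioo a b)] f₂ := by
  obtain ⟨⟨-, g, hg, -⟩, -, k, hk, hk2⟩ := hv
  have hki : IntegrableOn k (Ioo a b) := hk2.integrable (by norm_num)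
  have hwd := hg.weakDeriv
  obtain ⟨c₁, hc₁⟩ := hk.exists_ae_eq_primitive_Ioo hab hki
  set f₁ : ℝ → ℝ := fun x => c₁ + ∫ t in a..x, k t with hf₁
  have cont₁ : ContinuousOn f₁ (Icc a b) :=
    continuousOn_const.add (continuousOn_primitive_Icc hab.le hki)
  have hf₁i : IntegrableOn f₁ (Ioo a b) := cont₁.integrableOn_Icc.mono_set Ioo_subset_Icc_self
  have hwd' : IsWeakDeriv (Ioo a b) v f₁ := hwd.congr (ae_eq_refl _) hc₁
  obtain ⟨c₀, hc₀⟩ := hwd'.exists_ae_eq_primitive_Ioo hab hf₁i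
  set f : ℝ → ℝ := fun x => c₀ + ∫ t in a..x, f₁ t with hf
  have cont : ContinuousOn f (Icc a b) :=
    continuousOn_const.add (continuousOn_primitive_Icc hab.le hf₁i)
  have wd₂ : IsWeakDeriv (Ioo a b) f₁ k := hk.congr hc₁ (ae_eq_refl _)
  refine ⟨f, f₁, k, ⟨cont, cont₁, fun x hx => (hasDerivAt_primitive_Ioo cont₁ hx).const_add c₀,
    hwd'.congr hc₀ (ae_eq_refl _), wd₂, hk2, fun x hx => ?_⟩, hc₀, hc₁,
    hg.weakDeriv.weakDeriv_weakDeriv_ae_eq isOpen_Ioo hk⟩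
  refine forall_mem_of_ae_restrict isOpen_Ioo isClosed_Icc (cont.mono Ioo_subset_Icc_self) ?_ hx
  filter_upwards [h01, hc₀] with x h1 h2
  rwa [← h2]

/-- The density of the crack energy. -/
def crackDensity (ρ ε : ℝ) (f f₁ f₂ : ℝ → ℝ) (x : ℝ) : ℝ :=
  ε⁻¹ * f x + ε * f₁ x ^ 2 + ρ * ε ^ 3 * f₂ x ^ 2

namespace H2Rep

variable {a b : ℝ} {f f₁ f₂ : ℝ → ℝ}

theorem integrableOn_crackDensity (h : H2Rep a b f f₁ f₂) (ρ ε : ℝ) :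
    IntegrableOn (crackDensity ρ ε f f₁ f₂) (Ioo a b) := by
  have i0 : IntegrableOn f (Ioo a b) := h.cont.integrableOn_Icc.mono_set Ioo_subset_Icc_self
  have i1 : IntegrableOn (fun x => f₁ x ^ 2) (Ioo a b) :=
    (h.cont₁.pow 2).integrableOn_Icc.mono_set Ioo_subset_Icc_self
  exact ((i0.const_mul _).add (i1.const_mul _)).add (h.memLp₂.integrable_sq.const_mul _)

theorem crackDensity_nonneg (h : H2Rep a b f f₁ f₂) {ρ ε : ℝ} (hρ : 0 < ρ) (hε : 0 < ε) {x : ℝ}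
    (hx : x ∈ Ioo a b) : 0 ≤ crackDensity ρ ε f f₁ f₂ x := by
  have := (h.mem_Icc x hx).1
  unfold crackDensity
  positivity

theorem intervalIntegrable (h : H2Rep a b f f₁ f₂) (ρ ε : ℝ) {x y : ℝ} (hx : x ∈ Icc a b)
    (hy : y ∈ Icc a b) : IntervalIntegrable (crackDensity ρ ε f f₁ f₂) volume x y :=
  intervalIntegrable_of_integrableOn_Ioo (h.integrableOn_crackDensity ρ ε) hx hy

/-- The term `ε⁻¹ f` bounds the mean, hence the minimum, of `f` by `1/8`. Young's inequality `|f₁| ≤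
1/(4ε) + ε f₁²` bounds the oscillation on an interval of length `ε` by `1/4 + 1/8`. The sum is
`1/2`. -/
theorem le_half_of_integral_le (h : H2Rep a b f f₁ f₂) {ρ ε : ℝ} (hρ : 0 < ρ) (hε : 0 < ε) {l : ℝ}
    (hl : l ∈ Ioo a b) (hl' : l + ε ∈ Ioo a b)
    (he : ∫ t in l..(l + ε), crackDensity ρ ε f f₁ f₂ t ≤ 1 / 8) {x : ℝ}
    (hx : x ∈ Icc l (l + ε)) : f x ≤ 1 / 2 := by
  have hle : l ≤ l + ε := by linarith
  have sub : Icc l (l + ε) ⊆ Ioo a b := fun t ht => ⟨hl.1.trans_le ht.1, ht.2.trans_lt hl'.2⟩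
  have subI : Icc l (l + ε) ⊆ Icc a b := sub.trans Ioo_subset_Icc_self
  obtain ⟨y, hy, hmin⟩ := isCompact_Icc.exists_isMinOn (nonempty_Icc.2 hle) (h.cont.mono subI)
  have dI := h.intervalIntegrable ρ ε (subI (left_mem_Icc.2 hle)) (subI (right_mem_Icc.2 hle))
  have f1I : ∀ p ∈ Icc l (l + ε), ∀ q ∈ Icc l (l + ε), IntervalIntegrable f₁ volume p q :=
    fun p hp q hq => ((h.cont₁.mono subI).mono (uIcc_subset_Icc hp hq)).intervalIntegrable
  have h1 : f y ≤ 1 / 8 := by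
    have : ∫ _ in l..(l + ε), ε⁻¹ * f y ≤ ∫ t in l..(l + ε), crackDensity ρ ε f f₁ f₂ t := by
      refine intervalIntegral.integral_mono_on hle (by simp) dI fun t ht => ?_
      have h2 : f y ≤ f t := hmin ht
      have h3 : ε⁻¹ * f y ≤ ε⁻¹ * f t := mul_le_mul_of_nonneg_left h2 (by positivity)
      have h4 : 0 ≤ ε * f₁ t ^ 2 := by positivity
      have h5 : 0 ≤ ρ * ε ^ 3 * f₂ t ^ 2 := by positivity
      unfold crackDensity; linarith
    rw [intervalIntegral.integral_const, smul_eq_mul, add_sub_cancel_left,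
      mul_inv_cancel_left₀ hε.ne'] at this
    exact this.trans he
  have h2 : f x - f y = ∫ t in y..x, f₁ t := by
    refine (intervalIntegral.integral_eq_sub_of_hasDerivAt (fun t ht => h.hasDerivAt t (sub ?_))
      (f1I y hy x hx)).symm
    exact uIcc_subset_Icc hy hx ht
  have h3 : |∫ t in y..x, f₁ t| ≤ ∫ t in l..(l + ε), |f₁ t| := by
    refine (intervalIntegral.norm_integral_le_abs_integral_norm (f := f₁)).trans ?_
    simp only [Real.norm_eq_abs]
    have hnn : 0 ≤ᵐ[volume.restrict (Ioc l (l + ε))] fun t => |f₁ t| :=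
      Eventually.of_forall fun t => abs_nonneg _
    have hI := (f1I l (left_mem_Icc.2 hle) (l + ε) (right_mem_Icc.2 hle)).abs
    rcases le_total y x with hyx | hyx
    · rw [abs_of_nonneg (intervalIntegral.integral_nonneg hyx fun t _ => abs_nonneg _)]
      exact intervalIntegral.integral_mono_interval hy.1 hyx hx.2 hnn hI
    · rw [intervalIntegral.integral_symm, abs_neg,
        abs_of_nonneg (intervalIntegral.integral_nonneg hyx fun t _ => abs_nonneg _)]
      exact intervalIntegral.integral_mono_interval hx.1 hyx hy.2 hnn hI
  have h4 : ∫ t in l..(l + ε), |f₁ t|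
      ≤ ∫ t in l..(l + ε), (1 / (4 * ε) + crackDensity ρ ε f f₁ f₂ t) := by
    refine intervalIntegral.integral_mono_on hle
      (f1I l (left_mem_Icc.2 hle) (l + ε) (right_mem_Icc.2 hle)).abs
      (intervalIntegrable_const.add dI) fun t ht => ?_
    have h5 : 0 ≤ ρ * ε ^ 3 * f₂ t ^ 2 := by positivity
    have h6 : 0 ≤ ε⁻¹ * f t := mul_nonneg (by positivity) (h.mem_Icc t (sub ht)).1
    have h7 : |f₁ t| ≤ 1 / (4 * ε) + ε * f₁ t ^ 2 := by
      have : 1 / (4 * ε) + ε * f₁ t ^ 2 - |f₁ t| = ε * (|f₁ t| - 1 / (2 * ε)) ^ 2 := by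
        rw [← sq_abs (f₁ t)]; field_simp; ring
      have h8 : 0 ≤ ε * (|f₁ t| - 1 / (2 * ε)) ^ 2 := by positivity
      linarith
    unfold crackDensity; linarith
  rw [intervalIntegral.integral_add (by simp) dI, intervalIntegral.integral_const, smul_eq_mul,
    add_sub_cancel_left, show ε * (1 / (4 * ε)) = 1 / 4 by field_simp] at h4
  have := le_abs_self (∫ t in y..x, f₁ t)
  linarith

end H2Rep

/-- Pigeonhole over `⌊r / ε⌋` consecutive cells of length `ε`; there are at least `r / (2 ε)` of
them, whence the factor. -/
theorem exists_subinterval_integral_le {G : ℝ → ℝ} {p r ε : ℝ} (hε : 0 < ε) (hεr : ε ≤ r / 2)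
    (hG : IntervalIntegrable G volume p (p + r)) (hnn : ∀ t ∈ Icc p (p + r), 0 ≤ G t) :
    ∃ l, p ≤ l ∧ l + ε ≤ p + r ∧
      ∫ t in l..(l + ε), G t ≤ 2 * ε / r * ∫ t in p..(p + r), G t := by
  have hr : 0 < r := by linarith
  set N := ⌊r / ε⌋₊ with hN
  have hN1 : (N : ℝ) ≤ r / ε := Nat.floor_le (by positivity)
  have hN2 : r / ε < N + 1 := Nat.lt_floor_add_one _
  have hN3 : (N : ℝ) * ε ≤ r := by rwa [le_div_iff₀ hε] at hN1
  have hN4 : r < (N + 1) * ε := by rwa [div_lt_iff₀ hε] at hN2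
  have hN5 : r / (2 * ε) ≤ N := by
    rw [div_le_iff₀ (by positivity)]
    nlinarith
  have hN0 : (0 : ℝ) < N := lt_of_lt_of_le (by positivity) hN5
  set D := ∫ t in p..(p + r), G t with hD
  have hD0 : 0 ≤ D := intervalIntegral.integral_nonneg (by linarith) hnn
  have hmem : ∀ j : ℕ, j ≤ N → p + j * ε ∈ Icc p (p + r) := fun j hj => by
    have h1 : (j : ℝ) ≤ N := by exact_mod_cast hj
    have h2 : (j : ℝ) * ε ≤ N * ε := mul_le_mul_of_nonneg_right h1 hε.le
    have h3 : 0 ≤ (j : ℝ) * ε := by positivity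
    exact ⟨by linarith, by linarith⟩
  have hint : ∀ x ∈ Icc p (p + r), ∀ y ∈ Icc p (p + r), IntervalIntegrable G volume x y :=
    fun x hx y hy => hG.mono_set (by
      rw [uIcc_of_le (by linarith : p ≤ p + r)]; exact uIcc_subset_Icc hx hy)
  have hsum : ∑ j ∈ Finset.range N, ∫ t in (p + j * ε)..(p + (j + 1 : ℕ) * ε), G t ≤ D := by
    rw [intervalIntegral.sum_integral_adjacent_intervals (a := fun j : ℕ => p + j * ε)
      (fun j hj => hint _ (hmem j hj.le) _ (hmem (j + 1) hj))]
    refine intervalIntegral.integral_mono_interval (by simp) (hmem N le_rfl |>.1.trans' (by simp))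
      (hmem N le_rfl).2 ?_ hG
    filter_upwards [ae_restrict_mem measurableSet_Ioc] with t ht
    exact hnn t (Ioc_subset_Icc_self ht)
  have hne : (Finset.range N).Nonempty := by
    rw [Finset.nonempty_range_iff]; rintro h; rw [h] at hN0; simp at hN0
  obtain ⟨j, hj, hjle⟩ := Finset.exists_le_of_sum_le hne (f := fun j : ℕ =>
    ∫ t in (p + j * ε)..(p + (j + 1 : ℕ) * ε), G t) (g := fun _ => D / N) (by
      rw [Finset.sum_const, Finset.card_range, nsmul_eq_mul, mul_div_cancel₀ _ hN0.ne']
      exact hsum)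
  rw [Finset.mem_range] at hj
  have e : p + ((j + 1 : ℕ) : ℝ) * ε = p + j * ε + ε := by push_cast; ring
  rw [e] at hjle
  refine ⟨p + j * ε, (hmem j hj.le).1, e ▸ (hmem (j + 1) hj).2, hjle.trans ?_⟩
  rw [div_le_iff₀ hN0]
  calc D = (2 * ε / r * (r / (2 * ε))) * D := by field_simp
    _ ≤ (2 * ε / r * N) * D := by gcongr
    _ = 2 * ε / r * D * N := by ring

theorem memLp_comp_affine {a b : ℝ} {g : ℝ → ℝ} (hg : MemLp g 2 (volume.restrict (Ioo a b)))
    (x₀ : ℝ) {α : ℝ} (hα : α ≠ 0) {s : Set ℝ} (hs : MeasurableSet s)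
    (hsub : ∀ y ∈ s, x₀ + α * y ∈ Ioo a b) :
    MemLp (fun y => g (x₀ + α * y)) 2 (volume.restrict s) := by
  have i1 : Integrable ((Ioo a b).indicator g) :=
    (integrable_indicator_iff measurableSet_Ioo).2 (hg.integrable (by norm_num))
  have i2 : Integrable ((Ioo a b).indicator fun x => g x ^ 2) :=
    (integrable_indicator_iff measurableSet_Ioo).2 hg.integrable_sq
  have j1 : IntegrableOn (fun y => (Ioo a b).indicator g (x₀ + α * y)) s :=
    ((i1.comp_add_left x₀).comp_mul_left' hα).integrableOn
  have j2 : IntegrableOn (fun y => (Ioo a b).indicator (fun x => g x ^ 2) (x₀ + α * y)) s :=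
    ((i2.comp_add_left x₀).comp_mul_left' hα).integrableOn
  have k1 : IntegrableOn (fun y => g (x₀ + α * y)) s :=
    j1.congr_fun (fun y hy => indicator_of_mem (hsub y hy) g) hs
  have k2 : IntegrableOn (fun y => g (x₀ + α * y) ^ 2) s :=
    j2.congr_fun (fun y hy => indicator_of_mem (hsub y hy) fun x => g x ^ 2) hs
  exact (memLp_two_iff_integrable_sq k1.aestronglyMeasurable).2 k2

/-- The cost of a crack: twice the energy of the optimal profile. -/
theorem exists_crack_cost {ρ : ℝ} (hρ : 0 < ρ) : ∃ C, 0 ≤ C ∧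
    ∀ (K : ℝ), 0 ≤ K → (∀ w ∈ admissibleProfiles, K ≤ profileEnergy ρ w) →
    ∀ (a b : ℝ) (f f₁ f₂ : ℝ → ℝ), H2Rep a b f f₁ f₂ → ∀ (s r ε M D : ℝ),
      0 < r → a < s - 2 * r → s + 2 * r < b → 0 < ε → ε ≤ r / 2 →
      ∫ t in (s - 2 * r)..(s + 2 * r), crackDensity ρ ε f f₁ f₂ t ≤ D →
      2 * ε / r * D ≤ 1 / 8 → 1 / 2 < M → (∃ x ∈ Icc (s - r) (s + r), M ≤ f x) →
      2 * M ^ 2 * K ≤ (∫ t in (s - 2 * r)..(s + 2 * r), crackDensity ρ ε f f₁ f₂ t)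
        + C * (ε / r * D) := by
  obtain ⟨C, hC0, hC⟩ := exists_half_cost hρ
  refine ⟨4 * C, by positivity, ?_⟩
  intro K hK0 hK a b f f₁ f₂ h s r ε M D hr has hsb hε hεr hD hDs hM ⟨x, hx, hxM⟩
  set G := crackDensity ρ ε f f₁ f₂ with hG
  have mem : ∀ t ∈ Icc (s - 2 * r) (s + 2 * r), t ∈ Ioo a b := fun t ht =>
    ⟨has.trans_le ht.1, ht.2.trans_lt hsb⟩
  have memI : ∀ t ∈ Icc (s - 2 * r) (s + 2 * r), t ∈ Icc a b := fun t ht =>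
    Ioo_subset_Icc_self (mem t ht)
  have Gi : ∀ p ∈ Icc (s - 2 * r) (s + 2 * r), ∀ q ∈ Icc (s - 2 * r) (s + 2 * r),
      IntervalIntegrable G volume p q := fun p hp q hq => h.intervalIntegrable ρ ε (memI p hp) (memI q hq)
  have Gnn : ∀ t ∈ Icc (s - 2 * r) (s + 2 * r), 0 ≤ G t := fun t ht =>
    h.crackDensity_nonneg hρ hε (mem t ht)
  have Gmono : ∀ p q, s - 2 * r ≤ p → p ≤ q → q ≤ s + 2 * r →
      ∫ t in p..q, G t ≤ ∫ t in (s - 2 * r)..(s + 2 * r), G t := fun p q h1 h2 h3 =>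
    intervalIntegral.integral_mono_interval h1 h2 h3
      (by filter_upwards [ae_restrict_mem measurableSet_Ioc] with t ht
          exact Gnn t (Ioc_subset_Icc_self ht))
      (Gi _ ⟨le_rfl, by linarith⟩ _ ⟨by linarith, le_rfl⟩)
  have hfac : 0 ≤ 2 * ε / r := by positivity
  -- One quiet cell of length `ε` is chosen in each of the flanks `[s - 2r, s - r]` and `[s + r, s +
  -- 2r]`.
  obtain ⟨l', hl'1, hl'2, hl'3⟩ := exists_subinterval_integral_le (G := G) (p := s - 2 * r) (r := r)
    hε hεr (Gi _ ⟨le_rfl, by linarith⟩ _ ⟨by linarith, by linarith⟩)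
    (fun t ht => Gnn t ⟨ht.1, by linarith [ht.2]⟩)
  obtain ⟨l, hl1, hl2, hl3⟩ := exists_subinterval_integral_le (G := G) (p := s + r) (r := r)
    hε hεr (Gi _ ⟨by linarith, by linarith⟩ _ ⟨by linarith, by linarith⟩)
    (fun t ht => Gnn t ⟨by linarith [ht.1], by linarith [ht.2]⟩)
  have e' : ∫ t in l'..(l' + ε), G t ≤ 2 * ε / r * D := hl'3.trans
    (mul_le_mul_of_nonneg_left ((Gmono _ _ le_rfl (by linarith) (by linarith)).trans hD) hfac)
  have e : ∫ t in l..(l + ε), G t ≤ 2 * ε / r * D := hl3.trans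
    (mul_le_mul_of_nonneg_left ((Gmono _ _ (by linarith) (by linarith) (by linarith)).trans hD) hfac)
  have sm' : ∀ y ∈ Icc l' (l' + ε), f y ≤ 1 / 2 := fun y hy =>
    h.le_half_of_integral_le hρ hε (mem _ ⟨by linarith, by linarith⟩)
      (mem _ ⟨by linarith, by linarith⟩) (e'.trans hDs) hy
  have sm : ∀ y ∈ Icc l (l + ε), f y ≤ 1 / 2 := fun y hy =>
    h.le_half_of_integral_le hρ hε (mem _ ⟨by linarith, by linarith⟩)
      (mem _ ⟨by linarith, by linarith⟩) (e.trans hDs) hy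
  have subl : Icc l' (l + ε) ⊆ Icc (s - 2 * r) (s + 2 * r) := Icc_subset_Icc hl'1 (by linarith)
  -- The maximum is at least `M > 1/2`, while `f ≤ 1/2` on the quiet cells, so it lies strictly
  -- between them. There the slope vanishes, as the profile problem requires at the origin.
  obtain ⟨z, hz, hmax⟩ := isCompact_Icc.exists_isMaxOn (nonempty_Icc.2 (by linarith : l' ≤ l + ε))
    (h.cont.mono (subl.trans memI))
  have hzM : M ≤ f z := hxM.trans (hmax (⟨by linarith [hx.1], by linarith [hx.2]⟩ : x ∈ Icc l' (l + ε)))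
  have hz1 : l' + ε < z := by
    by_contra hn
    have := sm' z ⟨hz.1, not_lt.1 hn⟩
    linarith
  have hz2 : z < l := by
    by_contra hn
    have := sm z ⟨not_lt.1 hn, hz.2⟩
    linarith
  have hzI : z ∈ Ioo a b := mem z (subl hz)
  have hfz0 : f₁ z = 0 := by
    have hloc : IsLocalMax f z := hmax.isLocalMax (Icc_mem_nhds (by linarith) (by linarith))
    exact hloc.hasDerivAt_eq_zero (h.hasDerivAt z hzI)
  have hz01 := h.mem_Icc z hzI
  -- Taking `α = ε` gives the right half and `α = -ε` the reflected left half. In both cases `L` is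
  -- chosen so that the last unit `[L, L + 1]` corresponds exactly to the quiet cell.
  have half : ∀ (α L : ℝ), α ≠ 0 → α ^ 2 = ε ^ 2 → 0 < L →
      (∀ y ∈ Icc 0 (L + 1), z + α * y ∈ Icc l' (l + ε)) →
      f z ^ 2 * K ≤ (ε * α⁻¹) * (∫ t in z..(z + α * (L + 1)), G t)
        + C * ((ε * α⁻¹) * ∫ t in (z + α * L)..(z + α * (L + 1)), G t) := by
    intro α L hα hα2 hL hin
    have hA : Continuous fun y : ℝ => z + α * y := by fun_prop
    have hmaps : MapsTo (fun y => z + α * y) ((fun y => z + α * y) ⁻¹' Ioo a b) (Ioo a b) :=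
      fun y hy => hy
    have hin' : Icc 0 (L + 1) ⊆ (fun y => z + α * y) ⁻¹' Ioo a b := fun y hy =>
      mem _ (subl (hin y hy))
    have d1 := h.wd₁.comp_affine isOpen_Ioo z hα
    have d2 := (h.wd₂.comp_affine isOpen_Ioo z hα).const_mul α
    have key := hC K hK ((fun y => z + α * y) ⁻¹' Ioo a b) (fun y => f (z + α * y))
      (fun y => α * f₁ (z + α * y)) (fun y => α * (α * f₂ (z + α * y))) L (f z)
      (isOpen_Ioo.preimage hA) hL hin' d1 d2
      ((h.cont.mono Ioo_subset_Icc_self).comp hA.continuousOn hmaps)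
      (continuousOn_const.mul
        ((h.cont₁.mono Ioo_subset_Icc_self).comp hA.continuousOn hmaps))
      (((memLp_comp_affine h.memLp₂ z hα measurableSet_Icc hin').const_mul α).const_mul α)
      (by linarith) hz01.2 (by simp) (by simp [hfz0])
      (fun y hy => ⟨(h.mem_Icc _ (hin' hy)).1, hmax (hin y hy)⟩)
    have eG : ∀ y, f (z + α * y) + (α * f₁ (z + α * y)) ^ 2 + ρ * (α * (α * f₂ (z + α * y))) ^ 2
        = ε * G (z + α * y) := by
      intro y
      have h4 : (α * (α * f₂ (z + α * y))) ^ 2 = (α ^ 2) ^ 2 * f₂ (z + α * y) ^ 2 := by ring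
      rw [h4, mul_pow, hα2, hG, crackDensity]
      field_simp
    simp only [eG] at key
    rw [intervalIntegral.integral_const_mul, intervalIntegral.integral_const_mul,
      intervalIntegral.integral_comp_add_mul _ hα, intervalIntegral.integral_comp_add_mul _ hα] at key
    simp only [smul_eq_mul, mul_zero, add_zero, ← mul_assoc] at key ⊢
    exact key
  have right := half ε ((l - z) / ε) hε.ne' rfl (div_pos (by linarith) hε) (by
    intro y hy
    have h1 : ε * y ≤ ε * ((l - z) / ε + 1) := mul_le_mul_of_nonneg_left hy.2 hε.le
    have h2 : ε * ((l - z) / ε + 1) = l - z + ε := by field_simp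
    have h3 : 0 ≤ ε * y := mul_nonneg hε.le hy.1
    exact ⟨by linarith, by linarith⟩)
  have left := half (-ε) ((z - (l' + ε)) / ε) (by simpa using hε.ne') (by ring)
    (div_pos (by linarith) hε) (by
    intro y hy
    have h1 : ε * y ≤ ε * ((z - (l' + ε)) / ε + 1) := mul_le_mul_of_nonneg_left hy.2 hε.le
    have h2 : ε * ((z - (l' + ε)) / ε + 1) = z - l' := by field_simp; ring
    have h3 : 0 ≤ ε * y := mul_nonneg hε.le hy.1
    exact ⟨by linarith, by linarith⟩)
  rw [mul_inv_cancel₀ hε.ne', one_mul, one_mul,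
    show z + ε * ((l - z) / ε + 1) = l + ε by field_simp; ring,
    show z + ε * ((l - z) / ε) = l by field_simp; ring] at right
  rw [show ε * (-ε)⁻¹ = -1 by field_simp,
    show z + -ε * ((z - (l' + ε)) / ε + 1) = l' by field_simp; ring,
    show z + -ε * ((z - (l' + ε)) / ε) = l' + ε by field_simp; ring,
    neg_one_mul, neg_one_mul, ← intervalIntegral.integral_symm,
    ← intervalIntegral.integral_symm] at left
  have tot : (∫ t in l'..z, G t) + ∫ t in z..(l + ε), G t
      ≤ ∫ t in (s - 2 * r)..(s + 2 * r), G t := by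
    rw [intervalIntegral.integral_add_adjacent_intervals
      (Gi _ (subl ⟨le_rfl, by linarith⟩) _ (subl hz)) (Gi _ (subl hz) _ (subl ⟨by linarith, le_rfl⟩))]
    exact Gmono _ _ hl'1 (by linarith) (by linarith)
  have hMz : M ^ 2 * K ≤ f z ^ 2 * K :=
    mul_le_mul_of_nonneg_right (pow_le_pow_left₀ (by linarith) hzM 2) hK0
  have c1 : C * ∫ t in l'..(l' + ε), G t ≤ C * (2 * ε / r * D) := mul_le_mul_of_nonneg_left e' hC0
  have c2 : C * ∫ t in l..(l + ε), G t ≤ C * (2 * ε / r * D) := mul_le_mul_of_nonneg_left e hC0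
  have e3 : 4 * C * (ε / r * D) = 2 * (C * (2 * ε / r * D)) := by ring
  rw [e3]
  linarith

end ATFracture

end

noncomputable section

namespace ATFracture

/-! ### Structure of special functions of bounded variation -/

/-- The Heaviside function with jump at `s`. -/
def heaviside (s x : ℝ) : ℝ := if s < x then 1 else 0

theorem heaviside_of_lt {s x : ℝ} (h : s < x) : heaviside s x = 1 := if_pos h

theorem heaviside_of_le {s x : ℝ} (h : x ≤ s) : heaviside s x = 0 := if_neg (not_lt.2 h)

theorem measurable_heaviside (s : ℝ) : Measurable (heaviside s) :=
  Measurable.ite measurableSet_Ioi measurable_const measurable_const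

theorem abs_heaviside_le (s x : ℝ) : |heaviside s x| ≤ 1 := by
  unfold heaviside; split_ifs <;> simp

theorem locallyIntegrable_heaviside (s : ℝ) : LocallyIntegrable (heaviside s) :=
  (locallyIntegrable_const (1 : ℝ)).mono (measurable_heaviside s).aestronglyMeasurable
    (Eventually.of_forall fun x => by simpa using abs_heaviside_le s x)

theorem tendsto_heaviside_right (t s : ℝ) :
    Tendsto (heaviside t) (𝓝[>] s) (𝓝 (if t ≤ s then 1 else 0)) := by
  split_ifs with h
  · refine tendsto_const_nhds.congr' ?_
    filter_upwards [self_mem_nhdsWithin] with x hx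
    exact (heaviside_of_lt (lt_of_le_of_lt h hx)).symm
  · refine tendsto_const_nhds.congr' ?_
    filter_upwards [mem_nhdsWithin_of_mem_nhds (Iio_mem_nhds (not_le.1 h))] with x hx
    exact (heaviside_of_le (le_of_lt hx)).symm

theorem tendsto_heaviside_left (t s : ℝ) :
    Tendsto (heaviside t) (𝓝[<] s) (𝓝 (if t < s then 1 else 0)) := by
  split_ifs with h
  · refine tendsto_const_nhds.congr' ?_
    filter_upwards [mem_nhdsWithin_of_mem_nhds (Ioi_mem_nhds h)] with x hx
    exact (heaviside_of_lt hx).symm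
  · refine tendsto_const_nhds.congr' ?_
    filter_upwards [self_mem_nhdsWithin] with x hx
    exact (heaviside_of_le ((le_of_lt hx).trans (not_lt.1 h))).symm

theorem integral_heaviside_mul_deriv {φ : ℝ → ℝ} {Ω : Set ℝ} (hφ : IsTestFunction Ω φ) (s : ℝ) :
    ∫ x, heaviside s x * deriv φ x = -φ s := by
  have e : (fun x => heaviside s x * deriv φ x) = (Ioi s).indicator (deriv φ) := by
    ext x
    by_cases h : s < x
    · rw [heaviside_of_lt h, indicator_of_mem (show x ∈ Ioi s from h), one_mul]
    · rw [heaviside_of_le (not_lt.1 h), indicator_of_notMem (show x ∉ Ioi s from h), zero_mul]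
  rw [e, integral_indicator measurableSet_Ioi]
  exact HasCompactSupport.integral_Ioi_deriv_eq (hφ.1.of_le (by exact_mod_cast le_top)) hφ.2.1 s

theorem ae_restrict_Ioo_of_split {a s b : ℝ} {P : ℝ → Prop}
    (h1 : ∀ᵐ x ∂volume.restrict (Ioo a s), P x) (h2 : ∀ᵐ x ∂volume.restrict (Ioo s b), P x) :
    ∀ᵐ x ∂volume.restrict (Ioo a b), P x := by
  rw [ae_restrict_iff' measurableSet_Ioo] at *
  have h3 : ∀ᵐ x : ℝ, x ≠ s := by simp [ae_iff]
  filter_upwards [h1, h2, h3] with x h1 h2 h3 hx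
  rcases lt_or_gt_of_ne h3 with h | h
  · exact h1 ⟨hx.1, h⟩
  · exact h2 ⟨h, hx.2⟩

theorem isOpen_Ioo_diff_finset (a b : ℝ) (B : Finset ℝ) : IsOpen (Ioo a b \ (B : Set ℝ)) :=
  isOpen_Ioo.sdiff B.finite_toSet.isClosed

/-- Induction on the largest point `s`: to its left the function is a step function, to its right a
constant, and the new coefficient is the difference between that constant and the last value on the
left. -/
theorem exists_ae_eq_step {a : ℝ} {f : ℝ → ℝ} (B : Finset ℝ) :
    ∀ b, (∀ s ∈ B, s ∈ Ioo a b) → IsWeakDeriv (Ioo a b \ (B : Set ℝ)) f (fun _ => 0) →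
      ∃ (c : ℝ) (j : ℝ → ℝ),
        f =ᵐ[volume.restrict (Ioo a b)] fun x => c + ∑ s ∈ B, j s * heaviside s x := by
  induction B using Finset.induction_on_max with
  | empty =>
    intro b _ h
    obtain ⟨c, hc⟩ := (h.mono (Ω' := Ioo a b) (by simp)).ae_const isOpen_Ioo ordConnected_Ioo
    exact ⟨c, 0, by simpa using hc⟩
  | insert s B hlt ih =>
    intro b hB h
    have hs := hB s (Finset.mem_insert_self _ _)
    have hsB : s ∉ B := fun hmem => lt_irrefl _ (hlt s hmem)
    obtain ⟨c, j, hcj⟩ := ih s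
      (fun t ht => ⟨(hB t (Finset.mem_insert_of_mem ht)).1, hlt t ht⟩)
      (h.mono fun x hx => ⟨⟨hx.1.1, hx.1.2.trans hs.2⟩, by
        rw [Finset.coe_insert, mem_insert_iff, not_or]
        exact ⟨hx.1.2.ne, hx.2⟩⟩)
    obtain ⟨d, hd⟩ := (h.mono (Ω' := Ioo s b) fun x hx => ⟨⟨hs.1.trans hx.1, hx.2⟩, by
        rw [Finset.coe_insert, mem_insert_iff, not_or]
        exact ⟨hx.1.ne', fun hxB => lt_asymm hx.1 (hlt x hxB)⟩⟩).ae_const isOpen_Ioo ordConnected_Ioo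
    refine ⟨c, Function.update j s (d - c - ∑ t ∈ B, j t), ?_⟩
    have hsum : ∀ x, ∑ t ∈ insert s B,
        Function.update j s (d - c - ∑ t ∈ B, j t) t * heaviside t x
        = (d - c - ∑ t ∈ B, j t) * heaviside s x + ∑ t ∈ B, j t * heaviside t x := by
      intro x
      rw [Finset.sum_insert hsB, Function.update_self]
      congr 1
      refine Finset.sum_congr rfl fun t ht => ?_
      rw [Function.update_of_ne (ne_of_mem_of_not_mem ht hsB)]
    refine ae_restrict_Ioo_of_split (s := s) ?_ ?_
    · filter_upwards [hcj, ae_restrict_mem measurableSet_Ioo] with x hx hxm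
      rw [hx, hsum, heaviside_of_le hxm.2.le]; ring
    · filter_upwards [hd, ae_restrict_mem measurableSet_Ioo] with x hx hxm
      have : ∑ t ∈ B, j t * heaviside t x = ∑ t ∈ B, j t :=
        Finset.sum_congr rfl fun t ht => by
          rw [heaviside_of_lt ((hlt t ht).trans hxm.1), mul_one]
      rw [hx, hsum, heaviside_of_lt hxm.1, this]; ring

/-- The function with derivative `g dx + ∑_{s ∈ B} j_s δ_s` and value `c` at `a`. -/
def sbvRep (a c : ℝ) (g : ℝ → ℝ) (B : Finset ℝ) (j : ℝ → ℝ) (x : ℝ) : ℝ :=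
  (c + ∫ t in a..x, g t) + ∑ s ∈ B, j s * heaviside s x

/-- Subtracting the primitive of `g` leaves a function with zero derivative off `B`, that is, a step
function. -/
theorem IsWeakDeriv.exists_ae_eq_sbvRep {a b : ℝ} (hab : a < b) {u g : ℝ → ℝ} {B : Finset ℝ}
    (hB : ∀ s ∈ B, s ∈ Ioo a b) (hg : IntegrableOn g (Ioo a b))
    (h : IsWeakDeriv (Ioo a b \ (B : Set ℝ)) u g) :
    ∃ c j, u =ᵐ[volume.restrict (Ioo a b)] sbvRep a c g B j := by
  have h1 := (isWeakDeriv_primitive_Ioo hab hg 0).mono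
    (sdiff_subset : Ioo a b \ (B : Set ℝ) ⊆ _)
  have h2 := (h.add (h1.const_mul (-1))).congr (ae_eq_refl _) (g' := fun _ => 0)
    (Eventually.of_forall fun x => by simp)
  obtain ⟨c, j, hcj⟩ := exists_ae_eq_step B b hB h2
  refine ⟨c, j, ?_⟩
  filter_upwards [hcj] with x hx
  rw [sbvRep]
  linarith

section Rep

variable {a b c : ℝ} {g u : ℝ → ℝ} {B : Finset ℝ} {j : ℝ → ℝ}

theorem tendsto_essRight_of_ae_eq_sbvRep (hg : IntegrableOn g (Ioo a b))
    (hu : u =ᵐ[volume.restrict (Ioo a b)] sbvRep a c g B j) {s : ℝ} (hs : s ∈ Ioo a b) :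
    Tendsto u (essRight s)
      (𝓝 ((c + ∫ t in a..s, g t) + ∑ t ∈ B, j t * (if t ≤ s then 1 else 0))) := by
  refine tendsto_essRight_congr hs.2 (ae_restrict_of_ae_restrict_of_subset
    (Ioo_subset_Ioo_left hs.1.le) hu) ?_
  have h1 := (continuousOn_primitive_Icc (hs.1.trans hs.2).le hg).continuousAt
    (Icc_mem_nhds hs.1 hs.2)
  refine ((h1.tendsto.mono_left nhdsWithin_le_nhds).const_add c).add ?_
  exact tendsto_finsetSum _ fun t _ => (tendsto_heaviside_right t s).const_mul (j t)

theorem tendsto_essLeft_of_ae_eq_sbvRep (hg : IntegrableOn g (Ioo a b))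
    (hu : u =ᵐ[volume.restrict (Ioo a b)] sbvRep a c g B j) {s : ℝ} (hs : s ∈ Ioo a b) :
    Tendsto u (essLeft s)
      (𝓝 ((c + ∫ t in a..s, g t) + ∑ t ∈ B, j t * (if t < s then 1 else 0))) := by
  refine tendsto_essLeft_congr hs.1 (ae_restrict_of_ae_restrict_of_subset
    (Ioo_subset_Ioo_right hs.2.le) hu) ?_
  have h1 := (continuousOn_primitive_Icc (hs.1.trans hs.2).le hg).continuousAt
    (Icc_mem_nhds hs.1 hs.2)
  refine ((h1.tendsto.mono_left nhdsWithin_le_nhds).const_add c).add ?_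
  exact tendsto_finsetSum _ fun t _ => (tendsto_heaviside_left t s).const_mul (j t)

theorem sum_jump_eq (B : Finset ℝ) (j : ℝ → ℝ) (s : ℝ) :
    ∑ t ∈ B, j t * (if t ≤ s then (1 : ℝ) else 0) - ∑ t ∈ B, j t * (if t < s then (1 : ℝ) else 0)
      = if s ∈ B then j s else 0 := by
  rw [← Finset.sum_sub_distrib, ← Finset.sum_ite_eq' B s j]
  refine Finset.sum_congr rfl fun t _ => ?_
  rcases lt_trichotomy t s with h | h | h
  · simp [h, h.le, h.ne]
  · simp [h]
  · simp [not_lt.2 h.le, not_le.2 h, h.ne']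

theorem jump_of_ae_eq_sbvRep (hg : IntegrableOn g (Ioo a b))
    (hu : u =ᵐ[volume.restrict (Ioo a b)] sbvRep a c g B j) {s : ℝ} (hs : s ∈ Ioo a b) :
    jump u s = if s ∈ B then j s else 0 := by
  rw [jump, (tendsto_essRight_of_ae_eq_sbvRep hg hu hs).limUnder_eq,
    (tendsto_essLeft_of_ae_eq_sbvRep hg hu hs).limUnder_eq, ← sum_jump_eq]
  ring

/-- Zero coefficients must be discarded: in the lower bound `B` is the set of crack points, at which
the limit displacement need not jump. -/
theorem jumpSet_of_ae_eq_sbvRep (hg : IntegrableOn g (Ioo a b)) (hB : ∀ s ∈ B, s ∈ Ioo a b)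
    (hu : u =ᵐ[volume.restrict (Ioo a b)] sbvRep a c g B j) :
    jumpSet a b u = ((B.filter fun s => j s ≠ 0 : Finset ℝ) : Set ℝ) := by
  ext s
  simp only [Finset.coe_filter, mem_ofPred_eq]
  constructor
  · rintro ⟨hs, l, r, hl, hr, hne⟩
    have h1 := tendsto_nhds_unique hl (tendsto_essLeft_of_ae_eq_sbvRep hg hu hs)
    have h2 := tendsto_nhds_unique hr (tendsto_essRight_of_ae_eq_sbvRep hg hu hs)
    have h3 := sum_jump_eq B j s
    by_cases hsB : s ∈ B
    · rw [if_pos hsB] at h3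
      exact ⟨hsB, fun h0 => hne (by rw [h1, h2]; linarith)⟩
    · rw [if_neg hsB] at h3
      exact absurd (by rw [h1, h2]; linarith) hne
  · rintro ⟨hsB, hj⟩
    have hs := hB s hsB
    refine ⟨hs, _, _, tendsto_essLeft_of_ae_eq_sbvRep hg hu hs,
      tendsto_essRight_of_ae_eq_sbvRep hg hu hs, fun h => hj ?_⟩
    have h3 := sum_jump_eq B j s
    rw [if_pos hsB] at h3
    linarith

theorem integral_mul_deriv_of_ae_eq_sbvRep (hab : a < b) (hg : IntegrableOn g (Ioo a b))
    (hu : u =ᵐ[volume.restrict (Ioo a b)] sbvRep a c g B j) {φ : ℝ → ℝ}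
    (hφ : IsTestFunction (Ioo a b) φ) :
    ∫ x in Ioo a b, u x * deriv φ x
      = -((∫ x in Ioo a b, g x * φ x) + ∑ s ∈ B, j s * φ s) := by
  have h1 := isWeakDeriv_primitive_Ioo hab hg c
  have e : ∫ x in Ioo a b, u x * deriv φ x = ∫ x in Ioo a b, sbvRep a c g B j x * deriv φ x :=
    integral_congr_ae (by filter_upwards [hu] with x hx; rw [hx])
  have i1 := hφ.deriv.integrable_mul h1.1
  have i2 : ∀ s ∈ B, Integrable fun x => j s * (heaviside s x * deriv φ x) := fun s _ =>
    (hφ.deriv.integrable_mul ((locallyIntegrable_heaviside s).locallyIntegrableOn _)).const_mul _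
  have e2 : (fun x => sbvRep a c g B j x * deriv φ x) = fun x =>
      (c + ∫ t in a..x, g t) * deriv φ x + ∑ s ∈ B, j s * (heaviside s x * deriv φ x) := by
    ext x; rw [sbvRep, add_mul, Finset.sum_mul]; simp only [mul_assoc]
  rw [e, hφ.deriv.setIntegral_mul, hφ.setIntegral_mul, e2,
    integral_add i1 (integrable_finsetSum _ i2), integral_finsetSum _ i2, h1.integral_eq hφ]
  simp only [integral_const_mul, integral_heaviside_mul_deriv hφ, mul_neg, Finset.sum_neg_distrib]
  ring

theorem isWeakDeriv_of_ae_eq_sbvRep (hab : a < b) (hg : IntegrableOn g (Ioo a b))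
    (hu : u =ᵐ[volume.restrict (Ioo a b)] sbvRep a c g B j) {S : Set ℝ}
    (hBS : ∀ s ∈ B, j s ≠ 0 → s ∈ S)
    (hui : IntegrableOn u (Ioo a b)) :
    IsWeakDeriv (Ioo a b \ S) u g := by
  refine isWeakDeriv_of_integral_eq ((hui.mono_set sdiff_subset).locallyIntegrableOn)
    ((hg.mono_set sdiff_subset).locallyIntegrableOn) fun φ hφ => ?_
  have hφ' := hφ.mono (sdiff_subset : Ioo a b \ S ⊆ Ioo a b)
  have := integral_mul_deriv_of_ae_eq_sbvRep hab hg hu hφ'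
  rw [hφ'.setIntegral_mul, hφ'.deriv.setIntegral_mul] at this
  rw [this, Finset.sum_eq_zero, add_zero]
  intro s hs
  by_cases hj : j s = 0
  · rw [hj, zero_mul]
  · rw [hφ.eq_zero (fun h => h.2 (hBS s hs hj)), mul_zero]

theorem memSBV2_of_ae_eq_sbvRep (hab : a < b) (hg : MemLp g 2 (volume.restrict (Ioo a b)))
    (hB : ∀ s ∈ B, s ∈ Ioo a b) (hu : u =ᵐ[volume.restrict (Ioo a b)] sbvRep a c g B j)
    (hui : MemLp u 1 (volume.restrict (Ioo a b))) : MemSBV2 a b u := by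
  have hgi : IntegrableOn g (Ioo a b) := hg.integrable (by norm_num)
  have hJ := jumpSet_of_ae_eq_sbvRep hgi hB hu
  refine ⟨hui, hJ ▸ Finset.finite_toSet _, g, hg, fun φ hφ => ?_⟩
  rw [integral_mul_deriv_of_ae_eq_sbvRep hab hgi hu hφ, hJ, finsum_mem_coe_finset, Finset.sum_filter]
  congr 2
  refine Finset.sum_congr rfl fun s hs => ?_
  rw [jump_of_ae_eq_sbvRep hgi hu (hB s hs), if_pos hs]
  by_cases hj : j s = 0 <;> simp [hj]

theorem setLIntegral_weakDeriv_of_ae_eq_sbvRep (hab : a < b) (κ : ℝ)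
    (hg : MemLp g 2 (volume.restrict (Ioo a b)))
    (hB : ∀ s ∈ B, s ∈ Ioo a b) (hu : u =ᵐ[volume.restrict (Ioo a b)] sbvRep a c g B j)
    (hui : MemLp u 1 (volume.restrict (Ioo a b))) :
    ∫⁻ x in Ioo a b \ jumpSet a b u,
      ENNReal.ofReal (κ * (weakDeriv (Ioo a b \ jumpSet a b u) u x) ^ 2)
      = ∫⁻ x in Ioo a b, ENNReal.ofReal (κ * g x ^ 2) := by
  have hgi : IntegrableOn g (Ioo a b) := hg.integrable (by norm_num)
  have hJ := jumpSet_of_ae_eq_sbvRep hgi hB hu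
  have hop : IsOpen (Ioo a b \ jumpSet a b u) := by rw [hJ]; exact isOpen_Ioo_diff_finset _ _ _
  have hwd : IsWeakDeriv (Ioo a b \ jumpSet a b u) u g :=
    isWeakDeriv_of_ae_eq_sbvRep hab hgi hu (fun s hs hj => by
      rw [hJ, Finset.mem_coe, Finset.mem_filter]; exact ⟨hs, hj⟩) (memLp_one_iff_integrable.1 hui)
  have e1 : ∫⁻ x in Ioo a b \ jumpSet a b u,
      ENNReal.ofReal (κ * (weakDeriv (Ioo a b \ jumpSet a b u) u x) ^ 2)
      = ∫⁻ x in Ioo a b \ jumpSet a b u, ENNReal.ofReal (κ * g x ^ 2) :=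
    lintegral_congr_ae (by filter_upwards [hwd.weakDeriv_ae_eq hop] with x hx; rw [hx])
  rw [e1]
  refine setLIntegral_congr (sdiff_null_ae_eq_self ?_)
  rw [hJ]; exact (Finset.finite_toSet _).measure_zero _

theorem MemSBV2.exists_sbvRep (hab : a < b) (hu : MemSBV2 a b u) :
    ∃ (c : ℝ) (g : ℝ → ℝ) (B : Finset ℝ) (j : ℝ → ℝ),
      MemLp g 2 (volume.restrict (Ioo a b)) ∧ (∀ s ∈ B, s ∈ Ioo a b) ∧ (B : Set ℝ) = jumpSet a b u ∧
      u =ᵐ[volume.restrict (Ioo a b)] sbvRep a c g B j := by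
  obtain ⟨hui, hfin, g, hg, hφ⟩ := hu
  have hgi : IntegrableOn g (Ioo a b) := hg.integrable (by norm_num)
  have hcoe : (hfin.toFinset : Set ℝ) = jumpSet a b u := hfin.coe_toFinset
  have hB : ∀ s ∈ hfin.toFinset, s ∈ Ioo a b := fun s hs => (hfin.mem_toFinset.1 hs).1
  have hwd : IsWeakDeriv (Ioo a b \ (hfin.toFinset : Set ℝ)) u g := by
    refine isWeakDeriv_of_integral_eq
      ((IntegrableOn.mono_set (memLp_one_iff_integrable.1 hui) sdiff_subset).locallyIntegrableOn)
      ((hgi.mono_set sdiff_subset).locallyIntegrableOn) fun φ hφt => ?_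
    have hφ' := hφt.mono (sdiff_subset : Ioo a b \ (hfin.toFinset : Set ℝ) ⊆ Ioo a b)
    have h1 := hφ φ hφ'
    rw [hφ'.setIntegral_mul, hφ'.deriv.setIntegral_mul] at h1
    rw [h1, finsum_mem_eq_zero_of_forall_eq_zero, add_zero]
    intro s hs
    rw [hφt.eq_zero (fun h => h.2 (hcoe.symm ▸ hs)), mul_zero]
  obtain ⟨c, j, hcj⟩ := hwd.exists_ae_eq_sbvRep hab hB hgi
  exact ⟨c, g, hfin.toFinset, j, hg, hB, hcoe, hcj⟩

end Rep

end ATFracture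

end

noncomputable section

namespace ATFracture

/-! ### Consequences of an energy bound -/

/-- The continuous representative starts at 1 and stays above `1/2` near the origin, so the linear
term alone is positive. This makes the normalising constant `c` positive. -/
theorem profileEnergy_pos {ρ : ℝ} (hρ : 0 < ρ) {w : ℝ → ℝ} (hw : w ∈ admissibleProfiles) :
    0 < profileEnergy ρ w := by
  obtain ⟨q, hq, -, -, hE⟩ := exists_isProfileSecondDeriv hw
  rw [hE, hq.profileEnergy_eq]
  have hcont : ContinuousWithinAt (profileOf q) (Ici 0) 0 :=
    (continuousOn_const.add hq.nearZero.prim.continuousOn_prim) 0 self_mem_Ici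
  have h0 : profileOf q 0 = 1 := by simp [profileOf, prim]
  have hev : ∀ᶠ x in 𝓝[≥] (0 : ℝ), 1 / 2 < profileOf q x :=
    hcont.eventually (lt_mem_nhds (by rw [h0]; norm_num))
  obtain ⟨δ, hδ, hsub⟩ := mem_nhdsGE_iff_exists_Ico_subset.1 hev
  have hδ' : 0 < δ := hδ
  have h1 : ∫ _ in Ioo 0 δ, (1 / 2 : ℝ) ≤ ∫ x in Ioi (0 : ℝ), profileOf q x := by
    calc ∫ _ in Ioo 0 δ, (1 / 2 : ℝ) ≤ ∫ x in Ioo 0 δ, profileOf q x :=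
          setIntegral_mono_on (by simp) (hq.integrable.mono_set Ioo_subset_Ioi_self)
            measurableSet_Ioo fun x hx => le_of_lt (hsub (Ioo_subset_Ico_self hx))
      _ ≤ _ := setIntegral_mono_set hq.integrable
          (by filter_upwards [ae_restrict_mem measurableSet_Ioi] with x hx
              exact (hq.mem_Icc x (le_of_lt hx)).1) Ioo_subset_Ioi_self.eventuallyLE
  rw [setIntegral_const, smul_eq_mul, Measure.real, Real.volume_Ioo, sub_zero,
    ENNReal.toReal_ofReal hδ'.le] at h1
  have h2 : 0 < ∫ x in Ioi (0 : ℝ), profileOf q x := lt_of_lt_of_le (by positivity) h1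
  positivity

theorem H2Rep.memLp_mul {a b : ℝ} {f f₁ f₂ g : ℝ → ℝ} (h : H2Rep a b f f₁ f₂)
    (hg : MemLp g 2 (volume.restrict (Ioo a b))) :
    MemLp (fun x => (1 - f x) * g x) 2 (volume.restrict (Ioo a b)) := by
  refine MemLp.of_le_mul (c := 1) hg ?_ ?_
  · exact (((continuousOn_const.sub h.cont).mono Ioo_subset_Icc_self).aestronglyMeasurable
      measurableSet_Ioo).mul hg.aestronglyMeasurable
  · filter_upwards [ae_restrict_mem measurableSet_Ioo] with x hx
    have := h.mem_Icc x hx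
    rw [norm_mul]
    refine mul_le_mul_of_nonneg_right ?_ (norm_nonneg _)
    rw [Real.norm_eq_abs, abs_le]; constructor <;> linarith [this.1, this.2]

theorem max_sq_add_max_sq (x : ℝ) : max x 0 ^ 2 + max (-x) 0 ^ 2 = x ^ 2 := by
  rcases le_total x 0 with h | h
  · rw [max_eq_right h, max_eq_left (by linarith)]; ring
  · rw [max_eq_left h, max_eq_right (by linarith)]; ring

theorem MemLp.max_neg {a b : ℝ} {g : ℝ → ℝ} (hg : MemLp g 2 (volume.restrict (Ioo a b))) :
    MemLp (fun x => max (-g x) 0) 2 (volume.restrict (Ioo a b)) := by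
  refine MemLp.of_le_mul (c := 1) hg ?_ (Eventually.of_forall fun x => ?_)
  · exact hg.aestronglyMeasurable.neg.sup aestronglyMeasurable_const
  · rw [one_mul, Real.norm_eq_abs, Real.norm_eq_abs, abs_of_nonneg (le_max_right _ _)]
    exact max_le (neg_le_abs _) (abs_nonneg _)

theorem MemLp.max_pos {a b : ℝ} {g : ℝ → ℝ} (hg : MemLp g 2 (volume.restrict (Ioo a b))) :
    MemLp (fun x => max (g x) 0) 2 (volume.restrict (Ioo a b)) := by
  simpa using MemLp.max_neg hg.neg

/-- Two consequences of the bulk term are kept. Since `(1 - f)² ≤ 1`, degrading the compressive part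
as well only lowers the energy, which leaves the square of `(1 - f) g`. The undegraded compressive
part is recorded separately, because it decides the sign of the jumps. -/
theorem exists_of_atFunctional_lt {a b κ G ρ c η ε E : ℝ} (hab : a < b) (hκ : 0 < κ) (hG : 0 < G)
    (hρ : 0 < ρ) (hc : 0 < c) (hη : 0 < η) (hε : 0 < ε) {y : L1 a b × L1 a b}
    (h : atFunctional a b κ G ρ c η ε y < ENNReal.ofReal E) :
    ∃ g f f₁ f₂, IsWeakDeriv (Ioo a b) y.1 g ∧ MemLp g 2 (volume.restrict (Ioo a b)) ∧
      H2Rep a b f f₁ f₂ ∧ y.2 =ᵐ[volume.restrict (Ioo a b)] f ∧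
      κ * (∫ x in Ioo a b, ((1 - f x) * g x) ^ 2)
        + G / c * (∫ x in Ioo a b, crackDensity ρ ε f f₁ f₂ x) ≤ E ∧
      κ * (∫ x in Ioo a b, max (-g x) 0 ^ 2) ≤ E := by
  unfold atFunctional at h
  split_ifs at h with hif
  swap
  · exact absurd h (by simp)
  obtain ⟨⟨-, g, hg, hg2⟩, hv, h01⟩ := hif
  obtain ⟨f, f₁, f₂, hrep, e0, e1, e2⟩ := exists_H2Rep hab hv h01
  have eg := hg.weakDeriv_ae_eq isOpen_Ioo
  set q : ℝ → ℝ := fun x => κ * ((f x - 1) ^ 2 + η) * (max (g x) 0) ^ 2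
    + κ * (max (-g x) 0) ^ 2 with hq
  have E1 : atEnergy a b κ G ρ c η ε y.1 y.2 = (∫⁻ x in Ioo a b, ENNReal.ofReal (q x))
      + ENNReal.ofReal (G / c) * ∫⁻ x in Ioo a b, ENNReal.ofReal (crackDensity ρ ε f f₁ f₂ x) := by
    unfold atEnergy
    congr 1
    · refine lintegral_congr_ae ?_
      filter_upwards [e0, eg] with x h1 h2
      rw [h1, h2]
    · congr 1
      refine lintegral_congr_ae ?_
      filter_upwards [e0, e1, e2] with x h1 h2 h3
      rw [h1, h2, h3, crackDensity]
  have mh := hrep.memLp_mul hg2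
  have mneg := MemLp.max_neg hg2
  have mpos := MemLp.max_pos hg2
  have qi : IntegrableOn q (Ioo a b) := by
    have m1 : MemLp (fun x => (1 - f x) * max (g x) 0) 2 (volume.restrict (Ioo a b)) :=
      hrep.memLp_mul mpos
    refine (((m1.integrable_sq.add (mpos.integrable_sq.const_mul η)).const_mul κ).add
      (mneg.integrable_sq.const_mul κ)).congr (Eventually.of_forall fun x => ?_)
    simp only [hq, Pi.add_apply]; ring
  have qnn : ∀ x, 0 ≤ q x := fun x => by simp only [hq]; positivity
  have di := hrep.integrableOn_crackDensity ρ ε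
  have dnn : 0 ≤ᵐ[volume.restrict (Ioo a b)] crackDensity ρ ε f f₁ f₂ := by
    filter_upwards [ae_restrict_mem measurableSet_Ioo] with x hx
    exact hrep.crackDensity_nonneg hρ hε hx
  have hGc : 0 ≤ G / c := by positivity
  rw [E1, ← ofReal_integral_eq_lintegral_ofReal qi (Eventually.of_forall qnn),
    ← ofReal_integral_eq_lintegral_ofReal di dnn, ← ENNReal.ofReal_mul hGc,
    ← ENNReal.ofReal_add (integral_nonneg qnn) (mul_nonneg hGc (integral_nonneg_of_ae dnn))] at h
  have hlt := (ENNReal.ofReal_lt_ofReal_iff_of_nonneg (add_nonneg (integral_nonneg qnn)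
    (mul_nonneg hGc (integral_nonneg_of_ae dnn)))).1 h
  refine ⟨g, f, f₁, f₂, hg, hg2, hrep, e0, ?_, ?_⟩
  · have : κ * (∫ x in Ioo a b, ((1 - f x) * g x) ^ 2) ≤ ∫ x in Ioo a b, q x := by
      rw [← integral_const_mul]
      refine setIntegral_mono_on (mh.integrable_sq.const_mul κ) qi measurableSet_Ioo fun x hx => ?_
      have h1 := hrep.mem_Icc x hx
      have h2 : (1 - f x) ^ 2 ≤ 1 := pow_le_one₀ (by linarith [h1.2]) (by linarith [h1.1])
      have h3 : (f x - 1) ^ 2 = (1 - f x) ^ 2 := by ring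
      simp only [hq]
      rw [mul_pow, ← max_sq_add_max_sq (g x), h3, mul_add, mul_add]
      have h4 : (1 - f x) ^ 2 * max (-g x) 0 ^ 2 ≤ 1 * max (-g x) 0 ^ 2 :=
        mul_le_mul_of_nonneg_right h2 (sq_nonneg _)
      have h5 := mul_le_mul_of_nonneg_left h4 hκ.le
      have h6 : 0 ≤ κ * η * max (g x) 0 ^ 2 := by positivity
      linarith
    linarith
  · have : κ * (∫ x in Ioo a b, max (-g x) 0 ^ 2) ≤ ∫ x in Ioo a b, q x := by
      rw [← integral_const_mul]
      refine setIntegral_mono_on (mneg.integrable_sq.const_mul κ) qi measurableSet_Ioo fun x hx => ?_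
      simp only [hq]
      have : 0 ≤ κ * ((f x - 1) ^ 2 + η) * (max (g x) 0) ^ 2 := by positivity
      linarith
    have h2 : 0 ≤ G / c * ∫ x in Ioo a b, crackDensity ρ ε f f₁ f₂ x :=
      mul_nonneg hGc (integral_nonneg_of_ae dnn)
    linarith

/-! ### Limits along ultrafilters -/

theorem exists_tendsto_ultrafilter (𝒰 : Ultrafilter ℕ) {x : ℕ → ℝ} {m M : ℝ}
    (h : ∀ᶠ n in 𝒰, x n ∈ Icc m M) : ∃ l ∈ Icc m M, Tendsto x 𝒰 (𝓝 l) := by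
  obtain ⟨l, hl, hle⟩ := isCompact_Icc.ultrafilter_le_nhds (𝒰.map x)
    (le_principal_iff.2 (mem_map.2 h))
  exact ⟨l, hl, hle⟩

/-- Bounded scalar sequences converge along an ultrafilter, so all inner products converge at once
and the limit functional is bounded; Riesz represents it. Testing the limit against itself gives
lower semicontinuity of the norm. -/
theorem exists_weak_limit {H : Type*} [NormedAddCommGroup H] [InnerProductSpace ℝ H]
    [CompleteSpace H] (𝒰 : Ultrafilter ℕ) {x : ℕ → H} {C : ℝ} (h : ∀ᶠ n in 𝒰, ‖x n‖ ≤ C) :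
    ∃ l : H, (∀ y, Tendsto (fun n => inner ℝ (x n) y) 𝒰 (𝓝 (inner ℝ l y))) ∧
      ∀ C', (∀ᶠ n in 𝒰, ‖x n‖ ≤ C') → ‖l‖ ≤ C' := by
  have hC : 0 ≤ C := by
    obtain ⟨n, hn⟩ := h.exists
    exact (norm_nonneg _).trans hn
  have hb : ∀ y, ∀ᶠ n in 𝒰, inner ℝ (x n) y ∈ Icc (-(C * ‖y‖)) (C * ‖y‖) := fun y => by
    filter_upwards [h] with n hn
    have := abs_real_inner_le_norm (x n) y
    have h2 : ‖x n‖ * ‖y‖ ≤ C * ‖y‖ := mul_le_mul_of_nonneg_right hn (norm_nonneg _)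
    exact abs_le.1 (this.trans h2)
  choose L hL hLt using fun y => exists_tendsto_ultrafilter 𝒰 (hb y)
  let ℓ : H →ₗ[ℝ] ℝ :=
    { toFun := L
      map_add' := fun y z => tendsto_nhds_unique (hLt (y + z))
        (((hLt y).add (hLt z)).congr fun n => (inner_add_right _ _ _).symm)
      map_smul' := fun r y => tendsto_nhds_unique (hLt (r • y))
        (((hLt y).const_mul r).congr fun n => (real_inner_smul_right _ _ _).symm) }
  let ℓc : H →L[ℝ] ℝ := ℓ.mkContinuous C fun y => abs_le.2 (hL y)
  refine ⟨(InnerProductSpace.toDual ℝ H).symm ℓc, fun y => ?_, fun C' hC' => ?_⟩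
  · rw [InnerProductSpace.toDual_symm_apply]; exact hLt y
  · set l := (InnerProductSpace.toDual ℝ H).symm ℓc with hl
    have h1 : Tendsto (fun n => inner ℝ (x n) l) 𝒰 (𝓝 (inner ℝ l l)) := by
      have : inner ℝ l l = L l := InnerProductSpace.toDual_symm_apply
      rw [this]; exact hLt l
    have h2 : inner ℝ l l ≤ C' * ‖l‖ := by
      refine le_of_tendsto h1 ?_
      filter_upwards [hC'] with n hn
      exact (real_inner_le_norm _ _).trans (mul_le_mul_of_nonneg_right hn (norm_nonneg _))
    rw [real_inner_self_eq_norm_sq, sq] at h2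
    rcases (norm_nonneg l).eq_or_lt with h0 | h0
    · rw [← h0]
      obtain ⟨n, hn⟩ := hC'.exists
      exact (norm_nonneg _).trans hn
    · exact le_of_mul_le_mul_right h2 h0

theorem tendsto_integral_mul_of_tendsto {a b : ℝ} {l : Filter ℕ} {y : ℕ → L1 a b} {z : L1 a b}
    (h : Tendsto y l (𝓝 z)) {ψ : ℝ → ℝ} (hψ : Continuous ψ) (hc : HasCompactSupport ψ) :
    Tendsto (fun n => ∫ x in Ioo a b, y n x * ψ x) l (𝓝 (∫ x in Ioo a b, z x * ψ x)) := by
  obtain ⟨C, hC⟩ := hψ.bounded_above_of_compact_support hc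
  have hi : ∀ f : L1 a b, Integrable (fun x => f x * ψ x) (volume.restrict (Ioo a b)) := fun f =>
    (L1.integrable_coeFn f).mul_bdd hψ.aestronglyMeasurable (Eventually.of_forall hC)
  rw [tendsto_iff_norm_sub_tendsto_zero] at h ⊢
  have h2 := h.mul_const C
  rw [zero_mul] at h2
  refine squeeze_zero (fun _ => norm_nonneg _) (fun n => ?_) h2
  rw [← integral_sub (hi _) (hi _), L1.norm_eq_integral_norm, ← integral_mul_const]
  refine norm_integral_le_of_norm_le ((L1.integrable_coeFn (y n - z)).norm.mul_const C) ?_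
  filter_upwards [Lp.coeFn_sub (y n) z] with x hx
  rw [hx, Pi.sub_apply, ← sub_mul, norm_mul]
  exact mul_le_mul_of_nonneg_left (hC x) (norm_nonneg _)

/-! ### Counting the cracks -/

theorem exists_separating_radius {a b : ℝ} (B : Finset ℝ) (hB : ∀ s ∈ B, s ∈ Ioo a b) :
    ∃ r, 0 < r ∧ (∀ s ∈ B, a < s - 2 * r ∧ s + 2 * r < b) ∧
      ∀ s ∈ B, ∀ t ∈ B, s ≠ t → 4 * r < |s - t| := by
  have tend : ∀ c : ℝ, Tendsto (fun r : ℝ => c * r) (𝓝[>] 0) (𝓝 0) := fun c => by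
    have : Tendsto (fun r : ℝ => c * r) (𝓝 0) (𝓝 (c * 0)) := tendsto_id.const_mul c
    rw [mul_zero] at this
    exact this.mono_left nhdsWithin_le_nhds
  have h1 : ∀ᶠ r : ℝ in 𝓝[>] 0, ∀ s ∈ B, a < s - 2 * r ∧ s + 2 * r < b := by
    rw [Finset.eventually_all]
    intro s hs
    filter_upwards [(tend 2).eventually (gt_mem_nhds (show 0 < s - a by linarith [(hB s hs).1])),
      (tend 2).eventually (gt_mem_nhds (show 0 < b - s by linarith [(hB s hs).2]))] with r h1 h2
    constructor <;> linarith
  have h2 : ∀ᶠ r : ℝ in 𝓝[>] 0, ∀ s ∈ B, ∀ t ∈ B, s ≠ t → 4 * r < |s - t| := by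
    rw [Finset.eventually_all]
    intro s _
    rw [Finset.eventually_all]
    intro t _
    by_cases hst : s = t
    · exact Eventually.of_forall fun r h => absurd hst h
    · filter_upwards [(tend 4).eventually (gt_mem_nhds (abs_pos.2 (sub_ne_zero.2 hst)))] with r hr _
      exact hr
  obtain ⟨r, ⟨h1, h2⟩, hr⟩ := ((h1.and h2).and self_mem_nhdsWithin).exists
  exact ⟨r, hr, h1, h2⟩

theorem sum_integral_le_of_separated {a b r : ℝ} {B : Finset ℝ} (hr : 0 < r) {F : ℝ → ℝ}
    (hF : IntegrableOn F (Ioo a b)) (hnn : ∀ x ∈ Ioo a b, 0 ≤ F x)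
    (h1 : ∀ s ∈ B, a < s - 2 * r ∧ s + 2 * r < b)
    (h2 : ∀ s ∈ B, ∀ t ∈ B, s ≠ t → 4 * r < |s - t|) :
    ∑ s ∈ B, ∫ x in (s - 2 * r)..(s + 2 * r), F x ≤ ∫ x in Ioo a b, F x := by
  have hsub : ∀ s ∈ B, Ioc (s - 2 * r) (s + 2 * r) ⊆ Ioo a b := fun s hs x hx =>
    ⟨(h1 s hs).1.trans hx.1, hx.2.trans_lt (h1 s hs).2⟩
  have e : ∑ s ∈ B, ∫ x in (s - 2 * r)..(s + 2 * r), F x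
      = ∫ x in ⋃ s ∈ B, Ioc (s - 2 * r) (s + 2 * r), F x := by
    rw [integral_biUnion_finset B (fun s _ => measurableSet_Ioc) ?_
      (fun s hs => hF.mono_set (hsub s hs))]
    · exact Finset.sum_congr rfl fun s _ => intervalIntegral.integral_of_le (by linarith)
    · intro s hs t ht hst
      rw [Function.onFun, Set.disjoint_left]
      intro x hx hx'
      have := h2 s hs t ht hst
      rcases abs_cases (s - t) with h | h <;> linarith [hx.1, hx.2, hx'.1, hx'.2]
  rw [e]
  refine setIntegral_mono_set hF ?_ (iUnion₂_subset hsub).eventuallyLE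
  filter_upwards [ae_restrict_mem measurableSet_Ioo] with x hx using hnn x hx

/-- The points where the damage variable tends to `1` along the ultrafilter. -/
def crackPoints (𝒰 : Ultrafilter ℕ) (a b : ℝ) (f : ℕ → ℝ → ℝ) : Set ℝ :=
  {s | s ∈ Ioo a b ∧ ∀ r > 0, ∀ M < 1, ∀ᶠ n in 𝒰, ∃ x ∈ Icc (s - r) (s + r), M ≤ f n x}

/-- Disjoint windows around the points of `B` each carry energy at least `2 M² K - O(ε)` by
`exists_crack_cost`. Summing, passing to the limit along `𝒰` and letting `M ↑ 1` gives the count. -/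
theorem card_crackPoints_le {ρ K : ℝ} (hρ : 0 < ρ) (hK0 : 0 < K)
    (hK : ∀ w ∈ admissibleProfiles, K ≤ profileEnergy ρ w) {a b : ℝ} (𝒰 : Ultrafilter ℕ)
    {ε : ℕ → ℝ} (hε : ∀ n, 0 < ε n) (hε0 : Tendsto ε 𝒰 (𝓝 0)) {f f₁ f₂ : ℕ → ℝ → ℝ}
    (hrep : ∀ᶠ n in 𝒰, H2Rep a b (f n) (f₁ n) (f₂ n)) {β : ℝ}
    (hβ : Tendsto (fun n => ∫ x in Ioo a b, crackDensity ρ (ε n) (f n) (f₁ n) (f₂ n) x) 𝒰 (𝓝 β))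
    {B : Finset ℝ} (hB : (B : Set ℝ) ⊆ crackPoints 𝒰 a b f) : 2 * K * B.card ≤ β := by
  obtain ⟨C, hC0, hC⟩ := exists_crack_cost hρ
  obtain ⟨r, hr, h1, h2⟩ := exists_separating_radius B fun s hs => (hB hs).1
  have hβ1 : ∀ᶠ n in 𝒰, ∫ x in Ioo a b, crackDensity ρ (ε n) (f n) (f₁ n) (f₂ n) x ≤ β + 1 :=
    hβ.eventually (ge_mem_nhds (by linarith))
  have t1 : Tendsto (fun n => 2 * ε n / r * (β + 1)) 𝒰 (𝓝 0) := by
    have := ((hε0.const_mul 2).div_const r).mul_const (β + 1)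
    simpa using this
  have t2 : ∀ᶠ n in 𝒰, ε n ≤ r / 2 := hε0.eventually (ge_mem_nhds (by positivity))
  have key : ∀ M : ℝ, 1 / 2 < M → M < 1 → B.card * (2 * M ^ 2 * K) ≤ β := by
    intro M hM hM1
    have hev : ∀ᶠ n in 𝒰, ∀ s ∈ B, ∃ x ∈ Icc (s - r) (s + r), M ≤ f n x := by
      rw [Finset.eventually_all]
      exact fun s hs => (hB hs).2 r hr M hM1
    have t3 : Tendsto (fun n => (∫ x in Ioo a b, crackDensity ρ (ε n) (f n) (f₁ n) (f₂ n) x)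
        + B.card * (C * (ε n / r * (β + 1)))) 𝒰 (𝓝 β) := by
      have := hβ.add ((((hε0.div_const r).mul_const (β + 1)).const_mul C).const_mul (B.card : ℝ))
      simpa using this
    refine ge_of_tendsto t3 ?_
    filter_upwards [hrep, hβ1, t1.eventually (ge_mem_nhds (show (0 : ℝ) < 1 / 8 by norm_num)), t2,
      hev] with n hn hβn h8 hεn hx
    have hDi := hn.integrableOn_crackDensity ρ (ε n)
    have hDn : ∀ x ∈ Ioo a b, 0 ≤ crackDensity ρ (ε n) (f n) (f₁ n) (f₂ n) x := fun x hx =>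
      hn.crackDensity_nonneg hρ (hε n) hx
    have hsum := sum_integral_le_of_separated hr hDi hDn h1 h2
    have each : ∀ s ∈ B, 2 * M ^ 2 * K
        ≤ (∫ t in (s - 2 * r)..(s + 2 * r), crackDensity ρ (ε n) (f n) (f₁ n) (f₂ n) t)
          + C * (ε n / r * (β + 1)) := by
      intro s hs
      refine hC K hK0.le hK a b _ _ _ hn s r (ε n) M (β + 1) hr (h1 s hs).1 (h1 s hs).2 (hε n) hεn
        ?_ h8 hM (hx s hs)
      rw [intervalIntegral.integral_of_le (by linarith)]
      refine (setIntegral_mono_set hDi ?_ ?_).trans hβn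
      · filter_upwards [ae_restrict_mem measurableSet_Ioo] with x hx using hDn x hx
      · exact LE.le.eventuallyLE fun x hx =>
          ⟨(h1 s hs).1.trans hx.1, hx.2.trans_lt (h1 s hs).2⟩
    have := Finset.sum_le_sum each
    rw [Finset.sum_const, nsmul_eq_mul, Finset.sum_add_distrib, Finset.sum_const, nsmul_eq_mul] at this
    linarith
  have lim : Tendsto (fun M : ℝ => B.card * (2 * M ^ 2 * K)) (𝓝[<] 1)
      (𝓝 (B.card * (2 * 1 ^ 2 * K))) :=
    (Continuous.tendsto (by fun_prop) 1).mono_left nhdsWithin_le_nhds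
  have hle : (B.card : ℝ) * (2 * 1 ^ 2 * K) ≤ β := by
    refine le_of_tendsto lim ?_
    filter_upwards [Ioo_mem_nhdsLT (show (1 / 2 : ℝ) < 1 by norm_num)] with M hM
    exact key M hM.1 hM.2
  linarith

theorem finite_crackPoints {ρ K : ℝ} (hρ : 0 < ρ) (hK0 : 0 < K)
    (hK : ∀ w ∈ admissibleProfiles, K ≤ profileEnergy ρ w) {a b : ℝ} (𝒰 : Ultrafilter ℕ)
    {ε : ℕ → ℝ} (hε : ∀ n, 0 < ε n) (hε0 : Tendsto ε 𝒰 (𝓝 0)) {f f₁ f₂ : ℕ → ℝ → ℝ}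
    (hrep : ∀ᶠ n in 𝒰, H2Rep a b (f n) (f₁ n) (f₂ n)) {β : ℝ}
    (hβ : Tendsto (fun n => ∫ x in Ioo a b, crackDensity ρ (ε n) (f n) (f₁ n) (f₂ n) x) 𝒰 (𝓝 β)) :
    (crackPoints 𝒰 a b f).Finite := by
  by_contra hinf
  obtain ⟨N, hN⟩ := exists_nat_gt (β / (2 * K))
  obtain ⟨B, hB, hcard⟩ := Set.Infinite.exists_subset_card_eq hinf N
  have := card_crackPoints_le hρ hK0 hK 𝒰 hε hε0 hrep hβ hB
  rw [hcard] at this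
  rw [div_lt_iff₀ (by positivity)] at hN
  linarith

/-- For an ultrafilter "not eventually" is "eventually not", so failing to be a crack point is a
bound by some `M < 1` on a whole neighbourhood. Compactness reduces to finitely many neighbourhoods.
-/
theorem exists_bound_of_isCompact {𝒰 : Ultrafilter ℕ} {a b : ℝ} {f : ℕ → ℝ → ℝ} {S : Set ℝ}
    (hS : IsCompact S) (hsub : S ⊆ Ioo a b \ crackPoints 𝒰 a b f) :
    ∃ M < 1, ∀ᶠ n in 𝒰, ∀ x ∈ S, f n x ≤ M := by
  refine hS.induction_on (p := fun S => ∃ M < 1, ∀ᶠ n in 𝒰, ∀ x ∈ S, f n x ≤ M)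
    ⟨0, by norm_num, by simp⟩ ?_ ?_ ?_
  · rintro s t hst ⟨M, hM, h⟩
    exact ⟨M, hM, h.mono fun n hn x hx => hn x (hst hx)⟩
  · rintro s t ⟨M, hM, h⟩ ⟨M', hM', h'⟩
    refine ⟨max M M', max_lt hM hM', ?_⟩
    filter_upwards [h, h'] with n hn hn' x hx
    rcases hx with hx | hx
    · exact (hn x hx).trans (le_max_left _ _)
    · exact (hn' x hx).trans (le_max_right _ _)
  · intro s hs
    obtain ⟨hsI, hsB⟩ := hsub hs
    have : ∃ r > 0, ∃ M < 1, ¬ ∀ᶠ n in 𝒰, ∃ x ∈ Icc (s - r) (s + r), M ≤ f n x := by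
      by_contra hcon
      push Not at hcon
      exact hsB ⟨hsI, hcon⟩
    obtain ⟨r, hr, M, hM, hn⟩ := this
    rw [← Ultrafilter.eventually_not] at hn
    refine ⟨Icc (s - r) (s + r), mem_nhdsWithin_of_mem_nhds
      (Icc_mem_nhds (by linarith) (by linarith)), M, hM, hn.mono fun n hn x hx => ?_⟩
    by_contra hx'
    exact hn ⟨x, hx, (not_le.1 hx').le⟩

end ATFracture

end

noncomputable section

namespace ATFracture

/-! ### The lower bound -/

theorem IsTestFunction.memLp {Ω : Set ℝ} {φ : ℝ → ℝ} (hφ : IsTestFunction Ω φ) (p : ℝ≥0∞)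
    (a b : ℝ) : MemLp φ p (volume.restrict (Ioo a b)) :=
  (hφ.continuous.memLp_of_hasCompactSupport hφ.2.1).restrict _

theorem abs_mul_le_half (x y : ℝ) {θ : ℝ} (hθ : 0 < θ) :
    |x * y| ≤ θ / 2 * x ^ 2 + 1 / (2 * θ) * y ^ 2 := by
  have h1 : θ / 2 * x ^ 2 + 1 / (2 * θ) * y ^ 2 - |x * y| = 1 / (2 * θ) * (θ * |x| - |y|) ^ 2 := by
    rw [abs_mul, ← sq_abs x, ← sq_abs y]; field_simp; ring
  have h2 : 0 ≤ 1 / (2 * θ) * (θ * |x| - |y|) ^ 2 := by positivity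
  linarith

/-- Such a test function reads off the coefficient of a single jump, while its small `L²` norm makes
it negligible against anything bounded in `L²`. -/
theorem exists_test_bump {a b : ℝ} (B : Finset ℝ) {s : ℝ} (hs : s ∈ Ioo a b) {τ : ℝ} (hτ : 0 < τ) :
    ∃ φ, IsTestFunction (Ioo a b) φ ∧ (∀ x, φ x ∈ Icc (0 : ℝ) 1) ∧ φ s = 1 ∧
      (∀ t ∈ B, t ≠ s → φ t = 0) ∧ ∫ x in Ioo a b, φ x ^ 2 ≤ 2 * τ := by
  have hopen : IsOpen (Ioo a b \ ((B.erase s : Finset ℝ) : Set ℝ)) := isOpen_Ioo_diff_finset _ _ _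
  obtain ⟨r, hr, hsub⟩ := Metric.isOpen_iff.1 hopen s ⟨hs, by simp⟩
  set R := min (r / 2) τ with hR
  have hR0 : 0 < R := lt_min (by positivity) hτ
  let φ : ContDiffBump s := ⟨R / 2, R, by positivity, by linarith⟩
  have hts : tsupport φ = Metric.closedBall s R := φ.tsupport_eq
  have hts' : tsupport φ ⊆ Ioo a b \ ((B.erase s : Finset ℝ) : Set ℝ) := by
    rw [hts]
    exact (Metric.closedBall_subset_ball (by have := min_le_left (r / 2) τ; linarith)).trans hsub
  refine ⟨φ, ⟨φ.contDiff, φ.hasCompactSupport, hts'.trans sdiff_subset⟩,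
    fun x => ⟨φ.nonneg, φ.le_one⟩, ?_, ?_, ?_⟩
  · exact φ.one_of_mem_closedBall (Metric.mem_closedBall_self (by show 0 ≤ R / 2; positivity))
  · intro t ht hts2
    refine image_eq_zero_of_notMem_tsupport fun h => (hts' h).2 ?_
    exact Finset.mem_coe.2 (Finset.mem_erase.2 ⟨hts2, ht⟩)
  · have hint : IntegrableOn (fun _ : ℝ => (1 : ℝ)) (Icc (s - τ) (s + τ)) := by simp
    have e : ∫ x in Icc (s - τ) (s + τ), (1 : ℝ) = 2 * τ := by
      rw [setIntegral_const, smul_eq_mul, Measure.real, Real.volume_Icc,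
        ENNReal.toReal_ofReal (by linarith)]; ring
    rw [← e, ← integral_indicator measurableSet_Icc, ← integral_indicator measurableSet_Ioo]
    refine integral_mono_of_nonneg (Eventually.of_forall fun x => ?_)
      ((integrable_indicator_iff measurableSet_Icc).2 hint) (Eventually.of_forall fun x => ?_)
    · exact indicator_nonneg (fun _ _ => sq_nonneg _) x
    · have h01 : φ x ^ 2 ≤ 1 := pow_le_one₀ φ.nonneg φ.le_one
      by_cases hx : x ∈ Icc (s - τ) (s + τ)
      · simp only [indicator_of_mem hx]
        by_cases hx2 : x ∈ Ioo a b
        · simpa only [indicator_of_mem hx2] using h01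
        · simp [indicator_of_notMem hx2]
      · have h0 : φ x = 0 := by
          refine image_eq_zero_of_notMem_tsupport fun h => hx ?_
          rw [hts, Real.closedBall_eq_Icc] at h
          have := min_le_right (r / 2) τ
          exact ⟨by linarith [h.1], by linarith [h.2]⟩
        have : (Ioo a b).indicator (fun x => φ x ^ 2) x = 0 := by
          simp [indicator, h0]
        simp only [this, indicator_of_notMem hx, le_refl]

/-- Compactness and lower semicontinuity together. The limits `α` of the degraded elastic energy and
`β` of the surface energy share the budget `E`; `α` bounds the bulk term by weak lower
semicontinuity, and `β` bounds the number of crack points, which contain the jump set. -/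
theorem crackFunctional_le_of_ultrafilter {a b κ G ρ K E : ℝ} (hab : a < b) (hκ : 0 < κ)
    (hG : 0 < G) (hρ : 0 < ρ) (hK0 : 0 < K) (hK : ∀ w ∈ admissibleProfiles, K ≤ profileEnergy ρ w)
    (𝒰 : Ultrafilter ℕ) {ε η : ℕ → ℝ} (hε : ∀ n, 0 < ε n) (hε0 : Tendsto ε 𝒰 (𝓝 0))
    (hη : ∀ n, 0 < η n) {y : ℕ → L1 a b × L1 a b} {z : L1 a b × L1 a b} (hy : Tendsto y 𝒰 (𝓝 z))
    (hE : ∀ᶠ n in 𝒰, atFunctional a b κ G ρ (2 * K) (η n) (ε n) (y n) < ENNReal.ofReal E) :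
    crackFunctional a b κ G z ≤ ENNReal.ofReal E := by
  have hex : ∀ n, ∃ g f f₁ f₂,
      atFunctional a b κ G ρ (2 * K) (η n) (ε n) (y n) < ENNReal.ofReal E →
      (IsWeakDeriv (Ioo a b) (y n).1 g ∧ MemLp g 2 (volume.restrict (Ioo a b)) ∧
      H2Rep a b f f₁ f₂ ∧ (y n).2 =ᵐ[volume.restrict (Ioo a b)] f ∧
      κ * (∫ x in Ioo a b, ((1 - f x) * g x) ^ 2)
        + G / (2 * K) * (∫ x in Ioo a b, crackDensity ρ (ε n) f f₁ f₂ x) ≤ E ∧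
      κ * (∫ x in Ioo a b, max (-g x) 0 ^ 2) ≤ E) := fun n => by
    by_cases h : atFunctional a b κ G ρ (2 * K) (η n) (ε n) (y n) < ENNReal.ofReal E
    · obtain ⟨g, f, f₁, f₂, hh⟩ := exists_of_atFunctional_lt hab hκ hG hρ
        (by positivity : 0 < 2 * K) (hη n) (hε n) h
      exact ⟨g, f, f₁, f₂, fun _ => hh⟩
    · exact ⟨0, 0, 0, 0, fun h' => absurd h' h⟩
  choose g f f₁ f₂ hall using hex
  have hev := hE.mono fun n hn => hall n hn
  clear hall hE
  have hrep : ∀ᶠ n in 𝒰, H2Rep a b (f n) (f₁ n) (f₂ n) := hev.mono fun n hn => hn.2.2.1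
  set D : ℕ → ℝ := fun n => ∫ x in Ioo a b, crackDensity ρ (ε n) (f n) (f₁ n) (f₂ n) x with hD
  set A : ℕ → ℝ := fun n => ∫ x in Ioo a b, ((1 - f n x) * g n x) ^ 2 with hA
  have hGK : 0 < G / (2 * K) := by positivity
  have hA0 : ∀ n, 0 ≤ A n := fun n => integral_nonneg fun x => sq_nonneg _
  have hD0 : ∀ᶠ n in 𝒰, 0 ≤ D n := hrep.mono fun n hn =>
    setIntegral_nonneg measurableSet_Ioo fun x hx => hn.crackDensity_nonneg hρ (hε n) hx
  have hsum : ∀ᶠ n in 𝒰, κ * A n + G / (2 * K) * D n ≤ E := hev.mono fun n hn => hn.2.2.2.2.1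
  have hAb : ∀ᶠ n in 𝒰, A n ∈ Icc 0 (E / κ) := by
    filter_upwards [hsum, hD0] with n h1 h2
    refine ⟨hA0 n, (le_div_iff₀ hκ).2 ?_⟩
    have := mul_nonneg hGK.le h2
    linarith
  have hDb : ∀ᶠ n in 𝒰, D n ∈ Icc 0 (E / (G / (2 * K))) := by
    filter_upwards [hsum, hD0] with n h1 h2
    refine ⟨h2, (le_div_iff₀ hGK).2 ?_⟩
    have := mul_nonneg hκ.le (hA0 n)
    linarith
  obtain ⟨α, -, hα⟩ := exists_tendsto_ultrafilter 𝒰 hAb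
  obtain ⟨β, hβI, hβ⟩ := exists_tendsto_ultrafilter 𝒰 hDb
  have hαβ : κ * α + G / (2 * K) * β ≤ E :=
    le_of_tendsto ((hα.const_mul κ).add (hβ.const_mul _)) hsum
  set D₀ := E / (G / (2 * K)) with hD₀
  -- the damage variable vanishes in the limit
  have hfint : ∀ᶠ n in 𝒰, ∫ x in Ioo a b, f n x ≤ ε n * D₀ := by
    filter_upwards [hrep, hDb] with n hn hDn
    have : ∫ x in Ioo a b, (ε n)⁻¹ * f n x ≤ D n := by
      refine setIntegral_mono_on ((hn.cont.integrableOn_Icc.mono_set Ioo_subset_Icc_self).const_mul _)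
        (hn.integrableOn_crackDensity ρ (ε n)) measurableSet_Ioo fun x hx => ?_
      have hεn := hε n
      have h1 : 0 ≤ ε n * f₁ n x ^ 2 := by positivity
      have h2 : 0 ≤ ρ * ε n ^ 3 * f₂ n x ^ 2 := by positivity
      unfold crackDensity; linarith
    rw [integral_const_mul, inv_mul_le_iff₀ (hε n)] at this
    exact this.trans (mul_le_mul_of_nonneg_left hDn.2 (hε n).le)
  have hv0 : ∀ᵐ x ∂volume.restrict (Ioo a b), z.2 x = 0 := by
    have h1 : Tendsto (fun n => ‖(y n).2‖) 𝒰 (𝓝 ‖z.2‖) := (hy.snd_nhds).norm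
    have h2 : Tendsto (fun n => ε n * D₀) 𝒰 (𝓝 0) := by simpa using hε0.mul_const D₀
    have h3 : ‖z.2‖ ≤ 0 := by
      refine le_of_tendsto_of_tendsto h1 h2 ?_
      filter_upwards [hev, hfint] with n hn hf
      refine le_trans (le_of_eq ?_) hf
      rw [L1.norm_eq_integral_norm]
      refine integral_congr_ae ?_
      filter_upwards [hn.2.2.2.1, ae_restrict_mem measurableSet_Ioo] with x hx hxm
      rw [hx, Real.norm_eq_abs, abs_of_nonneg (hn.2.2.1.mem_Icc x hxm).1]
    have h4 : z.2 = 0 := norm_le_zero_iff.1 h3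
    rw [h4]
    filter_upwards [Lp.coeFn_zero ℝ 1 (volume.restrict (Ioo a b))] with x hx
    rw [hx]; rfl
  -- the weak limit of the degraded strain
  have hmem : ∀ᶠ n in 𝒰, MemLp (fun x => (1 - f n x) * g n x) 2 (volume.restrict (Ioo a b)) :=
    hev.mono fun n hn => hn.2.2.1.memLp_mul hn.2.1
  classical
  set X : ℕ → Lp ℝ 2 (volume.restrict (Ioo a b)) := fun n =>
    if h : MemLp (fun x => (1 - f n x) * g n x) 2 (volume.restrict (Ioo a b)) then h.toLp _ else 0
    with hX
  have hXn : ∀ᶠ n in 𝒰, ‖X n‖ ^ 2 = A n ∧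
      X n =ᵐ[volume.restrict (Ioo a b)] fun x => (1 - f n x) * g n x := by
    filter_upwards [hmem] with n hn
    simp only [hX, dif_pos hn]
    exact ⟨(MemLp.integral_sq_eq hn).symm, hn.coeFn_toLp⟩
  obtain ⟨Γ, hΓ, hΓn⟩ := exists_weak_limit 𝒰 (x := X) (C := Real.sqrt (E / κ)) (by
    filter_upwards [hXn, hAb] with n h1 h2
    exact Real.le_sqrt_of_sq_le (h1.1 ▸ h2.2))
  have hΓα : ‖Γ‖ ^ 2 ≤ α := by
    have h1 : ∀ δ > 0, ‖Γ‖ ^ 2 ≤ α + δ := fun δ hδ => by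
      have h2 : ‖Γ‖ ≤ Real.sqrt (α + δ) := hΓn _ (by
        filter_upwards [hXn, hα.eventually (ge_mem_nhds (show α < α + δ by linarith))] with n h1 h2
        exact Real.le_sqrt_of_sq_le (h1.1 ▸ h2))
      have hα0 : 0 ≤ α := ge_of_tendsto' hα hA0
      calc ‖Γ‖ ^ 2 ≤ Real.sqrt (α + δ) ^ 2 := pow_le_pow_left₀ (norm_nonneg _) h2 2
        _ = α + δ := Real.sq_sqrt (by linarith)
    exact le_of_forall_pos_le_add h1
  set γ : ℝ → ℝ := ⇑Γ with hγ
  have hγm : MemLp γ 2 (volume.restrict (Ioo a b)) := Lp.memLp Γ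
  have hγi : IntegrableOn γ (Ioo a b) := hγm.integrable (by norm_num)
  have hfin := finite_crackPoints hρ hK0 hK 𝒰 hε hε0 hrep hβ
  set B : Finset ℝ := hfin.toFinset with hB
  have hBc : (B : Set ℝ) = crackPoints 𝒰 a b f := hfin.coe_toFinset
  have hBI : ∀ s ∈ B, s ∈ Ioo a b := fun s hs => (hfin.mem_toFinset.1 hs).1
  have hBcard := card_crackPoints_le hρ hK0 hK 𝒰 hε hε0 hrep hβ hBc.le
  have hui : IntegrableOn z.1 (Ioo a b) := L1.integrable_coeFn z.1
  have hlimu : ∀ φ, IsTestFunction (Ioo a b) φ →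
      Tendsto (fun n => -∫ x in Ioo a b, g n x * φ x) 𝒰 (𝓝 (∫ x in Ioo a b, z.1 x * deriv φ x)) := by
    intro φ hφ
    refine (tendsto_integral_mul_of_tendsto hy.fst_nhds hφ.deriv.continuous hφ.deriv.2.1).congr' ?_
    filter_upwards [hev] with n hn
    exact hn.1.2.2 φ hφ
  have hwd : IsWeakDeriv (Ioo a b \ (B : Set ℝ)) z.1 γ := by
    refine isWeakDeriv_of_integral_eq ((hui.mono_set sdiff_subset).locallyIntegrableOn)
      ((hγi.mono_set sdiff_subset).locallyIntegrableOn) fun φ hφ => ?_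
    have hφ' := hφ.mono (sdiff_subset : Ioo a b \ (B : Set ℝ) ⊆ Ioo a b)
    rw [← hφ'.setIntegral_mul, ← hφ'.deriv.setIntegral_mul]
    obtain ⟨M, hM, hMn⟩ := exists_bound_of_isCompact (𝒰 := 𝒰) (f := f) hφ.2.1
      (hφ.2.2.trans (by rw [hBc]))
    obtain ⟨Cφ, hCφ⟩ := hφ.continuous.bounded_above_of_compact_support hφ.2.1
    have hφm := hφ.memLp 2 a b
    have l1 : Tendsto (fun n => ∫ x in Ioo a b, ((1 - f n x) * g n x) * φ x) 𝒰
        (𝓝 (∫ x in Ioo a b, γ x * φ x)) := by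
      have h1 := hΓ (hφm.toLp φ)
      have e : inner ℝ Γ (hφm.toLp φ) = ∫ x in Ioo a b, γ x * φ x := by
        rw [L2.inner_def]
        refine integral_congr_ae ?_
        filter_upwards [hφm.coeFn_toLp] with x hx
        rw [hx]; simp [hγ, mul_comm]
      rw [e] at h1
      refine h1.congr' ?_
      filter_upwards [hXn] with n hn
      rw [L2.inner_def]
      refine integral_congr_ae ?_
      filter_upwards [hφm.coeFn_toLp, hn.2] with x hx hx2
      rw [hx, hx2]; simp [mul_comm]
    -- On the support of `φ` one has `(1 - M) |f g| ≤ |(1 - f) g| f`. Young's inequality with weight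
    -- `√ε` balances the bounded norm of `(1 - f) g` against `∫ f² ≤ ∫ f = O(ε)`, leaving `O(√ε)`.
    have l2 : Tendsto (fun n => ∫ x in Ioo a b, (f n x * g n x) * φ x) 𝒰 (𝓝 0) := by
      have hC0 : 0 ≤ Cφ := (norm_nonneg _).trans (hCφ 0)
      have t1 : Tendsto (fun n => Cφ / (1 - M) * (Real.sqrt (ε n) / 2 * (E / κ)
          + Real.sqrt (ε n) / 2 * D₀)) 𝒰 (𝓝 0) := by
        have hs : Tendsto (fun n => Real.sqrt (ε n)) 𝒰 (𝓝 0) := by simpa using hε0.sqrt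
        have := (((hs.div_const 2).mul_const (E / κ)).add
          ((hs.div_const 2).mul_const D₀)).const_mul (Cφ / (1 - M))
        simpa using this
      refine squeeze_zero_norm' ?_ t1
      filter_upwards [hev, hMn, hAb, hfint, hmem] with n hn hMx hAn hfn hmn
      have hfi : IntegrableOn (f n) (Ioo a b) :=
        hn.2.2.1.cont.integrableOn_Icc.mono_set Ioo_subset_Icc_self
      set θ := Real.sqrt (ε n) with hθ
      have hθ0 : 0 < θ := Real.sqrt_pos.2 (hε n)
      have hθ2 : θ * θ = ε n := Real.mul_self_sqrt (hε n).le
      have hbd : ∀ x ∈ Ioo a b, ‖(f n x * g n x) * φ x‖ ≤ Cφ / (1 - M) *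
          (θ / 2 * ((1 - f n x) * g n x) ^ 2 + 1 / (2 * θ) * f n x) := by
        intro x hx
        have h01 := hn.2.2.1.mem_Icc x hx
        have hRnn : 0 ≤ θ / 2 * ((1 - f n x) * g n x) ^ 2 + 1 / (2 * θ) * f n x := by
          have := h01.1
          positivity
        have h1M : 0 < 1 - M := by linarith
        by_cases hxs : x ∈ tsupport φ
        · have hfM := hMx x hxs
          have h2 : |f n x * g n x| * (1 - M) ≤ |((1 - f n x) * g n x) * f n x| := by
            rw [abs_mul, abs_mul, abs_mul, abs_of_nonneg h01.1,
              abs_of_nonneg (by linarith [h01.2] : 0 ≤ 1 - f n x)]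
            have h3 := mul_nonneg h01.1 (abs_nonneg (g n x))
            nlinarith
          have h3 := abs_mul_le_half ((1 - f n x) * g n x) (f n x) hθ0
          have h4 : f n x ^ 2 ≤ f n x := by nlinarith [h01.1, h01.2]
          have h5 : 1 / (2 * θ) * f n x ^ 2 ≤ 1 / (2 * θ) * f n x :=
            mul_le_mul_of_nonneg_left h4 (by positivity)
          rw [norm_mul, Real.norm_eq_abs, div_mul_eq_mul_div, le_div_iff₀ h1M]
          calc |f n x * g n x| * ‖φ x‖ * (1 - M) = (|f n x * g n x| * (1 - M)) * ‖φ x‖ := by ring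
            _ ≤ (θ / 2 * ((1 - f n x) * g n x) ^ 2 + 1 / (2 * θ) * f n x) * Cφ :=
              mul_le_mul (by linarith) (hCφ x) (norm_nonneg _) hRnn
            _ = _ := by ring
        · rw [image_eq_zero_of_notMem_tsupport hxs]
          simp only [mul_zero, norm_zero]
          positivity
      refine (norm_integral_le_of_norm_le (((hmn.integrable_sq.const_mul (θ / 2)).add
        (hfi.const_mul (1 / (2 * θ)))).const_mul (Cφ / (1 - M))) ?_).trans ?_
      · filter_upwards [ae_restrict_mem measurableSet_Ioo] with x hx using hbd x hx
      · have hnn : 0 ≤ Cφ / (1 - M) := div_nonneg hC0 (by linarith)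
        rw [integral_const_mul]
        refine mul_le_mul_of_nonneg_left ?_ hnn
        have e2 := integral_add (hmn.integrable_sq.const_mul (θ / 2)) (hfi.const_mul (1 / (2 * θ)))
        simp only [Pi.add_apply] at e2 ⊢
        rw [e2, integral_const_mul, integral_const_mul]
        have h6 : θ / 2 * ∫ x in Ioo a b, ((1 - f n x) * g n x) ^ 2 ≤ θ / 2 * (E / κ) :=
          mul_le_mul_of_nonneg_left hAn.2 (by positivity)
        have h7 : 1 / (2 * θ) * ∫ x in Ioo a b, f n x ≤ 1 / (2 * θ) * (ε n * D₀) :=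
          mul_le_mul_of_nonneg_left hfn (by positivity)
        have h8 : 1 / (2 * θ) * (ε n * D₀) = θ / 2 * D₀ := by
          rw [← hθ2]; field_simp
        linarith
    have l3 := (l1.add l2).neg
    rw [add_zero] at l3
    refine tendsto_nhds_unique (hlimu φ hφ') (l3.congr' ?_)
    filter_upwards [hev, hmem] with n hn hmn
    have i1 : Integrable (fun x => ((1 - f n x) * g n x) * φ x) (volume.restrict (Ioo a b)) :=
      hmn.integrable_mul hφm
    have i0 : Integrable (fun x => g n x * φ x) (volume.restrict (Ioo a b)) :=
      hn.2.1.integrable_mul hφm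
    have i2 : Integrable (fun x => (f n x * g n x) * φ x) (volume.restrict (Ioo a b)) :=
      (i0.sub i1).congr (Eventually.of_forall fun x => by simp only [Pi.sub_apply]; ring)
    rw [← integral_add i1 i2]
    congr 1
    refine integral_congr_ae (Eventually.of_forall fun x => ?_)
    simp only; ring
  obtain ⟨c, j, hcj⟩ := hwd.exists_ae_eq_sbvRep hab hBI hγi
  -- the jumps are nonnegative
  have hjump : ∀ s ∈ B, 0 ≤ j s := by
    intro s hs
    have hE0 : ∃ C₁, 0 ≤ C₁ ∧ ∀ᶠ n in 𝒰, ∫ x in Ioo a b, max (-g n x) 0 ^ 2 ≤ C₁ := by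
      refine ⟨max (E / κ) 0, le_max_right _ _, hev.mono fun n hn => ?_⟩
      exact ((le_div_iff₀ hκ).2 (by linarith [hn.2.2.2.2.2])).trans (le_max_left _ _)
    obtain ⟨C₁, hC₁, hbd⟩ := hE0
    set S := ∫ x in Ioo a b, γ x ^ 2 with hS
    have hS0 : 0 ≤ S := integral_nonneg fun x => sq_nonneg _
    -- The bump at `s` has squared norm at most `2 θ²`. Young's inequality with weight `θ` costs `θ
    -- C₁ / 2 + θ` for the compressive strain of the sequence and `θ S / 2 + θ` for the limit
    -- strain; tensile strain only helps.
    have main : ∀ θ : ℝ, 0 < θ → -j s ≤ θ * ((C₁ + S) / 2 + 2) := by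
      intro θ hθ
      obtain ⟨φ, hφ, hφ01, hφs, hφB, hφ2⟩ := exists_test_bump (a := a) (b := b) B (hBI s hs)
        (τ := θ ^ 2) (by positivity)
      have hφm := hφ.memLp 2 a b
      have lim := hlimu φ hφ
      rw [integral_mul_deriv_of_ae_eq_sbvRep hab hγi hcj hφ] at lim
      have hsumφ : ∑ t ∈ B, j t * φ t = j s := by
        rw [Finset.sum_eq_single s, hφs, mul_one]
        · intro t ht hts; rw [hφB t ht hts, mul_zero]
        · exact fun h => absurd hs h
      rw [hsumφ] at lim
      have up : -((∫ x in Ioo a b, γ x * φ x) + j s)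
          ≤ θ / 2 * C₁ + 1 / (2 * θ) * (2 * θ ^ 2) := by
        refine le_of_tendsto lim ?_
        filter_upwards [hev, hbd] with n hn hb1
        have mneg := MemLp.max_neg hn.2.1
        have i0 : Integrable (fun x => g n x * φ x) (volume.restrict (Ioo a b)) :=
          hn.2.1.integrable_mul hφm
        rw [← integral_neg]
        have step : ∫ x in Ioo a b, -(g n x * φ x)
            ≤ ∫ x in Ioo a b, (θ / 2 * max (-g n x) 0 ^ 2 + 1 / (2 * θ) * φ x ^ 2) := by
          refine integral_mono i0.neg ((mneg.integrable_sq.const_mul _).add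
            (hφm.integrable_sq.const_mul _)) fun x => ?_
          have h1 := abs_mul_le_half (max (-g n x) 0) (φ x) hθ
          have h2 : -(g n x * φ x) ≤ max (-g n x) 0 * φ x := by
            have := mul_le_mul_of_nonneg_right (le_max_left (-g n x) 0) (hφ01 x).1
            linarith
          exact h2.trans ((le_abs_self _).trans h1)
        refine step.trans ?_
        rw [integral_add (mneg.integrable_sq.const_mul _) (hφm.integrable_sq.const_mul _),
          integral_const_mul, integral_const_mul]
        exact add_le_add (mul_le_mul_of_nonneg_left hb1 (by positivity))
          (mul_le_mul_of_nonneg_left hφ2 (by positivity))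
      have low : ∫ x in Ioo a b, γ x * φ x ≤ θ / 2 * S + 1 / (2 * θ) * (2 * θ ^ 2) := by
        have step : ∫ x in Ioo a b, γ x * φ x
            ≤ ∫ x in Ioo a b, (θ / 2 * γ x ^ 2 + 1 / (2 * θ) * φ x ^ 2) :=
          integral_mono (hγm.integrable_mul hφm) ((hγm.integrable_sq.const_mul _).add
            (hφm.integrable_sq.const_mul _)) fun x =>
            (le_abs_self _).trans (abs_mul_le_half (γ x) (φ x) hθ)
        refine step.trans ?_
        rw [integral_add (hγm.integrable_sq.const_mul _) (hφm.integrable_sq.const_mul _),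
          integral_const_mul, integral_const_mul]
        exact add_le_add le_rfl (mul_le_mul_of_nonneg_left hφ2 (by positivity))
      have e : 1 / (2 * θ) * (2 * θ ^ 2) = θ := by field_simp
      rw [e] at up low
      linarith
    have lim : Tendsto (fun θ : ℝ => θ * ((C₁ + S) / 2 + 2)) (𝓝[>] 0) (𝓝 (0 * ((C₁ + S) / 2 + 2))) :=
      (Continuous.tendsto (by fun_prop) 0).mono_left nhdsWithin_le_nhds
    have := ge_of_tendsto lim (by filter_upwards [self_mem_nhdsWithin] with θ hθ using main θ hθ)
    linarith
  have hL1 : MemLp z.1 1 (volume.restrict (Ioo a b)) := Lp.memLp z.1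
  have hsbv := memSBV2_of_ae_eq_sbvRep hab hγm hBI hcj hL1
  have hJ := jumpSet_of_ae_eq_sbvRep hγi hBI hcj
  have hpos : ∀ s ∈ jumpSet a b z.1, 0 < jump z.1 s := by
    intro s hs
    rw [hJ, Finset.mem_coe, Finset.mem_filter] at hs
    rw [jump_of_ae_eq_sbvRep hγi hcj (hBI s hs.1), if_pos hs.1]
    exact lt_of_le_of_ne (hjump s hs.1) (Ne.symm hs.2)
  unfold crackFunctional
  rw [if_pos ⟨hsbv, hpos, hv0⟩, setLIntegral_weakDeriv_of_ae_eq_sbvRep hab κ hγm hBI hcj hL1, hJ,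
    Set.ncard_coe_finset]
  have hcard : ((B.filter fun s => j s ≠ 0).card : ℝ) ≤ B.card := by
    exact_mod_cast Finset.card_filter_le _ _
  have e1 : ∫⁻ x in Ioo a b, ENNReal.ofReal (κ * γ x ^ 2) = ENNReal.ofReal (κ * ‖Γ‖ ^ 2) := by
    rw [← ofReal_integral_eq_lintegral_ofReal (hγm.integrable_sq.const_mul κ)
      (Eventually.of_forall fun x => by positivity), integral_const_mul, MemLp.integral_sq_eq hγm,
      Lp.toLp_coeFn Γ hγm]
  have e2 : (((B.filter fun s => j s ≠ 0).card : ℕ) : ℝ≥0∞)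
      = ENNReal.ofReal ((B.filter fun s => j s ≠ 0).card : ℝ) := by simp
  rw [e1, e2, ← ENNReal.ofReal_mul hG.le, ← ENNReal.ofReal_add (by positivity) (by positivity)]
  refine ENNReal.ofReal_le_ofReal ?_
  have h1 : κ * ‖Γ‖ ^ 2 ≤ κ * α := mul_le_mul_of_nonneg_left hΓα hκ.le
  have h2 : G * ((B.filter fun s => j s ≠ 0).card : ℝ) ≤ G * B.card :=
    mul_le_mul_of_nonneg_left hcard hG.le
  have h3 : G * B.card = G / (2 * K) * (2 * K * B.card) := by field_simp
  have h4 : G / (2 * K) * (2 * K * B.card) ≤ G / (2 * K) * β :=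
    mul_le_mul_of_nonneg_left hBcard hGK.le
  linarith

/-- Energies below any level above the liminf occur frequently, so some ultrafilter finer than
`atTop` concentrates on those indices. It replaces the extraction of a subsequence. -/
theorem crackFunctional_le_liminf {a b κ G ρ K : ℝ} (hab : a < b) (hκ : 0 < κ)
    (hG : 0 < G) (hρ : 0 < ρ) (hK0 : 0 < K) (hK : ∀ w ∈ admissibleProfiles, K ≤ profileEnergy ρ w)
    {ε η : ℕ → ℝ} (hε : ∀ n, 0 < ε n) (hε0 : Tendsto ε atTop (𝓝 0))
    (hη : ∀ n, 0 < η n) {y : ℕ → L1 a b × L1 a b} {z : L1 a b × L1 a b}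
    (hy : Tendsto y atTop (𝓝 z)) :
    crackFunctional a b κ G z
      ≤ liminf (fun n => atFunctional a b κ G ρ (2 * K) (η n) (ε n) (y n)) atTop := by
  refine le_of_forall_gt fun E hE => ?_
  obtain ⟨E', hE1, hE2⟩ := exists_between hE
  have hfr := frequently_lt_of_liminf_lt (by isBoundedDefault) hE1
  have hne : (atTop ⊓ 𝓟 {n | atFunctional a b κ G ρ (2 * K) (η n) (ε n) (y n) < E'} :
      Filter ℕ).NeBot := frequently_mem_iff_neBot.1 hfr
  set 𝒰 := Ultrafilter.of (atTop ⊓ 𝓟 {n | atFunctional a b κ G ρ (2 * K) (η n) (ε n) (y n) < E'})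
    with h𝒰
  have hle : (𝒰 : Filter ℕ) ≤ _ := Ultrafilter.of_le _
  have hle1 : (𝒰 : Filter ℕ) ≤ atTop := hle.trans inf_le_left
  have hle2 : ∀ᶠ n in 𝒰, atFunctional a b κ G ρ (2 * K) (η n) (ε n) (y n)
      < ENNReal.ofReal E'.toReal := by
    rw [ENNReal.ofReal_toReal hE2.ne_top]
    exact (hle.trans inf_le_right) (mem_principal_self _)
  have := crackFunctional_le_of_ultrafilter hab hκ hG hρ hK0 hK 𝒰 hε (hε0.mono_left hle1) hη
    (hy.mono_left hle1) hle2
  rw [ENNReal.ofReal_toReal hE2.ne_top] at this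
  exact this.trans_lt hE2

end ATFracture

end

noncomputable section
namespace ATFracture

/-! ### Splines on a bi-infinite knot sequence, by de Boor's algorithm -/

/-- One step of de Boor's algorithm at the point `x`. -/
def deBoorStep (t : ℤ → ℝ) (x : ℝ) (q : ℕ) (c : ℤ → ℝ) (i : ℤ) : ℝ :=
  ((x - t i) * c i + (t (i + q + 1) - x) * c (i - 1)) / (t (i + q + 1) - t i)

/-- The value at `x` of the polynomial piece on the cell `[t j, t (j + 1)]` of the spline of degree
`q` with control coefficients `c`. -/
def deBoor (t : ℤ → ℝ) (x : ℝ) : ℕ → ℤ → (ℤ → ℝ) → ℝ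
  | 0, j, c => c j
  | q + 1, j, c => deBoor t x q j (deBoorStep t x q c)

/-- The control coefficients of the derivative of a spline of degree `q`. -/
def splineDiff (t : ℤ → ℝ) (q : ℕ) (c : ℤ → ℝ) (i : ℤ) : ℝ :=
  q * (c i - c (i - 1)) / (t (i + q) - t i)

variable {t : ℤ → ℝ}

theorem deBoorStep_add (x : ℝ) (q : ℕ) (c d : ℤ → ℝ) :
    deBoorStep t x q (fun i => c i + d i) =
      fun i => deBoorStep t x q c i + deBoorStep t x q d i := by
  funext i; simp only [deBoorStep]; ring

theorem deBoorStep_const_mul (x : ℝ) (q : ℕ) (α : ℝ) (c : ℤ → ℝ) :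
    deBoorStep t x q (fun i => α * c i) = fun i => α * deBoorStep t x q c i := by
  funext i; simp only [deBoorStep]; ring

theorem deBoor_add (x : ℝ) (q : ℕ) (j : ℤ) (c d : ℤ → ℝ) :
    deBoor t x q j (fun i => c i + d i) = deBoor t x q j c + deBoor t x q j d := by
  induction q generalizing c d with
  | zero => rfl
  | succ q ih => simp only [deBoor]; rw [deBoorStep_add, ih]

theorem deBoor_const_mul (x : ℝ) (q : ℕ) (j : ℤ) (α : ℝ) (c : ℤ → ℝ) :
    deBoor t x q j (fun i => α * c i) = α * deBoor t x q j c := by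
  induction q generalizing c with
  | zero => rfl
  | succ q ih => simp only [deBoor]; rw [deBoorStep_const_mul, ih]

/-- A point of the cell `j` sees only the coefficients `c i`, `j - q ≤ i ≤ j`, and takes a convex
combination of them. -/
theorem deBoor_mem_Icc (ht : StrictMono t) {x : ℝ} {j : ℤ} (hx : t j ≤ x) (hx' : x ≤ t (j + 1))
    {m M : ℝ} (q : ℕ) {c : ℤ → ℝ} (hc : ∀ i, j - q ≤ i → i ≤ j → c i ∈ Icc m M) :
    deBoor t x q j c ∈ Icc m M := by
  induction q generalizing c with
  | zero => exact hc j (by simp) le_rfl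
  | succ q ih =>
    refine ih fun i hi hij => ?_
    have h1 := hc i (by push_cast; omega) hij
    have h2 := hc (i - 1) (by push_cast; omega) (by omega)
    have a1 : t i ≤ x := (ht.monotone hij).trans hx
    have a2 : x ≤ t (i + q + 1) := hx'.trans (ht.monotone (by omega))
    have a3 : 0 < t (i + q + 1) - t i := sub_pos.2 (ht (by omega))
    constructor
    · rw [deBoorStep, le_div_iff₀ a3]
      nlinarith [mul_le_mul_of_nonneg_left h1.1 (sub_nonneg.2 a1),
        mul_le_mul_of_nonneg_left h2.1 (sub_nonneg.2 a2)]
    · rw [deBoorStep, div_le_iff₀ a3]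
      nlinarith [mul_le_mul_of_nonneg_left h1.2 (sub_nonneg.2 a1),
        mul_le_mul_of_nonneg_left h2.2 (sub_nonneg.2 a2)]

/-- Adjacent pieces of a spline of positive degree agree at the knot between them. -/
theorem deBoor_knot (ht : StrictMono t) (q : ℕ) (j : ℤ) (c : ℤ → ℝ) :
    deBoor t (t j) (q + 1) (j - 1) c = deBoor t (t j) (q + 1) j c := by
  induction q generalizing c with
  -- In degree one both pieces take the value `c (j - 1)` at the knot. In higher degree the
  -- reduction steps do not depend on the cell, so the induction is immediate.
  | zero =>
    have a3 : t (j + 1) - t j ≠ 0 := (sub_pos.2 (ht (by omega))).ne'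
    have a4 : t j - t (j - 1) ≠ 0 := (sub_pos.2 (ht (by omega))).ne'
    simp [deBoor, deBoorStep, a3, a4]
  | succ q ih => exact ih _

/-- Coefficients depending polynomially on `x` are needed for the induction: one step of the
algorithm raises their degree by one. -/
theorem exists_polynomial_deBoor (q n : ℕ) (j : ℤ) (c : ℝ → ℤ → ℝ)
    (hc : ∀ i, ∃ P : Polynomial ℝ, P.natDegree ≤ n ∧ ∀ x, c x i = P.eval x) :
    ∃ P : Polynomial ℝ, P.natDegree ≤ n + q ∧ ∀ x, deBoor t x q j (c x) = P.eval x := by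
  induction q generalizing n c with
  | zero => exact hc j
  | succ q ih =>
    obtain ⟨P, hP, hP'⟩ := ih (n + 1) (fun x => deBoorStep t x q (c x)) fun i => by
      obtain ⟨A, hA, hA'⟩ := hc i
      obtain ⟨B, hB, hB'⟩ := hc (i - 1)
      refine ⟨Polynomial.C (t (i + q + 1) - t i)⁻¹ * ((Polynomial.X - Polynomial.C (t i)) * A
        + (Polynomial.C (t (i + q + 1)) - Polynomial.X) * B), ?_, fun x => ?_⟩
      · refine (Polynomial.natDegree_C_mul_le _ _).trans
          (Polynomial.natDegree_add_le_of_degree_le ?_ ?_)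
        · refine Polynomial.natDegree_mul_le.trans ?_
          have := Polynomial.natDegree_X_sub_C_le (t i)
          omega
        · refine Polynomial.natDegree_mul_le.trans ?_
          have := Polynomial.natDegree_X_sub_C_le (t (i + q + 1))
          rw [Polynomial.natDegree_sub] at this
          omega
      · simp [deBoorStep, hA', hB', div_eq_inv_mul]
    exact ⟨P, by omega, hP'⟩

/-- Differencing commutes with an algorithm step up to a scalar and a shift of degree. In the
derivative formula this weight `(q + 1)/(q + 2)` combines with the `1/(q + 2)` coming from the
explicit `x` in the step to give 1. -/
theorem splineDiff_deBoorStep (ht : StrictMono t) (x : ℝ) (q : ℕ) (c : ℤ → ℝ) :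
    splineDiff t (q + 1) (deBoorStep t x (q + 1) c) =
      fun i => ((q + 1 : ℝ) / (q + 2)) * deBoorStep t x q (splineDiff t (q + 2) c) i := by
  funext i
  have e1 : i - 1 + ((q + 1 : ℕ) : ℤ) + 1 = i + q + 1 := by push_cast; ring
  have e2 : i + (q : ℤ) + 1 + 1 = i + q + 2 := by ring
  have e3 : i + ((q + 2 : ℕ) : ℤ) = i + q + 2 := by push_cast; ring
  have e4 : i - 1 + ((q + 2 : ℕ) : ℤ) = i + q + 1 := by push_cast; ring
  have e5 : i + ((q + 1 : ℕ) : ℤ) = i + q + 1 := by push_cast; ring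
  have h1 : t (i + q + 2) - t i ≠ 0 := (sub_pos.2 (ht (by omega))).ne'
  have h2 : t (i + q + 1) - t i ≠ 0 := (sub_pos.2 (ht (by omega))).ne'
  have h3 : t (i + q + 1) - t (i - 1) ≠ 0 := (sub_pos.2 (ht (by omega))).ne'
  have h4 : (q : ℝ) + 2 ≠ 0 := by positivity
  simp only [splineDiff, deBoorStep, e1, e3, e4, e5, e2]
  push_cast
  field_simp
  ring

/-- The coefficients must be allowed to move with the point, since after one step of the algorithm
they do; only then does the induction on the degree close. -/
theorem hasDerivAt_deBoor (ht : StrictMono t) {x : ℝ} (q : ℕ) (j : ℤ) {c : ℝ → ℤ → ℝ} {c' : ℤ → ℝ}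
    (hc : ∀ i, HasDerivAt (fun y => c y i) (c' i) x) :
    HasDerivAt (fun y => deBoor t y (q + 1) j (c y))
      (deBoor t x (q + 1) j c' + deBoor t x q j (splineDiff t (q + 1) (c x))) x := by
  have key : ∀ (q : ℕ) (c : ℝ → ℤ → ℝ) (c' : ℤ → ℝ), (∀ i, HasDerivAt (fun y => c y i) (c' i) x) →
      ∀ i, HasDerivAt (fun y => deBoorStep t y q (c y) i)
        (deBoorStep t x q c' i + 1 / (q + 1 : ℝ) * splineDiff t (q + 1) (c x) i) x := by
    intro q c c' hc i
    have h := ((((hasDerivAt_id x).sub_const (t i)).mul (hc i)).add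
      (((hasDerivAt_id x).const_sub (t (i + q + 1))).mul (hc (i - 1)))).div_const
        (t (i + q + 1) - t i)
    refine h.congr_deriv ?_
    have h2 : (q : ℝ) + 1 ≠ 0 := by positivity
    have e : i + ((q + 1 : ℕ) : ℤ) = i + q + 1 := by push_cast; ring
    have h1 : t (i + q + 1) - t i ≠ 0 := (sub_pos.2 (ht (by omega))).ne'
    simp only [splineDiff, deBoorStep, e, id]
    push_cast
    field_simp
    ring
  induction q generalizing c c' with
  | zero =>
    have h := key 0 c c' hc j
    simp only [Nat.cast_zero, zero_add, div_one, one_mul] at h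
    exact h
  | succ q ih =>
    have h := ih (key (q + 1) c c' hc)
    refine h.congr_deriv ?_
    rw [deBoor_add, deBoor_const_mul, splineDiff_deBoorStep ht, deBoor_const_mul]
    simp only [deBoor]
    push_cast
    have h2 : (q : ℝ) + 2 ≠ 0 := by positivity
    have h3 : (q : ℝ) + 1 + 1 ≠ 0 := by positivity
    field_simp
    ring

/-! ### The global spline -/

/-- The index of the cell that contains `x`. -/
def knotCell (t : ℤ → ℝ) (x : ℝ) : ℤ :=
  sSup {j | t j ≤ x}

/-- The spline of degree `q` with control coefficients `c`. -/
def bSpline (t : ℤ → ℝ) (q : ℕ) (c : ℤ → ℝ) (x : ℝ) : ℝ :=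
  deBoor t x q (knotCell t x) c

/-- A knot sequence which exhausts the line. -/
structure IsKnots (t : ℤ → ℝ) : Prop where
  strictMono : StrictMono t
  exists_le : ∀ x, ∃ j, t j ≤ x
  exists_gt : ∀ x, ∃ j, x < t j

namespace IsKnots

theorem bddAbove (ht : IsKnots t) (x : ℝ) : BddAbove {j | t j ≤ x} := by
  obtain ⟨k, hk⟩ := ht.exists_gt x
  exact ⟨k, fun j hj => (ht.strictMono.lt_iff_lt.1 (lt_of_le_of_lt hj hk)).le⟩

theorem knotCell_le (ht : IsKnots t) (x : ℝ) : t (knotCell t x) ≤ x :=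
  Int.csSup_mem (ht.exists_le x) (ht.bddAbove x)

theorem lt_knotCell (ht : IsKnots t) (x : ℝ) : x < t (knotCell t x + 1) := by
  by_contra! h
  have := le_csSup (ht.bddAbove x) h
  change _ ≤ knotCell t x at this
  omega

theorem knotCell_eq (ht : IsKnots t) {x : ℝ} {j : ℤ} (h1 : t j ≤ x) (h2 : x < t (j + 1)) : knotCell t x = j := by
  have a := ht.strictMono.lt_iff_lt.1 (lt_of_le_of_lt h1 (ht.lt_knotCell x))
  have b := ht.strictMono.lt_iff_lt.1 (lt_of_le_of_lt (ht.knotCell_le x) h2)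
  omega

theorem knotCell_mono (ht : IsKnots t) : Monotone (knotCell t) := fun x y hxy => by
  have := ht.strictMono.lt_iff_lt.1 (lt_of_le_of_lt ((ht.knotCell_le x).trans hxy)
    (ht.lt_knotCell y))
  omega

theorem bSpline_eq (ht : IsKnots t) {q : ℕ} {c : ℤ → ℝ} {x : ℝ} {j : ℤ} (h1 : t j ≤ x) (h2 : x ≤ t (j + 1)) :
    bSpline t (q + 1) c x = deBoor t x (q + 1) j c := by
  rcases h2.lt_or_eq with h2 | h2
  · rw [bSpline, ht.knotCell_eq h1 h2]
  · have : knotCell t x = j + 1 := ht.knotCell_eq h2.ge (by rw [h2]; exact ht.strictMono (by omega))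
    have h := deBoor_knot ht.strictMono q (j + 1) c
    rw [bSpline, this, h2, ← h, add_sub_cancel_right]

theorem bSpline_mem_Icc (ht : IsKnots t) {q : ℕ} {c : ℤ → ℝ} {x : ℝ} {m M : ℝ}
    (hc : ∀ i, knotCell t x - q ≤ i → i ≤ knotCell t x → c i ∈ Icc m M) :
    bSpline t q c x ∈ Icc m M :=
  deBoor_mem_Icc ht.strictMono (ht.knotCell_le x) (ht.lt_knotCell x).le q hc

theorem hasDerivAt_deBoor_const (ht : IsKnots t) (q : ℕ) (j : ℤ) (c : ℤ → ℝ) (x : ℝ) :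
    HasDerivAt (fun y => deBoor t y (q + 1) j c) (deBoor t x q j (splineDiff t (q + 1) c)) x := by
  have h := hasDerivAt_deBoor ht.strictMono (x := x) q j (c := fun _ => c) (c' := fun _ => 0)
    fun i => hasDerivAt_const _ _
  have h0 : deBoor t x (q + 1) j (fun _ => (0 : ℝ)) = 0 := by
    simpa using deBoor_const_mul (t := t) x (q + 1) j 0 (fun _ => 0)
  rwa [h0, zero_add] at h

theorem eventually_knotCell (ht : IsKnots t) {x : ℝ} (h : t (knotCell t x) < x) :
    ∀ᶠ y in 𝓝 x, t (knotCell t x) ≤ y ∧ y ≤ t (knotCell t x + 1) := by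
  filter_upwards [Ioo_mem_nhds h (ht.lt_knotCell x)] with y hy using ⟨hy.1.le, hy.2.le⟩

/-- Off the knots a spline is differentiable. -/
theorem hasDerivAt_bSpline_of_lt (ht : IsKnots t) {q : ℕ} {c : ℤ → ℝ} {x : ℝ} (h : t (knotCell t x) < x) :
    HasDerivAt (bSpline t (q + 1) c) (bSpline t q (splineDiff t (q + 1) c) x) x :=
  (ht.hasDerivAt_deBoor_const q (knotCell t x) c x).congr_of_eventuallyEq <| by
    filter_upwards [ht.eventually_knotCell h] with y hy using ht.bSpline_eq hy.1 hy.2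

theorem bSpline_eventuallyEq_right (ht : IsKnots t) {q : ℕ} {c : ℤ → ℝ} (j : ℤ) :
    ∀ᶠ y in 𝓝[≥] t j, bSpline t (q + 1) c y = deBoor t y (q + 1) j c := by
  filter_upwards [self_mem_nhdsWithin,
    mem_nhdsWithin_of_mem_nhds (Iio_mem_nhds (ht.strictMono (show j < j + 1 by omega)))]
    with y hy hy' using ht.bSpline_eq hy (le_of_lt hy')

theorem bSpline_eventuallyEq_left (ht : IsKnots t) {q : ℕ} {c : ℤ → ℝ} (j : ℤ) :
    ∀ᶠ y in 𝓝[≤] t j, bSpline t (q + 1) c y = deBoor t y (q + 1) (j - 1) c := by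
  filter_upwards [self_mem_nhdsWithin,
    mem_nhdsWithin_of_mem_nhds (Ioi_mem_nhds (ht.strictMono (show j - 1 < j by omega)))]
    with y hy hy'
  refine ht.bSpline_eq (le_of_lt hy') ?_
  rw [sub_add_cancel]; exact hy

/-- At a knot the derivatives of the two pieces are the two pieces of a spline of positive degree,
which agree there by `deBoor_knot`. -/
theorem hasDerivAt_bSpline (ht : IsKnots t) (q : ℕ) (c : ℤ → ℝ) (x : ℝ) :
    HasDerivAt (bSpline t (q + 2) c) (bSpline t (q + 1) (splineDiff t (q + 2) c) x) x := by
  rcases (ht.knotCell_le x).lt_or_eq with h | h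
  · exact ht.hasDerivAt_bSpline_of_lt h
  · set j := knotCell t x
    have e : bSpline t (q + 1) (splineDiff t (q + 2) c) x =
      deBoor t x (q + 1) j (splineDiff t (q + 2) c) := rfl
    have e' : bSpline t (q + 1) (splineDiff t (q + 2) c) x =
        deBoor t x (q + 1) (j - 1) (splineDiff t (q + 2) c) := by
      rw [e, ← h, deBoor_knot ht.strictMono]
    have hr : HasDerivWithinAt (bSpline t (q + 2) c)
        (bSpline t (q + 1) (splineDiff t (q + 2) c) x) (Ici x) x := by
      rw [e]
      refine (ht.hasDerivAt_deBoor_const (q + 1) j c x).hasDerivWithinAt.congr_of_eventuallyEq_of_mem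
        ?_ self_mem_Ici
      have := ht.bSpline_eventuallyEq_right (q := q + 1) (c := c) j
      rwa [h] at this
    have hl : HasDerivWithinAt (bSpline t (q + 2) c)
        (bSpline t (q + 1) (splineDiff t (q + 2) c) x) (Iic x) x := by
      rw [e']
      refine (ht.hasDerivAt_deBoor_const (q + 1) (j - 1) c x).hasDerivWithinAt.congr_of_eventuallyEq_of_mem
        ?_ self_mem_Iic
      have := ht.bSpline_eventuallyEq_left (q := q + 1) (c := c) j
      rwa [h] at this
    have := hl.union hr
    rwa [Iic_union_Ici, hasDerivWithinAt_univ] at this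

theorem continuous_bSpline (ht : IsKnots t) (q : ℕ) (c : ℤ → ℝ) : Continuous (bSpline t (q + 1) c) := by
  refine continuous_iff_continuousAt.2 fun x => ?_
  rcases (ht.knotCell_le x).lt_or_eq with h | h
  · exact (ht.hasDerivAt_bSpline_of_lt h).continuousAt
  · set j := knotCell t x
    have e : bSpline t (q + 1) c x = deBoor t x (q + 1) j c := rfl
    have e' : bSpline t (q + 1) c x = deBoor t x (q + 1) (j - 1) c := by
      rw [e, ← h, deBoor_knot ht.strictMono]
    refine continuousAt_iff_continuous_left_right.2 ⟨?_, ?_⟩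
    · refine (ht.hasDerivAt_deBoor_const q (j - 1) c x).continuousAt.continuousWithinAt.congr_of_eventuallyEq
        ?_ e'
      have := ht.bSpline_eventuallyEq_left (q := q) (c := c) j
      rwa [h] at this
    · refine (ht.hasDerivAt_deBoor_const q j c x).continuousAt.continuousWithinAt.congr_of_eventuallyEq
        ?_ e
      have := ht.bSpline_eventuallyEq_right (q := q) (c := c) j
      rwa [h] at this

theorem contDiff_bSpline (ht : IsKnots t) (q : ℕ) (c : ℤ → ℝ) : ContDiff ℝ q (bSpline t (q + 1) c) := by
  induction q generalizing c with
  | zero => exact contDiff_zero.2 (ht.continuous_bSpline 0 c)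
  | succ q ih =>
    have hd := ht.hasDerivAt_bSpline q c
    have : ((q + 1 : ℕ) : WithTop ℕ∞) = (q : WithTop ℕ∞) + 1 := by push_cast; rfl
    rw [this, contDiff_succ_iff_deriv]
    refine ⟨fun x => (hd x).differentiableAt, by simp, ?_⟩
    rw [funext fun x => (hd x).deriv]
    exact ih _

/-- Degree zero cannot be avoided: the second derivative of a quadratic spline is piecewise constant
and only bounded. -/
theorem memLp_bSpline (ht : IsKnots t) (q : ℕ) (c : ℤ → ℝ) (a b : ℝ) (p : ℝ≥0∞) :
    MemLp (bSpline t q c) p (volume.restrict (Icc a b)) := by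
  cases q with
  | succ q => exact memLp_Icc_of_continuousOn (ht.continuous_bSpline q c).continuousOn
  | zero =>
    have hm : Measurable (bSpline t 0 c) :=
      (measurable_of_countable c).comp ht.knotCell_mono.measurable
    obtain ⟨C, hC⟩ : ∃ C, ∀ i ∈ Finset.Icc (knotCell t a) (knotCell t b), |c i| ≤ C := by
      obtain ⟨C, hC⟩ := ((Finset.Icc (knotCell t a) (knotCell t b)).image fun i => |c i|).bddAbove
      exact ⟨C, fun i hi => hC (by simpa using ⟨i, by simpa using hi, rfl⟩)⟩
    refine MemLp.of_bound hm.aestronglyMeasurable C ?_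
    filter_upwards [ae_restrict_mem measurableSet_Icc] with x hx
    exact hC _ (Finset.mem_Icc.2 ⟨ht.knotCell_mono hx.1, ht.knotCell_mono hx.2⟩)

theorem integrableOn_bSpline (ht : IsKnots t) (q : ℕ) (c : ℤ → ℝ) (a b : ℝ) :
    IntegrableOn (bSpline t q c) (Icc a b) :=
  memLp_one_iff_integrable.1 (ht.memLp_bSpline q c a b 1)

/-- The derivative of a spline, in the weak sense, down to degree one. -/
theorem isWeakDeriv_bSpline (ht : IsKnots t) {a b : ℝ} (hab : a < b) (q : ℕ) (c : ℤ → ℝ) :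
    IsWeakDeriv (Ioo a b) (bSpline t (q + 1) c) (bSpline t q (splineDiff t (q + 1) c)) := by
  have hi := ht.integrableOn_bSpline q (splineDiff t (q + 1) c) a b
  have h := isWeakDeriv_primitive_Ioo hab (hi.mono_set Ioo_subset_Icc_self)
    (bSpline t (q + 1) c a)
  refine h.congr ?_ (ae_eq_refl _)
  filter_upwards [ae_restrict_mem measurableSet_Ioo] with x hx
  have : ∫ y in a..x, bSpline t q (splineDiff t (q + 1) c) y =
      bSpline t (q + 1) c x - bSpline t (q + 1) c a := by
    refine integral_eq_of_hasDerivAt_off_countable _ _ (countable_range t)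
      (ht.continuous_bSpline q c).continuousOn (fun y hy => ?_) ?_
    · exact ht.hasDerivAt_bSpline_of_lt ((ht.knotCell_le y).lt_of_ne fun h => hy.2 ⟨_, h⟩)
    · rw [intervalIntegrable_iff_integrableOn_Icc_of_le hx.1.le]
      exact hi.mono_set (Icc_subset_Icc_right hx.2.le)
  rw [this]; ring

end IsKnots

end ATFracture
end

noncomputable section
namespace ATFracture

/-! ### The Schoenberg operator on nearly uniform knots -/

/-- The knots `t i` lie within `h` to the left of the uniform knots `x₀ + i δ`. -/
structure IsNearUniform (t : ℤ → ℝ) (x₀ δ h : ℝ) : Prop where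
  pos : 0 < δ
  nonneg : 0 ≤ h
  le : 2 * h ≤ δ
  mem (i : ℤ) : t i ∈ Icc (x₀ + i * δ - h) (x₀ + i * δ)

theorem IsNearUniform.isKnots {t : ℤ → ℝ} {x₀ δ h : ℝ} (ht : IsNearUniform t x₀ δ h) :
    IsKnots t where
  strictMono := by
    refine strictMono_int_of_lt_succ fun i => ?_
    have h1 := (ht.mem i).2
    have h2 := (ht.mem (i + 1)).1
    push_cast at h2
    linarith [ht.pos, ht.le]
  exists_le x := by
    refine ⟨⌊(x - x₀) / δ⌋, (ht.mem _).2.trans ?_⟩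
    have := (le_div_iff₀ ht.pos).1 (Int.floor_le ((x - x₀) / δ))
    linarith
  exists_gt x := by
    refine ⟨⌊(x - x₀) / δ⌋ + 2, lt_of_lt_of_le ?_ (ht.mem _).1⟩
    have := (div_lt_iff₀ ht.pos).1 (Int.lt_floor_add_one ((x - x₀) / δ))
    push_cast
    linarith [ht.pos, ht.le]

/-- The Greville abscissae. -/
def greville (t : ℤ → ℝ) (p : ℕ) (i : ℤ) : ℝ :=
  (∑ m ∈ Finset.range p, t (i + m + 1)) / p

/-- By telescoping, the denominators in `splineDiff` become distances between Greville abscissae, so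
the derivative of a Schoenberg spline has genuine difference quotients as coefficients. -/
theorem greville_sub (t : ℤ → ℝ) (p : ℕ) (i : ℤ) :
    greville t p i - greville t p (i - 1) = (t (i + p) - t i) / p := by
  have h := Finset.sum_range_sub (fun m : ℕ => t (i + m)) p
  rw [greville, greville, ← sub_div, ← Finset.sum_sub_distrib]
  congr 1
  simp only [Nat.cast_zero, add_zero] at h
  rw [← h]
  refine Finset.sum_congr rfl fun m _ => ?_
  congr 2 <;> push_cast <;> ring

theorem greville_mem {t : ℤ → ℝ} (ht : StrictMono t) (p : ℕ) (i : ℤ) :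
    greville t (p + 1) i ∈ Icc (t (i + 1)) (t (i + (p + 1))) := by
  have hp : (0 : ℝ) < ((p + 1 : ℕ) : ℝ) := by positivity
  have e1 := Finset.card_nsmul_le_sum (Finset.range (p + 1)) (fun m : ℕ => t (i + m + 1)) (t (i + 1))
    fun m _ => ht.monotone (by omega)
  have e2 := Finset.sum_le_card_nsmul (Finset.range (p + 1)) (fun m : ℕ => t (i + m + 1))
    (t (i + (p + 1))) fun m hm => ht.monotone (by have := Finset.mem_range.1 hm; omega)
  rw [Finset.card_range, nsmul_eq_mul] at e1 e2
  exact ⟨by rw [greville, le_div_iff₀ hp, mul_comm]; exact e1,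
    by rw [greville, div_le_iff₀ hp, mul_comm]; exact e2⟩

theorem greville_strictMono {t : ℤ → ℝ} (ht : StrictMono t) (p : ℕ) :
    StrictMono (greville t (p + 1)) := by
  refine strictMono_int_of_lt_succ fun i => ?_
  have h := greville_sub t (p + 1) (i + 1)
  rw [add_sub_cancel_right] at h
  have : 0 < (t (i + 1 + ((p + 1 : ℕ) : ℤ)) - t (i + 1)) / ((p + 1 : ℕ) : ℝ) :=
    div_pos (sub_pos.2 (ht (by omega))) (by positivity)
  linarith

/-- The Schoenberg operator. -/
def schoenberg (t : ℤ → ℝ) (p : ℕ) (f : ℝ → ℝ) : ℝ → ℝ :=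
  bSpline t p fun i => f (greville t p i)

/-- The first derivative of the Schoenberg spline. -/
def schoenberg₁ (t : ℤ → ℝ) (p : ℕ) (f : ℝ → ℝ) : ℝ → ℝ :=
  bSpline t (p - 1) (splineDiff t p fun i => f (greville t p i))

/-- The second derivative of the Schoenberg spline. -/
def schoenberg₂ (t : ℤ → ℝ) (p : ℕ) (f : ℝ → ℝ) : ℝ → ℝ :=
  bSpline t (p - 2) (splineDiff t (p - 1) (splineDiff t p fun i => f (greville t p i)))

/-- If `f'' ≤ M`, then `M s² / 2 - f` is convex, and the bound says that its adjacent slopes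
increase. -/
theorem divided_difference_le {f f₁ f₂ : ℝ → ℝ} (h1 : ∀ x, HasDerivAt f (f₁ x) x)
    (h2 : ∀ x, HasDerivAt f₁ (f₂ x) x) {x y z M : ℝ} (hxy : x < y) (hyz : y < z)
    (hM : ∀ s ∈ Icc x z, f₂ s ≤ M) :
    (f z - f y) / (z - y) - (f y - f x) / (y - x) ≤ M * ((z - x) / 2) := by
  have hc : ConvexOn ℝ (Icc x z) fun s => M * s ^ 2 / 2 - f s := by
    refine convexOn_of_hasDerivWithinAt2_nonneg (convex_Icc x z) (f' := fun s => M * s - f₁ s)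
      (f'' := fun s => M - f₂ s) (fun s _ => ?_) (fun s _ => ?_) (fun s _ => ?_) (fun s hs => ?_)
    · exact (((continuousAt_id.pow 2).const_mul M).div_const 2 |>.sub
        (h1 s).continuousAt).continuousWithinAt
    · have := ((((hasDerivAt_id s).pow 2).const_mul M).div_const 2).sub (h1 s)
      refine (this.congr_deriv ?_).hasDerivWithinAt
      simp only [id]; push_cast; ring
    · have := ((hasDerivAt_id s).const_mul M).sub (h2 s)
      exact (this.congr_deriv (by simp)).hasDerivWithinAt
    · exact sub_nonneg.2 (hM s (interior_subset hs))
  have h := hc.slope_mono_adjacent ⟨le_rfl, (hxy.trans hyz).le⟩ ⟨(hxy.trans hyz).le, le_rfl⟩ hxy hyz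
  have a1 : y - x ≠ 0 := (sub_pos.2 hxy).ne'
  have a2 : z - y ≠ 0 := (sub_pos.2 hyz).ne'
  have e1 : (M * y ^ 2 / 2 - f y - (M * x ^ 2 / 2 - f x)) / (y - x) =
      M * ((x + y) / 2) - (f y - f x) / (y - x) := by field_simp; ring
  have e2 : (M * z ^ 2 / 2 - f z - (M * y ^ 2 / 2 - f y)) / (z - y) =
      M * ((y + z) / 2) - (f z - f y) / (z - y) := by field_simp; ring
  rw [e1, e2] at h
  linarith

theorem le_divided_difference {f f₁ f₂ : ℝ → ℝ} (h1 : ∀ x, HasDerivAt f (f₁ x) x)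
    (h2 : ∀ x, HasDerivAt f₁ (f₂ x) x) {x y z m : ℝ} (hxy : x < y) (hyz : y < z)
    (hm : ∀ s ∈ Icc x z, m ≤ f₂ s) :
    m * ((z - x) / 2) ≤ (f z - f y) / (z - y) - (f y - f x) / (y - x) := by
  have h := divided_difference_le (f := -f) (f₁ := -f₁) (f₂ := -f₂) (fun x => (h1 x).neg)
    (fun x => (h2 x).neg) hxy hyz (M := -m) fun s hs => neg_le_neg (hm s hs)
  simp only [Pi.neg_apply, neg_sub_neg] at h
  have e1 : (f y - f z) / (z - y) = -((f z - f y) / (z - y)) := by ring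
  have e2 : (f x - f y) / (y - x) = -((f y - f x) / (y - x)) := by ring
  rw [e1, e2] at h
  linarith

namespace IsNearUniform

variable {t : ℤ → ℝ} {x₀ δ h : ℝ}

theorem greville_mem_nhds (ht : IsNearUniform t x₀ δ h) (p : ℕ) {x : ℝ} {i : ℤ}
    (hi : knotCell t x - (p + 1 : ℕ) ≤ i) (hi' : i ≤ knotCell t x) :
    greville t (p + 1) i ∈ Icc (x - (p + 2) * δ) (x + (p + 2) * δ) := by
  have hg := greville_mem ht.isKnots.strictMono p i
  have hx := ht.isKnots.knotCell_le x
  have hx' := ht.isKnots.lt_knotCell x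
  set j := knotCell t x
  have m1 : t (j - p) ≤ t (i + 1) := ht.isKnots.strictMono.monotone (by push_cast at hi; omega)
  have m2 : t (i + (p + 1)) ≤ t (j + (p + 1)) := ht.isKnots.strictMono.monotone (by omega)
  have a1 := (ht.mem (j - p)).1
  have a2 := (ht.mem (j + (p + 1))).2
  have a3 := (ht.mem j).1
  have a4 := (ht.mem (j + 1)).2
  push_cast at a1 a2 a3 a4
  have := ht.le
  have := ht.nonneg
  have := ht.pos
  constructor <;> nlinarith [hg.1, hg.2]

/-- The value is a convex combination of nearby samples. This positivity is the reason for using the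
Schoenberg operator: the constraint `0 ≤ v ≤ 1`, plateaus and zeros are preserved exactly. -/
theorem schoenberg_mem (ht : IsNearUniform t x₀ δ h) (p : ℕ) {f : ℝ → ℝ} {x m M : ℝ}
    (hf : ∀ y ∈ Icc (x - (p + 2) * δ) (x + (p + 2) * δ), f y ∈ Icc m M) :
    schoenberg t (p + 1) f x ∈ Icc m M :=
  ht.isKnots.bSpline_mem_Icc fun _ hi hi' => hf _ (ht.greville_mem_nhds p hi hi')

theorem splineDiff_eq (ht : IsNearUniform t x₀ δ h) (p : ℕ) (f : ℝ → ℝ) (i : ℤ) :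
    splineDiff t (p + 1) (fun i => f (greville t (p + 1) i)) i =
      (f (greville t (p + 1) i) - f (greville t (p + 1) (i - 1))) /
        (greville t (p + 1) i - greville t (p + 1) (i - 1)) := by
  have h1 : t (i + ((p + 1 : ℕ) : ℤ)) - t i ≠ 0 :=
    (sub_pos.2 (ht.isKnots.strictMono (by omega))).ne'
  have h2 : ((p + 1 : ℕ) : ℝ) ≠ 0 := by positivity
  rw [greville_sub, splineDiff]
  field_simp

theorem schoenberg₁_mem (ht : IsNearUniform t x₀ δ h) (p : ℕ) {f f₁ : ℝ → ℝ}
    (hf : ∀ x, HasDerivAt f (f₁ x) x) {x m M : ℝ}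
    (hb : ∀ y ∈ Icc (x - (p + 2) * δ) (x + (p + 2) * δ), f₁ y ∈ Icc m M) :
    schoenberg₁ t (p + 1) f x ∈ Icc m M := by
  refine ht.isKnots.bSpline_mem_Icc fun i hi hi' => ?_
  have g1 := ht.greville_mem_nhds p (by push_cast at hi ⊢; omega) hi'
  have g2 := ht.greville_mem_nhds p (x := x) (i := i - 1) (by push_cast at hi ⊢; omega) (by omega)
  have hlt := greville_strictMono ht.isKnots.strictMono p (show i - 1 < i by omega)
  obtain ⟨ξ, hξ, hξ'⟩ := exists_hasDerivAt_eq_slope f f₁ hlt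
    (continuous_iff_continuousAt.2 fun x => (hf x).continuousAt).continuousOn (fun x _ => hf x)
  rw [ht.splineDiff_eq, ← hξ']
  exact hb ξ ⟨g2.1.trans hξ.1.le, hξ.2.le.trans g1.2⟩

/-- With `n = p + 1`, a coefficient is `n X / S`, where `X` is a difference of adjacent slopes and
`S` a span of `n` knot intervals. `X` lies between `(A - τ) L` and `(A + τ) L`, with `L` half the
distance between the outer Greville abscissae. For uniform knots `n L = S`; here `n L / S` differs
from 1 by at most `4 h / δ ≤ 2`, which produces both `3 τ` and the term in `|A|`. Without near
uniformity this ratio need not approach 1. -/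
theorem schoenberg₂_mem (ht : IsNearUniform t x₀ δ h) (p : ℕ) {f f₁ f₂ : ℝ → ℝ}
    (hf : ∀ x, HasDerivAt f (f₁ x) x) (hf₁ : ∀ x, HasDerivAt f₁ (f₂ x) x) {x A τ : ℝ}
    (hb : ∀ y ∈ Icc (x - (p + 3) * δ) (x + (p + 3) * δ), |f₂ y - A| ≤ τ) :
    |schoenberg₂ t (p + 2) f x - A| ≤ 3 * τ + 4 * (h / δ) * |A| := by
  have hsm := ht.isKnots.strictMono
  have hδ := ht.pos
  suffices H : schoenberg₂ t (p + 2) f x ∈ Icc (A - (3 * τ + 4 * (h / δ) * |A|))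
      (A + (3 * τ + 4 * (h / δ) * |A|)) by
    rw [abs_le]; constructor <;> linarith [H.1, H.2]
  refine ht.isKnots.bSpline_mem_Icc fun i hi hi' => ?_
  have g1 := ht.greville_mem_nhds (p + 1) (x := x) (i := i) (by push_cast at hi ⊢; omega) hi'
  have g2 := ht.greville_mem_nhds (p + 1) (x := x) (i := i - 1 - 1)
    (by push_cast at hi ⊢; omega) (by omega)
  have hlt := greville_strictMono hsm (p + 1) (show i - 1 < i by omega)
  have hlt' := greville_strictMono hsm (p + 1) (show i - 1 - 1 < i - 1 by omega)
  have hb' : ∀ s ∈ Icc (greville t (p + 2) (i - 1 - 1)) (greville t (p + 2) i), |f₂ s - A| ≤ τ := by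
    intro s hs
    refine hb s ⟨?_, ?_⟩
    · have := g2.1.trans hs.1; push_cast at this; linarith
    · have := hs.2.trans g1.2; push_cast at this; linarith
  have u1 := divided_difference_le hf hf₁ hlt' hlt (M := A + τ)
    fun s hs => by have := (abs_le.1 (hb' s hs)).2; linarith
  have u2 := le_divided_difference hf hf₁ hlt' hlt (m := A - τ)
    fun s hs => by have := (abs_le.1 (hb' s hs)).1; linarith
  have hτ : 0 ≤ τ := (abs_nonneg _).trans (hb' _ ⟨le_rfl, (hlt'.trans hlt).le⟩)
  have e1 := greville_sub t (p + 2) i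
  have e2 := greville_sub t (p + 2) (i - 1)
  have hp2 : (0 : ℝ) < ((p + 2 : ℕ) : ℝ) := by positivity
  change splineDiff t (p + 1) (splineDiff t (p + 2) fun i => f (greville t (p + 2) i)) i ∈ _
  have e3 : splineDiff t (p + 1) (splineDiff t (p + 2) fun i => f (greville t (p + 2) i)) i =
      ((p + 1 : ℕ) : ℝ) * ((f (greville t (p + 2) i) - f (greville t (p + 2) (i - 1))) /
        (greville t (p + 2) i - greville t (p + 2) (i - 1)) -
        (f (greville t (p + 2) (i - 1)) - f (greville t (p + 2) (i - 1 - 1))) /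
        (greville t (p + 2) (i - 1) - greville t (p + 2) (i - 1 - 1))) /
        (t (i + (p + 1 : ℕ)) - t i) := by
    rw [splineDiff, ht.splineDiff_eq (p + 1) f, ht.splineDiff_eq (p + 1) f]
  rw [e3]
  set X := (f (greville t (p + 2) i) - f (greville t (p + 2) (i - 1))) /
        (greville t (p + 2) i - greville t (p + 2) (i - 1)) -
        (f (greville t (p + 2) (i - 1)) - f (greville t (p + 2) (i - 1 - 1))) /
        (greville t (p + 2) (i - 1) - greville t (p + 2) (i - 1 - 1))
  set L := (greville t (p + 2) i - greville t (p + 2) (i - 1 - 1)) / 2 with hL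
  set S := t (i + (p + 1 : ℕ)) - t i with hS
  set n : ℝ := ((p + 1 : ℕ) : ℝ) with hn
  have hn1 : 1 ≤ n := by rw [hn]; push_cast; linarith [(Nat.cast_nonneg p : (0 : ℝ) ≤ p)]
  have hn2 : ((p + 2 : ℕ) : ℝ) = n + 1 := by rw [hn]; push_cast; ring
  have m1 := ht.mem i
  have m2 := ht.mem (i + (p + 1 : ℕ))
  have m3 := ht.mem (i + (p + 2 : ℕ))
  have m4 := ht.mem (i - 1)
  have e5 : i - 1 + ((p + 2 : ℕ) : ℤ) = i + (p + 1 : ℕ) := by push_cast; ring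
  rw [e5] at e2
  have c1 : ((i + (p + 1 : ℕ) : ℤ) : ℝ) = i + n := by rw [hn]; push_cast; ring
  have c2 : ((i + (p + 2 : ℕ) : ℤ) : ℝ) = i + (n + 1) := by rw [hn]; push_cast; ring
  rw [c1] at m2
  rw [c2] at m3
  push_cast at m4
  rw [hn2] at e1 e2 hp2
  have hL' : L = (t (i + (p + 2 : ℕ)) - t i + (t (i + (p + 1 : ℕ)) - t (i - 1))) / (n + 1) / 2 := by
    rw [hL, add_div]; linarith
  have hLe : |L - δ| ≤ h / (n + 1) := by
    rw [hL', abs_le]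
    constructor
    · rw [← neg_div, div_le_iff₀ hp2]
      have : ((t (i + (p + 2 : ℕ)) - t i + (t (i + (p + 1 : ℕ)) - t (i - 1))) / (n + 1) / 2 - δ) *
        (n + 1) = (t (i + (p + 2 : ℕ)) - t i + (t (i + (p + 1 : ℕ)) - t (i - 1))) / 2
          - δ * (n + 1) := by field_simp
      rw [this]
      linarith [m1.1, m1.2, m2.1, m2.2, m3.1, m3.2, m4.1, m4.2]
    · rw [le_div_iff₀ hp2]
      have : ((t (i + (p + 2 : ℕ)) - t i + (t (i + (p + 1 : ℕ)) - t (i - 1))) / (n + 1) / 2 - δ) *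
        (n + 1) = (t (i + (p + 2 : ℕ)) - t i + (t (i + (p + 1 : ℕ)) - t (i - 1))) / 2
          - δ * (n + 1) := by field_simp
      rw [this]
      linarith [m1.1, m1.2, m2.1, m2.2, m3.1, m3.2, m4.1, m4.2]
  have hSe : |S - n * δ| ≤ h := by
    rw [abs_le, hS]; constructor <;> linarith [m1.1, m1.2, m2.1, m2.2]
  have hh := ht.nonneg
  have hle := ht.le
  have hSpos : δ / 2 ≤ S := by
    have := (abs_le.1 hSe).1
    nlinarith
  have hR : |n * L - S| ≤ 2 * h := by
    have : n * L - S = n * (L - δ) - (S - n * δ) := by ring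
    rw [this]
    refine (abs_sub _ _).trans ?_
    rw [abs_mul, abs_of_nonneg (by linarith : (0 : ℝ) ≤ n)]
    have : n * |L - δ| ≤ h := by
      refine (mul_le_mul_of_nonneg_left hLe (by linarith)).trans ?_
      rw [mul_div_assoc', div_le_iff₀ hp2]
      nlinarith
    linarith
  have hS0 : 0 < S := by linarith
  have hRS : |n * L / S - 1| ≤ 4 * (h / δ) := by
    rw [div_sub_one hS0.ne', abs_div, abs_of_pos hS0, div_le_iff₀ hS0]
    have : 2 * h ≤ 4 * (h / δ) * S := by
      have e : 4 * (h / δ) * (δ / 2) = 2 * h := by field_simp; ring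
      rw [← e]
      exact mul_le_mul_of_nonneg_left hSpos (by positivity)
    linarith
  have hq : 4 * (h / δ) ≤ 2 := by
    have : h / δ ≤ 1 / 2 := by rw [div_le_iff₀ hδ]; linarith
    linarith
  have hX1 : n * X / S ≤ (A + τ) * (n * L / S) := by
    rw [mul_div_assoc', div_le_div_iff_of_pos_right hS0]
    nlinarith
  have hX2 : (A - τ) * (n * L / S) ≤ n * X / S := by
    rw [mul_div_assoc', div_le_div_iff_of_pos_right hS0]
    nlinarith
  have hA : |A * (n * L / S - 1)| ≤ 4 * (h / δ) * |A| := by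
    rw [abs_mul, mul_comm]
    exact mul_le_mul_of_nonneg_right hRS (abs_nonneg _)
  have hR3 : n * L / S ≤ 3 := by have := (abs_le.1 hRS).2; linarith
  have hτ3 : τ * (n * L / S) ≤ τ * 3 := mul_le_mul_of_nonneg_left hR3 hτ
  obtain ⟨hA1, hA2⟩ := abs_le.1 hA
  constructor <;> linarith

end IsNearUniform

theorem IsNearUniform.isWeakDeriv_schoenberg {t : ℤ → ℝ} {x₀ δ h a b : ℝ}
    (ht : IsNearUniform t x₀ δ h) (hab : a < b) (p : ℕ) (f : ℝ → ℝ) :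
    IsWeakDeriv (Ioo a b) (schoenberg t (p + 1) f) (schoenberg₁ t (p + 1) f) :=
  ht.isKnots.isWeakDeriv_bSpline hab p _

theorem IsNearUniform.isWeakDeriv_schoenberg₁ {t : ℤ → ℝ} {x₀ δ h a b : ℝ}
    (ht : IsNearUniform t x₀ δ h) (hab : a < b) (p : ℕ) (f : ℝ → ℝ) :
    IsWeakDeriv (Ioo a b) (schoenberg₁ t (p + 2) f) (schoenberg₂ t (p + 2) f) :=
  ht.isKnots.isWeakDeriv_bSpline hab p _

/-! ### Nearly uniform coarsenings of a mesh -/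

section Mesh

variable {a b : ℝ} (T : Mesh a b)

theorem Mesh.le_size (i : Fin T.N) : T.node i.succ - T.node i.castSucc ≤ T.size :=
  le_ciSup (f := fun i : Fin T.N => T.node i.succ - T.node i.castSucc)
    (Set.finite_range _).bddAbove i

theorem Mesh.size_nonneg : 0 ≤ T.size :=
  Real.iSup_nonneg fun _ => sub_nonneg.2 (T.strictMono (Fin.castSucc_lt_succ)).le

theorem Mesh.exists_node_le {y : ℝ} (hy : y ∈ Ioo a b) :
    ∃ i, T.node i ∈ Icc (y - T.size) y := by
  classical
  set s := Finset.univ.filter fun i => T.node i ≤ y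
  have hs : s.Nonempty := ⟨0, by simp [s, T.node_zero, hy.1.le]⟩
  obtain ⟨i, hi, hmax⟩ := s.exists_max_image id hs
  have hiy : T.node i ≤ y := by simpa [s] using hi
  have hne : i ≠ Fin.last T.N := by
    rintro rfl
    rw [T.node_last] at hiy
    exact absurd hy.2 (not_lt.2 hiy)
  obtain ⟨j, rfl⟩ := Fin.exists_castSucc_eq.2 hne
  refine ⟨_, ?_, hiy⟩
  have : y < T.node j.succ := by
    by_contra! hc
    have := hmax j.succ (by simpa [s] using hc)
    exact absurd this (not_le.2 (Fin.castSucc_lt_succ))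
  linarith [T.le_size j]

/-- A fine mesh contains nearly uniform knots, on which all splines are splines on the mesh. -/
theorem Mesh.exists_isNearUniform {δ : ℝ} (hδ : 0 < δ) (h : 2 * T.size ≤ δ) :
    ∃ t : ℤ → ℝ, IsNearUniform t a δ T.size ∧
      ∀ p k : ℕ, k < p → ∀ c, bSpline t p c ∈ splineSpace T p k := by
  -- Inside `(a, b)` the target `a + i δ` is moved left to a mesh node; outside, any point will do,
  -- because a knot there cannot split an element.
  have H : ∀ i : ℤ, ∃ s ∈ Icc (a + i * δ - T.size) (a + i * δ),
      (∃ j, T.node j = s) ∨ s ∉ Ioo a b := by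
    intro i
    by_cases hi : a + i * δ ∈ Ioo a b
    · obtain ⟨j, hj⟩ := T.exists_node_le hi
      exact ⟨_, hj, Or.inl ⟨j, rfl⟩⟩
    · exact ⟨_, ⟨by linarith [T.size_nonneg], le_rfl⟩, Or.inr hi⟩
  choose t ht ht' using H
  have hu : IsNearUniform t a δ T.size := ⟨hδ, T.size_nonneg, h, ht⟩
  refine ⟨t, hu, fun p k hk c => ?_⟩
  obtain ⟨q, rfl⟩ : ∃ q, p = q + 1 := ⟨p - 1, by omega⟩
  refine ⟨((hu.isKnots.contDiff_bSpline q c).of_le (by exact_mod_cast Nat.lt_succ_iff.1 hk)).contDiffOn,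
    fun i => ?_⟩
  set j := knotCell t (T.node i.castSucc)
  obtain ⟨P, hP, hP'⟩ := exists_polynomial_deBoor (t := t) (q + 1) 0 j (fun _ => c)
    fun i => ⟨Polynomial.C (c i), by simp, by simp⟩
  refine ⟨P, by simpa using hP, fun x hx => ?_⟩
  rw [← hP', hu.isKnots.bSpline_eq ((hu.isKnots.knotCell_le _).trans hx.1) (hx.2.trans ?_)]
  have h1 := hu.isKnots.lt_knotCell (T.node i.castSucc)
  -- The first knot beyond the left end of the element is a node or lies outside `(a, b)`, so it
  -- cannot fall inside the element, and a single polynomial piece covers it.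
  rcases ht' (j + 1) with ⟨m, hm⟩ | hm
  · rw [← hm] at h1 ⊢
    have := T.strictMono.lt_iff_lt.1 h1
    exact T.strictMono.monotone (Fin.castSucc_lt_iff_succ_le.1 this)
  · by_contra! hc
    refine hm ⟨lt_of_le_of_lt ?_ h1, lt_of_lt_of_le hc ?_⟩
    · exact T.node_zero.symm.le.trans (T.strictMono.monotone (Fin.zero_le _))
    · exact (T.strictMono.monotone (Fin.le_last _)).trans T.node_last.le

end Mesh

end ATFracture
end

noncomputable section
namespace ATFracture

/-! ### Steklov averages -/

/-- The average of `g` over `[x - τ, x]`. -/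
def steklov (τ : ℝ) (g : ℝ → ℝ) (x : ℝ) : ℝ := τ⁻¹ * ∫ s in (x - τ)..x, g s

theorem steklov_eq_convolution {τ : ℝ} (hτ : 0 < τ) (g : ℝ → ℝ) :
    steklov τ g = fun x => convolution ((Ioc 0 τ).indicator fun _ => τ⁻¹) g
      (ContinuousLinearMap.lsmul ℝ ℝ) volume x := by
  funext x
  have h1 : ∀ s, (ContinuousLinearMap.lsmul ℝ ℝ) ((Ioc 0 τ).indicator (fun _ => τ⁻¹) s) (g (x - s))
      = (Ioc 0 τ).indicator (fun s => τ⁻¹ * g (x - s)) s := fun s => by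
    by_cases hs : s ∈ Ioc 0 τ <;> simp [hs]
  have h2 := intervalIntegral.integral_comp_sub_left (a := 0) (b := τ) g x
  simp only [convolution, h1]
  rw [integral_indicator measurableSet_Ioc, integral_const_mul,
    ← intervalIntegral.integral_of_le hτ.le, h2, sub_zero, steklov]

theorem integrable_steklov_kernel (τ : ℝ) :
    Integrable ((Ioc 0 τ).indicator fun _ => τ⁻¹ : ℝ → ℝ) :=
  (integrable_indicator_iff measurableSet_Ioc).2 (by simp [integrableOn_const_iff])

theorem integrable_steklov {τ : ℝ} (hτ : 0 < τ) {g : ℝ → ℝ} (hg : Integrable g) :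
    Integrable (steklov τ g) := by
  rw [steklov_eq_convolution hτ]
  exact (integrable_steklov_kernel τ).integrable_convolution _ hg

theorem integral_steklov {τ : ℝ} (hτ : 0 < τ) {g : ℝ → ℝ} (hg : Integrable g) :
    ∫ x, steklov τ g x = ∫ x, g x := by
  rw [steklov_eq_convolution hτ, integral_convolution _ (integrable_steklov_kernel τ) hg,
    integral_indicator measurableSet_Ioc]
  simp [hτ.le, hτ.ne']

/-- Jensen's inequality, obtained from the nonnegativity of the variance of `g` over the window. -/
theorem sq_steklov_le {τ : ℝ} (hτ : 0 < τ) {g : ℝ → ℝ} (hg : Integrable fun x => g x ^ 2)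
    (hg' : ∀ x y, IntervalIntegrable g volume x y) (x : ℝ) :
    steklov τ g x ^ 2 ≤ steklov τ (fun x => g x ^ 2) x := by
  set m := steklov τ g x with hm
  have h0 : 0 ≤ ∫ s in (x - τ)..x, (g s - m) ^ 2 :=
    intervalIntegral.integral_nonneg (by linarith) fun s _ => sq_nonneg _
  have i1 : IntervalIntegrable (fun s => g s ^ 2) volume (x - τ) x := hg.intervalIntegrable
  have i2 : IntervalIntegrable (fun s => (2 * m) * g s) volume (x - τ) x := (hg' _ _).const_mul _
  have e : ∫ s in (x - τ)..x, (g s - m) ^ 2 =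
      (∫ s in (x - τ)..x, g s ^ 2) - 2 * m * (∫ s in (x - τ)..x, g s) + τ * m ^ 2 := by
    have : ∀ s, (g s - m) ^ 2 = g s ^ 2 - 2 * m * g s + m ^ 2 := fun s => by ring
    simp only [this]
    rw [intervalIntegral.integral_add (i1.sub i2) intervalIntegrable_const,
      intervalIntegral.integral_sub i1 i2, intervalIntegral.integral_const_mul,
      intervalIntegral.integral_const]
    simp
  have e2 : ∫ s in (x - τ)..x, g s = τ * m := by
    rw [hm, steklov]; field_simp
  rw [e, e2] at h0
  rw [steklov, ← div_eq_inv_mul, le_div_iff₀ hτ]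
  linarith

theorem integral_sq_steklov_le {τ : ℝ} (hτ : 0 < τ) {g : ℝ → ℝ} (hg : Integrable fun x => g x ^ 2)
    (hg' : ∀ x y, IntervalIntegrable g volume x y) (hc : Continuous (steklov τ g)) :
    Integrable (fun x => steklov τ g x ^ 2) ∧ ∫ x, steklov τ g x ^ 2 ≤ ∫ x, g x ^ 2 := by
  have hi : Integrable (fun x => steklov τ g x ^ 2) :=
    (integrable_steklov hτ hg).mono' (hc.pow 2).aestronglyMeasurable
      (Eventually.of_forall fun x => by
        rw [Real.norm_eq_abs, abs_of_nonneg (sq_nonneg _)]; exact sq_steklov_le hτ hg hg' x)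
  exact ⟨hi, (integral_mono hi (integrable_steklov hτ hg) fun x => sq_steklov_le hτ hg hg' x).trans_eq
    (integral_steklov hτ hg)⟩

/-! ### Truncated profiles -/

/-- Truncation with `M = 1`, at an `L` so large that the energy on `[L, L + 1]`, multiplied by the
truncation constant, is at most `θ`. -/
theorem exists_truncated_profileOf {ρ : ℝ} (hρ : 0 < ρ) {w : ℝ → ℝ} (hw : w ∈ admissibleProfiles)
    {θ : ℝ} (hθ : 0 < θ) : ∃ (q : ℝ → ℝ) (R : ℝ), IsProfileSecondDeriv q ∧ 0 < R ∧
      (∀ x, R < x → profileOf q x = 0 ∧ prim q x = 0) ∧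
      profileEnergy ρ (profileOf q) ≤ profileEnergy ρ w + θ := by
  obtain ⟨q₀, hq₀, -, -, he⟩ := exists_isProfileSecondDeriv hw
  obtain ⟨C, hC, H⟩ := exists_truncated_profile hρ
  -- Extending the second derivative by zero extends the profile by the constant 1, because its
  -- slope at the origin is zero. The truncation requires an open domain containing the origin.
  set Q : ℝ → ℝ := (Ioi 0).indicator q₀ with hQ
  have hQ2 : MemLp Q 2 volume := (memLp_indicator_iff_restrict measurableSet_Ioi).2 hq₀.memLp
  have hQl : LocallyIntegrable Q volume := hQ2.locallyIntegrable (by norm_num)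
  have hQi : ∀ x y, IntervalIntegrable Q volume x y := fun x y =>
    (hQl.integrableOn_isCompact isCompact_uIcc).intervalIntegrable
  have hpc : Continuous (prim Q) := intervalIntegral.continuous_primitive hQi 0
  have hpe : ∀ x, 0 ≤ x → prim Q x = prim q₀ x := fun x hx => by
    simp only [prim]
    rw [intervalIntegral.integral_of_le hx, intervalIntegral.integral_of_le hx]
    exact setIntegral_congr_fun measurableSet_Ioc fun y hy => indicator_of_mem hy.1 _
  have hPe : ∀ x, 0 ≤ x → profileOf Q x = profileOf q₀ x := fun x hx => by
    simp only [profileOf]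
    congr 1
    rw [prim, prim, intervalIntegral.integral_of_le hx, intervalIntegral.integral_of_le hx]
    exact setIntegral_congr_fun measurableSet_Ioc fun y hy => hpe y hy.1.le
  have hPc : Continuous (profileOf Q) := continuous_const.add
    (intervalIntegral.continuous_primitive (fun x y => hpc.intervalIntegrable x y) 0)
  have d1 : IsWeakDeriv univ (profileOf Q) (prim Q) :=
    isWeakDeriv_primitive isOpen_univ ordConnected_univ
      (hpc.locallyIntegrable.locallyIntegrableOn _) (mem_univ 0) 1
  have d2 : IsWeakDeriv univ (prim Q) Q := by
    have := isWeakDeriv_primitive isOpen_univ ordConnected_univ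
      (hQl.locallyIntegrableOn _) (mem_univ 0) 0
    simp only [zero_add] at this
    exact this
  set D : ℝ → ℝ := fun y => profileOf q₀ y + prim q₀ y ^ 2 + ρ * q₀ y ^ 2 with hD
  have hDi : IntegrableOn D (Ioi 0) :=
    (hq₀.integrable.add hq₀.memLp_prim.integrable_sq).add (hq₀.memLp.integrable_sq.const_mul ρ)
  have hD0 : ∀ x, 0 < x → 0 ≤ D x := fun x hx => by
    have := (hq₀.mem_Icc x hx.le).1
    positivity
  have hDe : profileEnergy ρ w = ∫ x in Ioi (0 : ℝ), D x := by
    rw [he, profileEnergy_eq hq₀.isWeakDeriv_profileOf hq₀.isWeakDeriv_prim]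
  have hlim := intervalIntegral_tendsto_integral_Ioi 0 hDi tendsto_id
  obtain ⟨L, hL, hL1⟩ : ∃ L : ℝ, 0 < L ∧ C * ∫ y in L..(L + 1), D y ≤ θ := by
    have h2 := (hlim.comp (tendsto_atTop_add_const_right atTop (1 : ℝ) tendsto_id)).sub hlim
    have h3 := h2.const_mul C
    rw [sub_self, mul_zero] at h3
    obtain ⟨L, hL, hL0⟩ := ((h3.eventually (eventually_le_nhds hθ)).and
      (eventually_gt_atTop 0)).exists
    refine ⟨L, hL0, ?_⟩
    have i1 : IntervalIntegrable D volume 0 L := by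
      rw [intervalIntegrable_iff_integrableOn_Ioc_of_le hL0.le]
      exact hDi.mono_set Ioc_subset_Ioi_self
    have i2 : IntervalIntegrable D volume 0 (L + 1) := by
      rw [intervalIntegrable_iff_integrableOn_Ioc_of_le (by linarith)]
      exact hDi.mono_set Ioc_subset_Ioi_self
    simp only [Function.comp, id] at hL
    rwa [intervalIntegral.integral_interval_sub_left i2 i1] at hL
  obtain ⟨w', hw', hz, hle⟩ := H univ (profileOf Q) (prim Q) Q L 1 isOpen_univ hL (subset_univ _)
    d1 d2 hPc.continuousOn hpc.continuousOn (hQ2.restrict _) one_pos le_rfl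
    (by simp [profileOf, prim]) (by simp [prim])
    (fun y hy => by rw [hPe y hy.1]; exact hq₀.mem_Icc y hy.1)
  obtain ⟨q, hq, hwq, -, he'⟩ := exists_isProfileSecondDeriv hw'
  have hcongr : ∀ α β : ℝ, 0 ≤ α → α ≤ β →
      ∫ y in α..β, (profileOf Q y + prim Q y ^ 2 + ρ * Q y ^ 2) = ∫ y in α..β, D y := by
    intro α β hα hαβ
    rw [intervalIntegral.integral_of_le hαβ, intervalIntegral.integral_of_le hαβ]
    refine setIntegral_congr_fun measurableSet_Ioc fun y hy => ?_
    have hy0 : 0 < y := lt_of_le_of_lt hα hy.1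
    simp only [hD]
    rw [hPe y hy0.le, hpe y hy0.le, hQ, indicator_of_mem (show y ∈ Ioi 0 from hy0)]
  rw [one_pow, one_mul, hcongr 0 _ le_rfl (by linarith), hcongr L _ hL.le (by linarith)] at hle
  have hbd : ∫ y in (0 : ℝ)..(L + 1), D y ≤ ∫ y in Ioi (0 : ℝ), D y := by
    rw [intervalIntegral.integral_of_le (by linarith)]
    refine setIntegral_mono_set hDi ?_ (Eventually.of_forall Ioc_subset_Ioi_self)
    filter_upwards [ae_restrict_mem measurableSet_Ioi] with y hy using hD0 y hy
  have hP0 : ∀ x, L + 1 < x → profileOf q x = 0 := by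
    have hc : ContinuousOn (profileOf q) (Ioi (L + 1)) :=
      (continuousOn_const.add hq.nearZero.prim.continuousOn_prim).mono fun x hx => by
        have : L + 1 < x := hx
        exact (by linarith : (0 : ℝ) ≤ x)
    have hae : profileOf q =ᵐ[volume.restrict (Ioi (L + 1))] fun _ => 0 := by
      have h1 := ae_restrict_of_ae_restrict_of_subset
        (Ioi_subset_Ioi (by linarith : (0 : ℝ) ≤ L + 1)) hwq
      filter_upwards [h1, ae_restrict_mem measurableSet_Ioi] with x hx hxm
      rw [← hx, hz x hxm]
    exact fun x hx => Measure.eqOn_open_of_ae_eq hae isOpen_Ioi hc continuousOn_const hx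
  refine ⟨q, L + 1, hq, by linarith, fun x hx => ⟨hP0 x hx, ?_⟩, ?_⟩
  · have hx0 : 0 < x := by linarith
    have hd : HasDerivAt (fun x => ∫ s in (0 : ℝ)..x, prim q s) (prim q x) x :=
      intervalIntegral.integral_hasDerivAt_right
        (hq.nearZero.prim.intervalIntegrable le_rfl hx0.le)
        (hq.nearZero.continuousOn_prim.stronglyMeasurableAtFilter_nhdsWithin measurableSet_Ici x
          |>.filter_mono (by rw [nhdsWithin_eq_nhds.2 (Ici_mem_nhds hx0)]))
        (hq.nearZero.continuousOn_prim.continuousAt (Ici_mem_nhds hx0))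
    have hd' : HasDerivAt (profileOf q) (prim q x) x := hd.const_add 1
    have h0 : HasDerivAt (profileOf q) 0 x := (hasDerivAt_const x (0 : ℝ)).congr_of_eventuallyEq
      (by filter_upwards [Ioi_mem_nhds hx] with y hy using hP0 y hy)
    exact hd'.unique h0
  · rw [← he', hDe]; linarith

end ATFracture
end

noncomputable section
namespace ATFracture

/-! ### A smooth profile on the line -/

/-- The extension of `G` by zero from the half-line, translated by `r`. -/
def shiftRight (r : ℝ) (G : ℝ → ℝ) (x : ℝ) : ℝ := (Ioi 0).indicator G (x - r)

theorem shiftRight_of_le {r x : ℝ} (G : ℝ → ℝ) (h : x ≤ r) : shiftRight r G x = 0 :=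
  indicator_of_notMem (by simpa using h) _

theorem shiftRight_of_lt {r x : ℝ} (G : ℝ → ℝ) (h : r < x) : shiftRight r G x = G (x - r) :=
  indicator_of_mem (by simpa using h) _

theorem integral_shiftRight (r : ℝ) (G : ℝ → ℝ) :
    ∫ x, shiftRight r G x = ∫ x in Ioi (0 : ℝ), G x := by
  simp only [shiftRight]
  rw [integral_sub_right_eq_self (fun x => (Ioi 0).indicator G x) r,
    integral_indicator measurableSet_Ioi]

theorem integrable_shiftRight (r : ℝ) {G : ℝ → ℝ} (h : IntegrableOn G (Ioi 0)) :
    Integrable (shiftRight r G) :=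
  ((integrable_indicator_iff measurableSet_Ioi).2 h).comp_sub_right r

theorem shiftRight_sq (r : ℝ) (G : ℝ → ℝ) (x : ℝ) :
    shiftRight r G x ^ 2 = shiftRight r (fun y => G y ^ 2) x := by
  rcases le_or_gt x r with h | h
  · rw [shiftRight_of_le _ h, shiftRight_of_le _ h]; simp
  · rw [shiftRight_of_lt _ h, shiftRight_of_lt _ h]

theorem prim_shiftRight {r : ℝ} (hr : 0 < r) (G : ℝ → ℝ) :
    prim (shiftRight r G) = shiftRight r (prim G) := by
  funext x
  rcases le_or_gt x r with h | h
  · rw [shiftRight_of_le _ h, prim]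
    refine intervalIntegral.integral_zero_ae (Eventually.of_forall fun y hy => ?_)
    refine shiftRight_of_le _ ?_
    have := hy.2
    rcases max_choice 0 x with e | e <;> rw [e] at this <;> linarith
  · rw [shiftRight_of_lt _ h, prim, prim, intervalIntegral.integral_of_le (by linarith)]
    have e : ∀ y, shiftRight r G y = (Ioi r).indicator (fun y => G (y - r)) y := fun y => by
      rcases le_or_gt y r with hy | hy
      · rw [shiftRight_of_le _ hy, indicator_of_notMem (by simpa using hy)]
      · rw [shiftRight_of_lt _ hy, indicator_of_mem (by simpa using hy)]
    have e2 : Ioc 0 x ∩ Ioi r = Ioc r x := by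
      ext y
      simp only [mem_inter_iff, mem_Ioc, mem_Ioi]
      constructor
      · rintro ⟨⟨_, h2⟩, h3⟩; exact ⟨h3, h2⟩
      · rintro ⟨h1, h2⟩; exact ⟨⟨by linarith, h2⟩, h1⟩
    simp only [e]
    rw [setIntegral_indicator measurableSet_Ioi, e2, ← intervalIntegral.integral_of_le h.le,
      intervalIntegral.integral_comp_sub_right G r, sub_self]

theorem hasDerivAt_steklov {τ : ℝ} {g : ℝ → ℝ} (hg : Continuous g) (x : ℝ) :
    HasDerivAt (steklov τ g) (τ⁻¹ * (g x - g (x - τ))) x := by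
  have h1 : ∀ y, HasDerivAt (fun y => ∫ s in (0 : ℝ)..y, g s) (g y) y := fun y =>
    intervalIntegral.integral_hasDerivAt_right (hg.intervalIntegrable _ _)
      hg.stronglyMeasurable.stronglyMeasurableAtFilter hg.continuousAt
  have h2 := (((h1 x).sub (((h1 (x - τ)).comp x ((hasDerivAt_id x).sub_const τ))))).const_mul τ⁻¹
  rw [mul_one] at h2
  refine h2.congr_of_eventuallyEq (Eventually.of_forall fun y => ?_)
  simp only [steklov, Pi.sub_apply, Function.comp, id]
  rw [intervalIntegral.integral_interval_sub_left (hg.intervalIntegrable _ _)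
    (hg.intervalIntegrable _ _)]

theorem steklov_eq_const {τ : ℝ} (hτ : 0 < τ) {g : ℝ → ℝ} {x c : ℝ}
    (h : ∀ y ∈ Ioc (x - τ) x, g y = c) : steklov τ g x = c := by
  have : ∫ s in (x - τ)..x, g s = ∫ s in (x - τ)..x, c := by
    rw [intervalIntegral.integral_of_le (by linarith), intervalIntegral.integral_of_le (by linarith)]
    exact setIntegral_congr_fun measurableSet_Ioc h
  rw [steklov, this, intervalIntegral.integral_const, sub_sub_cancel, smul_eq_mul]
  field_simp

theorem steklov_mem_Icc {τ : ℝ} (hτ : 0 < τ) {g : ℝ → ℝ} (hc : Continuous g)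
    (h : ∀ y, g y ∈ Icc (0 : ℝ) 1) (x : ℝ) : steklov τ g x ∈ Icc (0 : ℝ) 1 := by
  have h1 : 0 ≤ ∫ s in (x - τ)..x, g s :=
    intervalIntegral.integral_nonneg (by linarith) fun s _ => (h s).1
  have h2 : ∫ s in (x - τ)..x, g s ≤ ∫ s in (x - τ)..x, (1 : ℝ) :=
    intervalIntegral.integral_mono_on (by linarith) (hc.intervalIntegrable _ _)
      intervalIntegrable_const fun s _ => (h s).2
  rw [intervalIntegral.integral_const, sub_sub_cancel, smul_eq_mul, mul_one] at h2
  refine ⟨mul_nonneg (inv_nonneg.2 hτ.le) h1, ?_⟩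
  rw [steklov, inv_mul_le_iff₀ hτ, mul_one]
  exact h2

/-- `F` is a `C²` profile with values in `[0, 1]`, equal to `1` on `[-r, r]` and to `0` outside
`(-R, R)`. -/
structure IsSmoothProfile (F F₁ F₂ : ℝ → ℝ) (r R : ℝ) : Prop where
  pos : 0 < r
  lt : r < R
  hasDerivAt (x : ℝ) : HasDerivAt F (F₁ x) x
  hasDerivAt₁ (x : ℝ) : HasDerivAt F₁ (F₂ x) x
  continuous₂ : Continuous F₂
  mem_Icc (x : ℝ) : F x ∈ Icc (0 : ℝ) 1
  eq_one (x : ℝ) : |x| ≤ r → F x = 1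
  eq_zero (x : ℝ) : R ≤ |x| → F x = 0

/-- The truncated profile is shifted right by `r`, leaving a plateau, and averaged over `[x - τ,
x]`, which makes the second derivative continuous and keeps the plateau because the window looks to
the left. By Jensen the quadratic terms do not grow, and the linear term grows by at most `r + τ`.
Reflection doubles the energy. -/
theorem exists_smooth_profile {ρ : ℝ} (hρ : 0 < ρ) {w : ℝ → ℝ} (hw : w ∈ admissibleProfiles)
    {θ : ℝ} (hθ : 0 < θ) : ∃ (F F₁ F₂ : ℝ → ℝ) (r R : ℝ), IsSmoothProfile F F₁ F₂ r R ∧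
      ∫ x, (F x + F₁ x ^ 2 + ρ * F₂ x ^ 2) ≤ 2 * profileEnergy ρ w + θ := by
  -- Twice the sum of `θ/4` for the truncation and `θ/16` each for `r` and `τ` is `3θ/4`.
  obtain ⟨q, R₀, hq, hR₀, hz, hle⟩ := exists_truncated_profileOf hρ hw (θ := θ / 4) (by positivity)
  set r := θ / 16 with hr
  have hr0 : 0 < r := by positivity
  set τ := θ / 16 with hτ
  have hτ0 : 0 < τ := by positivity
  set Q := shiftRight r q with hQ
  set H := profileOf Q with hH
  set H₁ := prim Q with hH1
  have eH1 : H₁ = shiftRight r (prim q) := prim_shiftRight hr0 q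
  have eH : ∀ x, H x = 1 + shiftRight r (prim (prim q)) x := fun x => by
    rw [hH, profileOf, ← hH1, eH1, prim_shiftRight hr0]
  have Hle : ∀ x, x ≤ r → H x = 1 := fun x hx => by rw [eH, shiftRight_of_le _ hx, add_zero]
  have Hlt : ∀ x, r < x → H x = profileOf q (x - r) := fun x hx => by
    rw [eH, shiftRight_of_lt _ hx]; rfl
  have H1le : ∀ x, x ≤ r → H₁ x = 0 := fun x hx => by rw [eH1, shiftRight_of_le _ hx]
  have iQ2 : Integrable fun x => Q x ^ 2 := by
    simp only [hQ, shiftRight_sq]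
    exact integrable_shiftRight r hq.memLp.integrable_sq
  have iH1 : Integrable fun x => H₁ x ^ 2 := by
    simp only [eH1, shiftRight_sq]
    exact integrable_shiftRight r hq.memLp_prim.integrable_sq
  have mQ : MemLp Q 2 volume :=
    ((memLp_indicator_iff_restrict measurableSet_Ioi).2 hq.memLp).comp_measurePreserving
      (measurePreserving_sub_right volume r)
  have hQi : ∀ x y, IntervalIntegrable Q volume x y := fun x y =>
    ((mQ.locallyIntegrable (by norm_num)).integrableOn_isCompact isCompact_uIcc).intervalIntegrable
  have cH1 : Continuous H₁ := intervalIntegral.continuous_primitive hQi 0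
  have dH : ∀ x, HasDerivAt H (H₁ x) x := fun x =>
    (intervalIntegral.integral_hasDerivAt_right (cH1.intervalIntegrable _ _)
      cH1.stronglyMeasurable.stronglyMeasurableAtFilter cH1.continuousAt).const_add 1
  have cH : Continuous H := continuous_iff_continuousAt.2 fun x => (dH x).continuousAt
  have H01 : ∀ x, H x ∈ Icc (0 : ℝ) 1 := fun x => by
    rcases le_or_gt x r with hx | hx
    · rw [Hle x hx]; simp
    · rw [Hlt x hx]; exact hq.mem_Icc _ (by linarith)
  set P : ℝ → ℝ := steklov τ H with hP
  set P₁ : ℝ → ℝ := fun x => τ⁻¹ * (H x - H (x - τ)) with hP1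
  set P₂ : ℝ → ℝ := fun x => τ⁻¹ * (H₁ x - H₁ (x - τ)) with hP2
  have dP : ∀ x, HasDerivAt P (P₁ x) x := fun x => hasDerivAt_steklov cH x
  have dP1 : ∀ x, HasDerivAt P₁ (P₂ x) x := fun x => by
    have := ((dH x).sub ((dH (x - τ)).comp x ((hasDerivAt_id x).sub_const τ))).const_mul τ⁻¹
    rw [mul_one] at this
    exact this
  have cP2 : Continuous P₂ := by fun_prop
  have sP1 : P₁ = steklov τ H₁ := by
    funext x
    rw [steklov, intervalIntegral.integral_eq_sub_of_hasDerivAt (fun y _ => dH y)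
      (cH1.intervalIntegrable _ _)]
  have sP2 : P₂ = steklov τ Q := by
    funext x
    rw [steklov, ← intervalIntegral.integral_interval_sub_left (hQi 0 x) (hQi 0 (x - τ))]
    rfl
  have Ple : ∀ x, x ≤ r → P x = 1 := fun x hx =>
    steklov_eq_const hτ0 fun y hy => Hle y (hy.2.trans hx)
  have P1le : ∀ x, x ≤ r → P₁ x = 0 := fun x hx => by
    rw [hP1]; simp only; rw [Hle x hx, Hle _ (by linarith)]; simp
  have P2le : ∀ x, x ≤ r → P₂ x = 0 := fun x hx => by
    rw [hP2]; simp only; rw [H1le x hx, H1le _ (by linarith)]; simp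
  have Pz : ∀ x, r + R₀ + τ ≤ x → P x = 0 := fun x hx =>
    steklov_eq_const hτ0 fun y hy => by
      have : r + R₀ < y := by linarith [hy.1]
      rw [Hlt y (by linarith)]
      exact (hz _ (by linarith)).1
  have P01 : ∀ x, P x ∈ Icc (0 : ℝ) 1 := steklov_mem_Icc hτ0 cH H01
  -- `H` equals 1 on the whole negative axis and is not integrable. `e` is an integrable function
  -- that agrees with it on every window ending at a positive point.
  set e : ℝ → ℝ := fun x => (Ioc (-τ) r).indicator (fun _ => (1 : ℝ)) x + shiftRight r (profileOf q) x
    with he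
  have ie1 : Integrable ((Ioc (-τ) r).indicator fun _ => (1 : ℝ)) :=
    (integrable_indicator_iff measurableSet_Ioc).2 (by simp [integrableOn_const_iff])
  have ie2 := integrable_shiftRight r hq.integrable
  have ie : Integrable e := ie1.add ie2
  have inte : ∫ x, e x = τ + r + ∫ x in Ioi (0 : ℝ), profileOf q x := by
    rw [he, integral_add ie1 ie2, integral_shiftRight, integral_indicator measurableSet_Ioc]
    simp only [integral_const, smul_eq_mul, mul_one]
    rw [measureReal_restrict_apply_univ, Real.volume_real_Ioc_of_le (by linarith)]
    ring
  have eH' : ∀ x, -τ < x → e x = H x := fun x hx => by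
    simp only [he]
    rcases le_or_gt x r with h | h
    · rw [indicator_of_mem (show x ∈ Ioc (-τ) r from ⟨hx, h⟩), shiftRight_of_le _ h, Hle x h,
        add_zero]
    · rw [indicator_of_notMem (fun h' => absurd h'.2 (not_le.2 h)), shiftRight_of_lt _ h, Hlt x h,
        zero_add]
  have e0 : ∀ x, 0 ≤ e x := fun x => by
    refine add_nonneg (indicator_nonneg (fun _ _ => zero_le_one) x) ?_
    rcases le_or_gt x r with h | h
    · rw [shiftRight_of_le _ h]
    · rw [shiftRight_of_lt _ h]; exact (hq.mem_Icc _ (by linarith)).1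
  have Pe : ∀ x, 0 < x → P x = steklov τ e x := fun x hx => by
    rw [hP, steklov, steklov, intervalIntegral.integral_of_le (by linarith),
      intervalIntegral.integral_of_le (by linarith)]
    congr 1
    exact setIntegral_congr_fun measurableSet_Ioc fun y hy => (eH' y (by linarith [hy.1])).symm
  have se0 : ∀ x, 0 ≤ steklov τ e x := fun x => mul_nonneg (inv_nonneg.2 hτ0.le)
    (intervalIntegral.integral_nonneg (by linarith) fun s _ => e0 s)
  have cP1 : Continuous P₁ := continuous_iff_continuousAt.2 fun x => (dP1 x).continuousAt
  have j0 := integrable_steklov hτ0 ie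
  obtain ⟨j1, j1'⟩ := integral_sq_steklov_le hτ0 iH1 (fun x y => cH1.intervalIntegrable x y)
    (sP1 ▸ cP1)
  obtain ⟨j2, j2'⟩ := integral_sq_steklov_le hτ0 iQ2 hQi (sP2 ▸ cP2)
  have half : ∫ x in Ioi (0 : ℝ), (P x + P₁ x ^ 2 + ρ * P₂ x ^ 2) ≤
      τ + r + profileEnergy ρ (profileOf q) := by
    calc ∫ x in Ioi (0 : ℝ), (P x + P₁ x ^ 2 + ρ * P₂ x ^ 2)
        = ∫ x in Ioi (0 : ℝ), (steklov τ e x + steklov τ H₁ x ^ 2 + ρ * steklov τ Q x ^ 2) := by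
          rw [sP1, sP2]
          exact setIntegral_congr_fun measurableSet_Ioi fun x hx => by rw [Pe x hx]
      _ ≤ ∫ x, (steklov τ e x + steklov τ H₁ x ^ 2 + ρ * steklov τ Q x ^ 2) := by
          refine setIntegral_le_integral ((j0.add j1).add (j2.const_mul ρ))
            (Eventually.of_forall fun x => ?_)
          have := se0 x
          change 0 ≤ steklov τ e x + steklov τ H₁ x ^ 2 + ρ * steklov τ Q x ^ 2
          positivity
      _ = (∫ x, steklov τ e x) + (∫ x, steklov τ H₁ x ^ 2) + ρ * ∫ x, steklov τ Q x ^ 2 := by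
          refine (integral_add (j0.add j1) (j2.const_mul ρ)).trans ?_
          rw [integral_const_mul]
          congr 1
          exact integral_add j0 j1
      _ ≤ (τ + r + ∫ x in Ioi (0 : ℝ), profileOf q x) + (∫ x in Ioi (0 : ℝ), prim q x ^ 2)
          + ρ * ∫ x in Ioi (0 : ℝ), q x ^ 2 := by
          have a1 : ∫ x, H₁ x ^ 2 = ∫ x in Ioi (0 : ℝ), prim q x ^ 2 := by
            simp only [eH1, shiftRight_sq]; exact integral_shiftRight r _
          have a2 : ∫ x, Q x ^ 2 = ∫ x in Ioi (0 : ℝ), q x ^ 2 := by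
            simp only [hQ, shiftRight_sq]; exact integral_shiftRight r _
          rw [integral_steklov hτ0 ie, inte, ← a1, ← a2]
          gcongr
      _ = τ + r + profileEnergy ρ (profileOf q) := by
          rw [hq.profileEnergy_eq, MemLp.integral_sq_eq hq.memLp_prim, MemLp.integral_sq_eq hq.memLp]
          ring
  -- At each point one of `P x`, `P (-x)` equals 1, so this is the even extension of `P`, written
  -- without a case distinction and visibly `C²`.
  refine ⟨fun x => P x + P (-x) - 1, fun x => P₁ x - P₁ (-x), fun x => P₂ x + P₂ (-x), r,
    r + R₀ + τ, ⟨hr0, by linarith, fun x => ?_, fun x => ?_, cP2.add (cP2.comp continuous_neg),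
    fun x => ?_, fun x hx => ?_, fun x hx => ?_⟩, ?_⟩
  · have := ((dP x).add ((dP (-x)).comp x (hasDerivAt_neg x))).sub_const 1
    exact this.congr_deriv (by ring)
  · have := (dP1 x).sub ((dP1 (-x)).comp x (hasDerivAt_neg x))
    exact this.congr_deriv (by ring)
  · rcases le_total 0 x with h | h
    · simp only [Ple (-x) (by linarith), add_sub_cancel_right]; exact P01 x
    · simp only [Ple x (by linarith), add_sub_cancel_left]; exact P01 (-x)
  · obtain ⟨h1, h2⟩ := abs_le.1 hx
    simp only [Ple x h2, Ple (-x) (by linarith)]; norm_num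
  · rcases le_total 0 x with h | h
    · rw [abs_of_nonneg h] at hx
      simp only [Ple (-x) (by linarith), Pz x hx]; norm_num
    · rw [abs_of_nonpos h] at hx
      simp only [Ple x (by linarith), Pz (-x) hx]; norm_num
  · have hE : ∀ x, P x + P (-x) - 1 + (P₁ x - P₁ (-x)) ^ 2 + ρ * (P₂ x + P₂ (-x)) ^ 2 =
        (fun y => P y + P₁ y ^ 2 + ρ * P₂ y ^ 2) |x| := fun x => by
      rcases le_total 0 x with h | h
      · simp only [abs_of_nonneg h, Ple (-x) (by linarith), P1le (-x) (by linarith),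
          P2le (-x) (by linarith)]
        ring
      · simp only [abs_of_nonpos h, Ple x (by linarith), P1le x (by linarith),
          P2le x (by linarith)]
        ring
    simp only [hE]
    rw [integral_comp_abs (f := fun y => P y + P₁ y ^ 2 + ρ * P₂ y ^ 2)]
    rw [hr, hτ] at half
    linarith

end ATFracture
end

noncomputable section
namespace ATFracture

/-! ### The phase field of the recovery sequence -/

namespace IsSmoothProfile

variable {F F₁ F₂ : ℝ → ℝ} {r R : ℝ}

theorem continuous (P : IsSmoothProfile F F₁ F₂ r R) : Continuous F :=
  continuous_iff_continuousAt.2 fun x => (P.hasDerivAt x).continuousAt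

theorem continuous₁ (P : IsSmoothProfile F F₁ F₂ r R) : Continuous F₁ :=
  continuous_iff_continuousAt.2 fun x => (P.hasDerivAt₁ x).continuousAt

theorem eventually_eq_zero (P : IsSmoothProfile F F₁ F₂ r R) {x : ℝ} (h : R < |x|) :
    ∀ᶠ y in 𝓝 x, F y = 0 := by
  filter_upwards [continuous_abs.continuousAt.eventually (lt_mem_nhds h)] with y hy
    using P.eq_zero y hy.le

theorem eq_zero₁ (P : IsSmoothProfile F F₁ F₂ r R) {x : ℝ} (h : R < |x|) : F₁ x = 0 :=
  (P.hasDerivAt x).unique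
    ((hasDerivAt_const x (0 : ℝ)).congr_of_eventuallyEq (P.eventually_eq_zero h))

theorem eq_zero₂ (P : IsSmoothProfile F F₁ F₂ r R) {x : ℝ} (h : R < |x|) : F₂ x = 0 := by
  refine (P.hasDerivAt₁ x).unique
    ((hasDerivAt_const x (0 : ℝ)).congr_of_eventuallyEq ?_)
  filter_upwards [continuous_abs.continuousAt.eventually (lt_mem_nhds h)] with y hy
    using P.eq_zero₁ hy

theorem hasCompactSupport_of_eq_zero {G : ℝ → ℝ} (h : ∀ x, R < |x| → G x = 0) :
    HasCompactSupport G :=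
  HasCompactSupport.intro (isCompact_Icc (a := -R) (b := R)) fun x hx =>
    h x (by by_contra! hc; exact hx (abs_le.1 hc))

theorem exists_modulus_of_eq_zero {G : ℝ → ℝ} (hG : Continuous G) (h : ∀ x, R < |x| → G x = 0)
    {τ : ℝ} (hτ : 0 < τ) : ∃ μ, 0 < μ ∧ ∀ x y, |x - y| ≤ μ → |G x - G y| ≤ τ := by
  have hu := (hasCompactSupport_of_eq_zero h).uniformContinuous_of_continuous hG
  obtain ⟨μ, hμ, hH⟩ := Metric.uniformContinuous_iff.1 hu τ hτ
  exact ⟨μ / 2, by positivity, fun x y hxy =>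
    (hH (lt_of_le_of_lt hxy (by linarith : μ / 2 < μ))).le⟩

theorem exists_modulus (P : IsSmoothProfile F F₁ F₂ r R) {τ : ℝ} (hτ : 0 < τ) :
    ∃ μ, 0 < μ ∧ ∀ x y, |x - y| ≤ μ →
      |F x - F y| ≤ τ ∧ |F₁ x - F₁ y| ≤ τ ∧ |F₂ x - F₂ y| ≤ τ := by
  obtain ⟨μ, h1, h2⟩ := exists_modulus_of_eq_zero P.continuous (fun x hx => P.eq_zero x hx.le) hτ
  obtain ⟨μ₁, h3, h4⟩ := exists_modulus_of_eq_zero P.continuous₁ (fun x hx => P.eq_zero₁ hx) hτ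
  obtain ⟨μ₂, h5, h6⟩ := exists_modulus_of_eq_zero P.continuous₂ (fun x hx => P.eq_zero₂ hx) hτ
  exact ⟨min μ (min μ₁ μ₂), by positivity, fun x y hxy =>
    ⟨h2 x y (hxy.trans (min_le_left _ _)),
      h4 x y (hxy.trans ((min_le_right _ _).trans (min_le_left _ _))),
      h6 x y (hxy.trans ((min_le_right _ _).trans (min_le_right _ _)))⟩⟩

theorem exists_bound (P : IsSmoothProfile F F₁ F₂ r R) :
    ∃ M, 0 ≤ M ∧ ∀ x, |F₁ x| ≤ M ∧ |F₂ x| ≤ M := by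
  obtain ⟨M₁, h1⟩ := (hasCompactSupport_of_eq_zero (R := R) (G := F₁)
    fun x hx => P.eq_zero₁ hx).exists_bound_of_continuous P.continuous₁
  obtain ⟨M₂, h2⟩ := (hasCompactSupport_of_eq_zero (R := R) (G := F₂)
    fun x hx => P.eq_zero₂ hx).exists_bound_of_continuous P.continuous₂
  exact ⟨max M₁ M₂, (norm_nonneg _).trans ((h1 0).trans (le_max_left _ _)), fun x =>
    ⟨(h1 x).trans (le_max_left _ _), (h2 x).trans (le_max_right _ _)⟩⟩

end IsSmoothProfile

/-- The superposition of copies of `G` of width `ε` at the points of `B`. -/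
def crackSum (B : Finset ℝ) (G : ℝ → ℝ) (ε x : ℝ) : ℝ := ∑ s ∈ B, G ((x - s) / ε)

theorem crackSum_eq_zero {B : Finset ℝ} {G : ℝ → ℝ} {R ε x : ℝ} (hε : 0 < ε)
    (hG : ∀ x, R < |x| → G x = 0) (hx : ∀ s ∈ B, R * ε < |x - s|) : crackSum B G ε x = 0 :=
  Finset.sum_eq_zero fun s hs => hG _ (by
    rw [abs_div, abs_of_pos hε, lt_div_iff₀ hε]; exact hx s hs)

theorem crackSum_eq {B : Finset ℝ} {G : ℝ → ℝ} {R ε x s : ℝ} (hε : 0 < ε)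
    (hG : ∀ x, R < |x| → G x = 0) (hs : s ∈ B)
    (hx : ∀ s' ∈ B, s' ≠ s → R * ε < |x - s'|) : crackSum B G ε x = G ((x - s) / ε) :=
  Finset.sum_eq_single s (fun s' hs' hne => hG _ (by
    rw [abs_div, abs_of_pos hε, lt_div_iff₀ hε]; exact hx s' hs' hne)) fun h => absurd hs h

theorem hasDerivAt_crackSum {B : Finset ℝ} {G G' : ℝ → ℝ} (ε : ℝ)
    (hG : ∀ x, HasDerivAt G (G' x) x) (x : ℝ) :
    HasDerivAt (crackSum B G ε) (ε⁻¹ * crackSum B G' ε x) x := by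
  have h : ∀ s ∈ B, HasDerivAt (fun x => G ((x - s) / ε)) (G' ((x - s) / ε) * (1 / ε)) x :=
    fun s _ => (hG ((x - s) / ε)).comp x (((hasDerivAt_id x).sub_const s).div_const ε)
  refine (HasDerivAt.fun_sum h).congr_deriv ?_
  rw [crackSum, Finset.mul_sum]
  exact Finset.sum_congr rfl fun s _ => by rw [one_div]; ring

/-- The smallness conditions on the parameters of the recovery sequence: cracks `B` of width `ε`
separated by more than the supports of the profiles, and knots `t` fine enough. -/
structure IsFine (F F₁ F₂ : ℝ → ℝ) (r R μ τ : ℝ) (B : Finset ℝ) (p : ℕ) (ε δ h x₀ : ℝ)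
    (t : ℤ → ℝ) : Prop where
  profile : IsSmoothProfile F F₁ F₂ r R
  pos : 0 < ε
  μ_le : μ ≤ 1
  μ_le' : μ ≤ r / 4
  modulus : ∀ x y, |x - y| ≤ μ → |F x - F y| ≤ τ ∧ |F₁ x - F₁ y| ≤ τ ∧ |F₂ x - F₂ y| ≤ τ
  separated : ∀ s ∈ B, ∀ s' ∈ B, s ≠ s' → 2 * (R + 2) * ε < |s - s'|
  knots : IsNearUniform t x₀ δ h
  δ_le : (p + 3) * δ ≤ μ * ε
  h_le : ∀ x, 4 * (h / δ) * |F₂ x| ≤ τ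

namespace IsFine

variable {F F₁ F₂ : ℝ → ℝ} {r R μ τ ε δ h x₀ : ℝ} {B : Finset ℝ} {p : ℕ} {t : ℤ → ℝ}

theorem abs_sub_le (H : IsFine F F₁ F₂ r R μ τ B p ε δ h x₀ t) {x y : ℝ}
    (hy : y ∈ Icc (x - (p + 3) * δ) (x + (p + 3) * δ)) : |y - x| ≤ μ * ε := by
  rw [abs_le]; constructor <;> linarith [hy.1, hy.2, H.δ_le]

theorem crackSum_near (H : IsFine F F₁ F₂ r R μ τ B p ε δ h x₀ t) {G : ℝ → ℝ}
    (hG : ∀ x, R < |x| → G x = 0) {s y : ℝ} (hs : s ∈ B) (hy : |y - s| ≤ (R + 2) * ε) :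
    crackSum B G ε y = G ((y - s) / ε) := by
  refine crackSum_eq H.pos hG hs fun s' hs' hne => ?_
  have h1 := H.separated s hs s' hs' hne.symm
  have h2 : |s - s'| ≤ |y - s| + |y - s'| := by
    have := abs_sub (y - s') (y - s)
    rw [sub_sub_sub_cancel_left] at this
    linarith
  nlinarith [H.pos]

theorem crackSum_mem (H : IsFine F F₁ F₂ r R μ τ B p ε δ h x₀ t) (y : ℝ) :
    crackSum B F ε y ∈ Icc (0 : ℝ) 1 := by
  by_cases hy : ∃ s ∈ B, |y - s| ≤ (R + 2) * ε
  · obtain ⟨s, hs, hy⟩ := hy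
    rw [H.crackSum_near (fun x hx => H.profile.eq_zero x hx.le) hs hy]
    exact H.profile.mem_Icc _
  · push Not at hy
    rw [crackSum_eq_zero H.pos (fun x hx => H.profile.eq_zero x hx.le) fun s hs => by
      have := hy s hs
      nlinarith [H.pos]]
    simp

theorem schoenberg_mem_unit (H : IsFine F F₁ F₂ r R μ τ B p ε δ h x₀ t) (x : ℝ) :
    schoenberg t (p + 2) (crackSum B F ε) x ∈ Icc (0 : ℝ) 1 :=
  H.knots.schoenberg_mem (p + 1) fun y _ => H.crackSum_mem y

theorem mem_nhds_cast {x y : ℝ}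
    (hy : y ∈ Icc (x - ((p + 1 : ℕ) + 2) * δ) (x + ((p + 1 : ℕ) + 2) * δ)) :
    y ∈ Icc (x - (p + 3) * δ) (x + (p + 3) * δ) := by
  push_cast at hy
  rwa [add_assoc, (by norm_num : (1 : ℝ) + 2 = 3)] at hy

/-- The samples used at `x` lie within `μ ε ≤ r ε / 4`, so within `r ε / 2` of the crack all of them
are taken on the plateau. -/
theorem schoenberg_eq_one (H : IsFine F F₁ F₂ r R μ τ B p ε δ h x₀ t) {s x : ℝ} (hs : s ∈ B)
    (hx : |x - s| ≤ r / 2 * ε) : schoenberg t (p + 2) (crackSum B F ε) x = 1 := by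
  have : schoenberg t (p + 2) (crackSum B F ε) x ∈ Icc (1 : ℝ) 1 := by
    refine H.knots.schoenberg_mem (p + 1) fun y hy => ?_
    have h1 := H.abs_sub_le (mem_nhds_cast hy)
    have h2 : |y - s| ≤ r * ε := by
      have := abs_add_le (y - x) (x - s)
      rw [sub_add_sub_cancel] at this
      nlinarith [H.pos, H.μ_le', H.profile.pos]
    rw [H.crackSum_near (fun x hx => H.profile.eq_zero x hx.le) hs
      (h2.trans (by nlinarith [H.pos, H.profile.lt])), H.profile.eq_one _ (by
        rw [abs_div, abs_of_pos H.pos, div_le_iff₀ H.pos]; exact h2)]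
    simp
  rwa [Icc_self, mem_singleton_iff] at this

theorem hasDerivAt_crackSum (H : IsFine F F₁ F₂ r R μ τ B p ε δ h x₀ t) (x : ℝ) :
    HasDerivAt (crackSum B F ε) (ε⁻¹ * crackSum B F₁ ε x) x :=
  ATFracture.hasDerivAt_crackSum ε H.profile.hasDerivAt x

theorem hasDerivAt_crackSum₁ (H : IsFine F F₁ F₂ r R μ τ B p ε δ h x₀ t) (x : ℝ) :
    HasDerivAt (fun x => ε⁻¹ * crackSum B F₁ ε x) (ε⁻¹ * (ε⁻¹ * crackSum B F₂ ε x)) x :=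
  (ATFracture.hasDerivAt_crackSum ε H.profile.hasDerivAt₁ x).const_mul _

/-- Away from the cracks, the phase field vanishes. -/
theorem schoenberg_far (H : IsFine F F₁ F₂ r R μ τ B p ε δ h x₀ t) {x : ℝ}
    (hx : ∀ s ∈ B, (R + 1) * ε < |x - s|) :
    schoenberg t (p + 2) (crackSum B F ε) x = 0 ∧
      schoenberg₁ t (p + 2) (crackSum B F ε) x = 0 ∧
      schoenberg₂ t (p + 2) (crackSum B F ε) x = 0 := by
  have hfar : ∀ y ∈ Icc (x - (p + 3) * δ) (x + (p + 3) * δ), ∀ s ∈ B, R * ε < |y - s| := by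
    intro y hy s hs
    have h1 := H.abs_sub_le hy
    have h2 := hx s hs
    have h3 : |x - s| ≤ |y - x| + |y - s| := by
      have := abs_sub (y - s) (y - x)
      rw [sub_sub_sub_cancel_left] at this
      linarith
    nlinarith [H.pos, H.μ_le]
  refine ⟨?_, ?_, ?_⟩
  · have : schoenberg t (p + 2) (crackSum B F ε) x ∈ Icc (0 : ℝ) 0 := by
      refine H.knots.schoenberg_mem (p + 1) fun y hy => ?_
      rw [crackSum_eq_zero H.pos (fun x hx => H.profile.eq_zero x hx.le)
        (hfar y (mem_nhds_cast hy))]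
      simp
    rwa [Icc_self, mem_singleton_iff] at this
  · have : schoenberg₁ t (p + 2) (crackSum B F ε) x ∈ Icc (0 : ℝ) 0 := by
      refine H.knots.schoenberg₁_mem (p + 1) H.hasDerivAt_crackSum fun y hy => ?_
      rw [crackSum_eq_zero H.pos (fun x hx => H.profile.eq_zero₁ hx) (hfar y (mem_nhds_cast hy))]
      simp
    rwa [Icc_self, mem_singleton_iff] at this
  · have := H.knots.schoenberg₂_mem p H.hasDerivAt_crackSum H.hasDerivAt_crackSum₁
      (x := x) (A := 0) (τ := 0) fun y hy => by
        rw [crackSum_eq_zero H.pos (fun x hx => H.profile.eq_zero₂ hx) (hfar y hy)]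
        simp
    simpa using this

/-- Near a crack, the phase field is close to the rescaled profile. -/
theorem schoenberg_near (H : IsFine F F₁ F₂ r R μ τ B p ε δ h x₀ t) {s x : ℝ} (hs : s ∈ B)
    (hx : |x - s| ≤ (R + 1) * ε) :
    |schoenberg t (p + 2) (crackSum B F ε) x - F ((x - s) / ε)| ≤ τ ∧
      |schoenberg₁ t (p + 2) (crackSum B F ε) x - ε⁻¹ * F₁ ((x - s) / ε)| ≤ ε⁻¹ * τ ∧
      |schoenberg₂ t (p + 2) (crackSum B F ε) x - ε⁻¹ * (ε⁻¹ * F₂ ((x - s) / ε))|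
        ≤ ε⁻¹ * (ε⁻¹ * (4 * τ)) := by
  have hε := H.pos
  have hi : 0 < ε⁻¹ := inv_pos.2 hε
  have hnear : ∀ y ∈ Icc (x - (p + 3) * δ) (x + (p + 3) * δ), |y - s| ≤ (R + 2) * ε ∧
      |(y - s) / ε - (x - s) / ε| ≤ μ := by
    intro y hy
    have h1 := H.abs_sub_le hy
    have h3 := abs_add_le (y - x) (x - s)
    rw [sub_add_sub_cancel] at h3
    refine ⟨by nlinarith [H.μ_le], ?_⟩
    rw [← sub_div, sub_sub_sub_cancel_right, abs_div, abs_of_pos hε, div_le_iff₀ hε]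
    exact h1
  have conv : ∀ {z A e : ℝ}, z ∈ Icc (A - e) (A + e) → |z - A| ≤ e := fun hz => by
    rw [abs_le]; constructor <;> linarith [hz.1, hz.2]
  have conv' : ∀ {z A e : ℝ}, |z - A| ≤ e → z ∈ Icc (A - e) (A + e) := fun hz => by
    rw [abs_le] at hz; constructor <;> linarith [hz.1, hz.2]
  refine ⟨conv ?_, conv ?_, ?_⟩
  · refine H.knots.schoenberg_mem (p + 1) fun y hy => conv' ?_
    obtain ⟨a1, a2⟩ := hnear y (mem_nhds_cast hy)
    rw [H.crackSum_near (fun x hx => H.profile.eq_zero x hx.le) hs a1]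
    exact (H.modulus _ _ a2).1
  · refine H.knots.schoenberg₁_mem (p + 1) H.hasDerivAt_crackSum fun y hy => conv' ?_
    obtain ⟨a1, a2⟩ := hnear y (mem_nhds_cast hy)
    rw [H.crackSum_near (fun x hx => H.profile.eq_zero₁ hx) hs a1, ← mul_sub, abs_mul,
      abs_of_pos hi]
    exact mul_le_mul_of_nonneg_left (H.modulus _ _ a2).2.1 hi.le
  · have := H.knots.schoenberg₂_mem p H.hasDerivAt_crackSum H.hasDerivAt_crackSum₁
      (x := x) (A := ε⁻¹ * (ε⁻¹ * F₂ ((x - s) / ε))) (τ := ε⁻¹ * (ε⁻¹ * τ)) fun y hy => by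
        obtain ⟨a1, a2⟩ := hnear y hy
        rw [H.crackSum_near (fun x hx => H.profile.eq_zero₂ hx) hs a1, ← mul_sub, ← mul_sub,
          abs_mul, abs_mul, abs_of_pos hi]
        exact mul_le_mul_of_nonneg_left (mul_le_mul_of_nonneg_left (H.modulus _ _ a2).2.2 hi.le)
          hi.le
    refine this.trans ?_
    rw [abs_mul, abs_mul, abs_of_pos hi]
    -- The factor 4 collects `3 τ` from the modulus of continuity of `F₂` and one `τ` from the
    -- non-uniformity of the knots.
    have h4 := mul_le_mul_of_nonneg_left (H.h_le ((x - s) / ε)) (mul_pos hi hi).le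
    calc 3 * (ε⁻¹ * (ε⁻¹ * τ)) + 4 * (h / δ) * (ε⁻¹ * (ε⁻¹ * |F₂ ((x - s) / ε)|))
        = 3 * (ε⁻¹ * (ε⁻¹ * τ)) + ε⁻¹ * ε⁻¹ * (4 * (h / δ) * |F₂ ((x - s) / ε)|) := by ring
      _ ≤ 3 * (ε⁻¹ * (ε⁻¹ * τ)) + ε⁻¹ * ε⁻¹ * τ := by gcongr
      _ = _ := by ring

end IsFine

end ATFracture
end

/-! ### Surface and bulk energy of the spline recovery pair -/

noncomputable section
namespace ATFracture

theorem sq_le_of_abs_sub_le {w f e M : ℝ} (h : |w - f| ≤ e) (hf : |f| ≤ M) :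
    w ^ 2 ≤ f ^ 2 + 2 * M * e + e ^ 2 := by
  have he : 0 ≤ e := (abs_nonneg _).trans h
  have h1 : (w - f) ^ 2 ≤ e ^ 2 := sq_le_sq' (abs_le.1 h).1 (abs_le.1 h).2
  have h2 : f * (w - f) ≤ M * e := by
    refine (le_abs_self _).trans ?_
    rw [abs_mul]
    exact mul_le_mul hf h (abs_nonneg _) ((abs_nonneg _).trans hf)
  nlinarith

namespace IsFine

variable {F F₁ F₂ : ℝ → ℝ} {r R μ τ ε δ h x₀ : ℝ} {B : Finset ℝ} {p : ℕ} {t : ℤ → ℝ}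

/-- The surface energy of the phase field is at most that of the profiles, up to a small error. -/
theorem lintegral_phase_le (H : IsFine F F₁ F₂ r R μ τ B p ε δ h x₀ t) {ρ M : ℝ} (hρ : 0 < ρ)
    (hM : ∀ x, |F₁ x| ≤ M ∧ |F₂ x| ≤ M) (hτ : 0 ≤ τ) (hτ1 : τ ≤ 1) (S : Set ℝ) :
    ∫⁻ x in S, ENNReal.ofReal (ε⁻¹ * schoenberg t (p + 2) (crackSum B F ε) x
        + ε * schoenberg₁ t (p + 2) (crackSum B F ε) x ^ 2
        + ρ * ε ^ 3 * schoenberg₂ t (p + 2) (crackSum B F ε) x ^ 2) ≤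
      ENNReal.ofReal (B.card * ((∫ x, (F x + F₁ x ^ 2 + ρ * F₂ x ^ 2))
        + 2 * (R + 1) * (τ * (2 + 2 * M + ρ * (8 * M + 16))))) := by
  have P := H.profile
  have hε := H.pos
  have hM0 : 0 ≤ M := (abs_nonneg _).trans (hM 0).1
  have hR : 0 < R := P.pos.trans P.lt
  -- The errors are `τ` from `v`, `2 M τ + τ²` from the slope and `ρ (8 M τ + 16 τ²)` from the
  -- second derivative, with `τ² ≤ τ`.
  set C := 2 + 2 * M + ρ * (8 * M + 16) with hC
  have hC0 : 0 ≤ C := by positivity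
  set E : ℝ → ℝ := fun x => F x + F₁ x ^ 2 + ρ * F₂ x ^ 2 with hE
  have hEc : Continuous E := (P.continuous.add (P.continuous₁.pow 2)).add
    (continuous_const.mul (P.continuous₂.pow 2))
  have hE0 : ∀ x, 0 ≤ E x := fun x => by
    have := (P.mem_Icc x).1
    simp only [hE]; positivity
  have hEi : Integrable E := hEc.integrable_of_hasCompactSupport
    (IsSmoothProfile.hasCompactSupport_of_eq_zero (R := R) fun x hx => by
      simp only [hE, P.eq_zero x hx.le, P.eq_zero₁ hx, P.eq_zero₂ hx]; simp)
  set I := Icc (-(R + 1)) (R + 1) with hI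
  -- A majorant of the rescaled density around one crack. Its width `R + 1` exceeds the support of
  -- the profile, to allow for the spread of the Schoenberg operator.
  set k : ℝ → ℝ := I.indicator fun x => E x + τ * C with hk
  have hk0 : ∀ x, 0 ≤ k x := fun x => indicator_nonneg (fun y _ => by
    have := hE0 y; positivity) x
  have hki : Integrable k := (integrable_indicator_iff measurableSet_Icc).2
    (hEc.add continuous_const).integrableOn_Icc
  have hkI : ∫ x, k x ≤ (∫ x, E x) + 2 * (R + 1) * (τ * C) := by
    rw [hk, integral_indicator measurableSet_Icc,
      integral_add hEi.integrableOn (integrable_const _), setIntegral_const,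
      Real.volume_real_Icc_of_le (by linarith), smul_eq_mul]
    have := setIntegral_le_integral (s := I) hEi (Eventually.of_forall hE0)
    linarith
  have hint : ∀ s : ℝ, Integrable fun x => ε⁻¹ * k ((x - s) / ε) := fun s =>
    ((hki.comp_div hε.ne').comp_sub_right s).const_mul _
  have hval : ∀ s : ℝ, ∫ x, ε⁻¹ * k ((x - s) / ε) = ∫ x, k x := fun s => by
    rw [integral_const_mul, integral_sub_right_eq_self (fun x => k (x / ε)) s,
      Measure.integral_comp_div, abs_of_pos hε, smul_eq_mul, inv_mul_cancel_left₀ hε.ne']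
  have hbound : ∀ x, ε⁻¹ * schoenberg t (p + 2) (crackSum B F ε) x
        + ε * schoenberg₁ t (p + 2) (crackSum B F ε) x ^ 2
        + ρ * ε ^ 3 * schoenberg₂ t (p + 2) (crackSum B F ε) x ^ 2 ≤
      ∑ s ∈ B, ε⁻¹ * k ((x - s) / ε) := by
    intro x
    have hnn : ∀ s ∈ B, 0 ≤ ε⁻¹ * k ((x - s) / ε) := fun s _ =>
      mul_nonneg (inv_pos.2 hε).le (hk0 _)
    by_cases hx : ∃ s ∈ B, |x - s| ≤ (R + 1) * ε
    · obtain ⟨s, hs, hx⟩ := hx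
      refine le_trans ?_ (Finset.single_le_sum hnn hs)
      obtain ⟨b0, b1, b2⟩ := H.schoenberg_near hs hx
      have hmem : (x - s) / ε ∈ I := abs_le.1 (by
        rw [abs_div, abs_of_pos hε, div_le_iff₀ hε]; exact hx)
      rw [hk, indicator_of_mem hmem]
      set v := schoenberg t (p + 2) (crackSum B F ε) x
      set v₁ := schoenberg₁ t (p + 2) (crackSum B F ε) x
      set v₂ := schoenberg₂ t (p + 2) (crackSum B F ε) x
      set ξ := (x - s) / ε
      have c1 : |ε * v₁ - F₁ ξ| ≤ τ := by
        have : ε * v₁ - F₁ ξ = ε * (v₁ - ε⁻¹ * F₁ ξ) := by field_simp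
        rw [this, abs_mul, abs_of_pos hε]
        calc ε * |v₁ - ε⁻¹ * F₁ ξ| ≤ ε * (ε⁻¹ * τ) := mul_le_mul_of_nonneg_left b1 hε.le
          _ = τ := by field_simp
      have c2 : |ε ^ 2 * v₂ - F₂ ξ| ≤ 4 * τ := by
        have : ε ^ 2 * v₂ - F₂ ξ = ε ^ 2 * (v₂ - ε⁻¹ * (ε⁻¹ * F₂ ξ)) := by field_simp
        rw [this, abs_mul, abs_of_pos (by positivity)]
        calc ε ^ 2 * |v₂ - ε⁻¹ * (ε⁻¹ * F₂ ξ)| ≤ ε ^ 2 * (ε⁻¹ * (ε⁻¹ * (4 * τ))) :=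
              mul_le_mul_of_nonneg_left b2 (by positivity)
          _ = 4 * τ := by field_simp
      have d1 := sq_le_of_abs_sub_le c1 (hM ξ).1
      have d2 := sq_le_of_abs_sub_le c2 (hM ξ).2
      have d0 := (abs_le.1 b0).2
      have e1 : ε⁻¹ * v + ε * v₁ ^ 2 + ρ * ε ^ 3 * v₂ ^ 2 =
          ε⁻¹ * (v + (ε * v₁) ^ 2 + ρ * (ε ^ 2 * v₂) ^ 2) := by field_simp
      rw [e1]
      refine mul_le_mul_of_nonneg_left ?_ (inv_pos.2 hε).le
      have hττ : τ ^ 2 ≤ τ := by nlinarith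
      have d3 : ρ * (ε ^ 2 * v₂) ^ 2 ≤ ρ * (F₂ ξ ^ 2 + τ * (8 * M + 16)) :=
        mul_le_mul_of_nonneg_left (by nlinarith) hρ.le
      simp only [hE, hC]
      nlinarith
    · push Not at hx
      obtain ⟨b0, b1, b2⟩ := H.schoenberg_far hx
      rw [b0, b1, b2]
      simpa using Finset.sum_nonneg hnn
  calc _ ≤ ∫⁻ x in S, ENNReal.ofReal (∑ s ∈ B, ε⁻¹ * k ((x - s) / ε)) :=
        lintegral_mono fun x => ENNReal.ofReal_le_ofReal (hbound x)
    _ ≤ ∫⁻ x, ENNReal.ofReal (∑ s ∈ B, ε⁻¹ * k ((x - s) / ε)) := setLIntegral_le_lintegral _ _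
    _ = ENNReal.ofReal (∫ x, ∑ s ∈ B, ε⁻¹ * k ((x - s) / ε)) :=
        (ofReal_integral_eq_lintegral_ofReal (integrable_finsetSum _ fun s _ => hint s)
          (Eventually.of_forall fun x => Finset.sum_nonneg fun s _ =>
            mul_nonneg (inv_pos.2 hε).le (hk0 _))).symm
    _ ≤ _ := by
        refine ENNReal.ofReal_le_ofReal ?_
        rw [integral_finsetSum _ fun s _ => hint s]
        simp only [hval]
        rw [Finset.sum_const, nsmul_eq_mul]
        exact mul_le_mul_of_nonneg_left hkI (Nat.cast_nonneg _)

end IsFine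

/-! ### The displacement of the recovery sequence -/

theorem exists_bound_deriv_smoothTransition :
    ∃ L, 0 ≤ L ∧ ∀ x, deriv Real.smoothTransition x ∈ Icc 0 L := by
  have hc : Continuous (deriv Real.smoothTransition) :=
    (Real.smoothTransition.contDiff (n := 1)).continuous_deriv le_rfl
  obtain ⟨L, hL⟩ := isCompact_Icc.exists_bound_of_continuousOn (s := Icc (0 : ℝ) 1) hc.continuousOn
  refine ⟨max L 0, le_max_right _ _, fun x => ⟨Real.smoothTransition.monotone.deriv_nonneg, ?_⟩⟩
  by_cases hx : x ∈ Icc (0 : ℝ) 1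
  · exact (le_abs_self _).trans ((hL x hx).trans (le_max_left _ _))
  · refine le_trans (le_of_eq ?_) (le_max_right _ _)
    rw [mem_Icc, not_and_or, not_le, not_le] at hx
    rcases hx with hx | hx
    · have : Real.smoothTransition =ᶠ[𝓝 x] fun _ => 0 := by
        filter_upwards [Iio_mem_nhds hx] with y hy
          using Real.smoothTransition.zero_of_nonpos (le_of_lt hy)
      rw [this.deriv_eq, deriv_const]
    · have : Real.smoothTransition =ᶠ[𝓝 x] fun _ => 1 := by
        filter_upwards [Ioi_mem_nhds hx] with y hy
          using Real.smoothTransition.one_of_one_le (le_of_lt hy)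
      rw [this.deriv_eq, deriv_const]

theorem deriv_smoothTransition_of_one_lt {x : ℝ} (hx : 1 < |x|) :
    deriv Real.smoothTransition x = 0 := by
  rcases lt_abs.1 hx with hx | hx
  · have : Real.smoothTransition =ᶠ[𝓝 x] fun _ => 1 := by
      filter_upwards [Ioi_mem_nhds hx] with y hy
        using Real.smoothTransition.one_of_one_le (le_of_lt hy)
    rw [this.deriv_eq, deriv_const]
  · have : Real.smoothTransition =ᶠ[𝓝 x] fun _ => 0 := by
      filter_upwards [Iio_mem_nhds (show x < 0 by linarith)] with y hy
        using Real.smoothTransition.zero_of_nonpos (le_of_lt hy)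
    rw [this.deriv_eq, deriv_const]

theorem smoothTransition_div_eq_heaviside {s x y l : ℝ} (hl : 0 < l) (h : |y - x| + l < |x - s|) :
    Real.smoothTransition ((y - s) / l) = heaviside s x := by
  rcases lt_or_ge s x with hx | hx
  · rw [abs_of_pos (sub_pos.2 hx)] at h
    have := neg_abs_le (y - x)
    rw [heaviside_of_lt hx, Real.smoothTransition.one_of_one_le]
    rw [le_div_iff₀ hl]; linarith
  · rw [abs_of_nonpos (sub_nonpos.2 hx)] at h
    have := le_abs_self (y - x)
    rw [heaviside_of_le hx, Real.smoothTransition.zero_of_nonpos]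
    exact div_nonpos_of_nonpos_of_nonneg (by linarith) hl.le

/-- The displacement with slope `g`, opening by `j s` over a length `l` at the points `s ∈ B`. -/
def smoothRep (a c : ℝ) (g : ℝ → ℝ) (B : Finset ℝ) (j : ℝ → ℝ) (l x : ℝ) : ℝ :=
  (c + ∫ t in a..x, g t) + ∑ s ∈ B, j s * Real.smoothTransition ((x - s) / l)

theorem hasDerivAt_smoothRep (a c : ℝ) {g : ℝ → ℝ} (hg : Continuous g) (B : Finset ℝ) (j : ℝ → ℝ)
    (l x : ℝ) : HasDerivAt (smoothRep a c g B j l)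
      (g x + ∑ s ∈ B, j s * (deriv Real.smoothTransition ((x - s) / l) * (1 / l))) x := by
  have h1 : HasDerivAt (fun x => c + ∫ t in a..x, g t) (g x) x :=
    (intervalIntegral.integral_hasDerivAt_right (hg.intervalIntegrable _ _)
      hg.stronglyMeasurable.stronglyMeasurableAtFilter hg.continuousAt).const_add c
  have hd : ∀ y, HasDerivAt Real.smoothTransition (deriv Real.smoothTransition y) y := fun y =>
    ((Real.smoothTransition.contDiff (n := 1)).differentiable (by norm_num) y).hasDerivAt
  have h2 : ∀ s ∈ B, HasDerivAt (fun x => j s * Real.smoothTransition ((x - s) / l))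
      (j s * (deriv Real.smoothTransition ((x - s) / l) * (1 / l))) x := fun s _ =>
    (HasDerivAt.comp (h₂ := Real.smoothTransition) x (hd ((x - s) / l))
      (((hasDerivAt_id x).sub_const s).div_const l)).const_mul (j s)
  exact h1.add (HasDerivAt.fun_sum h2)

/-- The number of points of `B` within distance `d` of `x`. -/
def zoneCount (B : Finset ℝ) (d x : ℝ) : ℝ :=
  ∑ s ∈ B, (Icc (s - d) (s + d)).indicator (fun _ => (1 : ℝ)) x

theorem zoneCount_nonneg (B : Finset ℝ) (d x : ℝ) : 0 ≤ zoneCount B d x :=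
  Finset.sum_nonneg fun _ _ => indicator_nonneg (fun _ _ => zero_le_one) _

theorem one_le_zoneCount {B : Finset ℝ} {d x s : ℝ} (hs : s ∈ B) (h : |x - s| ≤ d) :
    1 ≤ zoneCount B d x := by
  have h1 : (Icc (s - d) (s + d)).indicator (fun _ => (1 : ℝ)) x = 1 :=
    indicator_of_mem (by rw [abs_le] at h; constructor <;> linarith [h.1, h.2]) _
  rw [← h1]
  exact Finset.single_le_sum
    (f := fun s => (Icc (s - d) (s + d)).indicator (fun _ => (1 : ℝ)) x)
    (fun _ _ => indicator_nonneg (fun _ _ => zero_le_one) _) hs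

theorem integrable_zoneCount (B : Finset ℝ) (d : ℝ) : Integrable (zoneCount B d) :=
  integrable_finsetSum _ fun _ _ => (integrable_indicator_iff measurableSet_Icc).2
    (by simp [integrableOn_const_iff])

theorem setIntegral_zoneCount_le (B : Finset ℝ) {d : ℝ} (hd : 0 ≤ d) (S : Set ℝ) :
    ∫ x in S, zoneCount B d x ≤ B.card * (2 * d) := by
  refine (setIntegral_le_integral (integrable_zoneCount B d)
    (Eventually.of_forall (zoneCount_nonneg B d))).trans (le_of_eq ?_)
  have hi : ∀ s ∈ B, Integrable ((Icc (s - d) (s + d)).indicator fun _ => (1 : ℝ)) := fun s _ =>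
    (integrable_indicator_iff measurableSet_Icc).2 (by simp [integrableOn_const_iff])
  simp only [zoneCount]
  rw [integral_finsetSum _ hi, ← nsmul_eq_mul, ← Finset.sum_const]
  refine Finset.sum_congr rfl fun s _ => ?_
  rw [integral_indicator measurableSet_Icc, setIntegral_const,
    Real.volume_real_Icc_of_le (by linarith), smul_eq_mul]
  ring

namespace IsFine

variable {F F₁ F₂ : ℝ → ℝ} {r R μ τ ε δ h x₀ a c : ℝ} {B : Finset ℝ} {p : ℕ} {t : ℤ → ℝ}
  {g j : ℝ → ℝ}

/-- The two sides behave differently: the tensile strain may reach order `1 / ε`, but since all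
jumps open, the compressive strain stays bounded by `M` and costs only `O(ε)` in the opening zones.
-/
theorem schoenberg₁_smoothRep_mem (H : IsFine F F₁ F₂ r R μ τ B p ε δ h x₀ t) (hg : Continuous g)
    {M L : ℝ} (hM : ∀ x, |g x| ≤ M) (hj : ∀ s ∈ B, 0 ≤ j s)
    (hL : ∀ x, deriv Real.smoothTransition x ∈ Icc 0 L) (x : ℝ) :
    schoenberg₁ t (p + 2) (smoothRep a c g B j (r / 4 * ε)) x ∈
      Icc (-M) (M + (∑ s ∈ B, j s) * (L * (1 / (r / 4 * ε)))) := by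
  have hl : 0 < r / 4 * ε := by have := H.profile.pos; have := H.pos; positivity
  refine H.knots.schoenberg₁_mem (p + 1) (hasDerivAt_smoothRep a c hg B j _) fun y _ => ?_
  have h1 := abs_le.1 (hM y)
  have h2 : 0 ≤ ∑ s ∈ B, j s * (deriv Real.smoothTransition ((y - s) / (r / 4 * ε)) *
      (1 / (r / 4 * ε))) := Finset.sum_nonneg fun s hs => mul_nonneg (hj s hs)
        (mul_nonneg (hL _).1 (by positivity))
  have h3 : ∑ s ∈ B, j s * (deriv Real.smoothTransition ((y - s) / (r / 4 * ε)) *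
      (1 / (r / 4 * ε))) ≤ (∑ s ∈ B, j s) * (L * (1 / (r / 4 * ε))) := by
    rw [Finset.sum_mul]
    exact Finset.sum_le_sum fun s hs => mul_le_mul_of_nonneg_left
      (mul_le_mul_of_nonneg_right (hL _).2 (by positivity)) (hj s hs)
  constructor <;> linarith

theorem lt_of_far (H : IsFine F F₁ F₂ r R μ τ B p ε δ h x₀ t) {x y s : ℝ}
    (hx : r / 2 * ε < |x - s|) (hy : |y - x| ≤ μ * ε) : |y - x| + r / 4 * ε < |x - s| := by
  nlinarith [H.pos, H.μ_le']

theorem schoenberg₁_smoothRep_far (H : IsFine F F₁ F₂ r R μ τ B p ε δ h x₀ t) (hg : Continuous g)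
    (hmod : ∀ x y, |x - y| ≤ μ * ε → |g x - g y| ≤ τ) {x : ℝ}
    (hx : ∀ s ∈ B, r / 2 * ε < |x - s|) :
    |schoenberg₁ t (p + 2) (smoothRep a c g B j (r / 4 * ε)) x - g x| ≤ τ := by
  have hl : 0 < r / 4 * ε := by have := H.profile.pos; have := H.pos; positivity
  have : schoenberg₁ t (p + 2) (smoothRep a c g B j (r / 4 * ε)) x ∈ Icc (g x - τ) (g x + τ) := by
    refine H.knots.schoenberg₁_mem (p + 1) (hasDerivAt_smoothRep a c hg B j _) fun y hy => ?_
    have h1 := H.abs_sub_le (mem_nhds_cast hy)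
    rw [Finset.sum_eq_zero fun s hs => ?_, add_zero]
    · have := abs_le.1 (hmod y x h1)
      constructor <;> linarith
    · rw [deriv_smoothTransition_of_one_lt, zero_mul, mul_zero]
      rw [abs_div, abs_of_pos hl, lt_div_iff₀ hl, one_mul]
      have h2 := H.lt_of_far (hx s hs) h1
      have h3 : |x - s| ≤ |y - x| + |y - s| := by
        have := abs_sub (y - s) (y - x)
        rw [sub_sub_sub_cancel_left] at this
        linarith
      linarith
  rw [abs_le]; constructor <;> linarith [this.1, this.2]

/-- Away from the opening zones the smooth steps agree with the Heaviside functions at all samples,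
so only the slope contributes. In the zones the error is at most the total jump times the number of
zones containing `x`, on a set of measure `O(ε)`. -/
theorem abs_schoenberg_smoothRep_sub_le (H : IsFine F F₁ F₂ r R μ τ B p ε δ h x₀ t)
    (hg : Continuous g) {M : ℝ} (hM : ∀ x, |g x| ≤ M) (hj : ∀ s ∈ B, 0 ≤ j s) (x : ℝ) :
    |schoenberg t (p + 2) (smoothRep a c g B j (r / 4 * ε)) x - sbvRep a c g B j x| ≤
      M * (μ * ε) + (∑ s ∈ B, j s) * zoneCount B (r / 2 * ε) x := by
  have hl : 0 < r / 4 * ε := by have := H.profile.pos; have := H.pos; positivity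
  have hJ : 0 ≤ ∑ s ∈ B, j s := Finset.sum_nonneg hj
  have hM0 : 0 ≤ M := (abs_nonneg _).trans (hM 0)
  suffices hmem : ∀ y, |y - x| ≤ μ * ε → |smoothRep a c g B j (r / 4 * ε) y - sbvRep a c g B j x| ≤
      M * (μ * ε) + (∑ s ∈ B, j s) * zoneCount B (r / 2 * ε) x by
    have : schoenberg t (p + 2) (smoothRep a c g B j (r / 4 * ε)) x ∈
        Icc (sbvRep a c g B j x - (M * (μ * ε) + (∑ s ∈ B, j s) * zoneCount B (r / 2 * ε) x))
          (sbvRep a c g B j x + (M * (μ * ε) + (∑ s ∈ B, j s) * zoneCount B (r / 2 * ε) x)) := by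
      refine H.knots.schoenberg_mem (p + 1) fun y hy => ?_
      have := abs_le.1 (hmem y (H.abs_sub_le (mem_nhds_cast hy)))
      constructor <;> linarith
    rw [abs_le]; constructor <;> linarith [this.1, this.2]
  intro y hy
  have e : smoothRep a c g B j (r / 4 * ε) y - sbvRep a c g B j x = (∫ s in x..y, g s) +
      ∑ s ∈ B, j s * (Real.smoothTransition ((y - s) / (r / 4 * ε)) - heaviside s x) := by
    have h1 := intervalIntegral.integral_interval_sub_left (μ := volume) (a := a) (b := y) (c := x)
      (hg.intervalIntegrable _ _) (hg.intervalIntegrable _ _)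
    rw [smoothRep, sbvRep, ← h1]
    simp only [mul_sub, Finset.sum_sub_distrib]
    linarith
  rw [e]
  refine (abs_add_le _ _).trans (add_le_add ?_ ?_)
  · have := intervalIntegral.norm_integral_le_of_norm_le_const (a := x) (b := y) (f := g) (C := M)
      fun s _ => hM s
    exact this.trans (mul_le_mul_of_nonneg_left hy hM0)
  · refine (Finset.abs_sum_le_sum_abs _ _).trans ?_
    rw [Finset.sum_mul]
    refine Finset.sum_le_sum fun s hs => ?_
    rw [abs_mul, abs_of_nonneg (hj s hs)]
    refine mul_le_mul_of_nonneg_left ?_ (hj s hs)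
    rcases lt_or_ge (r / 2 * ε) |x - s| with hx | hx
    · rw [smoothTransition_div_eq_heaviside hl (H.lt_of_far hx hy), sub_self, abs_zero]
      exact zoneCount_nonneg _ _ _
    · refine le_trans ?_ (one_le_zoneCount hs hx)
      have h1 := Real.smoothTransition.nonneg ((y - s) / (r / 4 * ε))
      have h2 := Real.smoothTransition.le_one ((y - s) / (r / 4 * ε))
      unfold heaviside
      split_ifs <;> rw [abs_le] <;> constructor <;> linarith

/-- The bulk energy of the recovery sequence. -/
theorem lintegral_bulk_le (H : IsFine F F₁ F₂ r R μ τ B p ε δ h x₀ t) (hg : Continuous g)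
    {M L κ η b : ℝ} (hM : ∀ x, |g x| ≤ M) (hj : ∀ s ∈ B, 0 ≤ j s) (hκ : 0 < κ) (hη : 0 < η)
    (hab : a < b) (hL : ∀ x, deriv Real.smoothTransition x ∈ Icc 0 L) (hτ : 0 ≤ τ) (hτ1 : τ ≤ 1)
    (hmod : ∀ x y, |x - y| ≤ μ * ε → |g x - g y| ≤ τ) :
    ∫⁻ x in Ioo a b, ENNReal.ofReal
      (κ * ((schoenberg t (p + 2) (crackSum B F ε) x - 1) ^ 2 + η) *
          (max (schoenberg₁ t (p + 2) (smoothRep a c g B j (r / 4 * ε)) x) 0) ^ 2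
        + κ * (max (-schoenberg₁ t (p + 2) (smoothRep a c g B j (r / 4 * ε)) x) 0) ^ 2) ≤
    ENNReal.ofReal (κ * (1 + η) * ((∫ x in Ioo a b, g x ^ 2) + τ * (2 * M + 1) * (b - a))
      + (κ * η * (M + (∑ s ∈ B, j s) * (L * (1 / (r / 4 * ε)))) ^ 2 + κ * M ^ 2) *
        (B.card * (r * ε))) := by
  have hε := H.pos
  have hr := H.profile.pos
  have hM0 : 0 ≤ M := (abs_nonneg _).trans (hM 0)
  set N := M + (∑ s ∈ B, j s) * (L * (1 / (r / 4 * ε))) with hN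
  set Z := κ * η * N ^ 2 + κ * M ^ 2 with hZ
  have hZ0 : 0 ≤ Z := by positivity
  set D : ℝ → ℝ := fun x => κ * (1 + η) * (g x ^ 2 + τ * (2 * M + 1)) +
    Z * zoneCount B (r / 2 * ε) x with hD
  have ig : IntegrableOn (fun x => g x ^ 2) (Ioo a b) :=
    (hg.pow 2).integrableOn_Icc.mono_set Ioo_subset_Icc_self
  have ic : IntegrableOn (fun _ : ℝ => τ * (2 * M + 1)) (Ioo a b) := 
    continuous_const.integrableOn_Icc.mono_set Ioo_subset_Icc_self
  have iz : IntegrableOn (zoneCount B (r / 2 * ε)) (Ioo a b) := (integrable_zoneCount _ _).integrableOn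
  have hD0 : ∀ x, 0 ≤ D x := fun x => by
    have := zoneCount_nonneg B (r / 2 * ε) x
    simp only [hD]; positivity
  have hDi : IntegrableOn D (Ioo a b) := ((ig.add ic).const_mul _).add (iz.const_mul Z)
  have hbound : ∀ x, κ * ((schoenberg t (p + 2) (crackSum B F ε) x - 1) ^ 2 + η) *
          (max (schoenberg₁ t (p + 2) (smoothRep a c g B j (r / 4 * ε)) x) 0) ^ 2
        + κ * (max (-schoenberg₁ t (p + 2) (smoothRep a c g B j (r / 4 * ε)) x) 0) ^ 2 ≤ D x := by
    intro x
    have hu := H.schoenberg₁_smoothRep_mem (a := a) (c := c) hg hM hj hL x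
    have hv := H.schoenberg_mem_unit x
    rw [← hN] at hu
    set v := schoenberg t (p + 2) (crackSum B F ε) x with hvdef
    set u := schoenberg₁ t (p + 2) (smoothRep a c g B j (r / 4 * ε)) x with hudef
    -- In an opening zone `v = 1`, so the large tensile strain is weighted by `η` only. Outside, the
    -- strain is close to `g` and the crude bound `(v - 1)² ≤ 1` suffices.
    by_cases hx : ∃ s ∈ B, |x - s| ≤ r / 2 * ε
    · obtain ⟨s, hs, hx⟩ := hx
      have hv1 : v = 1 := H.schoenberg_eq_one hs hx
      have hN0 : 0 ≤ N := hM0.trans (le_add_of_nonneg_right (mul_nonneg (Finset.sum_nonneg hj)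
        (mul_nonneg ((hL 0).1.trans (hL 0).2) (by positivity))))
      have h1 : (max u 0) ^ 2 ≤ N ^ 2 := pow_le_pow_left₀ (le_max_right _ _) (max_le hu.2 hN0) 2
      have h2 : (max (-u) 0) ^ 2 ≤ M ^ 2 :=
        pow_le_pow_left₀ (le_max_right _ _) (max_le (by linarith [hu.1]) hM0) 2
      have h3 : κ * ((v - 1) ^ 2 + η) * (max u 0) ^ 2 + κ * (max (-u) 0) ^ 2 ≤ Z := by
        rw [hv1, sub_self, zero_pow two_ne_zero, zero_add]
        exact add_le_add (mul_le_mul_of_nonneg_left h1 (by positivity))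
          (mul_le_mul_of_nonneg_left h2 hκ.le)
      have h4 : Z ≤ Z * zoneCount B (r / 2 * ε) x := le_mul_of_one_le_right hZ0
        (one_le_zoneCount hs hx)
      have h5 : 0 ≤ κ * (1 + η) * (g x ^ 2 + τ * (2 * M + 1)) := by positivity
      simp only [hD]
      linarith
    · push Not at hx
      have h1 := sq_le_of_abs_sub_le
        (H.schoenberg₁_smoothRep_far (a := a) (c := c) (j := j) hg hmod hx) (hM x)
      rw [← hudef] at h1
      have h2 : (v - 1) ^ 2 ≤ 1 := by nlinarith [hv.1, hv.2]
      have h3 := max_sq_add_max_sq u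
      have h4 : u ^ 2 ≤ g x ^ 2 + τ * (2 * M + 1) := by nlinarith
      have h5 : κ * ((v - 1) ^ 2 + η) * (max u 0) ^ 2 + κ * (max (-u) 0) ^ 2 ≤
          κ * (1 + η) * u ^ 2 := by
        rw [← h3, mul_add (κ * (1 + η))]
        refine add_le_add ?_ ?_
        · exact mul_le_mul_of_nonneg_right (mul_le_mul_of_nonneg_left (by linarith) hκ.le)
            (sq_nonneg _)
        · refine mul_le_mul_of_nonneg_right ?_ (sq_nonneg _)
          nlinarith
      have h6 : 0 ≤ Z * zoneCount B (r / 2 * ε) x := mul_nonneg hZ0 (zoneCount_nonneg _ _ _)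
      have h7 : κ * (1 + η) * u ^ 2 ≤ κ * (1 + η) * (g x ^ 2 + τ * (2 * M + 1)) :=
        mul_le_mul_of_nonneg_left h4 (by positivity)
      simp only [hD]
      linarith
  refine (lintegral_mono fun x => ENNReal.ofReal_le_ofReal (hbound x)).trans ?_
  rw [← ofReal_integral_eq_lintegral_ofReal hDi (Eventually.of_forall hD0)]
  refine ENNReal.ofReal_le_ofReal ?_
  have e1 : ∫ x in Ioo a b, D x = κ * (1 + η) * ((∫ x in Ioo a b, g x ^ 2) +
      τ * (2 * M + 1) * (b - a)) + Z * ∫ x in Ioo a b, zoneCount B (r / 2 * ε) x := by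
    refine (integral_add ((ig.add ic).const_mul _) (iz.const_mul Z)).trans ?_
    rw [integral_const_mul, integral_const_mul]
    congr 2
    refine (integral_add ig ic).trans ?_
    rw [setIntegral_const, Real.volume_real_Ioo_of_le hab.le, smul_eq_mul]
    ring
  rw [e1]
  have := setIntegral_zoneCount_le B (d := r / 2 * ε) (by positivity) (Ioo a b)
  have h8 := mul_le_mul_of_nonneg_left this hZ0
  have h9 : (B.card : ℝ) * (2 * (r / 2 * ε)) = B.card * (r * ε) := by ring
  rw [h9] at h8
  linarith

end IsFine

end ATFracture
end

noncomputable section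
namespace ATFracture

/-! ### Recovery sequences -/

theorem atFunctional_eq {a b κ G ρ c η ε : ℝ} {z : L1 a b × L1 a b} {u u₁ v v₁ v₂ : ℝ → ℝ}
    (hu : z.1 =ᵐ[volume.restrict (Ioo a b)] u) (hv : z.2 =ᵐ[volume.restrict (Ioo a b)] v)
    (du : IsWeakDeriv (Ioo a b) u u₁) (dv : IsWeakDeriv (Ioo a b) v v₁)
    (dv₁ : IsWeakDeriv (Ioo a b) v₁ v₂) (mu : MemLp u 2 (volume.restrict (Ioo a b)))
    (mu₁ : MemLp u₁ 2 (volume.restrict (Ioo a b))) (mv : MemLp v 2 (volume.restrict (Ioo a b)))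
    (mv₁ : MemLp v₁ 2 (volume.restrict (Ioo a b))) (mv₂ : MemLp v₂ 2 (volume.restrict (Ioo a b)))
    (hI : ∀ x, v x ∈ Icc (0 : ℝ) 1) :
    atFunctional a b κ G ρ c η ε z =
      (∫⁻ x in Ioo a b, ENNReal.ofReal
        (κ * ((v x - 1) ^ 2 + η) * (max (u₁ x) 0) ^ 2 + κ * (max (-u₁ x) 0) ^ 2))
      + ENNReal.ofReal (G / c) * ∫⁻ x in Ioo a b, ENNReal.ofReal
        (ε⁻¹ * v x + ε * v₁ x ^ 2 + ρ * ε ^ 3 * v₂ x ^ 2) := by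
  have du' := du.congr hu.symm (ae_eq_refl _)
  have dv' := dv.congr hv.symm (ae_eq_refl _)
  have e1 := du'.weakDeriv_ae_eq isOpen_Ioo
  have e2 := dv'.weakDeriv_ae_eq isOpen_Ioo
  have e3 := dv'.weakDeriv_weakDeriv_ae_eq isOpen_Ioo dv₁
  rw [atFunctional, if_pos, atEnergy]
  · congr 1
    · refine lintegral_congr_ae ?_
      filter_upwards [hv, e1] with x h1 h2
      rw [h1, h2]
    · congr 1
      refine lintegral_congr_ae ?_
      filter_upwards [hv, e2, e3] with x h1 h2 h3
      rw [h1, h2, h3]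
  · refine ⟨⟨mu.ae_eq hu.symm, u₁, du', mu₁⟩, ⟨⟨mv.ae_eq hv.symm, v₁, dv', mv₁⟩,
      mv₁.ae_eq e2.symm, v₂, dv₁.congr e2.symm (ae_eq_refl _), mv₂⟩, ?_⟩
    filter_upwards [hv] with x hx
    rw [hx]; exact hI x

/-- Square integrable functions are approximated by continuous functions with compact support, in
energy and in mean. -/
theorem exists_continuous_approx {a b : ℝ} (hab : a < b) {g : ℝ → ℝ}
    (hg : MemLp g 2 (volume.restrict (Ioo a b))) {e : ℝ} (he : 0 < e) :
    ∃ f : ℝ → ℝ, Continuous f ∧ HasCompactSupport f ∧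
      ∫ x in Ioo a b, f x ^ 2 ≤ (∫ x in Ioo a b, g x ^ 2) + e ∧
      ∫ x in Ioo a b, |f x - g x| ≤ e := by
  set N := ‖hg.toLp g‖ with hN
  have hN0 : 0 ≤ N := norm_nonneg _
  obtain ⟨d, hd, hd1, hd2⟩ : ∃ d, 0 < d ∧ d * (2 * N + d) ≤ e ∧ d * ((b - a) / 2 + 1 / 2) ≤ e := by
    have t1 : Tendsto (fun d : ℝ => d * (2 * N + d)) (𝓝[>] 0) (𝓝 0) := by
      have : Continuous fun d : ℝ => d * (2 * N + d) := by fun_prop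
      simpa using (this.tendsto 0).mono_left nhdsWithin_le_nhds
    have t2 : Tendsto (fun d : ℝ => d * ((b - a) / 2 + 1 / 2)) (𝓝[>] 0) (𝓝 0) := by
      have : Continuous fun d : ℝ => d * ((b - a) / 2 + 1 / 2) := by fun_prop
      simpa using (this.tendsto 0).mono_left nhdsWithin_le_nhds
    obtain ⟨d, h1, h2, h3⟩ := ((self_mem_nhdsWithin : Ioi (0 : ℝ) ∈ 𝓝[>] 0)
      |> fun h => (eventually_mem_set.2 h).and ((t1.eventually (eventually_le_nhds he)).and
        (t2.eventually (eventually_le_nhds he)))).exists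
    exact ⟨d, h1, h2, h3⟩
  obtain ⟨f, hfs, hfd, hfc, hfm⟩ := hg.exists_hasCompactSupport_eLpNorm_sub_le (by norm_num)
    (ε := ENNReal.ofReal d) (by simpa using hd)
  have hD : MemLp (g - f) 2 (volume.restrict (Ioo a b)) := hg.sub hfm
  have hDn : ‖hD.toLp (g - f)‖ ≤ d := by
    rw [Lp.norm_toLp]
    exact ENNReal.toReal_le_of_le_ofReal hd.le hfd
  have hDsq : ∫ x in Ioo a b, (g - f) x ^ 2 ≤ d ^ 2 := by
    rw [MemLp.integral_sq_eq hD]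
    exact pow_le_pow_left₀ (norm_nonneg _) hDn 2
  refine ⟨f, hfc, hfs, ?_, ?_⟩
  · rw [MemLp.integral_sq_eq hfm, MemLp.integral_sq_eq hg, ← hN]
    have h1 : ‖hfm.toLp f‖ ≤ N + d := by
      have : hfm.toLp f = hg.toLp g - hD.toLp (g - f) := by
        rw [MemLp.toLp_sub hg hfm, sub_sub_cancel]
      rw [this]
      exact (norm_sub_le _ _).trans (by linarith)
    have h2 := pow_le_pow_left₀ (norm_nonneg _) h1 2
    nlinarith
  · have hi : Integrable (fun x => d / 2 + (g - f) x ^ 2 / (2 * d)) (volume.restrict (Ioo a b)) :=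
      (integrable_const _).add (hD.integrable_sq.div_const _)
    have hle : ∀ x, |f x - g x| ≤ d / 2 + (g - f) x ^ 2 / (2 * d) := fun x => by
      have e1 : d / 2 + (g - f) x ^ 2 / (2 * d) = (d ^ 2 + (g - f) x ^ 2) / (2 * d) := by
        field_simp
      rw [e1, le_div_iff₀ (by positivity), abs_sub_comm, Pi.sub_apply]
      nlinarith [sq_nonneg (|g x - f x| - d), sq_abs (g x - f x)]
    have hi' : Integrable (fun x => |f x - g x|) (volume.restrict (Ioo a b)) :=
      ((hfm.sub hg).integrable (by norm_num)).abs
    refine (integral_mono hi' hi hle).trans ?_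
    have e2 : ∫ x in Ioo a b, (d / 2 + (g - f) x ^ 2 / (2 * d)) =
        (b - a) * (d / 2) + (∫ x in Ioo a b, (g - f) x ^ 2) / (2 * d) := by
      refine (integral_add (integrable_const _) (hD.integrable_sq.div_const _)).trans ?_
      rw [setIntegral_const, Real.volume_real_Ioo_of_le hab.le, smul_eq_mul, integral_div]
    rw [e2]
    have h3 : (∫ x in Ioo a b, (g - f) x ^ 2) / (2 * d) ≤ d / 2 := by
      rw [div_le_iff₀ (by positivity)]
      nlinarith
    linarith

theorem exists_of_crackFunctional_ne_top {a b κ G : ℝ} (hab : a < b) (hκ : 0 < κ) (hG : 0 < G)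
    {z : L1 a b × L1 a b} (hz : crackFunctional a b κ G z ≠ ⊤) :
    ∃ (c : ℝ) (g : ℝ → ℝ) (B : Finset ℝ) (j : ℝ → ℝ),
      MemLp g 2 (volume.restrict (Ioo a b)) ∧ (∀ s ∈ B, s ∈ Ioo a b) ∧ (∀ s ∈ B, 0 ≤ j s) ∧
      z.1 =ᵐ[volume.restrict (Ioo a b)] sbvRep a c g B j ∧
      (∀ᵐ x ∂volume.restrict (Ioo a b), z.2 x = 0) ∧
      crackFunctional a b κ G z =
        ENNReal.ofReal (κ * (∫ x in Ioo a b, g x ^ 2) + G * B.card) := by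
  unfold crackFunctional at hz ⊢
  split_ifs at hz ⊢ with h
  swap
  · exact absurd rfl hz
  obtain ⟨hsbv, hpos, hv⟩ := h
  obtain ⟨c, g, B, j, hg, hB, hBJ, hu⟩ := hsbv.exists_sbvRep hab
  have hgi : IntegrableOn g (Ioo a b) := hg.integrable (by norm_num)
  refine ⟨c, g, B, j, hg, hB, fun s hs => ?_, hu, hv, ?_⟩
  · have h1 := hpos s (by rw [← hBJ]; exact hs)
    rw [jump_of_ae_eq_sbvRep hgi hu (hB s hs), if_pos hs] at h1
    exact h1.le
  · rw [setLIntegral_weakDeriv_of_ae_eq_sbvRep hab κ hg hB hu (Lp.memLp z.1), ← hBJ,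
      Set.ncard_coe_finset, ← ofReal_integral_eq_lintegral_ofReal (hg.integrable_sq.const_mul κ)
      (Eventually.of_forall fun x => by positivity), integral_const_mul,
      ENNReal.ofReal_add (mul_nonneg hκ.le (integral_nonneg fun x => sq_nonneg _)) (by positivity),
      ENNReal.ofReal_mul hG.le, ENNReal.ofReal_natCast]

theorem dist_le_of_integral_le {a b : ℝ} {f z : L1 a b} {u : ℝ → ℝ} {e : ℝ}
    (hf : f =ᵐ[volume.restrict (Ioo a b)] u) (h : ∫ x in Ioo a b, |u x - z x| ≤ e) :
    dist f z ≤ e := by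
  rw [L1.dist_eq_integral_dist]
  refine (integral_congr_ae ?_).trans_le h
  filter_upwards [hf] with x hx
  rw [hx, Real.dist_eq]

namespace IsFine

variable {F F₁ F₂ : ℝ → ℝ} {r R μ τ ε δ h x₀ a b c : ℝ} {B : Finset ℝ} {p : ℕ} {t : ℤ → ℝ}
  {g j : ℝ → ℝ}

theorem memLp_schoenberg (H : IsFine F F₁ F₂ r R μ τ B p ε δ h x₀ t) (a b : ℝ) (f : ℝ → ℝ)
    (q : ℝ≥0∞) : MemLp (schoenberg t (p + 2) f) q (volume.restrict (Ioo a b)) ∧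
      MemLp (schoenberg₁ t (p + 2) f) q (volume.restrict (Ioo a b)) ∧
      MemLp (schoenberg₂ t (p + 2) f) q (volume.restrict (Ioo a b)) := by
  have hle : volume.restrict (Ioo a b) ≤ volume.restrict (Icc a b) :=
    Measure.restrict_mono Ioo_subset_Icc_self le_rfl
  exact ⟨(H.knots.isKnots.memLp_bSpline _ _ a b q).mono_measure hle,
    (H.knots.isKnots.memLp_bSpline _ _ a b q).mono_measure hle,
    (H.knots.isKnots.memLp_bSpline _ _ a b q).mono_measure hle⟩

theorem integral_displacement_sub_le (H : IsFine F F₁ F₂ r R μ τ B p ε δ h x₀ t) (hab : a < b)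
    (hg : Continuous g) {M : ℝ} (hM : ∀ x, |g x| ≤ M) (hj : ∀ s ∈ B, 0 ≤ j s) {γ : ℝ → ℝ}
    (hγ : IntegrableOn γ (Ioo a b)) {z : L1 a b}
    (hz : z =ᵐ[volume.restrict (Ioo a b)] sbvRep a c γ B j) {e : ℝ}
    (he : ∫ x in Ioo a b, |g x - γ x| ≤ e) :
    ∫ x in Ioo a b, |schoenberg t (p + 2) (smoothRep a c g B j (r / 4 * ε)) x - z x| ≤
      (M * (μ * ε) + e) * (b - a) + (∑ s ∈ B, j s) * (B.card * (r * ε)) := by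
  have hgi : IntegrableOn g (Ioo a b) := hg.integrableOn_Icc.mono_set Ioo_subset_Icc_self
  have hJ : 0 ≤ ∑ s ∈ B, j s := Finset.sum_nonneg hj
  have hd : IntegrableOn (fun x => |g x - γ x|) (Ioo a b) := (hgi.sub hγ).abs
  have hi1 : IntegrableOn (fun _ : ℝ => M * (μ * ε) + e) (Ioo a b) :=
    continuous_const.integrableOn_Icc.mono_set Ioo_subset_Icc_self
  have hi2 : IntegrableOn (fun x => (∑ s ∈ B, j s) * zoneCount B (r / 2 * ε) x) (Ioo a b) :=
    (integrable_zoneCount B _).integrableOn.const_mul _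
  have hpt : ∀ᵐ x ∂volume.restrict (Ioo a b),
      |schoenberg t (p + 2) (smoothRep a c g B j (r / 4 * ε)) x - z x| ≤
        (M * (μ * ε) + e) + (∑ s ∈ B, j s) * zoneCount B (r / 2 * ε) x := by
    filter_upwards [hz, ae_restrict_mem measurableSet_Ioo] with x hx hxm
    rw [hx]
    have h1 := H.abs_schoenberg_smoothRep_sub_le (a := a) (c := c) hg hM hj x
    have h2 : |sbvRep a c g B j x - sbvRep a c γ B j x| ≤ e := by
      have e1 : sbvRep a c g B j x - sbvRep a c γ B j x = ∫ s in a..x, (g s - γ s) := by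
        have hx' := Ioo_subset_Icc_self hxm
        rw [intervalIntegral.integral_sub
          (intervalIntegrable_of_integrableOn_Ioo hgi (left_mem_Icc.2 hab.le) hx')
          (intervalIntegrable_of_integrableOn_Ioo hγ (left_mem_Icc.2 hab.le) hx'), sbvRep, sbvRep]
        ring
      rw [e1]
      refine (intervalIntegral.abs_integral_le_integral_abs hxm.1.le).trans ?_
      rw [intervalIntegral.integral_of_le hxm.1.le]
      exact (setIntegral_mono_set hd (Eventually.of_forall fun _ => abs_nonneg _)
        (Eventually.of_forall fun y hy => ⟨hy.1, lt_of_le_of_lt hy.2 hxm.2⟩)).trans he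
    have h3 := _root_.abs_sub_le (schoenberg t (p + 2) (smoothRep a c g B j (r / 4 * ε)) x)
      (sbvRep a c g B j x) (sbvRep a c γ B j x)
    linarith
  have hi0 : IntegrableOn (fun x =>
      |schoenberg t (p + 2) (smoothRep a c g B j (r / 4 * ε)) x - z x|) (Ioo a b) :=
    ((memLp_one_iff_integrable.1 (H.memLp_schoenberg a b _ 1).1).sub (L1.integrable_coeFn z)).abs
  refine (integral_mono_ae hi0 (hi1.add hi2) hpt).trans ?_
  have e2 : ∫ x in Ioo a b, ((M * (μ * ε) + e) + (∑ s ∈ B, j s) * zoneCount B (r / 2 * ε) x) =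
      (M * (μ * ε) + e) * (b - a) + (∑ s ∈ B, j s) * ∫ x in Ioo a b, zoneCount B (r / 2 * ε) x := by
    refine (integral_add hi1 hi2).trans ?_
    rw [setIntegral_const, Real.volume_real_Ioo_of_le hab.le, smul_eq_mul, integral_const_mul]
    ring
  refine (le_of_eq e2).trans ?_
  have h8 := setIntegral_zoneCount_le B (d := r / 2 * ε)
    (by have := H.pos; have := H.profile.pos; positivity) (Ioo a b)
  have h9 : (B.card : ℝ) * (2 * (r / 2 * ε)) = B.card * (r * ε) := by ring
  rw [h9] at h8
  linarith [mul_le_mul_of_nonneg_left h8 hJ]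

theorem integral_phase_le (H : IsFine F F₁ F₂ r R μ τ B p ε δ h x₀ t) {ρ V : ℝ} (hρ : 0 < ρ)
    (hV : 0 ≤ V)
    (hle : ∫⁻ x in Ioo a b, ENNReal.ofReal (ε⁻¹ * schoenberg t (p + 2) (crackSum B F ε) x
        + ε * schoenberg₁ t (p + 2) (crackSum B F ε) x ^ 2
        + ρ * ε ^ 3 * schoenberg₂ t (p + 2) (crackSum B F ε) x ^ 2) ≤ ENNReal.ofReal V) :
    ∫ x in Ioo a b, schoenberg t (p + 2) (crackSum B F ε) x ≤ ε * V := by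
  have hε := H.pos
  set v := schoenberg t (p + 2) (crackSum B F ε)
  have hv : ∀ x, v x ∈ Icc (0 : ℝ) 1 := H.schoenberg_mem_unit
  have hi : IntegrableOn v (Ioo a b) := memLp_one_iff_integrable.1 (H.memLp_schoenberg a b _ 1).1
  have h1 : ∫⁻ x in Ioo a b, ENNReal.ofReal (ε⁻¹ * v x) ≤ ENNReal.ofReal V := by
    refine (lintegral_mono fun x => ENNReal.ofReal_le_ofReal ?_).trans hle
    have : 0 ≤ ε * schoenberg₁ t (p + 2) (crackSum B F ε) x ^ 2 := by positivity
    have : 0 ≤ ρ * ε ^ 3 * schoenberg₂ t (p + 2) (crackSum B F ε) x ^ 2 := by positivity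
    linarith
  rw [← ofReal_integral_eq_lintegral_ofReal (hi.const_mul _) (Eventually.of_forall fun x =>
    mul_nonneg (inv_pos.2 hε).le (hv x).1), ENNReal.ofReal_le_ofReal_iff hV, integral_const_mul,
    inv_mul_le_iff₀ hε] at h1
  exact h1

end IsFine

end ATFracture
end

/-! ### Choice of parameters, diagonal sequence and conclusion -/

noncomputable section
namespace ATFracture

/-- The critical term is `η` times a strain squared of order `ε⁻²` on a zone of length of order `ε`,
that is `η / ε`. This is where `η = o(ε)` is used. -/
theorem tendsto_bulk_bound {η : ℝ → ℝ} (hη : η =o[𝓝[>] 0] fun ε => ε) (κ Q M J L r n : ℝ) :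
    Tendsto (fun ε => κ * (1 + η ε) * Q +
      (κ * η ε * (M + J * (L * (1 / (r / 4 * ε)))) ^ 2 + κ * M ^ 2) * (n * (r * ε)))
      (𝓝[>] 0) (𝓝 (κ * Q)) := by
  have h1 : Tendsto (fun ε => η ε / ε) (𝓝[>] 0) (𝓝 0) := hη.tendsto_div_nhds_zero
  have h0 : Tendsto (fun ε : ℝ => ε) (𝓝[>] 0) (𝓝 0) := tendsto_id.mono_left nhdsWithin_le_nhds
  have h2 : Tendsto (fun ε => κ * (1 + η ε / ε * ε) * Q +
      (κ * (η ε / ε) * (M * ε + J * (L * (1 / (r / 4)))) ^ 2 + κ * M ^ 2 * ε) * (n * r))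
      (𝓝[>] 0) (𝓝 (κ * (1 + 0 * 0) * Q +
        (κ * 0 * (M * 0 + J * (L * (1 / (r / 4)))) ^ 2 + κ * M ^ 2 * 0) * (n * r))) :=
    ((((h1.mul h0).const_add 1).const_mul κ).mul_const Q).add
      ((((h1.const_mul κ).mul (((h0.const_mul M).add_const _).pow 2)).add
        (h0.const_mul (κ * M ^ 2))).mul_const (n * r))
  have e : κ * (1 + 0 * 0) * Q +
      (κ * 0 * (M * 0 + J * (L * (1 / (r / 4)))) ^ 2 + κ * M ^ 2 * 0) * (n * r) = κ * Q := by ring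
  rw [e] at h2
  refine h2.congr' ?_
  filter_upwards [self_mem_nhdsWithin] with ε hε
  have hε0 : ε ≠ 0 := (ne_of_gt hε)
  have e1 : η ε / ε * ε = η ε := by field_simp
  have e2 : (M * ε + J * (L * (1 / (r / 4)))) = ε * (M + J * (L * (1 / (r / 4 * ε)))) := by
    rw [one_div, one_div, mul_inv]; field_simp
  rw [e1, e2, mul_pow]
  field_simp

theorem exists_pos_le_one_mul_le {A e : ℝ} (hA : 0 ≤ A) (he : 0 < e) :
    ∃ τ, 0 < τ ∧ τ ≤ 1 ∧ A * τ ≤ e := by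
  refine ⟨min 1 (e / (A + 1)), by positivity, min_le_left _ _, ?_⟩
  calc A * min 1 (e / (A + 1)) ≤ A * (e / (A + 1)) :=
        mul_le_mul_of_nonneg_left (min_le_right _ _) hA
    _ ≤ e := by rw [mul_div_assoc', div_le_iff₀ (by positivity)]; nlinarith

theorem eventually_mul_le {c e : ℝ} (he : 0 < e) : ∀ᶠ ε : ℝ in 𝓝[>] 0, c * ε ≤ e := by
  have : Tendsto (fun ε : ℝ => c * ε) (𝓝 0) (𝓝 (c * 0)) := tendsto_id.const_mul c
  rw [mul_zero] at this
  exact (this.mono_left nhdsWithin_le_nhds).eventually (eventually_le_nhds he)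

theorem eventually_size_le {a b : ℝ} {T : ℝ → Mesh a b}
    (hT : (fun ε => (T ε).size) =o[𝓝[>] 0] fun ε => ε) {c : ℝ} (hc : 0 < c) :
    ∀ᶠ ε in 𝓝[>] 0, (T ε).size ≤ c * ε := by
  filter_upwards [hT.def hc, self_mem_nhdsWithin] with ε h hε
  rw [Real.norm_of_nonneg (T ε).size_nonneg, Real.norm_of_nonneg (le_of_lt hε)] at h
  exact h

/-- Recovery at finite accuracy. -/
theorem eventually_exists_isoFunctional_le {a b κ G ρ : ℝ} (hab : a < b) (hκ : 0 < κ) (hG : 0 < G)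
    (hρ : 0 < ρ) {w : ℝ → ℝ} (hw : w ∈ admissibleProfiles) {p k : ℕ} (hkp : k < p + 2)
    {η : ℝ → ℝ} (hη_pos : ∀ ε, 0 < ε → 0 < η ε) (hη : η =o[𝓝[>] 0] fun ε => ε)
    {T : ℝ → Mesh a b} (hT : (fun ε => (T ε).size) =o[𝓝[>] 0] fun ε => ε)
    {z : L1 a b × L1 a b} (hz : crackFunctional a b κ G z ≠ ⊤) {e : ℝ} (he : 0 < e) :
    ∀ᶠ ε in 𝓝[>] 0, ∃ y : L1 a b × L1 a b, dist y z ≤ e ∧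
      isoFunctional (T ε) (p + 2) k κ G ρ (2 * profileEnergy ρ w) (η ε) ε y ≤
        crackFunctional a b κ G z + ENNReal.ofReal e := by
  obtain ⟨c, γ, B, j, hγ, hB, hj, hz1, hz2, hval⟩ := exists_of_crackFunctional_ne_top hab hκ hG hz
  have hK := profileEnergy_pos hρ hw
  set K := profileEnergy ρ w with hKdef
  set n : ℝ := (B.card : ℝ) with hn
  have hn0 : 0 ≤ n := Nat.cast_nonneg _
  -- the profile
  obtain ⟨F, F₁, F₂, r, R, P, hE⟩ := exists_smooth_profile hρ hw
    -- Chosen so that the profile error, multiplied by `n G / (2 K)`, is at most `e / 4`; `n + 1`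
    -- covers the case without cracks.
    (θ := e * K / (2 * G * (n + 1))) (by positivity)
  rw [← hKdef] at hE
  set E := ∫ x, (F x + F₁ x ^ 2 + ρ * F₂ x ^ 2) with hEdef
  have hGE : G / (2 * K) * (n * E) ≤ G * n + e / 4 := by
    calc G / (2 * K) * (n * E) ≤ G / (2 * K) * (n * (2 * K + e * K / (2 * G * (n + 1)))) := by
          gcongr
      _ = G * n + e / 4 * (n / (n + 1)) := by field_simp; ring
      _ ≤ G * n + e / 4 * 1 := by
          gcongr
          rw [div_le_one (by positivity)]; linarith
      _ = _ := by ring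
  obtain ⟨N, hN0, hN⟩ := P.exists_bound
  have hr := P.pos
  have hR : 0 < R := P.pos.trans P.lt
  -- the slope
  have hba : 0 < b - a := sub_pos.2 hab
  obtain ⟨d, hd, hd1, hd2⟩ := exists_pos_le_one_mul_le (A := κ + (b - a)) (by positivity)
    (show 0 < e / 8 by positivity)
  obtain ⟨g, hg, hgs, hgsq, hgd⟩ := exists_continuous_approx hab hγ hd
  obtain ⟨M, hM⟩ := hgs.exists_bound_of_continuous hg
  have hM' : ∀ x, |g x| ≤ M := hM
  have hM0 : 0 ≤ M := (abs_nonneg _).trans (hM' 0)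
  obtain ⟨L, hL0, hL⟩ := exists_bound_deriv_smoothTransition
  -- the accuracy
  set C := 2 * (R + 1) * (2 + 2 * N + ρ * (8 * N + 16)) with hC
  have hC0 : 0 ≤ C := by positivity
  obtain ⟨τ, hτ, hτ1, hτe⟩ := exists_pos_le_one_mul_le
    (A := κ * ((2 * M + 1) * (b - a)) + G / (2 * K) * (n * C)) (by positivity)
    (show 0 < e / 8 by positivity)
  obtain ⟨μ₀, hμ₀, hmod⟩ := P.exists_modulus hτ
  set μ := min μ₀ (min 1 (r / 4)) with hμdef
  have hμ : 0 < μ := by positivity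
  obtain ⟨ω', hω', hgmod⟩ : ∃ ω', 0 < ω' ∧ ∀ x y, |x - y| ≤ ω' → |g x - g y| ≤ τ := by
    have hu := hgs.uniformContinuous_of_continuous hg
    obtain ⟨m, hm, hH⟩ := Metric.uniformContinuous_iff.1 hu τ hτ
    exact ⟨m / 2, by positivity, fun x y hxy =>
      (hH (lt_of_le_of_lt hxy (by linarith : m / 2 < m))).le⟩
  -- With `δ = ν ε` the sampling window of radius `(p + 3) δ` is exactly `μ ε`: the knot spacing is
  -- a fixed fraction of `ε`, while the mesh size is `o(ε)`.
  set ν := μ / (p + 3) with hν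
  have hν0 : 0 < ν := by positivity
  obtain ⟨r₀, hr₀, -, hsep⟩ := exists_separating_radius B hB
  set J := ∑ s ∈ B, j s with hJ
  have hJ0 : 0 ≤ J := Finset.sum_nonneg hj
  set A := ∫ x in Ioo a b, g x ^ 2 with hA
  have hA0 : 0 ≤ A := integral_nonneg fun x => sq_nonneg _
  set Q := A + τ * (2 * M + 1) * (b - a) with hQ
  set V := n * (E + 2 * (R + 1) * (τ * (2 + 2 * N + ρ * (8 * N + 16)))) with hV
  have hE0 : 0 ≤ E := integral_nonneg fun x => by
    have := (P.mem_Icc x).1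
    change 0 ≤ F x + F₁ x ^ 2 + ρ * F₂ x ^ 2
    positivity
  have hV0 : 0 ≤ V := by positivity
  have hbulk := (tendsto_bulk_bound hη κ Q M J L r n).eventually
    (eventually_le_nhds (show κ * Q < κ * Q + e / 8 by linarith))
  filter_upwards [self_mem_nhdsWithin, hbulk,
    eventually_mul_le (c := 2 * (R + 2)) (show 0 < 4 * r₀ by positivity),
    eventually_mul_le (c := μ) hω', eventually_size_le hT (show 0 < ν / 2 by positivity),
    eventually_size_le hT (show 0 < τ * ν / (4 * (N + 1)) by positivity),
    eventually_mul_le (c := M * μ * (b - a) + J * (n * r)) (show 0 < e / 2 by positivity),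
    eventually_mul_le (c := V) he] with ε hε hU hsepε hμε hs1 hs2 hdu hdv
  have hε0 : 0 < ε := hε
  obtain ⟨t, ht, hspl⟩ := (T ε).exists_isNearUniform (δ := ν * ε) (by positivity) (by linarith)
  have H : IsFine F F₁ F₂ r R μ τ B p ε (ν * ε) (T ε).size a t := by
    refine ⟨P, hε0, (min_le_right _ _).trans (min_le_left _ _),
      (min_le_right _ _).trans (min_le_right _ _), fun x y hxy => hmod x y
        (hxy.trans (min_le_left _ _)), fun s hs s' hs' hne => lt_of_le_of_lt hsepε
        (hsep s hs s' hs' hne), ht, ?_, fun x => ?_⟩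
    · rw [hν]; field_simp; exact le_rfl
    · have h1 : (T ε).size / (ν * ε) ≤ τ / (4 * (N + 1)) := by
        rw [div_le_iff₀ (by positivity)]
        exact hs2.trans (le_of_eq (by ring))
      calc 4 * ((T ε).size / (ν * ε)) * |F₂ x| ≤ 4 * (τ / (4 * (N + 1))) * (N + 1) := by
            refine mul_le_mul (by linarith) ((hN x).2.trans (by linarith)) (abs_nonneg _)
              (by positivity)
        _ = τ := by field_simp
  set v := schoenberg t (p + 2) (crackSum B F ε) with hvdef
  set u := schoenberg t (p + 2) (smoothRep a c g B j (r / 4 * ε)) with hudef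
  obtain ⟨mv, mv₁, mv₂⟩ := H.memLp_schoenberg a b (crackSum B F ε) 2
  obtain ⟨mu, mu₁, -⟩ := H.memLp_schoenberg a b (smoothRep a c g B j (r / 4 * ε)) 2
  have mv' := (H.memLp_schoenberg a b (crackSum B F ε) 1).1
  have mu' := (H.memLp_schoenberg a b (smoothRep a c g B j (r / 4 * ε)) 1).1
  have hphase := H.lintegral_phase_le hρ hN hτ.le hτ1 (Ioo a b)
  have hbulk' := H.lintegral_bulk_le (a := a) (c := c) (b := b) hg hM' hj hκ (hη_pos ε hε0) hab hL
    hτ.le hτ1 fun x y hxy => hgmod x y (hxy.trans hμε)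
  refine ⟨(mu'.toLp _, mv'.toLp _), ?_, ?_⟩
  · refine max_le ?_ ?_
    · refine dist_le_of_integral_le mu'.coeFn_toLp
        ((H.integral_displacement_sub_le hab hg hM' hj (hγ.integrable (by norm_num)) hz1 hgd).trans ?_)
      have h1 : d * (b - a) ≤ e / 8 := by
        have : 0 ≤ κ * d := by positivity
        linarith
      have h2 : (M * (μ * ε) + d) * (b - a) + J * (n * (r * ε)) =
        (M * μ * (b - a) + J * (n * r)) * ε + d * (b - a) := by ring
      rw [h2]
      linarith
    · refine dist_le_of_integral_le mv'.coeFn_toLp ?_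
      refine le_trans (le_of_eq (integral_congr_ae ?_))
        ((H.integral_phase_le hρ hV0 hphase).trans (by rw [mul_comm]; exact hdv))
      filter_upwards [hz2] with x hx
      rw [hx, sub_zero, abs_of_nonneg (H.schoenberg_mem_unit x).1]
  · rw [isoFunctional, if_pos ⟨⟨_, hspl (p + 2) k hkp _, mu'.coeFn_toLp⟩,
      ⟨_, hspl (p + 2) k hkp _, mv'.coeFn_toLp⟩⟩,
      atFunctional_eq mu'.coeFn_toLp mv'.coeFn_toLp (ht.isWeakDeriv_schoenberg hab (p + 1) _)
        (ht.isWeakDeriv_schoenberg hab (p + 1) _) (ht.isWeakDeriv_schoenberg₁ hab p _) mu mu₁ mv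
        mv₁ mv₂ H.schoenberg_mem_unit, hval]
    have hGK : 0 < G / (2 * K) := by positivity
    calc _ ≤ ENNReal.ofReal (κ * Q + e / 8) + ENNReal.ofReal (G / (2 * K)) * ENNReal.ofReal V :=
          add_le_add (hbulk'.trans (ENNReal.ofReal_le_ofReal hU)) (mul_le_mul_right hphase _)
      _ = ENNReal.ofReal (κ * Q + e / 8 + G / (2 * K) * V) := by
          rw [← ENNReal.ofReal_mul hGK.le, ← ENNReal.ofReal_add (by positivity) (by positivity)]
      -- The error budget is `e/4` for the profile and `e/8` each for the limit in `ε`, the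
      -- approximation of the slope and the accuracy `τ`.
      _ ≤ ENNReal.ofReal (κ * (∫ x in Ioo a b, γ x ^ 2) + G * n + e) := by
          refine ENNReal.ofReal_le_ofReal ?_
          have h1 : G / (2 * K) * V = G / (2 * K) * (n * E) + G / (2 * K) * (n * C) * τ := by
            rw [hV, hC]; ring
          have h2 : κ * Q = κ * A + κ * ((2 * M + 1) * (b - a)) * τ := by rw [hQ]; ring
          have h3 : κ * A ≤ κ * (∫ x in Ioo a b, γ x ^ 2) + κ * d := by
            rw [← mul_add]; exact mul_le_mul_of_nonneg_left hgsq hκ.le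
          have h4 : 0 ≤ (b - a) * d := by positivity
          linarith
      _ = _ := ENNReal.ofReal_add (add_nonneg (mul_nonneg hκ.le (integral_nonneg fun x =>
          sq_nonneg _)) (by positivity)) he.le

/-- Recovery at every finite accuracy yields a recovery sequence. -/
theorem exists_recovery_sequence {X : Type*} [PseudoMetricSpace X] {Φ : ℕ → X → ℝ≥0∞} {z : X}
    {c : ℝ≥0∞} (h : ∀ e : ℝ, 0 < e → ∀ᶠ n in atTop, ∃ y, dist y z ≤ e ∧
      Φ n y ≤ c + ENNReal.ofReal e) :
    ∃ y : ℕ → X, Tendsto y atTop (𝓝 z) ∧ limsup (fun n => Φ n (y n)) atTop ≤ c := by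
  classical
  set S : ℕ → ℕ → Prop := fun n m => ∃ y, dist y z ≤ 1 / ((m : ℝ) + 1) ∧
    Φ n y ≤ c + ENNReal.ofReal (1 / ((m : ℝ) + 1)) with hS
  have hSev : ∀ m, ∀ᶠ n in atTop, S n m := fun m => h _ (by positivity)
  -- The best accuracy index up to `n` attained at stage `n`. If none is attained the default is 0,
  -- for which `S n 0` may fail, whence the fallback `z` in the next line.
  set m : ℕ → ℕ := fun n => Nat.findGreatest (S n) n with hm
  set y : ℕ → X := fun n => if hn : S n (m n) then hn.choose else z with hy
  have key : ∀ i : ℕ, ∀ᶠ n in atTop, dist (y n) z ≤ 1 / ((i : ℝ) + 1) ∧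
      Φ n (y n) ≤ c + ENNReal.ofReal (1 / ((i : ℝ) + 1)) := by
    intro i
    filter_upwards [hSev i, eventually_ge_atTop i] with n hn hin
    have h1 : i ≤ m n := Nat.le_findGreatest hin hn
    have h2 : S n (m n) := Nat.findGreatest_spec hin hn
    have h3 : y n = h2.choose := dif_pos h2
    have h4 : 1 / ((m n : ℝ) + 1) ≤ 1 / ((i : ℝ) + 1) := Nat.one_div_le_one_div h1
    rw [h3]
    exact ⟨h2.choose_spec.1.trans h4, h2.choose_spec.2.trans
      (add_le_add le_rfl (ENNReal.ofReal_le_ofReal h4))⟩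
  refine ⟨y, ?_, ?_⟩
  · rw [Metric.tendsto_nhds]
    intro e he
    obtain ⟨i, hi⟩ := exists_nat_one_div_lt he
    filter_upwards [key i] with n hn using lt_of_le_of_lt hn.1 hi
  · have h1 : ∀ i : ℕ, limsup (fun n => Φ n (y n)) atTop ≤
        c + ENNReal.ofReal (1 / ((i : ℝ) + 1)) := fun i =>
      limsup_le_of_le (by isBoundedDefault) ((key i).mono fun n hn => hn.2)
    have h2 : Tendsto (fun i : ℕ => c + ENNReal.ofReal (1 / ((i : ℝ) + 1))) atTop
        (𝓝 (c + ENNReal.ofReal 0)) :=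
      (ENNReal.tendsto_ofReal tendsto_one_div_add_atTop_nhds_zero_nat).const_add c
    rw [ENNReal.ofReal_zero, add_zero] at h2
    exact ge_of_tendsto' h2 h1

theorem atFunctional_le_isoFunctional {a b : ℝ} (T : Mesh a b) (p k : ℕ) (κ G ρ c η ε : ℝ)
    (z : L1 a b × L1 a b) :
    atFunctional a b κ G ρ c η ε z ≤ isoFunctional T p k κ G ρ c η ε z := by
  unfold isoFunctional
  split_ifs
  · exact le_rfl
  · exact le_top

end ATFracture
end

theorem theorem2p5 (a b κ G ρ : ℝ) (hab : a < b) (hκ : 0 < κ) (hG : 0 < G) (hρ : 0 < ρ)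
    (p k : ℕ) (hp : 2 ≤ p) (hk : 1 ≤ k) (hkp : k < p)
    (η : ℝ → ℝ) (hη_pos : ∀ ε, 0 < ε → 0 < η ε)
    (hη : η =o[𝓝[>] 0] fun ε => ε)
    (T : ℝ → ATFracture.Mesh a b)
    (hT : (fun ε => (T ε).size) =o[𝓝[>] 0] fun ε => ε) :
    (∃ w, ATFracture.IsOptimalProfile ρ w) ∧
      ∀ w, ATFracture.IsOptimalProfile ρ w →
        ATFracture.GammaConverges
          (fun ε => ATFracture.isoFunctional (T ε) p k κ G ρ
            (2 * ATFracture.profileEnergy ρ w) (η ε) ε)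
          (ATFracture.crackFunctional a b κ G) := by
  refine ⟨ATFracture.exists_isOptimalProfile hρ, fun w hw ε hε hε0 => ⟨fun z y hy => ?_, fun z => ?_⟩⟩
  · refine (ATFracture.crackFunctional_le_liminf hab hκ hG hρ
      (ATFracture.profileEnergy_pos hρ hw.1) (fun w' hw' => hw.2 hw') hε hε0
      (fun n => hη_pos _ (hε n)) hy).trans ?_
    exact liminf_le_liminf (Eventually.of_forall fun n =>
      ATFracture.atFunctional_le_isoFunctional (T (ε n)) p k _ _ _ _ _ _ _)
  · by_cases hz : ATFracture.crackFunctional a b κ G z = ⊤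
    -- Where the limit energy is infinite, every sequence converging to `z` recovers it.
    · exact ⟨fun _ => z, tendsto_const_nhds, by rw [hz]; exact le_top⟩
    · obtain ⟨q, rfl⟩ : ∃ q, p = q + 2 := ⟨p - 2, by omega⟩
      have hε' : Tendsto ε atTop (𝓝[>] 0) :=
        tendsto_nhdsWithin_iff.2 ⟨hε0, Eventually.of_forall hε⟩
      exact ATFracture.exists_recovery_sequence fun e he => hε'.eventually
        (ATFracture.eventually_exists_isoFunctional_le hab hκ hG hρ hw.1 hkp hη_pos hη hT hz he)
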